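/- Let $\lambda$ be the security parameter, let $k=k(\lambda)\ge 1$, $n=n(\lambda)$, $m=m(\lambda)$, $\kappa=\kappa(\lambda)$ be functions such that $1^{k}$ and $1^\kappa$ are computable in polynomial time from $1^\lambda$, and put $\ell=\lceil\log_2 k\rceil+1$. "QPT" means quantum polynomial time, either for plain (uniform) algorithms throughout, or throughout for algorithms with classical advice of polynomial length; the theorem holds for each of the two readings. All keys and ciphertexts are bit strings whose length is a function of the parameters. Let * $\mathsf{SKE}=(\mathsf{Gen},\mathsf{Enc},\mathsf{Dec})$ be an efficient, perfectly correct secret-key encryption scheme with plaintext space $\{0,1\}^{\ell}$ and ciphertext space $\{0,1\}^n$, which is sparse ($\Pr[\mathsf{Dec}(K,c)\neq\bot]$ is negligible for $K\leftarrow\mathsf{Gen}(1^\lambda)$ and uniform $c\in\{0,1\}^n$) and has pseudorandom ciphertexts (a QPT adversary with access to $\mathsf{Enc}(K,\cdot)$ cannot distinguish an encryption of a plaintext of its choice from a uniform string); * $\mathsf{CPRF}=(\mathsf{Setup},\mathsf{Constrain},\mathsf{Eval},\mathsf{CEval})$ be a selectively single-key private constrained PRF with domain $\{0,1\}^n$,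 range $\{0,1\}^m$, and as constraints with parameter $\kappa$ the Boolean circuits $f$ of size at most $\kappa$: it is efficient, and for a constrained key for an $f$ chosen by a QPT adversary at the start, and with access to $\mathsf{Eval}(msk,\cdot)$, (correctness) the adversary finds an $x$ with $f(x)=0$ and $\mathsf{CEval}(sk_f,x)\ne\mathsf{Eval}(msk,x)$ only with negligible probability; (pseudorandomness) it cannot distinguish $\mathsf{Eval}(msk,x)$ from a uniform string, for a never queried $x$ of its choice with $f(x)\neq 0$; (privacy) for every QPT adversary there is a stateful efficient simulator, which gets only the parameters and, for each query $x$, the pair $(x,f(x))$, such that the adversary cannot distinguish the simulated constrained key and evaluation oracle from the true ones; * $\mathsf{PKE}=(\mathsf{Gen},\mathsf{Enc},\mathsf{Dec})$ be an efficient, perfectly correct, CCA secure public-key encryption scheme whose plaintexts are the strings of the form $sk\|K$ with $sk$ of the length of a constrained key of $\mathsf{CPRF}$ for $(\lambda,\kappa)$ and $K$ of the length of a key of $\mathsf{SKE}$. (In the pseudorandomness and CCA games an adversary that breaks the rules counts as guessing at random.) For an $\mathsf{SKE}$ key $K$ and $\mathsf{msg}\in\{0,1\}^k$ let $D[K,\mathsf{msg}]$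 and $D_{\mathrm{auth}}[K]$ be circuits of size at most $\kappa$ on $\{0,1\}^n$, computable in polynomial time from $(K,\mathsf{msg})$ and $K$, such that $D[K,\mathsf{msg}](x)=1$ iff $\mathsf{SKE.Dec}(K,x)=i\|\gamma$ for some $i\in[k]$ with $\gamma=\mathsf{msg}[i]$, and $D_{\mathrm{auth}}[K](x)=1$ iff $\mathsf{SKE.Dec}(K,x)=\bot$. Define $\mathsf{PRF}_{\mathsf{cprf}}$ by: * $\mathsf{Setup}(1^\lambda)$: $(\mathsf{pp},\mathsf{xk})=(pk,sk)\leftarrow\mathsf{PKE.Gen}(1^\lambda)$. * $\mathsf{Gen}(pk)$: sample $G\leftarrow\mathsf{CPRF.Setup}(1^\lambda,1^\kappa)$, $K\leftarrow\mathsf{SKE.Gen}(1^\lambda)$ and $G_{\mathrm{auth}}\leftarrow\mathsf{CPRF.Constrain}(G,D_{\mathrm{auth}}[K])$; output the PRF key $(G,K)$ and the public tag $\tau\leftarrow\mathsf{PKE.Enc}(pk,G_{\mathrm{auth}}\|K)$. * $\mathsf{Eval}((G,K),x)=\mathsf{CPRF.Eval}(G,x)$. * $\mathsf{Mark}(pk,(G,K),\mathsf{msg})$: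 output the marked circuit $\widetilde C=\mathsf{CPRF.CEval}(sk_D,\cdot)$, where $sk_D\leftarrow\mathsf{CPRF.Constrain}(G,D[K,\mathsf{msg}])$. * $\mathsf{Sim}(sk,\tau,i)$: decrypt $\tau$ to $G_{\mathrm{auth}}\|K$, sample $\gamma\leftarrow\{0,1\}$ and $x\leftarrow\mathsf{SKE.Enc}(K,i\|\gamma)$, and output $(\gamma,x,\mathsf{CPRF.CEval}(G_{\mathrm{auth}},x))$; if the decryption fails, output $(0,0^n,0^m)$. Then $\mathsf{PRF}_{\mathsf{cprf}}$ is an extraction-less watermarking PRF with message space $\{0,1\}^k$, domain $\{0,1\}^n$ and range $\{0,1\}^m$ that is SIM-MDD secure with private simulation. That is: 1. All its algorithms run in probabilistic polynomial time. 2. (Evaluation correctness.) For honestly generated $\mathsf{pp}$, PRF key $\mathsf{prfk}$, and marked circuit $\widetilde C\leftarrow\mathsf{Mark}(\mathsf{pp},\mathsf{prfk},\mathsf{msg})$, and uniform $x\in\{0,1\}^n$, $\Pr[\widetilde C(x)=\mathsf{Eval}(\mathsf{prfk},x)]\ge 1-\mathsf{negl}(\lambda)$, for any sequence of messages $\mathsf{msg}\in\{0,1\}^{k}$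 (with plain QPT adversaries: for any messages $\mathsf{msg}$ sampled by a probabilistic polynomial time algorithm on input $1^\lambda$). 3. (SIM-MDD security with private simulation.) For all indices $i^\ast=i^\ast(\lambda)\in[k]$ and every QPT adversary $\mathcal A$, $2\left|\Pr[\mathrm{Expt}_{i^\ast,\mathcal A}(\lambda)=1]-\tfrac12\right|$ is negligible, where in $\mathrm{Expt}_{i^\ast,\mathcal A}(\lambda)$ the challenger samples $(\mathsf{pp},\mathsf{xk})\leftarrow\mathsf{Setup}(1^\lambda)$ and sends $\mathsf{pp}$; $\mathcal A$ sends $\mathsf{msg}\in\{0,1\}^k$; the challenger samples $(\mathsf{prfk},\tau)\leftarrow\mathsf{Gen}(\mathsf{pp})$ and $\widetilde C\leftarrow\mathsf{Mark}(\mathsf{pp},\mathsf{prfk},\mathsf{msg})$ and sends $(\tau,\widetilde C)$; $\mathcal A$ may then query the oracle $(\tau',i')\mapsto\mathsf{Sim}(\mathsf{xk},\tau',i')$; the challenger samples a bit $\mathsf{coin}$ and sends a tuple $(\gamma,x,y)$, which is $\mathsf{Sim}(\mathsf{xk},\tau,i^\ast)$ if $\mathsf{coin}=1$, while if $\mathsf{coin}=0$,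 then $\gamma\leftarrow\{0,1\}$, $x\leftarrow\{0,1\}^n$, and $y\leftarrow\{0,1\}^m$ if $\gamma=\mathsf{msg}[i^\ast]$ and $y=\mathsf{Eval}(\mathsf{prfk},x)$ otherwise; finally $\mathcal A$, without oracle, outputs $\mathsf{coin}'$, and the experiment outputs 1 iff $\mathsf{coin}'=\mathsf{coin}$. -/

import Mathlib

open Filter Topology

/-! ## Bit strings and their encodings -/

/-- Bit strings of arbitrary length. -/
abbrev Str := List Bool

/-- `{0,1}^n`. -/
abbrev Bits (n : ℕ) := Fin n → Bool

/-- The unary string `1^n`. -/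
def unary (n : ℕ) : Str := List.replicate n true

/-- An encoding of the elements of `α` as tuples of bit strings, of a fixed arity. -/
class BitRep (α : Type) where
  arity : ℕ
  rep : α → List Str
  length_rep : ∀ a, (rep a).length = arity
  rep_injective : Function.Injective rep

open BitRep (rep)

instance : BitRep Unit where
  arity := 0
  rep _ := []
  length_rep _ := rfl
  rep_injective _ _ _ := rfl

instance : BitRep Bool where
  arity := 1
  rep b := [[b]]
  length_rep _ := rfl
  rep_injective a b h := by simpa using h

instance : BitRep Str where
  arity := 1
  rep s := [s]
  length_rep _ := rfl
  rep_injective a b h := by simpa using h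

instance (n : ℕ) : BitRep (Bits n) where
  arity := 1
  rep x := [List.ofFn x]
  length_rep _ := rfl
  rep_injective a b h := by
    simp only [List.cons.injEq, and_true] at h
    exact List.ofFn_injective h

/-- `⊥` is encoded by the empty string, a proper value `x` by `1‖x`. -/
instance (n : ℕ) : BitRep (Option (Bits n)) where
  arity := 1
  rep o := match o with
    | none => [[]]
    | some x => [true :: List.ofFn x]
  length_rep o := by cases o <;> rfl
  rep_injective a b h := by
    cases a <;> cases b <;> simp_all

instance {α β : Type} [BitRep α] [BitRep β] : BitRep (α × β) where
  arity := BitRep.arity α + BitRep.arity β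
  rep p := rep p.1 ++ rep p.2
  length_rep p := by simp [BitRep.length_rep]
  rep_injective p q h := by
    have h' := List.append_inj h (by simp [BitRep.length_rep])
    exact Prod.ext (BitRep.rep_injective h'.1) (BitRep.rep_injective h'.2)

/-- The binary expansion of an index in `[k]`, a string of `⌈log₂ k⌉` bits, lowest bit first. The
indices `1, …, k` are represented by `0, …, k - 1`. -/
def indexBits {k : ℕ} (i : Fin k) : Bits (Nat.clog 2 k) := fun j => (i : ℕ).testBit j

theorem indexBits_injective {k : ℕ} : Function.Injective (indexBits (k := k)) := by
  intro a b h
  apply Fin.ext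
  apply Nat.eq_of_testBit_eq
  intro j
  by_cases hj : j < Nat.clog 2 k
  · exact congrFun h ⟨j, hj⟩
  · have hk : k ≤ 2 ^ j :=
      (Nat.le_pow_clog (by norm_num) k).trans (Nat.pow_le_pow_right (by norm_num) (not_lt.mp hj))
    rw [Nat.testBit_lt_two_pow (lt_of_lt_of_le a.2 hk),
      Nat.testBit_lt_two_pow (lt_of_lt_of_le b.2 hk)]

instance (k : ℕ) : BitRep (Fin k) where
  arity := 1
  rep i := [List.ofFn (indexBits i)]
  length_rep _ := rfl
  rep_injective a b h := by
    simp only [List.cons.injEq, and_true] at h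
    exact indexBits_injective (List.ofFn_injective h)

open Classical in
/-- Reads a tuple of strings as an element of `α`; `none` if it does not encode any. -/
noncomputable def parse {α : Type} [BitRep α] (xs : List Str) : Option α :=
  if h : ∃ a : α, rep a = xs then some h.choose else none

theorem parse_rep {α : Type} [BitRep α] (a : α) : parse (rep a) = some a := by
  have h : ∃ b : α, rep b = rep a := ⟨a, rfl⟩
  simp only [parse, dif_pos h, Option.some.injEq]
  exact BitRep.rep_injective h.choose_spec

/-! ## Boolean circuits -/

/-- A gate is a constant or the NAND of two earlier wires. -/
inductive Gate where
  | const (b : Bool)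
  | nand (i j : ℕ)

namespace Gate

/-- The value of a gate, given the values of the earlier wires. -/
def eval (w : List Bool) : Gate → Bool
  | const b => b
  | nand i j => !(w.getD i false && w.getD j false)

/-- All wires that the gate reads are among the first `t`. -/
def Below (t : ℕ) : Gate → Prop
  | const _ => True
  | nand i j => i < t ∧ j < t

/-- A prefix-free encoding of gates. -/
def encode : Gate → Str
  | const b => [false, b]
  | nand i j => true :: (unary i ++ false :: (unary j ++ [false]))

end Gate

/-- Every gate reads only earlier wires, if the first gate is preceded by `t` wires. -/
def GatesOK : ℕ → List Gate → Prop
  | _, [] => True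
  | t, g :: gs => g.Below t ∧ GatesOK (t + 1) gs

/-- Circuits with `n` input wires and at most `κ` gates. -/
def Circ (n κ : ℕ) : Type := {gs : List Gate // GatesOK n gs ∧ gs.length ≤ κ}

/-- The value of a circuit is the value of its last wire. -/
def Circ.eval {n κ : ℕ} (C : Circ n κ) (x : Bits n) : Bool :=
  (C.1.foldl (fun w g => w ++ [g.eval w]) (List.ofFn x)).getLastD false

instance (n κ : ℕ) : Inhabited (Circ n κ) := ⟨⟨[], trivial, Nat.zero_le _⟩⟩

theorem unary_append_inj {i i' : ℕ} {s t : Str}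
    (h : unary i ++ false :: s = unary i' ++ false :: t) : i = i' ∧ s = t := by
  induction i generalizing i' with
  | zero => cases i' <;> simp_all [unary, List.replicate_succ]
  | succ i ih =>
    cases i' with
    | zero => simp [unary, List.replicate_succ] at h
    | succ i' =>
      simp only [unary, List.replicate_succ, List.cons_append, List.cons.injEq, true_and] at h
      obtain ⟨h1, h2⟩ := ih h
      exact ⟨by rw [h1], h2⟩

theorem Gate.encode_append_inj {g g' : Gate} {s t : Str} (h : g.encode ++ s = g'.encode ++ t) :
    g = g' ∧ s = t := by
  cases g with
  | const b =>
    cases g' with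
    | const b' => simpa [Gate.encode] using h
    | nand i' j' => simp [Gate.encode] at h
  | nand i j =>
    cases g' with
    | const b' => simp [Gate.encode] at h
    | nand i' j' =>
      simp only [Gate.encode, List.cons_append, List.append_assoc, List.cons.injEq, true_and,
        List.nil_append] at h
      obtain ⟨h1, h⟩ := unary_append_inj h
      obtain ⟨h2, h⟩ := unary_append_inj h
      exact ⟨by rw [h1, h2], h⟩

theorem Gate.encode_flatMap_injective :
    Function.Injective (fun gs : List Gate => gs.flatMap Gate.encode) := by
  intro a
  induction a with
  | nil =>
    intro b h
    cases b with
    | nil => rfl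
    | cons g b => cases g <;> simp [Gate.encode] at h
  | cons g a ih =>
    intro b h
    cases b with
    | nil => cases g <;> simp [Gate.encode] at h
    | cons g' b =>
      simp only [List.flatMap_cons] at h
      obtain ⟨h1, h⟩ := Gate.encode_append_inj h
      rw [h1, ih h]

instance (n κ : ℕ) : BitRep (Circ n κ) where
  arity := 1
  rep C := [C.1.flatMap Gate.encode]
  length_rep _ := rfl
  rep_injective a b h := by
    simp only [List.cons.injEq, and_true] at h
    exact Subtype.ext (Gate.encode_flatMap_injective h)

/-! ## The machine model

Structured programs over registers that hold bit strings and are used as stacks, and over a quantum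
memory of qubits that are initially `|0⟩`. Every elementary instruction costs one step. No
instruction lengthens the longest string by more than one bit (except for messages received), so
that this cost is polynomially equivalent to the time of a Turing machine. A loop runs through the
length of a register; polynomial time computations, which can be run under a polynomial clock, need
no other loops. -/

/-- A (not normalized) vector of the quantum memory; the computational basis states are indexed by
the finite set of those qubits whose value is 1. -/
abbrev QState := Finset ℕ →₀ ℂ

namespace QState

/-- Applies a linear map that is given by its action on the computational basis. -/
noncomputable def apply (U : Finset ℕ → QState) (ψ : QState) : QState :=
  ψ.sum fun s a => a • U s

/-- The Hadamard gate on qubit `q`. -/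
noncomputable def hadamard (q : ℕ) : QState → QState :=
  apply fun s => ((Real.sqrt 2 : ℂ)⁻¹) •
    (Finsupp.single (s.erase q) 1 + Finsupp.single (insert q s) (if q ∈ s then -1 else 1))

/-- The gate `T = diag(1, exp(iπ/4))` on qubit `q`. -/
noncomputable def tgate (q : ℕ) : QState → QState :=
  apply fun s => Finsupp.single s (if q ∈ s then Complex.exp (Complex.I * Real.pi / 4) else 1)

/-- The controlled-NOT gate with control `c` and target `t`; no effect if `c = t`. -/
noncomputable def cnot (c t : ℕ) : QState → QState :=
  apply fun s => Finsupp.single (if c ∈ s ∧ c ≠ t then symmDiff s {t} else s) 1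

/-- The projection to the subspace where qubit `q` has the value `b`. -/
noncomputable def project (q : ℕ) (b : Bool) (ψ : QState) : QState :=
  ψ.filter fun s => decide (q ∈ s) = b

/-- The squared norm. -/
noncomputable def weight (ψ : QState) : NNReal := ψ.sum fun _ a => ‖a‖₊ ^ 2

/-- The probability of the outcome 1 when qubit `q` is measured. -/
noncomputable def probOne (q : ℕ) (ψ : QState) : NNReal :=
  (ψ.project q true).weight / ((ψ.project q false).weight + (ψ.project q true).weight)

theorem probOne_le_one (q : ℕ) (ψ : QState) : ψ.probOne q ≤ 1 :=
  div_le_one_of_le₀ le_add_self zero_le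

/-- The outcome of a measurement of qubit `q` in the computational basis. -/
noncomputable def measure (q : ℕ) (ψ : QState) : PMF Bool :=
  PMF.ofFintype (fun b => ((if b then ψ.probOne q else 1 - ψ.probOne q : NNReal) : ENNReal)) (by
    have h := ψ.probOne_le_one q
    simp only [Fintype.sum_bool, if_true, Bool.false_eq_true, if_false]
    rw [← ENNReal.coe_add, add_tsub_cancel_of_le h, ENNReal.coe_one])

end QState

/-- Programs. Registers are numbered; a qubit is addressed by the length of a register. -/
inductive Prog where
  | skip
  /-- push a bit on a register -/
  | push (b : Bool) (r : ℕ)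
  /-- remove the top bit of a register -/
  | pop (r : ℕ)
  /-- overwrite `dst` by the content of `src` -/
  | copy (src dst : ℕ)
  /-- push a uniformly random bit on `r` -/
  | coin (r : ℕ)
  | hadamard (q : ℕ)
  | tgate (q : ℕ)
  | cnot (c t : ℕ)
  /-- measure a qubit and push the outcome on `r` -/
  | measure (q r : ℕ)
  /-- discard the quantum memory and set all qubits to `|0⟩` -/
  | reset
  /-- send the contents of the registers `args` to the oracle and store its answer in `res` -/
  | query (args res : List ℕ)
  /-- run a subroutine on fresh registers, where the first ones hold the contents of `args`, and
  store the contents of its first registers in `res` -/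
  | call (P : Prog) (args res : List ℕ)
  | seq (P Q : Prog)
  /-- run `P`, `Q` or `R` if the register `r` is empty, has top bit 0, or has top bit 1 -/
  | branch (r : ℕ) (P Q R : Prog)
  /-- run `P` as many times as the register `r` is long when the loop is entered -/
  | loop (r : ℕ) (P : Prog)

/-- Programs of classical probabilistic algorithms without oracle. -/
def Prog.Classical : Prog → Prop
  | skip | push _ _ | pop _ | copy _ _ | coin _ => True
  | hadamard _ | tgate _ | cnot _ _ | measure _ _ | reset | query _ _ => False
  | call P _ _ => P.Classical
  | seq P Q => P.Classical ∧ Q.Classical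
  | branch _ P Q R => P.Classical ∧ Q.Classical ∧ R.Classical
  | loop _ P => P.Classical

/-- The state of a machine: registers, quantum memory, and the number of steps made so far. -/
structure Mem where
  regs : ℕ → Str
  qubits : QState
  clock : ℕ

namespace Mem

/-- Empty registers, all qubits `|0⟩`. -/
noncomputable def empty : Mem := ⟨fun _ => [], Finsupp.single ∅ 1, 0⟩

def tick (s : Mem) : Mem := { s with clock := s.clock + 1 }

def set (s : Mem) (r : ℕ) (x : Str) : Mem := { s with regs := Function.update s.regs r x }

/-- Writes the strings `xs` in the registers `0, 1, …`. -/
def load (s : Mem) (xs : List Str) : Mem := { s with regs := fun r => xs.getD r (s.regs r) }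

/-- Writes the strings `xs` in the registers `rs`; missing strings count as empty. -/
def store (s : Mem) (rs : List ℕ) (xs : List Str) : Mem :=
  { s with regs := fun r => if r ∈ rs then xs.getD (rs.idxOf r) [] else s.regs r }

/-- The contents of `len` consecutive registers. -/
def out (s : Mem) (first len : ℕ) : List Str := (List.range len).map fun j => s.regs (first + j)

/-- The element of `β` in the registers `first, first + 1, …`; anything that is not the encoding of
an element of `β` counts as the default element. -/
noncomputable def read (β : Type) [BitRep β] [Inhabited β] (s : Mem) (first : ℕ := 0) : β :=
  (parse (s.out first (BitRep.arity β))).getD default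

end Mem

/-- A fair coin. -/
noncomputable def coin : PMF Bool := PMF.uniformOfFintype Bool

/-- The uniform distribution on `{0,1}^n`. -/
noncomputable def unif (n : ℕ) : PMF (Bits n) := PMF.uniformOfFintype (Bits n)

/-- A classical oracle with internal state in `σ`. -/
abbrev Oracle (σ : Type) := σ → List Str → PMF (List Str × σ)

/-- `t` repetitions of a random step. -/
noncomputable def iterPMF {α : Type} (f : α → PMF α) : ℕ → α → PMF α
  | 0, a => pure a
  | t + 1, a => f a >>= iterPMF f t

/-- The distribution of the final state of a program (and of its oracle). -/
noncomputable def Prog.exec {σ : Type} (O : Oracle σ) : Prog → Mem × σ → PMF (Mem × σ)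
  | skip, s => pure (s.1.tick, s.2)
  | push b r, s => pure (s.1.tick.set r (b :: s.1.regs r), s.2)
  | pop r, s => pure (s.1.tick.set r (s.1.regs r).tail, s.2)
  | copy src dst, s => pure (s.1.tick.set dst (s.1.regs src), s.2)
  | coin r, s => do
      let b ← _root_.coin
      pure (s.1.tick.set r (b :: s.1.regs r), s.2)
  | hadamard q, s =>
      pure ({ s.1.tick with qubits := s.1.qubits.hadamard (s.1.regs q).length }, s.2)
  | tgate q, s => pure ({ s.1.tick with qubits := s.1.qubits.tgate (s.1.regs q).length }, s.2)
  | cnot c t, s =>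
      pure ({ s.1.tick with
        qubits := s.1.qubits.cnot (s.1.regs c).length (s.1.regs t).length }, s.2)
  | measure q r, s => do
      let b ← s.1.qubits.measure (s.1.regs q).length
      pure ({ s.1.tick.set r (b :: s.1.regs r) with
        qubits := s.1.qubits.project (s.1.regs q).length b }, s.2)
  | reset, s => pure ({ s.1.tick with qubits := Mem.empty.qubits }, s.2)
  | query args res, s => do
      let a ← O s.2 (args.map s.1.regs)
      pure (s.1.tick.store res a.1, a.2)
  | call P args res, s => do
      let t ← P.exec O ({ s.1.tick with regs := (Mem.empty.load (args.map s.1.regs)).regs }, s.2)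
      pure ({ t.1 with regs := (s.1.store res (t.1.out 0 res.length)).regs }, t.2)
  | seq P Q, s => P.exec O s >>= Q.exec O
  | branch r P Q R, s =>
      match s.1.regs r with
      | [] => P.exec O (s.1.tick, s.2)
      | false :: _ => Q.exec O (s.1.tick, s.2)
      | true :: _ => R.exec O (s.1.tick, s.2)
  | loop r P, s =>
      iterPMF (fun s => P.exec O (s.1.tick, s.2)) (s.1.regs r).length (s.1.tick, s.2)

/-! ## Efficient algorithms -/

/-- No oracle. -/
noncomputable def noOracle : Oracle Unit := fun _ _ => pure ([], ())

/-- On input `xs`, the program has the output distribution `d` and makes at most `t` steps. -/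
def Prog.Computes {β : Type} [BitRep β] (P : Prog) (xs : List Str) (d : PMF β) (t : ℕ) : Prop :=
  (P.exec noOracle (Mem.empty.load xs, ())).map (fun s => s.1.out 0 (BitRep.arity β)) = d.map rep ∧
    ∀ s ∈ (P.exec noOracle (Mem.empty.load xs, ())).support, s.1.clock ≤ t

/-- `f` is a probabilistic polynomial time algorithm. It gets its parameters, the security parameter
among them, in unary, and its time is polynomial in them. -/
def PPT {ι : Type} (params : ι → List ℕ) {α β : ι → Type} [∀ i, BitRep (α i)] [∀ i, BitRep (β i)]
    (f : ∀ i, α i → PMF (β i)) : Prop :=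
  ∃ P : Prog, P.Classical ∧ ∃ p : Polynomial ℕ, ∀ (i : ι) (a : α i),
    P.Computes ((params i).map unary ++ rep a) (f i a) (p.eval (params i).sum)

/-- The security parameter as only parameter. -/
abbrev secParam (n : ℕ) : List ℕ := [n]

/-- The security parameter and the constraint parameter `κ`. -/
abbrev secParams (i : ℕ × ℕ) : List ℕ := [i.1, i.2]

/-- `1^n ↦ 1^(k n)` is computable in polynomial time; in particular `k` is polynomially bounded. -/
def UnaryComputable (k : ℕ → ℕ) : Prop :=
  PPT secParam (α := fun _ => Unit) (β := fun _ => Str) fun n _ => pure (unary (k n))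

/-- Negligible functions of the security parameter. -/
def Negl (f : ℕ → ℝ) : Prop := Asymptotics.SuperpolynomialDecay atTop (fun n : ℕ => (n : ℝ)) f

/-- The probability that an experiment outputs 1. -/
noncomputable def prob (g : PMF Bool) : ℝ := (g true).toReal

/-- `2 |Pr[g = 1] - 1/2|`. -/
noncomputable def advantage (g : PMF Bool) : ℝ := 2 * |prob g - 1 / 2|

/-! ## Adversaries -/

/-- Adversaries are plain quantum polynomial time algorithms, or are helped by classical advice of
polynomial length. -/
inductive Uniformity where
  | uniform
  | nonuniform

/-- The advice that is available to an adversary. -/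
def Uniformity.Advice : Uniformity → (ℕ → Str) → Prop
  | uniform, a => ∀ n, a n = []
  | nonuniform, a => ∃ p : Polynomial ℕ, ∀ n, (a n).length ≤ p.eval n

/-- A stateful adversary: round `j` of a game is played by `prog j`, and the memory persists. -/
structure Adversary where
  prog : ℕ → Prog
  advice : ℕ → Str

/-- Round `j`: the adversary is run on `1^n`, its advice, and the message `xs` of the challenger. -/
noncomputable def Adversary.run {σ : Type} (A : Adversary) (n j : ℕ) (O : Oracle σ)
    (xs : List Str) (s : Mem × σ) : PMF (Mem × σ) :=
  (A.prog j).exec O (s.1.load (unary n :: A.advice n :: xs), s.2)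

/-- The format of a round: which messages of the challenger (in dependence on what the adversary has
sent before) and which answers to an oracle query are well-formed. -/
structure Round where
  input : Mem → Set (List Str)
  answer : List Str → Set (List Str)

/-- All the states that the adversary can reach in rounds of the given formats, whatever well-formed
messages and answers it gets. -/
def Adversary.reach (A : Adversary) (n : ℕ) : ℕ → List Round → Set Mem → Set Mem
  | _, [], S => S
  | j, R :: Rs, S => A.reach n (j + 1) Rs
      {t | ∃ s ∈ S, ∃ xs ∈ R.input s, ∃ O : Oracle Unit,
        (∀ q, ∀ a ∈ (O () q).support, a.1 ∈ R.answer q) ∧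
          (t, ()) ∈ (A.run n j O xs (s, ())).support}

/-- Polynomial time adversaries for games of the given format. -/
def Adversary.QPT (A : Adversary) (u : Uniformity) (rounds : ℕ → List Round) : Prop :=
  u.Advice A.advice ∧
    ∃ p : Polynomial ℕ, ∀ n, ∀ s ∈ A.reach n 0 (rounds n) {Mem.empty}, s.clock ≤ p.eval n

/-- The messages that encode an element of `α`. -/
def msgs (α : Type) [BitRep α] : Set (List Str) := Set.range (rep : α → List Str)

/-- The oracle that answers queries in `α` by `f`; other queries are answered by nothing. -/
noncomputable def oracle {σ α β : Type} [BitRep α] [BitRep β] (f : σ → α → PMF (β × σ)) : Oracle σ :=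
  fun st q => match (parse q : Option α) with
    | none => pure ([], st)
    | some a => (f st a).map fun r => (rep r.1, r.2)

/-- The oracle that answers by a randomized function and keeps a list of the queries. -/
noncomputable def logged {α β : Type} [BitRep α] [BitRep β] (f : α → PMF β) : Oracle (List α) :=
  oracle fun log a => (f a).map fun b => (b, a :: log)

open Classical in
/-- The well-formed answers of an oracle with queries in `α` and answers in `β`. -/
def answers (α β : Type) [BitRep α] [BitRep β] (q : List Str) : Set (List Str) :=
  if q ∈ msgs α then msgs β else {[]}

/-- The format of a round without oracle. -/
def silent (input : Mem → Set (List Str)) : Round := ⟨input, fun _ => {[]}⟩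

/-! ## Symmetric key encryption -/

/-- Symmetric key encryption with plaintexts in `{0,1}^(pt n)` and ciphertexts in `{0,1}^(ct n)`. -/
structure SKE (pt ct : ℕ → ℕ) where
  keyLen : ℕ → ℕ
  gen : ∀ n, PMF (Bits (keyLen n))
  enc : ∀ n, Bits (keyLen n) → Bits (pt n) → PMF (Bits (ct n))
  dec : ∀ n, Bits (keyLen n) → Bits (ct n) → Option (Bits (pt n))

namespace SKE

variable {pt ct : ℕ → ℕ}

/-- The algorithms are efficient. -/
def Efficient (E : SKE pt ct) : Prop :=
  PPT secParam (α := fun _ => Unit) (fun n _ => E.gen n) ∧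
  PPT secParam (α := fun n => Bits (E.keyLen n) × Bits (pt n)) (fun n a => E.enc n a.1 a.2) ∧
  PPT secParam (α := fun n => Bits (E.keyLen n) × Bits (ct n)) (fun n a => pure (E.dec n a.1 a.2))

/-- Decryption recovers the plaintext with probability 1. -/
def Correct (E : SKE pt ct) : Prop :=
  ∀ n m, prob (do
    let key ← E.gen n
    let c ← E.enc n key m
    pure (decide (E.dec n key c = some m))) = 1

/-- Most strings are not valid ciphertexts. -/
def Sparse (E : SKE pt ct) : Prop :=
  Negl fun n => prob (do
    let key ← E.gen n
    let c ← unif (ct n)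
    pure (decide (E.dec n key c ≠ none)))

/-- The game of ciphertext pseudorandomness. -/
noncomputable def game (E : SKE pt ct) (A : Adversary) (n : ℕ) : PMF Bool := do
  let key ← E.gen n
  let s ← A.run n 0 (logged (E.enc n key)) [] (Mem.empty, [])
  let m := s.1.read (Bits (pt n))
  let b ← coin
  let c ← if b then unif (ct n) else E.enc n key m
  let s ← A.run n 1 (logged (E.enc n key)) (rep c) s
  pure (s.1.read Bool == b)

def rounds (_ : SKE pt ct) (n : ℕ) : List Round :=
  [⟨fun _ => {[]}, answers (Bits (pt n)) (Bits (ct n))⟩,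
   ⟨fun _ => msgs (Bits (ct n)), answers (Bits (pt n)) (Bits (ct n))⟩]

def PseudorandomCiphertexts (E : SKE pt ct) (u : Uniformity) : Prop :=
  ∀ A : Adversary, A.QPT u E.rounds → Negl fun n => advantage (E.game A n)

/-- A secure SKE scheme with sparse, pseudorandom ciphertexts. -/
def Secure (E : SKE pt ct) (u : Uniformity) : Prop :=
  E.Efficient ∧ E.Correct ∧ E.Sparse ∧ E.PseudorandomCiphertexts u

end SKE

/-! ## Public key encryption -/

/-- Public key encryption with plaintexts in `{0,1}^(pt n)`. -/
structure PKE (pt : ℕ → ℕ) where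
  pkLen : ℕ → ℕ
  skLen : ℕ → ℕ
  ctLen : ℕ → ℕ
  gen : ∀ n, PMF (Bits (pkLen n) × Bits (skLen n))
  enc : ∀ n, Bits (pkLen n) → Bits (pt n) → PMF (Bits (ctLen n))
  dec : ∀ n, Bits (skLen n) → Bits (ctLen n) → Option (Bits (pt n))

namespace PKE

variable {pt : ℕ → ℕ}

/-- The algorithms are efficient. -/
def Efficient (E : PKE pt) : Prop :=
  PPT secParam (α := fun _ => Unit) (fun n _ => E.gen n) ∧
  PPT secParam (α := fun n => Bits (E.pkLen n) × Bits (pt n)) (fun n a => E.enc n a.1 a.2) ∧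
  PPT secParam (α := fun n => Bits (E.skLen n) × Bits (E.ctLen n))
    (fun n a => pure (E.dec n a.1 a.2))

/-- Decryption recovers the plaintext with probability 1. -/
def Correct (E : PKE pt) : Prop :=
  ∀ n m, prob (do
    let keys ← E.gen n
    let c ← E.enc n keys.1 m
    pure (decide (E.dec n keys.2 c = some m))) = 1

/-- The CCA game. An adversary that asks for the decryption of the challenge ciphertext is treated
as if it had guessed at random. -/
noncomputable def game (E : PKE pt) (A : Adversary) (n : ℕ) : PMF Bool := do
  let keys ← E.gen n
  let O := logged fun c : Bits (E.ctLen n) => (pure (E.dec n keys.2 c) : PMF _)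
  let s ← A.run n 0 O (rep keys.1) (Mem.empty, [])
  let m₀ := s.1.read (Bits (pt n)) 0
  let m₁ := s.1.read (Bits (pt n)) 1
  let b ← coin
  let c ← E.enc n keys.1 (if b then m₁ else m₀)
  let s ← A.run n 1 O (rep c) (s.1, [])
  if c ∈ s.2 then coin else pure (s.1.read Bool == b)

def rounds (E : PKE pt) (n : ℕ) : List Round :=
  [⟨fun _ => msgs (Bits (E.pkLen n)), answers (Bits (E.ctLen n)) (Option (Bits (pt n)))⟩,
   ⟨fun _ => msgs (Bits (E.ctLen n)), answers (Bits (E.ctLen n)) (Option (Bits (pt n)))⟩]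

/-- A CCA secure PKE scheme. -/
def CCASecure (E : PKE pt) (u : Uniformity) : Prop :=
  E.Efficient ∧ E.Correct ∧
    ∀ A : Adversary, A.QPT u E.rounds → Negl fun n => advantage (E.game A n)

end PKE

/-! ## Constrained pseudorandom functions -/

/-- A constrained PRF with domain `{0,1}^(dom n)`, range `{0,1}^(ran n)`, and, as constraints with
parameter `κ`, the Boolean circuits of size at most `κ`. A value `x` with `f x = 1` is one at which
the constrained key for `f` does not allow the evaluation. -/
structure CPRF (dom ran : ℕ → ℕ) where
  mskLen : ℕ → ℕ → ℕ
  skLen : ℕ → ℕ → ℕ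
  setup : ∀ n κ, PMF (Bits (mskLen n κ))
  constrain : ∀ n κ, Bits (mskLen n κ) → Circ (dom n) κ → PMF (Bits (skLen n κ))
  eval : ∀ n κ, Bits (mskLen n κ) → Bits (dom n) → Bits (ran n)
  ceval : ∀ n κ, Bits (skLen n κ) → Bits (dom n) → Bits (ran n)

/-- A simulator of a constrained PRF: `init` outputs an initial state and a simulated constrained
key, and `step` outputs a new state and a simulated value. -/
structure CPRF.Simulator {dom ran : ℕ → ℕ} (C : CPRF dom ran) where
  init : ∀ n κ, PMF (Str × Bits (C.skLen n κ))
  step : ∀ n, ℕ → Str → Bits (dom n) → Bool → PMF (Str × Bits (ran n))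

/-- The states in which a simulator can be after `j` queries. -/
def CPRF.Simulator.states {dom ran : ℕ → ℕ} {C : CPRF dom ran} (S : C.Simulator) (n κ : ℕ) :
    ℕ → Set Str
  | 0 => {st | ∃ sk, (st, sk) ∈ (S.init n κ).support}
  | j + 1 => {st' | ∃ st ∈ S.states n κ j, ∃ x b y, (st', y) ∈ (S.step n κ st x b).support}

/-- The simulator is a stateful probabilistic polynomial time algorithm: the time for a query is
polynomial in the parameters and in the number of queries before. It may use advice if the adversary
may. -/
def CPRF.Simulator.Efficient {dom ran : ℕ → ℕ} {C : CPRF dom ran} (S : C.Simulator)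
    (u : Uniformity) : Prop :=
  ∃ P₁ P₂ : Prog, P₁.Classical ∧ P₂.Classical ∧ ∃ advice : ℕ → Str, u.Advice advice ∧
    ∃ p : Polynomial ℕ, ∀ n κ,
      P₁.Computes [unary n, unary κ, advice n] (S.init n κ) (p.eval (n + κ)) ∧
      ∀ j, ∀ st ∈ S.states n κ j, ∀ (x : Bits (dom n)) (b : Bool),
        P₂.Computes ([unary n, unary κ, advice n] ++ rep (st, x, b)) (S.step n κ st x b)
          (p.eval (n + κ + j))

namespace CPRF

variable {dom ran : ℕ → ℕ}

/-- The algorithms are efficient. -/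
def Efficient (C : CPRF dom ran) : Prop :=
  PPT secParams (α := fun _ => Unit) (fun i _ => C.setup i.1 i.2) ∧
  PPT secParams (α := fun i => Bits (C.mskLen i.1 i.2) × Circ (dom i.1) i.2)
    (fun i a => C.constrain i.1 i.2 a.1 a.2) ∧
  PPT secParams (α := fun i => Bits (C.mskLen i.1 i.2) × Bits (dom i.1))
    (β := fun i => Bits (ran i.1)) (fun i a => pure (C.eval i.1 i.2 a.1 a.2)) ∧
  PPT secParams (α := fun i => Bits (C.skLen i.1 i.2) × Bits (dom i.1))
    (β := fun i => Bits (ran i.1)) (fun i a => pure (C.ceval i.1 i.2 a.1 a.2))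

/-- The constraint parameter sent by the adversary: register 0, in unary. -/
def sentParam (s : Mem) : ℕ := (s.regs 0).length

/-- The constraint sent by the adversary, in register 1. -/
noncomputable def sentConstraint (_ : CPRF dom ran) (n : ℕ) (s : Mem) :
    Circ (dom n) (sentParam s) :=
  s.read (Circ (dom n) (sentParam s)) 1

/-- The first round of the games: no input, no oracle. -/
def firstRound : Round := silent fun _ => {[]}

/-- The second round of the games: the adversary gets a constrained key, and oracle access. -/
def secondRound (C : CPRF dom ran) (n : ℕ) : Round :=
  ⟨fun s => msgs (Bits (C.skLen n (sentParam s))), answers (Bits (dom n)) (Bits (ran n))⟩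

/-- The correctness game: the adversary looks for an `x` with `f x = 0` at which the constrained
evaluation is wrong. -/
noncomputable def correctnessGame (C : CPRF dom ran) (A : Adversary) (n : ℕ) : PMF Bool := do
  let s ← A.run n 0 noOracle [] (Mem.empty, ())
  let κ := sentParam s.1
  let f := C.sentConstraint n s.1
  let msk ← C.setup n κ
  let sk ← C.constrain n κ msk f
  let s ← A.run n 1 (logged fun x => (pure (C.eval n κ msk x) : PMF _)) (rep sk) (s.1, [])
  let x := s.1.read (Bits (dom n))
  pure (decide (C.eval n κ msk x ≠ C.ceval n κ sk x ∧ f.eval x = false))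

def Correct (C : CPRF dom ran) (u : Uniformity) : Prop :=
  ∀ A : Adversary, A.QPT u (fun n => [firstRound, C.secondRound n]) →
    Negl fun n => prob (C.correctnessGame A n)

/-- The game of selective single-key pseudorandomness. An adversary that violates the conditions on
the challenge `x` (never queried, and `f x ≠ 0`) is treated as if it had guessed at random. -/
noncomputable def pseudorandomnessGame (C : CPRF dom ran) (A : Adversary) (n : ℕ) : PMF Bool := do
  let s ← A.run n 0 noOracle [] (Mem.empty, ())
  let κ := sentParam s.1
  let f := C.sentConstraint n s.1
  let msk ← C.setup n κ
  let sk ← C.constrain n κ msk f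
  let O := logged fun x => (pure (C.eval n κ msk x) : PMF (Bits (ran n)))
  let s ← A.run n 1 O (rep sk) (s.1, [])
  let x := s.1.read (Bits (dom n))
  let b ← coin
  let y ← if b then unif (ran n) else pure (C.eval n κ msk x)
  let s ← A.run n 2 O (rep y) s
  if x ∉ s.2 ∧ f.eval x ≠ false then pure (s.1.read Bool == b) else coin

def Pseudorandom (C : CPRF dom ran) (u : Uniformity) : Prop :=
  ∀ A : Adversary,
    A.QPT u (fun n => [firstRound, C.secondRound n,
      ⟨fun _ => msgs (Bits (ran n)), answers (Bits (dom n)) (Bits (ran n))⟩]) →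
    Negl fun n => advantage (C.pseudorandomnessGame A n)

/-- The game of selective single-key privacy. -/
noncomputable def privacyGame (C : CPRF dom ran) (S : C.Simulator) (A : Adversary) (n : ℕ) :
    PMF Bool := do
  let s ← A.run n 0 noOracle [] (Mem.empty, ())
  let κ := sentParam s.1
  let f := C.sentConstraint n s.1
  let b ← coin
  if b then do
    let r ← S.init n κ
    let O : Oracle Str := oracle fun st x => (S.step n κ st x (f.eval x)).map Prod.swap
    let t ← A.run n 1 O (rep r.2) (s.1, r.1)
    pure (t.1.read Bool == b)
  else do
    let msk ← C.setup n κ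
    let sk ← C.constrain n κ msk f
    let t ← A.run n 1 (logged fun x => (pure (C.eval n κ msk x) : PMF _)) (rep sk) (s.1, [])
    pure (t.1.read Bool == b)

def Private (C : CPRF dom ran) (u : Uniformity) : Prop :=
  ∀ A : Adversary, A.QPT u (fun n => [firstRound, C.secondRound n]) →
    ∃ S : C.Simulator, S.Efficient u ∧ Negl fun n => advantage (C.privacyGame S A n)

/-- A selectively single-key private constrained PRF. -/
def SelectivelySingleKeyPrivate (C : CPRF dom ran) (u : Uniformity) : Prop :=
  C.Efficient ∧ C.Correct u ∧ C.Pseudorandom u ∧ C.Private u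

end CPRF

/-! ## Extraction-less watermarking PRFs -/

/-- The algorithms of an extraction-less watermarking PRF with message space `{0,1}^(k n)`, domain
`{0,1}^(dom n)` and range `{0,1}^(ran n)`. A marked circuit is given by its description, an element
of `Marked n`, and `evalMarked` evaluates it. -/
structure ELWMPRF (k dom ran : ℕ → ℕ) where
  PP : ℕ → Type
  XK : ℕ → Type
  Key : ℕ → Type
  Tag : ℕ → Type
  Marked : ℕ → Type
  repPP : ∀ n, BitRep (PP n)
  repXK : ∀ n, BitRep (XK n)
  repKey : ∀ n, BitRep (Key n)
  repTag : ∀ n, BitRep (Tag n)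
  repMarked : ∀ n, BitRep (Marked n)
  setup : ∀ n, PMF (PP n × XK n)
  gen : ∀ n, PP n → PMF (Key n × Tag n)
  eval : ∀ n, Key n → Bits (dom n) → Bits (ran n)
  mark : ∀ n, PP n → Key n → Bits (k n) → PMF (Marked n)
  evalMarked : ∀ n, Marked n → Bits (dom n) → Bits (ran n)
  sim : ∀ n, XK n → Tag n → Fin (k n) → PMF (Bool × Bits (dom n) × Bits (ran n))

attribute [instance] ELWMPRF.repPP ELWMPRF.repXK ELWMPRF.repKey ELWMPRF.repTag ELWMPRF.repMarked

namespace ELWMPRF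

variable {k dom ran : ℕ → ℕ}

/-- The algorithms are efficient. -/
def Efficient (W : ELWMPRF k dom ran) : Prop :=
  PPT secParam (α := fun _ => Unit) (fun n _ => W.setup n) ∧
  PPT secParam (α := W.PP) (fun n a => W.gen n a) ∧
  PPT secParam (α := fun n => W.Key n × Bits (dom n)) (β := fun n => Bits (ran n))
    (fun n a => pure (W.eval n a.1 a.2)) ∧
  PPT secParam (α := fun n => W.PP n × W.Key n × Bits (k n))
    (fun n a => W.mark n a.1 a.2.1 a.2.2) ∧
  PPT secParam (α := fun n => W.Marked n × Bits (dom n)) (β := fun n => Bits (ran n))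
    (fun n a => pure (W.evalMarked n a.1 a.2)) ∧
  PPT secParam (α := fun n => W.XK n × W.Tag n × Fin (k n))
    (β := fun n => Bool × Bits (dom n) × Bits (ran n)) (fun n a => W.sim n a.1 a.2.1 a.2.2)

/-- The choices of messages for which evaluation correctness is required: all sequences of messages
in the nonuniform setting, all efficiently samplable messages in the uniform setting. -/
def Messages (u : Uniformity) (M : ∀ n, PMF (Bits (k n))) : Prop :=
  match u with
  | .uniform => PPT secParam (α := fun _ => Unit) fun n _ => M n
  | .nonuniform => ∀ n, ∃ m, M n = pure m

/-- A marked circuit agrees with the PRF at a random point. -/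
noncomputable def evaluationGame (W : ELWMPRF k dom ran) (M : ∀ n, PMF (Bits (k n))) (n : ℕ) :
    PMF Bool := do
  let m ← M n
  let keys ← W.setup n
  let r ← W.gen n keys.1
  let c ← W.mark n keys.1 r.1 m
  let x ← unif (dom n)
  pure (decide (W.evalMarked n c x = W.eval n r.1 x))

def EvaluationCorrect (W : ELWMPRF k dom ran) (u : Uniformity) : Prop :=
  ∀ M, Messages u M → Negl fun n => 1 - prob (W.evaluationGame M n)

/-- The distribution `D_{real,i}`: `(γ, x, y)` where `y` is uniform if `γ = m[i]` and the value of
the PRF at `x` otherwise. -/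
noncomputable def real (W : ELWMPRF k dom ran) (n : ℕ) (key : W.Key n) (m : Bits (k n))
    (i : Fin (k n)) : PMF (Bool × Bits (dom n) × Bits (ran n)) := do
  let γ ← coin
  let x ← unif (dom n)
  let y ← if γ = m i then unif (ran n) else pure (W.eval n key x)
  pure (γ, x, y)

/-- The SIM-MDD game with private simulation. -/
noncomputable def simMDDGame (W : ELWMPRF k dom ran) (A : Adversary) (n : ℕ) (i : Fin (k n)) :
    PMF Bool := do
  let keys ← W.setup n
  let s ← A.run n 0 noOracle (rep keys.1) (Mem.empty, ())
  let m := s.1.read (Bits (k n))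
  let r ← W.gen n keys.1
  let c ← W.mark n keys.1 r.1 m
  let s ← A.run n 1 (logged fun q : W.Tag n × Fin (k n) => W.sim n keys.2 q.1 q.2)
    (rep (r.2, c)) (s.1, [])
  let b ← coin
  let z ← if b then W.sim n keys.2 r.2 i else W.real n r.1 m i
  let s ← A.run n 2 noOracle (rep z) (s.1, ())
  pure (s.1.read Bool == b)

def rounds (W : ELWMPRF k dom ran) (n : ℕ) : List Round :=
  [silent fun _ => msgs (W.PP n),
   ⟨fun _ => msgs (W.Tag n × W.Marked n),
    answers (W.Tag n × Fin (k n)) (Bool × Bits (dom n) × Bits (ran n))⟩,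
   silent fun _ => msgs (Bool × Bits (dom n) × Bits (ran n))]

/-- SIM-MDD security with private simulation. -/
def SimMDDSecure (W : ELWMPRF k dom ran) (u : Uniformity) : Prop :=
  ∀ (i : ∀ n, Fin (k n)) (A : Adversary), A.QPT u W.rounds →
    Negl fun n => advantage (W.simMDDGame A n (i n))

end ELWMPRF

/-! ## The construction -/

/-- The plaintext `i‖γ`. -/
def indexed {k : ℕ} (i : Fin k) (γ : Bool) : Bits (Nat.clog 2 k + 1) := Fin.snoc (indexBits i) γ

section Construction

variable {k dom ran : ℕ → ℕ}

/-- The two families of circuits of the construction, of size at most `κ n`, written down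
efficiently. `mark n key m` outputs 1 on `x` if `x` decrypts to some `i‖γ` with `γ = m[i]`, and 0
otherwise; `auth n key` outputs 0 if `x` is decryptable, and 1 otherwise. -/
structure ConstraintCircuits (E : SKE (fun n => Nat.clog 2 (k n) + 1) dom) (κ : ℕ → ℕ) where
  mark : ∀ n, Bits (E.keyLen n) → Bits (k n) → Circ (dom n) (κ n)
  auth : ∀ n, Bits (E.keyLen n) → Circ (dom n) (κ n)
  mark_eval : ∀ n key m x,
    (mark n key m).eval x = true ↔ ∃ i, E.dec n key x = some (indexed i (m i))
  auth_eval : ∀ n key x, (auth n key).eval x = true ↔ E.dec n key x = none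
  mark_ppt : PPT secParam (α := fun n => Bits (E.keyLen n) × Bits (k n))
    (β := fun n => Circ (dom n) (κ n)) fun n a => pure (mark n a.1 a.2)
  auth_ppt : PPT secParam (α := fun n => Bits (E.keyLen n))
    (β := fun n => Circ (dom n) (κ n)) fun n a => pure (auth n a)

/-- The extraction-less watermarking PRF from a constrained PRF `C`, symmetric key encryption `E`
and public key encryption `P`. The plaintexts of `P` are the pairs of a constrained key of `C` and a
key of `E`, written one after the other. -/
noncomputable def cprfWatermarking {κ : ℕ → ℕ} (E : SKE (fun n => Nat.clog 2 (k n) + 1) dom)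
    (C : CPRF dom ran) (P : PKE (fun n => C.skLen n (κ n) + E.keyLen n))
    (D : ConstraintCircuits E κ) : ELWMPRF k dom ran where
  PP n := Bits (P.pkLen n)
  XK n := Bits (P.skLen n)
  Key n := Bits (C.mskLen n (κ n)) × Bits (E.keyLen n)
  Tag n := Bits (P.ctLen n)
  Marked n := Bits (C.skLen n (κ n))
  repPP _ := inferInstance
  repXK _ := inferInstance
  repKey _ := inferInstance
  repTag _ := inferInstance
  repMarked _ := inferInstance
  setup n := P.gen n
  gen n pk := do
    let msk ← C.setup n (κ n)
    let key ← E.gen n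
    let sk ← C.constrain n (κ n) msk (D.auth n key)
    let τ ← P.enc n pk (Fin.append sk key)
    pure ((msk, key), τ)
  eval n prfk x := C.eval n (κ n) prfk.1 x
  mark n _ prfk m := C.constrain n (κ n) prfk.1 (D.mark n prfk.2 m)
  evalMarked n sk x := C.ceval n (κ n) sk x
  sim n sk τ i :=
    match P.dec n sk τ with
    -- an invalid tag is answered by a fixed triple
    | none => pure (false, fun _ => false, fun _ => false)
    | some d => do
      let skAuth : Bits (C.skLen n (κ n)) := fun j => d (Fin.castAdd (E.keyLen n) j)
      let key : Bits (E.keyLen n) := fun j => d (Fin.natAdd (C.skLen n (κ n)) j)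
      let γ ← coin
      let x ← E.enc n key (indexed i γ)
      pure (γ, x, C.ceval n (κ n) skAuth x)

end Construction

/-! A triple of `Sim` differs from the triple for `coin = 0` in two ways: `x` is a ciphertext of
`i‖γ` instead of a uniform string, and `y` is computed with the constrained key of the tag, instead
of being uniform for `γ = msg[i]` and the PRF value otherwise. A chain of hybrid games removes both
differences. By perfect correctness of the public key encryption, everything that concerns the
challenge tag `τ` can be answered from the keys inside it (`tagGame_false`). The CCA reduction then
replaces `τ` by an encryption of zeros, since all other tags are handled by the decryption oracle
(`pke_step`). The key `G_auth` now serves only to evaluate at ciphertexts. These are decryptable, so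
`D_auth` is 0 there and correctness of the constrained PRF yields the true PRF values
(`ceval_step`). If `γ = msg[i]`, the challenge ciphertext is a point with `D[K,msg] = 1`, so
pseudorandomness makes `y` uniform, unless the point was evaluated before (`pr_step`). Such
repetitions are rare: a sparse scheme with pseudorandom ciphertexts hardly ever produces the same
ciphertext twice (`SKE.Secure.collision_negl`, `expect_repeated`). At this point `y` follows the
same rule in both cases of the challenge. Privacy replaces the marked key and the PRF by a simulator
that sees only the bits `D[K,msg](x)` (`privacy_step`). For a ciphertext of `i‖γ` this bit says
whether `γ = msg[i]`; for a uniform `x` it is 0 up to sparsity; hence the key `K` is not needed to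
compute it (`sparse_step`). Since `K` is now used for encryption only, the challenge ciphertext is
indistinguishable from a uniform string (`ske_step`). The index `i*` need not be computable, so a
uniform reduction cannot contain it. The chain is therefore proved for adversaries that choose the
index themselves (`HybridAdversary.advantage_negl`). For a fixed index, a new adversary draws a
random index, first plays the whole game against its own challenger, and uses the outcome to correct
the sign of its advantage in the true game. Its advantage is the average over the drawn strings of
the squared advantages, so the advantage at `i*` is at most the root of `2k` times a negligible
function (`HybridAdversary.exists_signed`, `advantage_sq_le`). Every reduction has to be an actual
program. `Eff` and `EffO` are classes of typed functions, without and with oracle access, that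
polynomial time programs compute; they are closed under the usual operations. `Prog.trans` runs one
adversary inside another one, and `Realized` describes steps that combine such runs with
calculations. Distributions are compared by `Couples` and `Approx`, which express exact and
approximate couplings by inequalities between expectations, so that no joint distribution has to be
constructed. -/

set_option linter.unusedSectionVars false


/-! ## Expectations and relational reasoning for random experiments -/

section Expect

open ENNReal

variable {α β γ δ : Type}

/-- The expectation of a nonnegative function. -/
noncomputable def expect (p : PMF α) (f : α → ENNReal) : ENNReal := ∑' a, p a * f a

theorem expect_pure (a : α) (f : α → ENNReal) : expect (pure a) f = f a := by
  show ∑' b, PMF.pure a b * f b = f a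
  rw [tsum_eq_single a]
  · simp
  · intro b hb
    simp [hb]

theorem expect_bind (p : PMF α) (k : α → PMF β) (f : β → ENNReal) :
    expect (p >>= k) f = expect p fun a => expect (k a) f := by
  show ∑' b, (∑' a, p a * k a b) * f b = ∑' a, p a * ∑' b, k a b * f b
  simp_rw [← ENNReal.tsum_mul_right, ← ENNReal.tsum_mul_left]
  rw [ENNReal.tsum_comm]
  simp_rw [mul_assoc]

theorem expect_map (p : PMF α) (g : α → β) (f : β → ENNReal) :
    expect (p.map g) f = expect p fun a => f (g a) := by
  have h : p.map g = p >>= fun a => pure (g a) := rfl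
  rw [h, expect_bind]
  simp_rw [expect_pure]

theorem expect_mono_of_support {p : PMF α} {f g : α → ENNReal} (h : ∀ a ∈ p.support, f a ≤ g a) :
    expect p f ≤ expect p g := by
  refine ENNReal.tsum_le_tsum fun a => ?_
  by_cases ha : a ∈ p.support
  · gcongr
    exact h a ha
  · have : p a = 0 := by simpa [PMF.mem_support_iff] using ha
    simp [this]

theorem expect_mono {p : PMF α} {f g : α → ENNReal} (h : ∀ a, f a ≤ g a) :
    expect p f ≤ expect p g := expect_mono_of_support fun a _ => h a

theorem expect_congr {p : PMF α} {f g : α → ENNReal} (h : ∀ a ∈ p.support, f a = g a) :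
    expect p f = expect p g :=
  le_antisymm (expect_mono_of_support fun a ha => (h a ha).le)
    (expect_mono_of_support fun a ha => (h a ha).ge)

theorem expect_const (p : PMF α) (c : ENNReal) : expect p (fun _ => c) = c := by
  rw [expect, ENNReal.tsum_mul_right, p.tsum_coe, one_mul]

theorem expect_add (p : PMF α) (f g : α → ENNReal) :
    expect p (fun a => f a + g a) = expect p f + expect p g := by
  simp only [expect, mul_add]
  exact ENNReal.tsum_add

theorem expect_mul_left (p : PMF α) (c : ENNReal) (f : α → ENNReal) :
    expect p (fun a => c * f a) = c * expect p f := by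
  simp only [expect]
  rw [← ENNReal.tsum_mul_left]
  simp_rw [mul_left_comm]

theorem expect_le_one {p : PMF α} {f : α → ENNReal} (h : ∀ a, f a ≤ 1) : expect p f ≤ 1 :=
  (expect_mono h).trans (expect_const p 1).le

theorem expect_eq_zero_iff {p : PMF α} {f : α → ENNReal} :
    expect p f = 0 ↔ ∀ a ∈ p.support, f a = 0 := by
  simp only [expect, ENNReal.tsum_eq_zero, mul_eq_zero, PMF.mem_support_iff]
  exact forall_congr' fun a => or_iff_not_imp_left

theorem expect_single [DecidableEq α] (p : PMF α) (a : α) :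
    expect p (fun b => if b = a then 1 else 0) = p a := by
  rw [expect, tsum_eq_single a]
  · simp
  · intro b hb
    simp [hb]

theorem mem_support_bind {p : PMF α} {k : α → PMF β} {b : β} :
    b ∈ (p >>= k).support ↔ ∃ a ∈ p.support, b ∈ (k a).support :=
  PMF.mem_support_bind_iff p k b

theorem mem_support_pure {a b : α} : b ∈ (pure a : PMF α).support ↔ b = a :=
  PMF.mem_support_pure_iff a b

theorem PMF.exists_mem_support (p : PMF α) : ∃ a, a ∈ p.support := p.support_nonempty

/-- Two random values can be coupled such that the relation `R` holds, expressed by the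
inequalities between expectations that this implies. -/
def Couples (p : PMF α) (q : PMF β) (R : α → β → Prop) : Prop :=
  ∀ (f : α → ENNReal) (g : β → ENNReal), (∀ a b, R a b → f a ≤ g b) → expect p f ≤ expect q g

namespace Couples

variable {p : PMF α} {q : PMF β} {R S : α → β → Prop}

theorem pure {a : α} {b : β} (h : R a b) : Couples (pure a) (pure b) R := by
  intro f g hfg
  rw [expect_pure, expect_pure]
  exact hfg a b h

theorem bind {k : α → PMF γ} {l : β → PMF δ} {T : γ → δ → Prop} (h : Couples p q R)
    (h' : ∀ a b, R a b → Couples (k a) (l b) T) : Couples (p >>= k) (q >>= l) T := by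
  intro f g hfg
  rw [expect_bind, expect_bind]
  exact h _ _ fun a b hab => h' a b hab f g hfg

theorem mono (h : Couples p q R) (hRS : ∀ a b, R a b → S a b) : Couples p q S :=
  fun f g hfg => h f g fun a b hab => hfg a b (hRS a b hab)

theorem refl (p : PMF α) : Couples p p Eq := by
  intro f g hfg
  exact expect_mono fun a => hfg a a rfl

/-- The supremum of `F` over a fibre of `f` depends only on the value of `f`, so its expectation can
be transported along the equality of the image distributions. -/
theorem of_map_eq {f : α → γ} {g : β → γ} (h : p.map f = q.map g) :
    Couples p q fun a b => f a = g b := by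
  intro F G hFG
  have h1 : expect p F ≤ expect p fun a => ⨆ a' : {a' // f a' = f a}, F a' :=
    expect_mono fun a => le_iSup (fun a' : {a' // f a' = f a} => F a') ⟨a, rfl⟩
  have h2 := expect_map p f fun c => ⨆ a' : {a' // f a' = c}, F a'
  rw [h, expect_map] at h2
  rw [← h2] at h1
  exact h1.trans (expect_mono fun b => iSup_le fun a' => hFG _ _ a'.2)

/-- Off the supports `f` may be lowered to 0 and `g` raised to `⊤`; neither changes an expectation,
and the inequality to be checked becomes trivial there. -/
theorem support (h : Couples p q R) : Couples p q fun a b => R a b ∧ a ∈ p.support ∧ b ∈ q.support := by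
  classical
  intro f g hfg
  have h1 : expect p f = expect p fun a => if a ∈ p.support then f a else 0 :=
    expect_congr fun a ha => by rw [if_pos ha]
  have h2 : expect q g = expect q fun b => if b ∈ q.support then g b else ⊤ :=
    expect_congr fun a ha => by rw [if_pos ha]
  rw [h1, h2]
  refine h _ _ fun a b hab => ?_
  by_cases ha : a ∈ p.support
  · by_cases hb : b ∈ q.support
    · simpa [ha, hb] using hfg a b ⟨hab, ha, hb⟩
    · simp [hb]
  · simp [ha]

/-- If `a` had no partner, the indicator of `a` could be tested against the function 0, and `p a`
would vanish. This is how bounds that hold for all outcomes are extracted from a coupling. -/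
theorem exists_right (h : Couples p q R) {a : α} (ha : a ∈ p.support) :
    ∃ b ∈ q.support, R a b := by
  classical
  by_contra hcon
  push Not at hcon
  have h1 := h.support (fun x => if x = a then 1 else 0) (fun _ => 0) (by
    rintro x b ⟨hxb, -, hb⟩
    have : x ≠ a := by
      rintro rfl
      exact hcon b hb hxb
    simp [this])
  rw [expect_single, expect_const] at h1
  exact ha (le_antisymm h1 bot_le)

/-- Indicators give `p ≤ q` pointwise; as both have total mass 1, no inequality can be strict. -/
theorem eq {p q : PMF α} (h : Couples p q Eq) : p = q := by
  classical
  have hle : ∀ a, p a ≤ q a := by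
    intro a
    have := h (fun b => if b = a then 1 else 0) (fun b => if b = a then 1 else 0) (by
      rintro _ _ rfl
      exact le_rfl)
    rwa [expect_single, expect_single] at this
  ext a
  refine le_antisymm (hle a) ?_
  by_contra hlt
  push Not at hlt
  have := ENNReal.tsum_lt_tsum (i := a) p.tsum_coe_ne_top hle hlt
  rw [p.tsum_coe, q.tsum_coe] at this
  exact lt_irrefl _ this

theorem map_eq (h : Couples p q R) {f : α → γ} {g : β → γ} (hR : ∀ a b, R a b → f a = g b) :
    p.map f = q.map g := by
  apply Couples.eq
  have : Couples (p >>= fun a => Pure.pure (f a)) (q >>= fun b => Pure.pure (g b)) Eq :=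
    h.bind fun a b hab => Couples.pure (hR a b hab)
  exact this

theorem bind_eq {k : α → PMF γ} {l : β → PMF γ} (h : Couples p q R)
    (hR : ∀ a b, R a b → k a = l b) : p >>= k = q >>= l := by
  apply Couples.eq
  exact h.bind fun a b hab => by rw [hR a b hab]; exact Couples.refl _

theorem map_right {g : β → γ} {T : α → γ → Prop} (h : Couples p q R)
    (hR : ∀ a b, R a b → T a (g b)) : Couples p (q.map g) T := by
  intro f f' hff
  rw [expect_map]
  exact h _ _ fun a b hab => hff _ _ (hR a b hab)

end Couples

theorem iterPMF_rel {f : α → PMF α} {g : β → PMF β} {R : α → β → Prop}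
    (h : ∀ a b, R a b → Couples (f a) (g b) R) (t : ℕ) {a : α} {b : β} (hab : R a b) :
    Couples (iterPMF f t a) (iterPMF g t b) R := by
  induction t generalizing a b with
  | zero => exact Couples.pure hab
  | succ t ih => exact (h a b hab).bind fun a b hab => ih hab

theorem bind_const_pmf (p : PMF α) (q : PMF β) : (p >>= fun _ => q) = q := PMF.bind_const p q

theorem bind_comm_pmf (p : PMF α) (q : PMF β) (f : α → β → PMF γ) :
    (p >>= fun a => q >>= f a) = q >>= fun b => p >>= fun a => f a b := PMF.bind_comm p q f

theorem bind_congr_support {p : PMF α} {k l : α → PMF β} (h : ∀ a ∈ p.support, k a = l a) :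
    p >>= k = p >>= l :=
  (Couples.refl p).support.bind_eq (by
    rintro a _ ⟨rfl, ha, -⟩
    exact h a ha)

end Expect

/-! ## Properties of executions -/

namespace Prog

/-- The final clock is at least the initial one, and no register gets longer than what was there in
the beginning by more than the number of steps; programs without oracle. -/
theorem exec_length (P : Prog) (s : Mem × Unit) (M : ℕ) (hM : ∀ r, (s.1.regs r).length ≤ M) :
    ∀ t ∈ (P.exec noOracle s).support,
      s.1.clock ≤ t.1.clock ∧ ∀ r, (t.1.regs r).length + s.1.clock ≤ M + t.1.clock := by
  induction P generalizing s M with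
  | skip | pop r | copy a b | push b r | hadamard q | tgate q | cnot a b | reset =>
    intro t ht
    simp only [exec, mem_support_pure] at ht
    subst ht
    refine ⟨by simp [Mem.tick, Mem.set], fun r' => ?_⟩
    have h1 := hM r'
    simp only [Mem.tick, Mem.set, Function.update_apply]
    try split_ifs
    all_goals try simp only [List.length_tail, List.length_cons]
    all_goals first | omega | (have := hM r; omega) | (have := hM a; omega)
  | coin r | measure q r =>
    intro t ht
    simp only [exec, mem_support_bind, mem_support_pure] at ht
    obtain ⟨b, -, rfl⟩ := ht
    refine ⟨by simp [Mem.tick, Mem.set], fun r' => ?_⟩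
    have h1 := hM r'
    have h2 := hM r
    simp only [Mem.tick, Mem.set, Function.update_apply]
    split_ifs <;> (try simp only [List.length_cons]) <;> omega
  | query args res =>
    intro t ht
    simp only [exec, noOracle, mem_support_bind, mem_support_pure, exists_eq_left] at ht
    subst ht
    refine ⟨by simp [Mem.tick, Mem.store], fun r' => ?_⟩
    have h1 := hM r'
    simp only [Mem.tick, Mem.store]
    split_ifs <;> simp <;> omega
  | call P args res ih =>
    intro t ht
    simp only [exec, mem_support_bind, mem_support_pure] at ht
    obtain ⟨u, hu, rfl⟩ := ht
    obtain ⟨h1, h2⟩ := ih _ M (fun r => by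
      simp only [Mem.load, Mem.empty, List.getD_eq_getElem?_getD, List.getElem?_map]
      cases h : args[r]? <;> simp [hM]) u hu
    simp only [Mem.tick] at h1 h2
    refine ⟨by simp only; omega, fun r' => ?_⟩
    simp only [Mem.store]
    split_ifs
    · simp only [Mem.out, List.getD_eq_getElem?_getD, List.getElem?_map]
      cases h : (List.range res.length)[List.idxOf r' res]? with
      | none => simp; omega
      | some v => have := h2 (0 + v); simp only [Option.map_some, Option.getD_some]; omega
    · have := hM r'; omega
  | seq P Q ihP ihQ =>
    intro t ht
    simp only [exec, mem_support_bind] at ht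
    obtain ⟨u, hu, ht⟩ := ht
    obtain ⟨h1, h2⟩ := ihP s M hM u hu
    obtain ⟨h3, h4⟩ := ihQ u (M + u.1.clock - s.1.clock) (fun r => by have := h2 r; omega) t ht
    exact ⟨by omega, fun r => by have := h4 r; omega⟩
  | branch r P Q R ihP ihQ ihR =>
    intro t ht
    simp only [exec] at ht
    have key : ∀ u : Prog, (∀ (s : Mem × Unit) (M : ℕ), (∀ r, (s.1.regs r).length ≤ M) →
        ∀ t ∈ (u.exec noOracle s).support,
          s.1.clock ≤ t.1.clock ∧ ∀ r, (t.1.regs r).length + s.1.clock ≤ M + t.1.clock) →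
        t ∈ (u.exec noOracle (s.1.tick, s.2)).support →
        s.1.clock ≤ t.1.clock ∧ ∀ r, (t.1.regs r).length + s.1.clock ≤ M + t.1.clock := by
      intro u ih hu
      obtain ⟨h1, h2⟩ := ih (s.1.tick, s.2) M hM t hu
      simp only [Mem.tick] at h1 h2
      exact ⟨by omega, fun r => by have := h2 r; omega⟩
    split at ht
    · exact key P ihP ht
    · exact key Q ihQ ht
    · exact key R ihR ht
  | loop r P ih =>
    intro t ht
    simp only [exec] at ht
    have key : ∀ (m : ℕ) (s : Mem × Unit) (M : ℕ), (∀ r, (s.1.regs r).length ≤ M) →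
        ∀ t ∈ (iterPMF (fun s => P.exec noOracle (s.1.tick, s.2)) m s).support,
          s.1.clock ≤ t.1.clock ∧ ∀ r, (t.1.regs r).length + s.1.clock ≤ M + t.1.clock := by
      intro m
      induction m with
      | zero =>
        intro s M hM t ht
        simp only [iterPMF, mem_support_pure] at ht
        subst ht
        exact ⟨le_rfl, fun r => by have := hM r; omega⟩
      | succ m ihm =>
        intro s M hM t ht
        simp only [iterPMF, mem_support_bind] at ht
        obtain ⟨u, hu, ht⟩ := ht
        obtain ⟨h1, h2⟩ := ih (s.1.tick, s.2) M hM u hu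
        simp only [Mem.tick] at h1 h2
        obtain ⟨h3, h4⟩ := ihm u (M + u.1.clock - s.1.clock) (fun r => by have := h2 r; omega) t ht
        exact ⟨by omega, fun r => by have := h4 r; omega⟩
    obtain ⟨h1, h2⟩ := key _ (s.1.tick, s.2) M hM t ht
    simp only [Mem.tick] at h1 h2
    exact ⟨by omega, fun r => by have := h2 r; omega⟩

/-- A classical program neither depends on nor changes the quantum memory, the oracle and the
time. -/
theorem exec_classical {σ : Type} (O : Oracle σ) (P : Prog) (hP : P.Classical) (s : Mem × σ)
    (s₀ : Mem × Unit) (d : ℕ) (hr : s.1.regs = s₀.1.regs) (hc : s.1.clock = s₀.1.clock + d) :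
    Couples (P.exec O s) (P.exec noOracle s₀) fun t t₀ =>
      t.1.regs = t₀.1.regs ∧ t.1.clock = t₀.1.clock + d ∧ t.1.qubits = s.1.qubits ∧ t.2 = s.2 := by
  induction P generalizing s s₀ d with
  | skip | pop r | copy a b | push b r =>
    simp only [exec]
    refine Couples.pure ?_
    simp only [Mem.tick, Mem.set, hr, hc, and_true, true_and]
    omega
  | hadamard q | tgate q | cnot a b | reset | query a b | measure q r => exact hP.elim
  | coin r =>
    simp only [exec]
    refine (Couples.refl _).bind ?_
    rintro b _ rfl
    refine Couples.pure ?_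
    simp only [Mem.tick, Mem.set, hr, hc, and_true, true_and]
    omega
  | call P args res ih =>
    simp only [exec]
    refine (ih hP _ ({ s₀.1.tick with regs := (Mem.empty.load (args.map s₀.1.regs)).regs }, s₀.2) d
      (by simp only [hr]) (by simp only [Mem.tick]; omega)).bind ?_
    rintro t t₀ ⟨h1, h2, h3, h4⟩
    refine Couples.pure ⟨?_, h2, by simpa [Mem.tick] using h3, h4⟩
    simp only [Mem.store, Mem.out, hr, h1]
  | seq P Q ihP ihQ =>
    simp only [exec]
    refine (ihP hP.1 s s₀ d hr hc).bind ?_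
    rintro t t₀ ⟨h1, h2, h3, h4⟩
    refine (ihQ hP.2 t t₀ d h1 h2).mono ?_
    rintro u u₀ ⟨h5, h6, h7, h8⟩
    exact ⟨h5, h6, h7.trans h3, h8.trans h4⟩
  | branch r P Q R ihP ihQ ihR =>
    simp only [exec, hr]
    have h : (s.1.tick).clock = (s₀.1.tick).clock + d := by simp only [Mem.tick]; omega
    split
    · exact ihP hP.1 (s.1.tick, s.2) (s₀.1.tick, s₀.2) d hr h
    · exact ihQ hP.2.1 (s.1.tick, s.2) (s₀.1.tick, s₀.2) d hr h
    · exact ihR hP.2.2 (s.1.tick, s.2) (s₀.1.tick, s₀.2) d hr h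
  | loop r P ih =>
    simp only [exec, hr]
    refine iterPMF_rel ?_ _ ⟨hr, by simp only [Mem.tick]; omega, rfl, rfl⟩
    rintro t t₀ ⟨h1, h2, h3, h4⟩
    refine (ih hP (t.1.tick, t.2) (t₀.1.tick, t₀.2) d h1 (by simp only [Mem.tick]; omega)).mono ?_
    rintro u u₀ ⟨h5, h6, h7, h8⟩
    exact ⟨h5, h6, h7.trans h3, h8.trans h4⟩

end Prog

/-- The general principle behind comparisons of the runs of a program with two oracles: `G t st₁ st₂`
is a relation between numbers that holds for the final values. -/
theorem Prog.exec_compare {σ₁ σ₂ : Type} (O₁ : Oracle σ₁) (O₂ : Oracle σ₂)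
    (G : ℕ → σ₁ → σ₂ → ENNReal → ENNReal → Prop)
    (tick : ∀ {t st₁ st₂ x y}, G (t + 1) st₁ st₂ x y → G t st₁ st₂ x y)
    (avg : ∀ {t st₁ st₂} (p : PMF Bool) {x y : Bool → ENNReal}, (∀ b, G t st₁ st₂ (x b) (y b)) →
      G t st₁ st₂ (expect p x) (expect p y))
    (query : ∀ {t st₁ st₂} (q : List Str) (x : List Str × σ₁ → ENNReal)
      (y : List Str × σ₂ → ENNReal),
      (∀ a st₁ st₂, G (t + 1) st₁ st₂ (x (a, st₁)) (y (a, st₂))) →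
      G t st₁ st₂ (expect (O₁ st₁ q) x) (expect (O₂ st₂ q) y))
    (P : Prog) (h₁ : Mem × σ₁ → ENNReal) (h₂ : Mem × σ₂ → ENNReal)
    (h : ∀ s st₁ st₂, G s.clock st₁ st₂ (h₁ (s, st₁)) (h₂ (s, st₂))) (s : Mem) (st₁ : σ₁) (st₂ : σ₂) :
    G s.clock st₁ st₂ (expect (P.exec O₁ (s, st₁)) h₁) (expect (P.exec O₂ (s, st₂)) h₂) := by
  have step : ∀ (h₁ : Mem × σ₁ → ENNReal) (h₂ : Mem × σ₂ → ENNReal),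
      (∀ s st₁ st₂, G s.clock st₁ st₂ (h₁ (s, st₁)) (h₂ (s, st₂))) → ∀ (s s' : Mem) st₁ st₂,
      s'.clock = s.clock + 1 → G s.clock st₁ st₂ (h₁ (s', st₁)) (h₂ (s', st₂)) :=
    fun h₁ h₂ h s s' st₁ st₂ e => tick (e ▸ h s' st₁ st₂)
  induction P generalizing s st₁ st₂ h₁ h₂ with
  | skip | pop r | copy a b | push b r | hadamard q | tgate q | cnot a b | reset =>
    simp only [exec, expect_pure]
    exact step _ _ h _ _ _ _ rfl
  | coin r =>
    simp only [exec, expect_bind, expect_pure]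
    exact avg _ fun b => step _ _ h _ _ _ _ rfl
  | measure q r =>
    simp only [exec, expect_bind, expect_pure]
    exact avg _ fun b => step _ _ h _ _ _ _ rfl
  | query args res =>
    simp only [exec, expect_bind, expect_pure]
    exact query _ _ _ fun a st₁ st₂ => h (s.tick.store res a) _ _
  | call P args res ih =>
    simp only [exec, expect_bind, expect_pure]
    exact tick (ih (fun t => h₁ ({ t.1 with regs := (s.store res (t.1.out 0 res.length)).regs }, t.2))
      (fun t => h₂ ({ t.1 with regs := (s.store res (t.1.out 0 res.length)).regs }, t.2))
      (fun t st₁ st₂ => h { t with regs := (s.store res (t.out 0 res.length)).regs } _ _)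
      { s.tick with regs := (Mem.empty.load (args.map s.regs)).regs } _ _)
  | seq P Q ihP ihQ =>
    simp only [exec, expect_bind]
    -- The expectation over the second program is a function of the intermediate state and takes the
    -- role of the final value for the first one.
    exact ihP _ _ (fun s st₁ st₂ => ihQ _ _ h s st₁ st₂) s st₁ st₂
  | branch r P Q R ihP ihQ ihR =>
    simp only [exec]
    split
    · exact tick (ihP _ _ h s.tick _ _)
    · exact tick (ihQ _ _ h s.tick _ _)
    · exact tick (ihR _ _ h s.tick _ _)
  | loop r P ih =>
    simp only [exec]
    refine tick ?_
    have key : ∀ (m : ℕ) (s : Mem) (st₁ : σ₁) (st₂ : σ₂), G s.clock st₁ st₂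
        (expect (iterPMF (fun s => P.exec O₁ (s.1.tick, s.2)) m (s, st₁)) h₁)
        (expect (iterPMF (fun s => P.exec O₂ (s.1.tick, s.2)) m (s, st₂)) h₂) := by
      intro m
      induction m with
      | zero =>
        intro s st₁ st₂
        simp only [iterPMF, expect_pure]
        exact h _ _ _
      | succ m ihm =>
        intro s st₁ st₂
        simp only [iterPMF, expect_bind]
        exact tick (ih _ _ (fun s st₁ st₂ => ihm s st₁ st₂) s.tick _ _)
    exact key _ s.tick st₁ st₂

/-! ## Register bookkeeping -/

namespace Mem

theorem map_load_range' (s : Mem) (xs : List Str) :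
    (List.range' 0 xs.length).map (s.load xs).regs = xs := by
  apply List.ext_getElem
  · simp
  · intro i h1 h2
    simp [load, List.getD_eq_getElem?_getD, h2]

theorem map_store (s : Mem) {rs : List ℕ} {xs : List Str} (h : rs.Nodup)
    (hl : rs.length = xs.length) : rs.map (s.store rs xs).regs = xs := by
  apply List.ext_getElem
  · simpa using hl
  · intro i h1 h2
    have h1' : i < rs.length := by simpa using h1
    simp [store, List.getD_eq_getElem?_getD, h.idxOf_getElem i h1', h2]

theorem map_store_of_disjoint (s : Mem) {rs rs' : List ℕ} (xs : List Str)
    (h : ∀ r ∈ rs', r ∉ rs) : rs'.map (s.store rs xs).regs = rs'.map s.regs := by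
  apply List.map_congr_left
  intro r hr
  simp [store, h r hr]

theorem out_eq_map (s : Mem) (a len : ℕ) : s.out a len = (List.range' a len).map s.regs := by
  simp [out, List.range'_eq_map_range, Function.comp_def]

theorem out_load (s : Mem) (xs : List Str) {len : ℕ} (h : xs.length = len) :
    (s.load xs).out 0 len = xs := by
  rw [out_eq_map, ← h, map_load_range']

theorem load_append_regs (s : Mem) (xs ys : List Str) (r : ℕ) :
    (s.load (xs ++ ys)).regs (xs.length + r) = ys.getD r (s.regs (xs.length + r)) := by
  simp [load, List.getD_eq_getElem?_getD, List.getElem?_append_right]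

end Mem

theorem map_regs_congr {s t : Mem} (h : s.regs = t.regs) (rs : List ℕ) :
    rs.map s.regs = rs.map t.regs := by rw [h]

section Calls

variable {σ : Type} (O : Oracle σ) {β : Type} [BitRep β]

/-- All closure properties of `Eff` go through this criterion: a coupling with the intended output
distribution gives the law of the output, and the time bound for every possible run because each run
has a partner. -/
theorem Prog.computes_of_couples {P : Prog} {xs : List Str} {d : PMF β} {T : ℕ}
    (h : Couples (P.exec noOracle (Mem.empty.load xs, ())) d fun t b =>
      t.1.out 0 (BitRep.arity β) = rep b ∧ t.1.clock ≤ T) : P.Computes xs d T := by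
  refine ⟨h.map_eq fun t b hb => hb.1, fun s hs => ?_⟩
  obtain ⟨b, -, hb⟩ := h.exists_right hs
  exact hb.2

/-- The effect of calling a subroutine. -/
theorem Prog.call_couples {P : Prog} (hP : P.Classical) {xs : List Str} {d : PMF β} {T : ℕ}
    (h : P.Computes xs d T) (s : Mem × σ) {args res : List ℕ}
    (hargs : args.map s.1.regs = xs) (hres : res.length = BitRep.arity β) :
    Couples ((call P args res).exec O s) d fun t b =>
      t.1.regs = (s.1.store res (rep b)).regs ∧ t.1.qubits = s.1.qubits ∧ t.2 = s.2 ∧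
        s.1.clock ≤ t.1.clock ∧ t.1.clock ≤ s.1.clock + 1 + T := by
  have h1 := (Couples.of_map_eq h.1).support
  have h2 := exec_classical O P hP
    ({ s.1.tick with regs := (Mem.empty.load (args.map s.1.regs)).regs }, s.2)
    (Mem.empty.load xs, ()) (s.1.clock + 1) (by simp only [hargs]) (by simp [Mem.tick, Mem.load, Mem.empty])
  simp only [exec]
  have h3 : Couples (P.exec O ({ s.1.tick with regs := (Mem.empty.load (args.map s.1.regs)).regs }, s.2))
      d fun t b => t.1.out 0 (BitRep.arity β) = rep b ∧ t.1.qubits = s.1.qubits ∧ t.2 = s.2 ∧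
        s.1.clock ≤ t.1.clock ∧ t.1.clock ≤ s.1.clock + 1 + T := by
    intro f g hfg
    -- Two couplings are composed on the level of test functions: the intermediate test function is
    -- the supremum of `f` over all states that match `t₀`.
    refine (h2 f (fun t₀ => ⨆ t : {t : Mem × σ // t.1.regs = t₀.1.regs ∧
      t.1.clock = t₀.1.clock + (s.1.clock + 1) ∧ t.1.qubits = s.1.qubits ∧ t.2 = s.2}, f t) ?_).trans
      (h1 _ _ ?_)
    · intro t t₀ ht
      exact le_iSup (fun t : {t : Mem × σ // t.1.regs = t₀.1.regs ∧
        t.1.clock = t₀.1.clock + (s.1.clock + 1) ∧ t.1.qubits = s.1.qubits ∧ t.2 = s.2} => f t)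
        ⟨t, ht⟩
    · rintro t₀ b ⟨hb, hs, -⟩
      refine iSup_le ?_
      rintro ⟨t, ht1, ht2, ht3, ht4⟩
      have := h.2 t₀ hs
      refine hfg _ _ ⟨?_, ht3, ht4, ?_, ?_⟩
      · rw [← hb]
        simp only [Mem.out, ht1]
      · show s.1.clock ≤ t.1.clock
        omega
      · show t.1.clock ≤ _
        omega
  have h4 := h3.bind (T := fun t b => t.1.regs = (s.1.store res (rep b)).regs ∧
      t.1.qubits = s.1.qubits ∧ t.2 = s.2 ∧ s.1.clock ≤ t.1.clock ∧ t.1.clock ≤ s.1.clock + 1 + T)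
    (k := fun t => pure ({ t.1 with regs := (s.1.store res (t.1.out 0 res.length)).regs }, t.2))
    (l := fun b => pure b) (by
      rintro t b ⟨h1, h2, h3, h4, h5⟩
      refine Couples.pure ⟨?_, h2, h3, h4, h5⟩
      rw [hres]
      simp only [h1])
  rwa [bind_pure] at h4

theorem Prog.exec_seq (P Q : Prog) (s : Mem × σ) :
    (seq P Q).exec O s = P.exec O s >>= Q.exec O := rfl

theorem Prog.exec_branch_nil {s : Mem × σ} {r : ℕ} (h : s.1.regs r = []) (P Q R : Prog) :
    (branch r P Q R).exec O s = P.exec O (s.1.tick, s.2) := by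
  simp only [exec, h]

theorem Prog.exec_branch_false {s : Mem × σ} {r : ℕ} {l : Str} (h : s.1.regs r = false :: l)
    (P Q R : Prog) : (branch r P Q R).exec O s = Q.exec O (s.1.tick, s.2) := by
  simp only [exec, h]

theorem Prog.exec_branch_true {s : Mem × σ} {r : ℕ} {l : Str} (h : s.1.regs r = true :: l)
    (P Q R : Prog) : (branch r P Q R).exec O s = R.exec O (s.1.tick, s.2) := by
  simp only [exec, h]

/-- Copies registers. -/
def Prog.move (args res : List ℕ) : Prog := call skip args res

/-- A call reads all its arguments before it writes, so sources and targets may overlap. The two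
steps are the call and the `skip` inside. -/
theorem Prog.move_exec (s : Mem × σ) {args res : List ℕ} (h : args.length = res.length) :
    (move args res).exec O s = pure ({ s.1.store res (args.map s.1.regs) with
      clock := s.1.clock + 2 }, s.2) := by
  simp only [move, exec, LawfulMonad.pure_bind]
  congr 2
  simp only [Mem.tick, Mem.mk.injEq, and_true]
  refine ⟨?_, rfl⟩
  have := Mem.out_load (Mem.empty) (args.map s.1.regs) (len := res.length) (by simpa using h)
  simp only [Mem.out] at this
  simp only [Mem.out, this]

end Calls

/-! ## Efficient typed functions -/

/-- A family of types whose encodings have the same arity. -/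
class Arity (α : ℕ → Type) [∀ n, BitRep (α n)] where
  ar : ℕ
  arity_eq : ∀ n, BitRep.arity (α n) = ar

section Instances

variable {α β : ℕ → Type} [∀ n, BitRep (α n)] [∀ n, BitRep (β n)]

instance : Arity (fun _ => Unit) := ⟨0, fun _ => rfl⟩
instance : Arity (fun _ => Bool) := ⟨1, fun _ => rfl⟩
instance : Arity (fun _ => Str) := ⟨1, fun _ => rfl⟩
instance (L : ℕ → ℕ) : Arity (fun n => Bits (L n)) := ⟨1, fun _ => rfl⟩
instance (L : ℕ → ℕ) : Arity (fun n => Option (Bits (L n))) := ⟨1, fun _ => rfl⟩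
instance (k : ℕ → ℕ) : Arity (fun n => Fin (k n)) := ⟨1, fun _ => rfl⟩
instance (L κ : ℕ → ℕ) : Arity (fun n => Circ (L n) (κ n)) := ⟨1, fun _ => rfl⟩

instance [Arity α] [Arity β] : Arity (fun n => α n × β n) :=
  ⟨Arity.ar α + Arity.ar β, fun n => by
    rw [← Arity.arity_eq (α := α) n, ← Arity.arity_eq (α := β) n]; rfl⟩

/-- Invariants, such as bounds on lengths, can be put into a type without changing the code of its
elements, hence without any cost for programs. -/
instance {α : Type} [BitRep α] {p : α → Prop} : BitRep {a // p a} where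
  arity := BitRep.arity α
  rep a := rep a.1
  length_rep a := BitRep.length_rep a.1
  rep_injective _ _ h := Subtype.ext (BitRep.rep_injective h)

instance [Arity α] {p : ∀ n, α n → Prop} : Arity (fun n => {a : α n // p n a}) :=
  ⟨Arity.ar α, fun n => Arity.arity_eq (α := α) n⟩

/-- The query type of rounds without oracle: there are no well-formed queries, and every query is
answered by nothing. -/
instance : BitRep Empty where
  arity := 0
  rep := Empty.elim
  length_rep a := a.elim
  rep_injective a := a.elim

instance : Arity (fun _ => Empty) := ⟨0, fun _ => rfl⟩

end Instances

theorem length_rep_eq {α : ℕ → Type} [∀ n, BitRep (α n)] [Arity α] {n : ℕ} (a : α n) :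
    (rep a).length = Arity.ar α := by rw [BitRep.length_rep, Arity.arity_eq]

theorem rep_prod {α β : Type} [BitRep α] [BitRep β] (p : α × β) : rep p = rep p.1 ++ rep p.2 := rfl

/-- The families of randomized functions that are computable in polynomial time from `1^n`, the
`n`-th string of `adv`, and the input. -/
def Eff (adv : ℕ → Str) {α β : ℕ → Type} [∀ n, BitRep (α n)] [∀ n, BitRep (β n)]
    (f : ∀ n, α n → PMF (β n)) : Prop :=
  ∃ P : Prog, P.Classical ∧ ∃ p : Polynomial ℕ, ∀ n (a : α n),
    P.Computes ([unary n, adv n] ++ rep a) (f n a) (p.eval n)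

/-- Deterministic functions that are computable in polynomial time. -/
def EffD (adv : ℕ → Str) {α β : ℕ → Type} [∀ n, BitRep (α n)] [∀ n, BitRep (β n)]
    (f : ∀ n, α n → β n) : Prop :=
  Eff adv fun n a => (pure (f n a) : PMF (β n))

section Eff

variable {adv : ℕ → Str} {α β γ δ : ℕ → Type} [∀ n, BitRep (α n)] [∀ n, BitRep (β n)]
  [∀ n, BitRep (γ n)] [∀ n, BitRep (δ n)]

/-- The registers in the beginning. -/
theorem load_input {n : ℕ} [Arity α] (a : α n) :
    (List.range' 0 (2 + Arity.ar α)).map (Mem.empty.load ([unary n, adv n] ++ rep a)).regs =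
      [unary n, adv n] ++ rep a := by
  have := Mem.map_load_range' Mem.empty ([unary n, adv n] ++ rep a)
  rwa [List.length_append, length_rep_eq] at this

theorem map_load_base (s : Mem) (x y : Str) (xs : List Str) :
    [0, 1].map (s.load ([x, y] ++ xs)).regs = [x, y] := rfl

theorem Eff.congr {f g : ∀ n, α n → PMF (β n)} (hf : Eff adv f) (h : ∀ n a, f n a = g n a) :
    Eff adv g := by
  have : f = g := by
    funext n a
    exact h n a
  rwa [← this]

theorem EffD.congr {f g : ∀ n, α n → β n} (hf : EffD adv f) (h : ∀ n a, f n a = g n a) :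
    EffD adv g :=
  Eff.congr hf fun n a => by rw [h]

/-- Only the encodings matter. -/
theorem Eff.retype {f : ∀ n, α n → PMF (β n)} (hf : Eff adv f) {g : ∀ n, γ n → PMF (δ n)}
    (φ : ∀ n, γ n → α n) (hφ : ∀ n c, rep (φ n c) = rep c)
    (har : ∀ n, BitRep.arity (β n) = BitRep.arity (δ n))
    (h : ∀ n c, (g n c).map rep = (f n (φ n c)).map rep) : Eff adv g := by
  obtain ⟨P, hP, p, hp⟩ := hf
  refine ⟨P, hP, p, fun n c => ?_⟩
  have := hp n (φ n c)
  rw [hφ] at this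
  refine ⟨?_, this.2⟩
  rw [h, ← this.1, har]

theorem EffD.retype {f : ∀ n, α n → β n} (hf : EffD adv f) {g : ∀ n, γ n → δ n}
    (φ : ∀ n, γ n → α n) (hφ : ∀ n c, rep (φ n c) = rep c)
    (har : ∀ n, BitRep.arity (β n) = BitRep.arity (δ n))
    (h : ∀ n c, rep (g n c) = rep (f n (φ n c))) : EffD adv g :=
  Eff.retype hf φ hφ har fun n c => by
    show (PMF.pure _).map rep = (PMF.pure _).map rep
    rw [PMF.pure_map, PMF.pure_map, h]

/-- The effect of calling an efficient function. -/
theorem call_couples_of_eff {σ : Type} {O : Oracle σ} {f : ∀ n, α n → PMF (β n)} [Arity β] {P : Prog}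
    (hP : P.Classical) {p : Polynomial ℕ}
    (hp : ∀ n (a : α n), P.Computes ([unary n, adv n] ++ rep a) (f n a) (p.eval n)) {n : ℕ} {a : α n}
    {s : Mem × σ} {args res : List ℕ} (hargs : args.map s.1.regs = [unary n, adv n] ++ rep a)
    (hres : res.length = Arity.ar β) :
    Couples ((Prog.call P args res).exec O s) (f n a) fun t b =>
      t.1.regs = (s.1.store res (rep b)).regs ∧ t.1.qubits = s.1.qubits ∧ t.2 = s.2 ∧
        s.1.clock ≤ t.1.clock ∧ t.1.clock ≤ s.1.clock + 1 + p.eval n :=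
  Prog.call_couples O hP (hp n a) s hargs (hres.trans (Arity.arity_eq n).symm)

/-- The layout used throughout: registers 0 and 1 keep `1^n` and the advice, the input starts at
register 2, and outputs are delivered from register 0 on. -/
theorem Eff.comp [Arity α] [Arity β] [Arity γ] {f : ∀ n, α n → PMF (β n)}
    {g : ∀ n, β n → PMF (γ n)} (hg : Eff adv g) (hf : Eff adv f) :
    Eff adv fun n a => f n a >>= g n := by
  obtain ⟨P, hP, p, hp⟩ := hf
  obtain ⟨Q, hQ, q, hq⟩ := hg
  refine ⟨.seq (.call P (List.range' 0 (2 + Arity.ar α)) (List.range' 2 (Arity.ar β)))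
    (.call Q ([0, 1] ++ List.range' 2 (Arity.ar β)) (List.range' 0 (Arity.ar γ))), ⟨hP, hQ⟩,
    p + q + 2, fun n a => Prog.computes_of_couples ?_⟩
  simp only [Prog.exec_seq]
  have h0 := load_input (adv := adv) a
  refine (call_couples_of_eff hP hp h0 (by simp)).bind ?_
  rintro t b ⟨h1, -, -, -, h2⟩
  refine (call_couples_of_eff (s := t) hQ hq (a := b) ?_ (by simp)).mono ?_
  · rw [List.map_append, map_regs_congr h1, map_regs_congr h1, Mem.map_store _ List.nodup_range'
      (by simp [length_rep_eq]), Mem.map_store_of_disjoint _ _ (by simp)]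
    simp only [map_load_base]
  · rintro u c ⟨h3, -, -, -, h4⟩
    refine ⟨?_, ?_⟩
    · rw [Mem.out_eq_map, map_regs_congr h3, Arity.arity_eq, Mem.map_store _ List.nodup_range'
        (by simp [length_rep_eq])]
    · have h5 : (Mem.empty.load ([unary n, adv n] ++ rep a)).clock = 0 := rfl
      simp only [Polynomial.eval_add, Polynomial.eval_ofNat]
      simp only at h2
      omega

/-- Two computations on the same input. -/
theorem Eff.pair [Arity α] [Arity β] [Arity γ] {f : ∀ n, α n → PMF (β n)}
    {g : ∀ n, α n → PMF (γ n)} (hf : Eff adv f) (hg : Eff adv g) :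
    Eff adv (β := fun n => β n × γ n) fun n a =>
      f n a >>= fun b => g n a >>= fun c => pure (b, c) := by
  obtain ⟨P, hP, p, hp⟩ := hf
  obtain ⟨Q, hQ, q, hq⟩ := hg
  refine ⟨.seq (.call P (List.range' 0 (2 + Arity.ar α)) (List.range' (2 + Arity.ar α) (Arity.ar β)))
    (.seq (.call Q (List.range' 0 (2 + Arity.ar α))
        (List.range' (2 + Arity.ar α + Arity.ar β) (Arity.ar γ)))
      (.move (List.range' (2 + Arity.ar α) (Arity.ar β) ++
        List.range' (2 + Arity.ar α + Arity.ar β) (Arity.ar γ))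
        (List.range' 0 (Arity.ar β + Arity.ar γ)))), ⟨hP, hQ, trivial⟩,
    p + q + 4, fun n a => Prog.computes_of_couples ?_⟩
  have h0 := load_input (adv := adv) a
  simp only [Prog.exec_seq]
  refine (call_couples_of_eff hP hp h0 (by simp)).bind ?_
  rintro t b ⟨h1, -, -, -, h2⟩
  refine (call_couples_of_eff (s := t) hQ hq (a := a) ?_ (by simp)).bind ?_
  · rw [map_regs_congr h1, Mem.map_store_of_disjoint _ _ (by simp; omega)]
    exact h0
  · rintro u c ⟨h3, -, -, -, h4⟩
    rw [Prog.move_exec _ _ (by simp)]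
    refine Couples.pure ⟨?_, ?_⟩
    · simp only
      rw [Mem.out_eq_map]
      refine Eq.trans (b := List.map (Mem.regs _) _) rfl (Eq.trans ?_ (rep_prod (b, c)).symm)
      rw [Arity.arity_eq (α := fun n => β n × γ n)]
      refine (Mem.map_store _ List.nodup_range' (by simp)).trans ?_
      rw [List.map_append, map_regs_congr h3, map_regs_congr h3,
        Mem.map_store _ List.nodup_range' (by simp [length_rep_eq]),
        Mem.map_store_of_disjoint _ _ (by simp; omega), map_regs_congr h1,
        Mem.map_store _ List.nodup_range' (by simp [length_rep_eq])]
    · have h5 : (Mem.empty.load ([unary n, adv n] ++ rep a)).clock = 0 := rfl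
      simp only [Polynomial.eval_add, Polynomial.eval_ofNat]
      simp only at h2
      omega

theorem Eff.ite [Arity α] [Arity β] {c : ∀ n, α n → Bool} (hc : EffD adv c)
    {f g : ∀ n, α n → PMF (β n)} (hf : Eff adv f) (hg : Eff adv g) :
    Eff adv fun n a => if c n a then f n a else g n a := by
  obtain ⟨R, hR, r, hr⟩ := hc
  obtain ⟨P, hP, p, hp⟩ := hf
  obtain ⟨Q, hQ, q, hq⟩ := hg
  refine ⟨.seq (.call R (List.range' 0 (2 + Arity.ar α)) [2 + Arity.ar α])
    (.branch (2 + Arity.ar α) .skip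
      (.call Q (List.range' 0 (2 + Arity.ar α)) (List.range' 0 (Arity.ar β)))
      (.call P (List.range' 0 (2 + Arity.ar α)) (List.range' 0 (Arity.ar β)))),
    ⟨hR, trivial, hQ, hP⟩, p + q + r + 3, fun n a => Prog.computes_of_couples ?_⟩
  have h0 := load_input (adv := adv) a
  show Couples _ (if c n a then f n a else g n a) _
  -- The deterministic test is written as a random step, so that the two sides can be coupled
  -- instruction by instruction. The same device recurs below.
  rw [← LawfulMonad.pure_bind (c n a) fun b => if b then f n a else g n a]
  simp only [Prog.exec_seq]
  refine (call_couples_of_eff hR hr h0 rfl).bind ?_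
  rintro t b ⟨h1, -, -, -, h2⟩
  have h5 : (Mem.empty.load ([unary n, adv n] ++ rep a)).clock = 0 := rfl
  have h3 : t.1.regs (2 + Arity.ar α) = [b] := by
    have : List.map t.1.regs [2 + Arity.ar α] = [[b]] := by
      rw [map_regs_congr h1, Mem.map_store _ (List.nodup_singleton _) rfl]
      rfl
    simpa using this
  have h4 : (List.range' 0 (2 + Arity.ar α)).map t.1.tick.regs = [unary n, adv n] ++ rep a := by
    show (List.range' 0 (2 + Arity.ar α)).map t.1.regs = _
    rw [map_regs_congr h1, Mem.map_store_of_disjoint _ _ (by simp; omega)]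
    exact h0
  cases b
  · rw [Prog.exec_branch_false noOracle h3]
    refine (call_couples_of_eff (s := (t.1.tick, t.2)) hQ hq h4 (by simp)).mono ?_
    rintro u c ⟨h6, -, -, -, h7⟩
    refine ⟨?_, ?_⟩
    · rw [Mem.out_eq_map, map_regs_congr h6, Arity.arity_eq, Mem.map_store _ List.nodup_range'
        (by simp [length_rep_eq])]
    · simp only [Polynomial.eval_add, Polynomial.eval_ofNat]
      simp only [Mem.tick] at h2 h7
      omega
  · rw [Prog.exec_branch_true noOracle h3]
    refine (call_couples_of_eff (s := (t.1.tick, t.2)) hP hp h4 (by simp)).mono ?_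
    rintro u c ⟨h6, -, -, -, h7⟩
    refine ⟨?_, ?_⟩
    · rw [Mem.out_eq_map, map_regs_congr h6, Arity.arity_eq, Mem.map_store _ List.nodup_range'
        (by simp [length_rep_eq])]
    · simp only [Polynomial.eval_add, Polynomial.eval_ofNat]
      simp only [Mem.tick] at h2 h7
      omega

/-- A program of moves computes a rearrangement of the input. -/
theorem EffD.of_move [Arity α] [Arity β] (args : List ℕ) (hargs : args.length = Arity.ar β)
    {f : ∀ n, α n → β n} (h : ∀ n a,
      args.map (Mem.empty.load ([unary n, adv n] ++ rep a)).regs = rep (f n a)) : EffD adv f := by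
  refine ⟨.move args (List.range' 0 (Arity.ar β)), trivial, 2, fun n a =>
    Prog.computes_of_couples ?_⟩
  rw [Prog.move_exec _ _ (by simpa using hargs)]
  refine Couples.pure ⟨?_, by simp [Mem.load, Mem.empty]⟩
  rw [Mem.out_eq_map]
  refine Eq.trans (b := List.map (Mem.regs _) _) rfl (Eq.trans ?_ (h n a))
  rw [Arity.arity_eq (α := β)]
  exact Mem.map_store _ List.nodup_range' (by simp [hargs])

theorem map_load_drop {n : ℕ} [Arity α] [Arity β] (p : α n × β n) :
    (List.range' 2 (Arity.ar α)).map (Mem.empty.load ([unary n, adv n] ++ rep p)).regs = rep p.1 ∧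
    (List.range' (2 + Arity.ar α) (Arity.ar β)).map
      (Mem.empty.load ([unary n, adv n] ++ rep p)).regs = rep p.2 := by
  have h := load_input (adv := adv) (α := fun n => α n × β n) p
  have e : List.range' 0 (2 + Arity.ar (fun n => α n × β n)) =
      [0, 1] ++ (List.range' 2 (Arity.ar α) ++ List.range' (2 + Arity.ar α) (Arity.ar β)) := by
    rw [List.range'_append_1 (s := 2)]
    have := List.range'_append_1 (s := 0) (m := 2) (n := Arity.ar α + Arity.ar β)
    exact this.symm
  rw [e, List.map_append, List.map_append, rep_prod] at h
  have h' := (List.append_inj h (by simp)).2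
  exact List.append_inj h' (by simp [length_rep_eq])

theorem EffD.id [Arity α] : EffD adv fun n (a : α n) => a :=
  EffD.of_move (List.range' 2 (Arity.ar α)) (by simp) fun n a => by
    have h := load_input (adv := adv) a
    have e : List.range' 0 (2 + Arity.ar α) = [0, 1] ++ List.range' 2 (Arity.ar α) :=
      (List.range'_append_1 (s := 0) (m := 2) (n := Arity.ar α)).symm
    rw [e, List.map_append] at h
    exact (List.append_inj h (by simp)).2

theorem EffD.sec [Arity α] : EffD adv (β := fun _ => Str) fun n (_ : α n) => unary n :=
  EffD.of_move [0] rfl fun _ _ => rfl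

theorem EffD.advice [Arity α] : EffD adv (β := fun _ => Str) fun n (_ : α n) => adv n :=
  EffD.of_move [1] rfl fun _ _ => rfl

theorem EffD.unit [Arity α] : EffD adv (β := fun _ => Unit) fun n (_ : α n) => () :=
  EffD.of_move [] rfl fun _ _ => rfl

/-- The register just behind the input has never been written, hence holds the empty string. -/
theorem EffD.nil [Arity α] : EffD adv (β := fun _ => Str) fun n (_ : α n) => [] :=
  EffD.of_move [2 + Arity.ar α] rfl fun n a => by
    have : ([unary n, adv n] ++ rep a).length ≤ 2 + Arity.ar α := by
      rw [List.length_append, length_rep_eq]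
      rfl
    simp only [List.map_cons, List.map_nil, Mem.load, List.getD_eq_default _ _ this]
    rfl

theorem Eff.compD [Arity α] [Arity β] [Arity γ] {f : ∀ n, α n → β n} {g : ∀ n, β n → PMF (γ n)}
    (hg : Eff adv g) (hf : EffD adv f) : Eff adv fun n a => g n (f n a) :=
  (Eff.comp hg hf).congr fun _ _ => LawfulMonad.pure_bind _ _

theorem EffD.comp [Arity α] [Arity β] [Arity γ] {f : ∀ n, α n → β n} {g : ∀ n, β n → γ n}
    (hg : EffD adv g) (hf : EffD adv f) : EffD adv fun n a => g n (f n a) :=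
  Eff.compD (g := fun n b => (pure (g n b) : PMF (γ n))) hg hf

theorem EffD.fst [Arity α] [Arity β] [Arity γ] {f : ∀ n, α n → β n × γ n}
    (hf : EffD adv (β := fun n => β n × γ n) f) : EffD adv fun n a => (f n a).1 :=
  EffD.comp (g := fun n (p : β n × γ n) => p.1)
    (EffD.of_move (List.range' 2 (Arity.ar β)) (by simp) fun _ p => (map_load_drop p).1) hf

theorem EffD.snd [Arity α] [Arity β] [Arity γ] {f : ∀ n, α n → β n × γ n}
    (hf : EffD adv (β := fun n => β n × γ n) f) : EffD adv fun n a => (f n a).2 :=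
  EffD.comp (g := fun n (p : β n × γ n) => p.2)
    (EffD.of_move (List.range' (2 + Arity.ar β) (Arity.ar γ)) (by simp)
      fun _ p => (map_load_drop p).2) hf

theorem EffD.pair [Arity α] [Arity β] [Arity γ] {f : ∀ n, α n → β n} {g : ∀ n, α n → γ n}
    (hf : EffD adv f) (hg : EffD adv g) :
    EffD adv (β := fun n => β n × γ n) fun n a => (f n a, g n a) :=
  (Eff.pair hf hg).congr fun n a => by simp only [LawfulMonad.pure_bind]

theorem EffD.ite [Arity α] [Arity β] {c : ∀ n, α n → Bool} (hc : EffD adv c)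
    {f g : ∀ n, α n → β n} (hf : EffD adv f) (hg : EffD adv g) :
    EffD adv fun n a => if c n a then f n a else g n a :=
  (Eff.ite hc hf hg).congr fun n a => by dsimp only; split_ifs <;> rfl

/-- Sequential composition, where the second computation also gets the input. -/
theorem Eff.bind [Arity α] [Arity β] [Arity γ] {f : ∀ n, α n → PMF (β n)}
    {g : ∀ n, α n → β n → PMF (γ n)} (hf : Eff adv f)
    (hg : Eff adv (α := fun n => α n × β n) fun n p => g n p.1 p.2) :
    Eff adv fun n a => f n a >>= g n a :=
  (Eff.comp hg (Eff.pair (f := fun n a => (pure a : PMF (α n))) EffD.id hf)).congr fun n a => by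
    simp only [LawfulMonad.pure_bind, bind_assoc]

end Eff

/-! ## Efficient operations on strings -/

/-- Functions that are bounded by a polynomial. -/
def PolyLe (L : ℕ → ℕ) : Prop := ∃ p : Polynomial ℕ, ∀ n, L n ≤ p.eval n

theorem Polynomial.eval_nat_mono (p : Polynomial ℕ) {m n : ℕ} (h : m ≤ n) :
    p.eval m ≤ p.eval n := by
  induction p using Polynomial.induction_on' with
  | add p q hp hq => simpa using Nat.add_le_add hp hq
  | monomial i a => simpa using Nat.mul_le_mul_left _ (Nat.pow_le_pow_left h i)

theorem PolyLe.mono {L M : ℕ → ℕ} (h : PolyLe M) (hLM : ∀ n, L n ≤ M n) : PolyLe L :=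
  h.imp fun _ hp n => (hLM n).trans (hp n)

theorem PolyLe.eval (p : Polynomial ℕ) : PolyLe fun n => p.eval n := ⟨p, fun _ => le_rfl⟩

theorem PolyLe.id : PolyLe fun n => n := ⟨.X, fun n => by simp⟩

theorem PolyLe.const (c : ℕ) : PolyLe fun _ => c := ⟨.C c, fun n => by simp⟩

theorem PolyLe.add {L M : ℕ → ℕ} (hL : PolyLe L) (hM : PolyLe M) : PolyLe fun n => L n + M n := by
  obtain ⟨p, hp⟩ := hL
  obtain ⟨q, hq⟩ := hM
  exact ⟨p + q, fun n => by simpa using Nat.add_le_add (hp n) (hq n)⟩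

theorem PolyLe.mul {L M : ℕ → ℕ} (hL : PolyLe L) (hM : PolyLe M) : PolyLe fun n => L n * M n := by
  obtain ⟨p, hp⟩ := hL
  obtain ⟨q, hq⟩ := hM
  exact ⟨p * q, fun n => by simpa using Nat.mul_le_mul (hp n) (hq n)⟩

theorem PolyLe.eval_comp (p : Polynomial ℕ) {L : ℕ → ℕ} (hL : PolyLe L) :
    PolyLe fun n => p.eval (L n) := by
  obtain ⟨q, hq⟩ := hL
  exact ⟨p.comp q, fun n => by simpa using p.eval_nat_mono (hq n)⟩

/-- Case distinction for strings. -/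
def strCase {X : Type} (x : X) (f : Bool → Str → X) : Str → X
  | [] => x
  | b :: l => f b l

namespace Prog

variable {σ : Type} (O : Oracle σ)

/-- Stores a bit in a register. -/
def setBit (b : Bool) (r : ℕ) : Prog := call (push b 0) [] [r]

theorem setBit_exec (b : Bool) (r : ℕ) (s : Mem × σ) :
    (setBit b r).exec O s = pure ({ s.1.store [r] [[b]] with clock := s.1.clock + 2 }, s.2) := by
  simp only [setBit, exec, LawfulMonad.pure_bind]
  rfl

end Prog

section StrOps

variable {adv : ℕ → Str} {α β γ δ : ℕ → Type} [∀ n, BitRep (α n)] [∀ n, BitRep (β n)]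
  [∀ n, BitRep (γ n)] [∀ n, BitRep (δ n)]

theorem EffD.bool [Arity α] (b : Bool) : EffD adv (β := fun _ => Bool) fun n (_ : α n) => b := by
  refine ⟨.setBit b 0, trivial, 2, fun n a => Prog.computes_of_couples ?_⟩
  rw [Prog.setBit_exec]
  exact Couples.pure ⟨rfl, by simp [Mem.load, Mem.empty]⟩

theorem Eff.coin [Arity α] : Eff adv (β := fun _ => Bool) fun n (_ : α n) => coin := by
  refine ⟨.call (.coin 0) [] [0], trivial, 2, fun n a => Prog.computes_of_couples ?_⟩
  rw [← bind_pure _root_.coin]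
  simp only [Prog.exec, bind_assoc, LawfulMonad.pure_bind]
  refine (Couples.refl _).bind ?_
  rintro b _ rfl
  exact Couples.pure ⟨rfl, by simp [Mem.load, Mem.empty, Mem.set, Mem.tick]⟩

theorem Mem.map_set_of_notMem (s : Mem) {r : ℕ} {x : Str} {rs : List ℕ} (h : r ∉ rs) :
    rs.map (s.set r x).regs = rs.map s.regs := by
  apply List.map_congr_left
  intro r' hr
  have : r' ≠ r := by
    rintro rfl
    exact h hr
  simp [Mem.set, this]

theorem Eff.strCase [Arity α] [Arity γ] {l : ∀ n, α n → Str} (hl : EffD adv (β := fun _ => Str) l)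
    {f : ∀ n, α n → PMF (γ n)} {g : ∀ n, α n → Bool → Str → PMF (γ n)} (hf : Eff adv f)
    (hg : Eff adv (α := fun n => α n × Bool × Str) fun n p => g n p.1 p.2.1 p.2.2) :
    Eff adv fun n a => strCase (f n a) (g n a) (l n a) := by
  obtain ⟨R, hR, r, hr⟩ := hl
  obtain ⟨P, hP, p, hp⟩ := hf
  obtain ⟨Q, hQ, q, hq⟩ := hg
  -- Register `2 + ar` holds the string, which loses its top bit here, and `3 + ar` receives that
  -- bit. As the bit is known in each branch, it can be stored as a constant.
  let B (x : Bool) : Prog := .seq (.pop (2 + Arity.ar α)) (.seq (.setBit x (3 + Arity.ar α))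
    (.call Q (List.range' 0 (2 + Arity.ar α) ++ [3 + Arity.ar α, 2 + Arity.ar α])
      (List.range' 0 (Arity.ar γ))))
  refine ⟨.seq (.call R (List.range' 0 (2 + Arity.ar α)) [2 + Arity.ar α])
    (.branch (2 + Arity.ar α) (.call P (List.range' 0 (2 + Arity.ar α)) (List.range' 0 (Arity.ar γ)))
      (B false) (B true)),
    ⟨hR, hP, ⟨trivial, trivial, hQ⟩, ⟨trivial, trivial, hQ⟩⟩, p + q + r + 6, fun n a =>
      Prog.computes_of_couples ?_⟩
  have h0 := load_input (adv := adv) a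
  show Couples _ (_root_.strCase (f n a) (g n a) (l n a)) _
  rw [← LawfulMonad.pure_bind (l n a) fun l => _root_.strCase (f n a) (g n a) l]
  simp only [Prog.exec_seq]
  refine (call_couples_of_eff hR hr h0 rfl).bind ?_
  rintro t l ⟨h1, -, -, -, h2⟩
  have h5 : (Mem.empty.load ([unary n, adv n] ++ rep a)).clock = 0 := rfl
  have h3 : t.1.regs (2 + Arity.ar α) = l := by
    have : List.map t.1.regs [2 + Arity.ar α] = [l] := by
      rw [map_regs_congr h1, Mem.map_store _ (List.nodup_singleton _) rfl]
      rfl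
    simpa using this
  have h4 : (List.range' 0 (2 + Arity.ar α)).map t.1.regs = [unary n, adv n] ++ rep a := by
    rw [map_regs_congr h1, Mem.map_store_of_disjoint _ _ (by simp; omega)]
    exact h0
  have key : ∀ (x : Bool) (l : Str), t.1.regs (2 + Arity.ar α) = x :: l →
      Couples ((B x).exec noOracle (t.1.tick, t.2)) (g n a x l) fun t b =>
        t.1.out 0 (BitRep.arity (γ n)) = rep b ∧ t.1.clock ≤ Polynomial.eval n (p + q + r + 6) := by
    intro x l hl
    simp only [B, Prog.exec_seq]
    rw [show (Prog.pop (2 + Arity.ar α)).exec noOracle (t.1.tick, t.2) = pure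
      (t.1.tick.tick.set (2 + Arity.ar α) (t.1.regs (2 + Arity.ar α)).tail, t.2) from rfl,
      LawfulMonad.pure_bind, Prog.exec_seq, Prog.setBit_exec, LawfulMonad.pure_bind]
    refine (call_couples_of_eff hQ hq (a := (a, x, l)) ?_ (by simp)).mono ?_
    · rw [List.map_append]
      simp only [List.map_cons, List.map_nil]
      have e1 := Mem.map_store_of_disjoint
        (t.1.tick.tick.set (2 + Arity.ar α) (t.1.regs (2 + Arity.ar α)).tail)
        (rs := [3 + Arity.ar α]) (rs' := List.range' 0 (2 + Arity.ar α)) [[x]] (by simp; omega)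
      have e2 := Mem.map_set_of_notMem t.1.tick.tick (r := 2 + Arity.ar α)
        (x := (t.1.regs (2 + Arity.ar α)).tail) (rs := List.range' 0 (2 + Arity.ar α)) (by simp)
      refine (congrArg₂ (· ++ ·) (e1.trans (e2.trans h4)) ?_).trans
        (List.append_assoc [unary n, adv n] (rep a) [[x], l])
      simp [Mem.store, Mem.set, hl]
    · rintro u c ⟨h6, -, -, -, h7⟩
      refine ⟨?_, ?_⟩
      · rw [Mem.out_eq_map, map_regs_congr h6, Arity.arity_eq, Mem.map_store _ List.nodup_range'
          (by simp [length_rep_eq])]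
      · simp only [Polynomial.eval_add, Polynomial.eval_ofNat]
        simp only [Mem.tick, Mem.set] at h2 h7
        omega
  cases l with
  | nil =>
    rw [Prog.exec_branch_nil noOracle h3]
    refine (call_couples_of_eff (s := (t.1.tick, t.2)) hP hp h4 (by simp)).mono ?_
    rintro u c ⟨h6, -, -, -, h7⟩
    refine ⟨?_, ?_⟩
    · rw [Mem.out_eq_map, map_regs_congr h6, Arity.arity_eq, Mem.map_store _ List.nodup_range'
        (by simp [length_rep_eq])]
    · simp only [Polynomial.eval_add, Polynomial.eval_ofNat]
      simp only [Mem.tick] at h2 h7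
      omega
  | cons x l =>
    cases x
    · rw [Prog.exec_branch_false noOracle h3]
      exact key false l h3
    · rw [Prog.exec_branch_true noOracle h3]
      exact key true l h3

theorem EffD.strCase [Arity α] [Arity γ] {l : ∀ n, α n → Str} (hl : EffD adv (β := fun _ => Str) l)
    {f : ∀ n, α n → γ n} {g : ∀ n, α n → Bool → Str → γ n} (hf : EffD adv f)
    (hg : EffD adv (α := fun n => α n × Bool × Str) fun n p => g n p.1 p.2.1 p.2.2) :
    EffD adv fun n a => strCase (f n a) (g n a) (l n a) :=
  (Eff.strCase hl hf (g := fun n a b l => (pure (g n a b l) : PMF (γ n))) hg).congr fun n a => by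
    cases h : l n a <;> simp [h, _root_.strCase]

theorem EffD.push [Arity α] (b : Bool) {l : ∀ n, α n → Str} (hl : EffD adv (β := fun _ => Str) l) :
    EffD adv (β := fun _ => Str) fun n a => b :: l n a := by
  obtain ⟨R, hR, r, hr⟩ := hl
  refine ⟨.seq (.call R (List.range' 0 (2 + Arity.ar α)) [0]) (.push b 0), ⟨hR, trivial⟩, r + 2,
    fun n a => Prog.computes_of_couples ?_⟩
  have h0 := load_input (adv := adv) a
  show Couples _ (pure (b :: l n a) : PMF Str) _
  rw [Prog.exec_seq, ← LawfulMonad.pure_bind (l n a) fun l => (pure (b :: l) : PMF Str)]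
  refine (call_couples_of_eff hR hr h0 rfl).bind ?_
  rintro t l ⟨h1, -, -, -, h2⟩
  have h5 : (Mem.empty.load ([unary n, adv n] ++ rep a)).clock = 0 := rfl
  refine Couples.pure ⟨?_, ?_⟩
  · simp [Mem.out, Mem.set, Mem.tick, h1, Mem.store, BitRep.arity, BitRep.rep]
  · simp only [Polynomial.eval_add, Polynomial.eval_ofNat, Mem.set, Mem.tick]
    simp only at h2
    omega

theorem EffD.cons [Arity α] {b : ∀ n, α n → Bool} {l : ∀ n, α n → Str}
    (hb : EffD adv (β := fun _ => Bool) b) (hl : EffD adv (β := fun _ => Str) l) :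
    EffD adv (β := fun _ => Str) fun n a => b n a :: l n a :=
  (EffD.ite hb (EffD.push true hl) (EffD.push false hl)).congr fun n a => by
    cases h : b n a <;> simp

/-- Loops through strings of polynomial length. -/
theorem Eff.foldlM [Arity α] [Arity β] {l : ∀ n, α n → Str} (hl : EffD adv (β := fun _ => Str) l)
    (hlen : ∃ L, PolyLe L ∧ ∀ n a, (l n a).length ≤ L n) {b : ∀ n, α n → β n} (hb : EffD adv b)
    {f : ∀ n, α n → Bool → β n → PMF (β n)}
    (hf : Eff adv (α := fun n => α n × Bool × β n) fun n p => f n p.1 p.2.1 p.2.2) :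
    Eff adv fun n a => (l n a).foldlM (fun c x => f n a x c) (b n a) := by
  obtain ⟨R, hR, r, hr⟩ := hl
  obtain ⟨P, hP, p, hp⟩ := hb
  obtain ⟨Q, hQ, q, hq⟩ := hf
  obtain ⟨L', ⟨L, hL'⟩, hL⟩ := hlen
  -- Behind the input follow the rest of the string, the current bit, and the accumulator, in this
  -- order.
  let B (x : Bool) : Prog := .seq (.pop (2 + Arity.ar α)) (.seq (.setBit x (3 + Arity.ar α))
    (.call Q (List.range' 0 (2 + Arity.ar α) ++ ([3 + Arity.ar α] ++
      List.range' (4 + Arity.ar α) (Arity.ar β))) (List.range' (4 + Arity.ar α) (Arity.ar β))))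
  let B' : Prog := .branch (2 + Arity.ar α) .skip (B false) (B true)
  refine ⟨.seq (.call R (List.range' 0 (2 + Arity.ar α)) [2 + Arity.ar α])
    (.seq (.call P (List.range' 0 (2 + Arity.ar α)) (List.range' (4 + Arity.ar α) (Arity.ar β)))
      (.seq (.loop (2 + Arity.ar α) B') (.move (List.range' (4 + Arity.ar α) (Arity.ar β))
        (List.range' 0 (Arity.ar β))))),
    ⟨hR, hP, ⟨trivial, ⟨trivial, trivial, hQ⟩, ⟨trivial, trivial, hQ⟩⟩, trivial⟩,
    -- One iteration costs, beyond the body, a tick of the loop, the branch, the `pop`, two steps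
    -- for the bit and one for the call. The last summand counts the two calls, the entry of the
    -- loop and the final move.
    r + p + L * (q + 6) + 5, fun n a => Prog.computes_of_couples ?_⟩
  have h0 := load_input (adv := adv) a
  have body : ∀ (x : Bool) (l : Str) (c : β n) (t : Mem × Unit),
      t.1.regs (2 + Arity.ar α) = x :: l →
      (List.range' 0 (2 + Arity.ar α)).map t.1.regs = [unary n, adv n] ++ rep a →
      (List.range' (4 + Arity.ar α) (Arity.ar β)).map t.1.regs = rep c →
      Couples ((B x).exec noOracle t) (f n a x c) fun u d => u.1.regs (2 + Arity.ar α) = l ∧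
        (List.range' 0 (2 + Arity.ar α)).map u.1.regs = [unary n, adv n] ++ rep a ∧
        (List.range' (4 + Arity.ar α) (Arity.ar β)).map u.1.regs = rep d ∧
        u.1.clock ≤ t.1.clock + q.eval n + 4 := by
    intro x l c t hl ha hc
    simp only [B, Prog.exec_seq]
    rw [show (Prog.pop (2 + Arity.ar α)).exec noOracle t = pure
      (t.1.tick.set (2 + Arity.ar α) (t.1.regs (2 + Arity.ar α)).tail, t.2) from rfl,
      LawfulMonad.pure_bind, Prog.exec_seq, Prog.setBit_exec, LawfulMonad.pure_bind]
    have e (rs : List ℕ) (h3 : ∀ r ∈ rs, r ∉ [3 + Arity.ar α]) (h2 : 2 + Arity.ar α ∉ rs) :=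
      (Mem.map_store_of_disjoint
        (t.1.tick.set (2 + Arity.ar α) (t.1.regs (2 + Arity.ar α)).tail) [[x]] h3).trans
        (Mem.map_set_of_notMem t.1.tick (x := (t.1.regs (2 + Arity.ar α)).tail) h2)
    have e1 := e (List.range' 0 (2 + Arity.ar α)) (by simp; omega) (by simp)
    have e2 := e (List.range' (4 + Arity.ar α) (Arity.ar β)) (by simp; omega) (by simp)
    have e3 := e1.trans ha
    have e4 := e2.trans hc
    refine (call_couples_of_eff hQ hq (a := (a, x, c)) ?_ (by simp)).mono ?_
    · rw [List.map_append, List.map_append]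
      refine (congrArg₂ (· ++ ·) e3 (congrArg₂ (· ++ ·) (x' := [[x]]) ?_ e4)).trans
        (List.append_assoc [unary n, adv n] (rep a) _)
      simp [Mem.store]
    · rintro u d ⟨h6, -, -, -, h7⟩
      refine ⟨?_, ?_, ?_, ?_⟩
      · simp [h6, Mem.store, Mem.set, hl]
      · rw [map_regs_congr h6, Mem.map_store_of_disjoint _ _ (by simp; omega)]
        exact e3
      · rw [map_regs_congr h6, Mem.map_store _ List.nodup_range' (by simp [length_rep_eq])]
      · simp only [Mem.tick, Mem.set] at h7
        omega
  have loop : ∀ (l : Str) (c : β n) (t : Mem × Unit),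
      t.1.regs (2 + Arity.ar α) = l →
      (List.range' 0 (2 + Arity.ar α)).map t.1.regs = [unary n, adv n] ++ rep a →
      (List.range' (4 + Arity.ar α) (Arity.ar β)).map t.1.regs = rep c →
      Couples (iterPMF (fun s => B'.exec noOracle (s.1.tick, s.2)) l.length t)
        (l.foldlM (fun c x => f n a x c) c) fun u d =>
        (List.range' (4 + Arity.ar α) (Arity.ar β)).map u.1.regs = rep d ∧
        u.1.clock ≤ t.1.clock + l.length * (q.eval n + 6) := by
    intro l
    induction l with
    | nil =>
      intro c t _ _ hc
      exact Couples.pure ⟨hc, by simp⟩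
    | cons x l ih =>
      intro c t hl ha hc
      simp only [List.length_cons, iterPMF, List.foldlM_cons]
      have hb : Couples (B'.exec noOracle (t.1.tick, t.2)) (f n a x c) fun u d =>
          u.1.regs (2 + Arity.ar α) = l ∧
          (List.range' 0 (2 + Arity.ar α)).map u.1.regs = [unary n, adv n] ++ rep a ∧
          (List.range' (4 + Arity.ar α) (Arity.ar β)).map u.1.regs = rep d ∧
          u.1.clock ≤ t.1.clock + 2 + q.eval n + 4 := by
        cases x
        · rw [Prog.exec_branch_false noOracle (l := l) (s := (t.1.tick, t.2)) hl]
          exact body false l c (t.1.tick.tick, t.2) hl ha hc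
        · rw [Prog.exec_branch_true noOracle (l := l) (s := (t.1.tick, t.2)) hl]
          exact body true l c (t.1.tick.tick, t.2) hl ha hc
      refine hb.bind ?_
      rintro u d ⟨h1, h2, h3, h4⟩
      refine (ih d u h1 h2 h3).mono ?_
      rintro v e ⟨h5, h6⟩
      refine ⟨h5, h6.trans ?_⟩
      rw [Nat.add_mul]
      omega
  simp only [Prog.exec_seq]
  rw [← LawfulMonad.pure_bind (l n a) fun l => l.foldlM (fun c x => f n a x c) (b n a)]
  have hlen : (l n a).length ≤ L.eval n := (hL n a).trans (hL' n)
  refine (call_couples_of_eff hR hr h0 rfl).support.bind ?_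
  rintro t l' ⟨⟨h1, -, -, -, h2⟩, -, hl'⟩
  rw [mem_support_pure] at hl'
  subst hl'
  rw [Prog.exec_seq, ← LawfulMonad.pure_bind (b n a) fun b => (l n a).foldlM (fun c x => f n a x c) b]
  have h4 : (List.range' 0 (2 + Arity.ar α)).map t.1.regs = [unary n, adv n] ++ rep a := by
    rw [map_regs_congr h1, Mem.map_store_of_disjoint _ _ (by simp; omega)]
    exact h0
  refine (call_couples_of_eff hP hp h4 (by simp)).bind ?_
  rintro u c ⟨h6, -, -, -, h7⟩
  rw [← bind_pure ((l n a).foldlM (fun c x => f n a x c) c)]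
  have h9 : u.1.regs (2 + Arity.ar α) = l n a := by
    have : List.map u.1.regs [2 + Arity.ar α] = [l n a] := by
      rw [map_regs_congr h6, Mem.map_store_of_disjoint _ _ (by simp), map_regs_congr h1,
        Mem.map_store _ (List.nodup_singleton _) rfl]
      rfl
    simpa using this
  have h10 : (Prog.loop (2 + Arity.ar α) B').exec noOracle u =
      iterPMF (fun s => B'.exec noOracle (s.1.tick, s.2)) (l n a).length (u.1.tick, u.2) := by
    simp only [Prog.exec, h9]
  rw [Prog.exec_seq, h10]
  refine (loop (l n a) c (u.1.tick, u.2) h9 ?_ ?_).bind ?_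
  · show List.map u.1.regs _ = _
    rw [map_regs_congr h6, Mem.map_store_of_disjoint _ _ (by simp; omega)]
    exact h4
  · show List.map u.1.regs _ = _
    rw [map_regs_congr h6, Mem.map_store _ List.nodup_range' (by simp [length_rep_eq])]
  · rintro v d ⟨h11, h12⟩
    rw [Prog.move_exec _ _ (by simp)]
    refine Couples.pure ⟨?_, ?_⟩
    · rw [Mem.out_eq_map, Arity.arity_eq]
      exact (Mem.map_store _ List.nodup_range' (by simp)).trans h11
    · have h5 : (Mem.empty.load ([unary n, adv n] ++ rep a)).clock = 0 := rfl
      simp only [Polynomial.eval_add, Polynomial.eval_ofNat, Polynomial.eval_mul]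
      simp only [Mem.tick] at h2 h7 h12
      have h13 := Nat.mul_le_mul_right (q.eval n + 6) hlen
      omega

theorem EffD.foldl [Arity α] [Arity β] {l : ∀ n, α n → Str} (hl : EffD adv (β := fun _ => Str) l)
    (hlen : ∃ L, PolyLe L ∧ ∀ n a, (l n a).length ≤ L n) {b : ∀ n, α n → β n} (hb : EffD adv b)
    {f : ∀ n, α n → Bool → β n → β n}
    (hf : EffD adv (α := fun n => α n × Bool × β n) fun n p => f n p.1 p.2.1 p.2.2) :
    EffD adv fun n a => (l n a).foldl (fun c x => f n a x c) (b n a) :=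
  (Eff.foldlM hl hlen hb (f := fun n a x c => (pure (f n a x c) : PMF (β n))) hf).congr
    fun _ _ => List.foldlM_pure

end StrOps

/-! ## Efficient functions and probabilistic polynomial time algorithms -/

section PPT

variable {adv : ℕ → Str} {α β : ℕ → Type} [∀ n, BitRep (α n)] [∀ n, BitRep (β n)]

/-- A program that does not use the advice. -/
theorem Eff.of_computes [Arity α] [Arity β] {f : ∀ n, α n → PMF (β n)} {P : Prog} (hP : P.Classical)
    {T : ℕ → ℕ} (hT : PolyLe T) (h : ∀ n a, P.Computes (unary n :: rep a) (f n a) (T n)) :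
    Eff adv f := by
  obtain ⟨p, hp⟩ := hT
  refine ⟨.call P ([0] ++ List.range' 2 (Arity.ar α)) (List.range' 0 (Arity.ar β)), hP, p + 1,
    fun n a => Prog.computes_of_couples ?_⟩
  have h0 := load_input (adv := adv) a
  have e : List.range' 0 (2 + Arity.ar α) = [0, 1] ++ List.range' 2 (Arity.ar α) :=
    (List.range'_append_1 (s := 0) (m := 2) (n := Arity.ar α)).symm
  rw [e, List.map_append] at h0
  have h1 := (List.append_inj h0 (by simp)).2
  refine (Prog.call_couples noOracle hP (h n a) _ ?_ (by simp [Arity.arity_eq])).mono ?_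
  · rw [List.map_append, h1]
    rfl
  · rintro u c ⟨h6, -, -, -, h7⟩
    refine ⟨?_, ?_⟩
    · rw [Mem.out_eq_map, map_regs_congr h6, Arity.arity_eq, Mem.map_store _ List.nodup_range'
        (by simp [length_rep_eq])]
    · have h5 : (Mem.empty.load ([unary n, adv n] ++ rep a)).clock = 0 := rfl
      have h8 := hp n
      simp only [Polynomial.eval_add, Polynomial.eval_one]
      dsimp only at h7
      omega

theorem Eff.of_ppt [Arity α] [Arity β] {f : ∀ n, α n → PMF (β n)} (hf : PPT secParam f) :
    Eff adv f := by
  obtain ⟨P, hP, p, hp⟩ := hf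
  exact Eff.of_computes hP (PolyLe.eval p) fun n a => by simpa using hp n a

/-- Register `1 + ar` lies behind the input and is empty, so it can be handed over as the empty
advice. -/
theorem Eff.ppt [Arity α] [Arity β] {f : ∀ n, α n → PMF (β n)} (hf : Eff (fun _ => []) f) :
    PPT secParam f := by
  obtain ⟨P, hP, p, hp⟩ := hf
  refine ⟨.call P ([0, 1 + Arity.ar α] ++ List.range' 1 (Arity.ar α)) (List.range' 0 (Arity.ar β)),
    hP, p + 1, fun n a => Prog.computes_of_couples ?_⟩
  refine (Prog.call_couples noOracle hP (hp n a) _ ?_ (by simp [Arity.arity_eq])).mono ?_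
  · have h := Mem.map_load_range' Mem.empty ([unary n] ++ rep a)
    rw [List.length_append, length_rep_eq] at h
    have e : List.range' 0 (1 + Arity.ar α) = [0] ++ List.range' 1 (Arity.ar α) :=
      (List.range'_append_1 (s := 0) (m := 1) (n := Arity.ar α)).symm
    change List.map _ (List.range' 0 (1 + Arity.ar α)) = _ at h
    rw [e, List.map_append] at h
    rw [List.map_append]
    refine congrArg₂ (· ++ ·) ?_ (List.append_inj h (by simp)).2
    have : (List.map unary (secParam n) ++ rep a).length ≤ 1 + Arity.ar α := by
      rw [List.length_append, length_rep_eq]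
      rfl
    show [_, (List.map unary (secParam n) ++ rep a).getD (1 + Arity.ar α) []] = _
    rw [List.getD_eq_default _ _ this]
    rfl
  · rintro u c ⟨h6, -, -, -, h7⟩
    refine ⟨?_, ?_⟩
    · rw [Mem.out_eq_map, map_regs_congr h6, Arity.arity_eq, Mem.map_store _ List.nodup_range'
        (by simp [length_rep_eq])]
    · have h5 : (Mem.empty.load (List.map unary (secParam n) ++ rep a)).clock = 0 := rfl
      simp only [Polynomial.eval_add, Polynomial.eval_one, List.sum_cons, List.sum_nil, Nat.add_zero]
      simp only at h7
      omega

/-- The outputs of efficient functions are short. -/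
theorem Eff.length_le [Arity α] [Arity β] {f : ∀ n, α n → PMF (β n)} (hf : Eff adv f)
    (hadv : PolyLe fun n => (adv n).length)
    (hα : ∃ L, PolyLe L ∧ ∀ n (a : α n), ∀ s ∈ rep a, s.length ≤ L n) :
    ∃ L, PolyLe L ∧ ∀ n a, ∀ b ∈ (f n a).support, ∀ s ∈ rep b, s.length ≤ L n := by
  obtain ⟨P, hP, p, hp⟩ := hf
  obtain ⟨L, hL, hL'⟩ := hα
  refine ⟨fun n => n + (adv n).length + L n + p.eval n,
    ((PolyLe.id.add hadv).add hL).add (PolyLe.eval p), fun n a b hb s hs => ?_⟩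
  obtain ⟨h1, h2⟩ := hp n a
  have h3 : rep b ∈ ((f n a).map rep).support := by
    rw [PMF.mem_support_map_iff]
    exact ⟨b, hb, rfl⟩
  rw [← h1, PMF.mem_support_map_iff] at h3
  obtain ⟨t, ht, ht'⟩ := h3
  have h4 := P.exec_length (Mem.empty.load ([unary n, adv n] ++ rep a), ())
    (n + (adv n).length + L n) (by
      intro r
      simp only [Mem.load, List.getD_eq_getElem?_getD]
      cases h : ([unary n, adv n] ++ rep a)[r]? with
      | none => simp [Mem.empty]
      | some x =>
        have := List.mem_of_getElem? h
        simp only [List.cons_append, List.nil_append, List.mem_cons] at this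
        rcases this with rfl | rfl | h
        · simp [unary]
          omega
        · simp only [Option.getD_some]
          omega
        · have := hL' n a x h
          simp only [Option.getD_some]
          omega) t ht
  rw [← ht'] at hs
  simp only [Mem.out, List.mem_map] at hs
  obtain ⟨j, -, rfl⟩ := hs
  have h5 := h4.2 (0 + j)
  have h6 := h2 t ht
  have h7 : (Mem.empty.load ([unary n, adv n] ++ rep a), ()).1.clock = 0 := rfl
  show _ ≤ n + (adv n).length + L n + p.eval n
  omega

end PPT

/-! ## String functions -/

/-- The elements of a string at even positions. -/
def evens : Str → Str
  | [] => []
  | [x] => [x]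
  | x :: _ :: l => x :: evens l

theorem evens_cons (x : Bool) (l : Str) : evens (x :: l) = x :: evens l.tail := by
  cases l <;> rfl

theorem evens_getElem? (l : Str) (t : ℕ) : (evens l)[t]? = l[2 * t]? := by
  induction l using evens.induct generalizing t with
  | case1 => simp [evens]
  | case2 x => cases t <;> simp [evens, Nat.mul_add]
  | case3 x y l ih =>
    cases t with
    | zero => simp [evens]
    | succ t => simpa [evens, Nat.mul_add] using ih t

theorem evens_length_le (l : Str) : (evens l).length ≤ l.length := by
  induction l using evens.induct with
  | case1 | case2 => simp [evens]
  | case3 x y l ih => simp [evens]; omega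

/-- Dropping every other symbol halves a unary number, rounding up, which is the recursion of the
binary logarithm `Nat.clog 2`. -/
theorem evens_unary (n : ℕ) : evens (unary n) = unary ((n + 1) / 2) := by
  induction n using Nat.strong_induction_on with
  | _ n ih =>
    match n with
    | 0 => rfl
    | 1 => rfl
    | n + 2 =>
      have e : (n + 2 + 1) / 2 = (n + 1) / 2 + 1 := by omega
      have := ih n (by omega)
      simp only [unary, e, List.replicate_succ, evens] at this ⊢
      rw [this]

/-- A loop with an alternating flag that collects its output on a stack, hence in reverse order. -/
theorem evens_eq_foldl (l : Str) (fl : Bool) (out : Str) :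
    (l.foldl (fun c x => (!c.1, if c.1 then x :: c.2 else c.2)) (fl, out)).2 =
      (if fl then evens l else evens l.tail).reverse ++ out := by
  induction l generalizing fl out with
  | nil => cases fl <;> simp [evens]
  | cons x l ih =>
    rw [List.foldl_cons, ih]
    cases fl
    · simp
    · simp [evens_cons]

/-- The elements of a string at the positions that are congruent to the number with the binary
expansion `bits`, lowest bit first. -/
def selectBits (bits l : Str) : Str := bits.foldl (fun l b => evens (if b then l.tail else l)) l

/-- The number with the given binary expansion, lowest bit first. -/
def bitsVal : Str → ℕ
  | [] => 0
  | b :: l => b.toNat + 2 * bitsVal l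

/-- Each bit of the position, lowest first, selects a parity class. The first remaining entry is
therefore the one at the encoded position, which allows a table lookup without counting. -/
theorem selectBits_getElem? (bits l : Str) (t : ℕ) :
    (selectBits bits l)[t]? = l[bitsVal bits + 2 ^ bits.length * t]? := by
  induction bits generalizing l with
  | nil => simp [selectBits, bitsVal]
  | cons b bits ih =>
    have : selectBits (b :: bits) l = selectBits bits (evens (if b then l.tail else l)) := rfl
    rw [this, ih, evens_getElem?]
    cases b
    · simp only [Bool.false_eq_true, if_false, bitsVal, Bool.toNat_false, List.length_cons]
      congr 1
      ring
    · simp only [if_true, List.getElem?_tail, bitsVal, Bool.toNat_true, List.length_cons]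
      congr 1
      ring

theorem bitsVal_ofFn (L i : ℕ) : bitsVal (List.ofFn fun j : Fin L => i.testBit j) = i % 2 ^ L := by
  induction L generalizing i with
  | zero => simp [bitsVal, Nat.mod_one]
  | succ L ih =>
    have h : (List.ofFn fun j : Fin L => i.testBit (j + 1)) = List.ofFn fun j : Fin L => (i / 2).testBit j := by
      simp [Nat.testBit_succ]
    rw [List.ofFn_succ]
    simp only [Fin.val_zero, Fin.val_succ, bitsVal]
    rw [h, ih, pow_succ, mul_comm (2 ^ L) 2, Nat.mod_mul, Nat.testBit_zero]
    rcases Nat.mod_two_eq_zero_or_one i with h | h <;> simp [h]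

theorem testBit_bitsVal (s : Str) (j : ℕ) : (bitsVal s).testBit j = s.getD j false := by
  induction s generalizing j with
  | nil => simp [bitsVal]
  | cons b s ih =>
    cases j with
    | zero => cases b <;> simp [bitsVal, Nat.testBit_zero]
    | succ j =>
      have : (bitsVal (b :: s)) / 2 = bitsVal s := by
        cases b <;> simp [bitsVal]
        omega
      rw [Nat.testBit_succ, this, ih]
      simp

theorem bitsVal_indexBits {k : ℕ} (i : Fin k) : bitsVal (List.ofFn (indexBits i)) = i := by
  unfold indexBits
  rw [bitsVal_ofFn, Nat.mod_eq_of_lt]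
  exact lt_of_lt_of_le i.2 (Nat.le_pow_clog (by norm_num) k)

/-- A string represents an index in `[k]` if it has the right length and a value below `k`. -/
theorem mem_msgs_fin {k : ℕ} {s : Str} :
    s.length = Nat.clog 2 k ∧ bitsVal s < k ↔ [s] ∈ msgs (Fin k) := by
  constructor
  · rintro ⟨h1, h2⟩
    refine ⟨⟨bitsVal s, h2⟩, ?_⟩
    show [List.ofFn (indexBits _)] = [s]
    rw [List.cons.injEq]
    refine ⟨?_, rfl⟩
    apply List.ext_getElem
    · simp [h1]
    · intro j hj hj'
      simp [indexBits, testBit_bitsVal, List.getD_eq_getElem?_getD, hj']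
  · rintro ⟨i, hi⟩
    have : List.ofFn (indexBits i) = s := by simpa [rep] using hi
    subst this
    rw [bitsVal_indexBits]
    exact ⟨by simp, i.2⟩

theorem selectBits_indexBits {k : ℕ} (i : Fin k) (m : Bits k) :
    (selectBits (List.ofFn (indexBits i)) (List.ofFn m))[0]? = some (m i) := by
  rw [selectBits_getElem?, bitsVal_indexBits]
  simp

theorem mem_msgs_bits {L : ℕ} {s : Str} : s.length = L ↔ [s] ∈ msgs (Bits L) := by
  constructor
  · rintro rfl
    exact ⟨s.get, by simp [rep]⟩
  · rintro ⟨x, hx⟩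
    have : List.ofFn x = s := by simpa [rep] using hx
    simp [← this]

theorem parse_eq_none {α : Type} [BitRep α] {xs : List Str} (h : xs ∉ msgs α) :
    (parse xs : Option α) = none := by
  rw [parse, dif_neg]
  exact h

/-- Reads a string as a bit string of length `L`. -/
noncomputable def readBits (L : ℕ) (s : Str) : Bits L := (parse [s]).getD default

theorem readBits_ofFn {L : ℕ} (x : Bits L) : readBits L (List.ofFn x) = x := by
  have := parse_rep x
  simp only [rep] at this
  simp [readBits, this]

theorem ofFn_readBits (L : ℕ) (s : Str) :
    List.ofFn (readBits L s) = if s.length = L then s else List.replicate L false := by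
  split_ifs with h
  · obtain ⟨x, hx⟩ := mem_msgs_bits.1 h
    have : List.ofFn x = s := by simpa [rep] using hx
    rw [← this, readBits_ofFn]
  · rw [mem_msgs_bits] at h
    rw [readBits, parse_eq_none h]
    exact List.ofFn_const L false

/-- Reads a string as an index. -/
noncomputable def readFin {k : ℕ} (hk : 0 < k) (s : Str) : Fin k := (parse [s]).getD ⟨0, hk⟩

theorem readFin_rep {k : ℕ} (hk : 0 < k) (i : Fin k) : readFin hk (List.ofFn (indexBits i)) = i := by
  have := parse_rep i
  simp only [rep] at this
  simp [readFin, this]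

open Classical in
theorem ofFn_readFin {k : ℕ} (hk : 0 < k) (s : Str) : List.ofFn (indexBits (readFin hk s)) =
    if s.length = Nat.clog 2 k ∧ bitsVal s < k then s else List.replicate (Nat.clog 2 k) false := by
  split_ifs with h
  · obtain ⟨x, hx⟩ := mem_msgs_fin.1 h
    have : List.ofFn (indexBits x) = s := by simpa [rep] using hx
    rw [← this, readFin_rep]
  · rw [mem_msgs_fin] at h
    rw [readFin, parse_eq_none h, ← List.ofFn_const]
    congr 1
    funext j
    simp [indexBits]

/-- Reads a string as a bit. -/
noncomputable def readBool (s : Str) : Bool := (parse [s]).getD default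

theorem readBool_eq (s : Str) : readBool s = strCase false (fun b l => strCase b (fun _ _ => false) l) s := by
  by_cases h : [s] ∈ msgs Bool
  · obtain ⟨b, hb⟩ := h
    have : [b] = s := by simpa [rep] using hb
    subst this
    have := parse_rep b
    simp only [rep] at this
    simp [readBool, this, strCase]
  · rw [readBool, parse_eq_none h]
    match s with
    | [] => rfl
    | [b] => exact (h ⟨b, rfl⟩).elim
    | _ :: _ :: _ => rfl

theorem unif_succ (n : ℕ) :
    unif (n + 1) = coin >>= fun b => (unif n).map fun x => (Fin.cons b x : Bits (n + 1)) := by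
  ext y
  show _ = ∑' b, coin b * _
  rw [tsum_fintype, Finset.sum_eq_single (y 0)]
  · rw [PMF.map_apply, tsum_eq_single (Fin.tail y)]
    · simp only [Fin.cons_self_tail, if_true, unif, coin, PMF.uniformOfFintype_apply,
        Fintype.card_bool, Fintype.card_pi, Finset.prod_const, Finset.card_univ, Fintype.card_fin]
      rw [← ENNReal.mul_inv (by simp) (by simp), ← Nat.cast_mul, pow_succ, mul_comm]
    · intro x hx
      rw [if_neg]
      intro e
      exact hx (by rw [e, Fin.tail_cons])
  · intro b _ hb
    rw [PMF.map_apply, ENNReal.tsum_eq_zero.2, mul_zero]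
    intro x
    rw [if_neg]
    intro e
    exact hb (by rw [e, Fin.cons_zero])
  · simp

/-- Coins pushed on a stack give the uniform string in reverse order; the reversal is undone later.
-/
theorem foldlM_coin (n : ℕ) (l : Str) :
    (unary n).foldlM (fun c _ => coin >>= fun b => (pure (b :: c) : PMF Str)) l =
      (unif n).map fun x => (List.ofFn x).reverse ++ l := by
  induction n generalizing l with
  | zero =>
    have : (unif 0).map (fun x => (List.ofFn x).reverse ++ l) = (unif 0).map (Function.const _ l) := by
      congr 1
    rw [this, PMF.map_const]
    rfl
  | succ n ih =>
    rw [unary, List.replicate_succ, List.foldlM_cons, unif_succ]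
    rw [bind_assoc]
    refine Eq.trans ?_ (PMF.map_bind _ _ _).symm
    show (coin >>= _) = coin >>= _
    congr 1
    funext b
    rw [LawfulMonad.pure_bind, PMF.map_comp]
    refine (ih (b :: l)).trans ?_
    congr 1
    funext x
    simp [List.ofFn_succ]

/-- While the first number is at least 2, it is halved and the counter grows by one. The string `l`
only drives the loop; it may be longer than needed, as the state is then constant. -/
theorem foldl_clog (l : Str) (a b : ℕ) (h : a ≤ l.length + 1) :
    (l.foldl (fun c _ => strCase c (fun _ _ => (evens c.1, true :: c.2)) c.1.tail)
      (unary a, unary b)).2 = unary (b + Nat.clog 2 a) := by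
  induction l generalizing a b with
  | nil =>
    have : Nat.clog 2 a = 0 := Nat.clog_of_right_le_one (by simpa using h) 2
    simp [this]
  | cons x l ih =>
    rw [List.foldl_cons]
    match a with
    | 0 => simpa [unary, strCase] using ih 0 b (by simp)
    | 1 => simpa [unary, strCase] using ih 1 b (by simp)
    | a + 2 =>
      have e : strCase ((unary (a + 2), unary b) : Str × Str)
          (fun _ _ => (evens (unary (a + 2)), true :: unary b)) (unary (a + 2)).tail =
          (unary ((a + 2 + 1) / 2), unary (b + 1)) := by
        rw [evens_unary]
        simp [unary, List.replicate_succ, strCase]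
      rw [e, ih _ _ (by simp only [List.length_cons] at h; omega),
        Nat.clog_of_two_le (by norm_num) (show 2 ≤ a + 2 by omega)]
      congr 1
      rw [show a + 2 + 2 - 1 = a + 2 + 1 from rfl]
      omega

/-! ## Efficient string functions -/

/-- String-valued functions with outputs of polynomial length. -/
def ShortStr {α : ℕ → Type} (l : ∀ n, α n → Str) : Prop :=
  ∃ L, PolyLe L ∧ ∀ n a, (l n a).length ≤ L n

theorem ShortStr.mono {α : ℕ → Type} {l l' : ∀ n, α n → Str} (h : ShortStr l')
    (hl : ∀ n a, (l n a).length ≤ (l' n a).length) : ShortStr l :=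
  h.imp fun _ ⟨h1, h2⟩ => ⟨h1, fun n a => (hl n a).trans (h2 n a)⟩

/-- `1^n ↦ 1^(L n)` is efficient. -/
def EffLen (adv : ℕ → Str) (L : ℕ → ℕ) : Prop :=
  PolyLe L ∧ EffD adv (α := fun _ => Unit) (β := fun _ => Str) fun n _ => unary (L n)

section

variable {adv : ℕ → Str} {α β γ : ℕ → Type} [∀ n, BitRep (α n)] [∀ n, BitRep (β n)]
  [∀ n, BitRep (γ n)] [Arity α] [Arity β] [Arity γ] {l l' : ∀ n, α n → Str}

theorem EffLen.eff {L : ℕ → ℕ} (h : EffLen adv L) :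
    EffD adv (β := fun _ => Str) fun n (_ : α n) => unary (L n) :=
  EffD.comp (g := fun n (_ : Unit) => unary (L n)) h.2 (EffD.unit (α := α))

theorem EffLen.short {L : ℕ → ℕ} (h : EffLen adv L) : ShortStr fun n (_ : α n) => unary (L n) :=
  ⟨L, h.1, fun n _ => by simp [unary]⟩

theorem EffD.not {b : ∀ n, α n → Bool} (hb : EffD adv (β := fun _ => Bool) b) :
    EffD adv (β := fun _ => Bool) fun n a => !b n a :=
  (EffD.ite hb (EffD.bool false) (EffD.bool true)).congr fun n a => by cases h : b n a <;> simp

theorem EffD.and {b c : ∀ n, α n → Bool} (hb : EffD adv (β := fun _ => Bool) b)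
    (hc : EffD adv (β := fun _ => Bool) c) : EffD adv (β := fun _ => Bool) fun n a => b n a && c n a :=
  (EffD.ite hb hc (EffD.bool false)).congr fun n a => by cases h : b n a <;> simp

theorem EffD.beqBool {b c : ∀ n, α n → Bool} (hb : EffD adv (β := fun _ => Bool) b)
    (hc : EffD adv (β := fun _ => Bool) c) : EffD adv (β := fun _ => Bool) fun n a => b n a == c n a :=
  (EffD.ite hb hc hc.not).congr fun n a => by cases h : b n a <;> simp

theorem EffD.tail (hl : EffD adv (β := fun _ => Str) l) :
    EffD adv (β := fun _ => Str) fun n a => (l n a).tail :=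
  (EffD.strCase hl EffD.nil (g := fun _ _ _ t => t) (EffD.snd (EffD.snd EffD.id))).congr
    fun n a => by cases h : l n a <;> simp [_root_.strCase]

theorem EffD.isNil (hl : EffD adv (β := fun _ => Str) l) :
    EffD adv (β := fun _ => Bool) fun n a => decide (l n a = []) :=
  (EffD.strCase hl (EffD.bool true) (g := fun _ _ _ _ => false) (EffD.bool false)).congr
    fun n a => by cases h : l n a <;> simp [_root_.strCase]

theorem EffD.headD (hl : EffD adv (β := fun _ => Str) l) :
    EffD adv (β := fun _ => Bool) fun n a => (l n a)[0]?.getD false :=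
  (EffD.strCase hl (EffD.bool false) (g := fun _ _ b _ => b) (EffD.fst (EffD.snd EffD.id))).congr
    fun n a => by cases h : l n a <;> simp [_root_.strCase]

theorem EffD.reverseAppend (hl : EffD adv (β := fun _ => Str) l) (h : ShortStr l)
    (hl' : EffD adv (β := fun _ => Str) l') :
    EffD adv (β := fun _ => Str) fun n a => (l n a).reverse ++ l' n a :=
  (EffD.foldl hl h hl' (f := fun _ _ x c => x :: c)
    (EffD.cons (EffD.fst (EffD.snd EffD.id)) (EffD.snd (EffD.snd EffD.id)))).congr fun n a => by
      simp

theorem EffD.reverse (hl : EffD adv (β := fun _ => Str) l) (h : ShortStr l) :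
    EffD adv (β := fun _ => Str) fun n a => (l n a).reverse :=
  (EffD.reverseAppend hl h EffD.nil).congr fun n a => by simp

theorem EffD.append (hl : EffD adv (β := fun _ => Str) l) (h : ShortStr l)
    (hl' : EffD adv (β := fun _ => Str) l') :
    EffD adv (β := fun _ => Str) fun n a => l n a ++ l' n a :=
  (EffD.reverseAppend (hl.reverse h) (h.mono (by simp)) hl').congr fun n a => by simp

theorem EffD.drop (hl : EffD adv (β := fun _ => Str) l) (h : ShortStr l)
    (hl' : EffD adv (β := fun _ => Str) l') :
    EffD adv (β := fun _ => Str) fun n a => (l' n a).drop (l n a).length :=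
  (EffD.foldl hl h hl' (f := fun _ _ _ c => c.tail) (EffD.tail (EffD.snd (EffD.snd EffD.id)))).congr
    fun n a => by
      generalize l' n a = t
      induction l n a generalizing t with
      | nil => simp
      | cons x l ih => simp [ih]

theorem EffD.take (hl : EffD adv (β := fun _ => Str) l) (h : ShortStr l)
    (hl' : EffD adv (β := fun _ => Str) l') :
    EffD adv (β := fun _ => Str) fun n a => (l' n a).take (l n a).length := by
  have h1 : EffD adv (β := fun _ => Str × Str) fun n a =>
      (l n a).foldl (fun c x => _root_.strCase c (fun y t => (t, y :: c.2)) c.1) (l' n a, ([] : Str)) :=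
    EffD.foldl hl h (EffD.pair hl' EffD.nil)
      (f := fun _ _ x c => _root_.strCase c (fun y t => (t, y :: c.2)) c.1)
      (EffD.strCase (EffD.fst (EffD.snd (EffD.snd EffD.id))) (EffD.snd (EffD.snd EffD.id))
        (g := fun _ p y t => (t, y :: p.2.2.2))
        (EffD.pair (EffD.snd (EffD.snd EffD.id)) (EffD.cons (EffD.fst (EffD.snd EffD.id))
          (EffD.snd (EffD.snd (EffD.snd (EffD.fst EffD.id)))))))
  have key : ∀ (l t o : Str),
      (l.foldl (fun (c : Str × Str) _ => _root_.strCase c (fun y t => (t, y :: c.2)) c.1) (t, o)).2 =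
        (t.take l.length).reverse ++ o := by
    intro l
    induction l with
    | nil => simp
    | cons x l ih =>
      intro t o
      rw [List.foldl_cons]
      cases t with
      | nil => simpa [_root_.strCase] using ih [] o
      | cons y t => simpa [_root_.strCase] using ih t (y :: o)
  refine ((EffD.snd h1).reverse (h.mono ?_)).congr fun n a => ?_
  · intro n a
    rw [key]
    simp
  · beta_reduce
    rw [key]
    simp

theorem EffD.replicate (b : Bool) (hl : EffD adv (β := fun _ => Str) l) (h : ShortStr l) :
    EffD adv (β := fun _ => Str) fun n a => List.replicate (l n a).length b :=
  (EffD.foldl hl h EffD.nil (f := fun _ _ _ c => b :: c)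
    (EffD.push b (EffD.snd (EffD.snd EffD.id)))).congr fun n a => by
      have : ∀ (l o : Str), l.foldl (fun c _ => b :: c) o = List.replicate l.length b ++ o := by
        intro l
        induction l with
        | nil => simp
        | cons x l ih =>
          intro o
          rw [List.foldl_cons, ih, List.length_cons, List.replicate_succ']
          simp
      rw [this, List.append_nil]

/-- The lengths agree if nothing remains of either string after removing as many symbols as the
other one has. Loops may run only over strings of bounded length, so the second comparison uses a
prefix of `l'` instead of `l'`. -/
theorem EffD.lengthEq (hl : EffD adv (β := fun _ => Str) l) (h : ShortStr l)
    (hl' : EffD adv (β := fun _ => Str) l') :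
    EffD adv (β := fun _ => Bool) fun n a => decide ((l' n a).length = (l n a).length) := by
  have h1 := EffD.drop hl h hl'
  have h2 := EffD.take hl h hl'
  have h3 := EffD.drop h2 (h.mono (by simp)) hl
  refine (h1.isNil.and h3.isNil).congr fun n a => ?_
  rw [Bool.eq_iff_iff]
  simp only [List.length_take, Bool.and_eq_true, decide_eq_true_eq, List.drop_eq_nil_iff]
  omega

theorem EffD.eqStr (hl : EffD adv (β := fun _ => Str) l) (h : ShortStr l)
    (hl' : EffD adv (β := fun _ => Str) l') :
    EffD adv (β := fun _ => Bool) fun n a => decide (l n a = l' n a) := by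
  have h1 : EffD adv (β := fun _ => Bool × Str) fun n a =>
      (l n a).foldl (fun c x => _root_.strCase (false, ([] : Str)) (fun y t => (c.1 && (x == y), t)) c.2)
        (true, l' n a) :=
    EffD.foldl hl h (EffD.pair (EffD.bool true) hl')
      (f := fun _ _ x c => _root_.strCase (false, ([] : Str)) (fun y t => (c.1 && (x == y), t)) c.2)
      (EffD.strCase (EffD.snd (EffD.snd (EffD.snd EffD.id))) (EffD.pair (EffD.bool false) EffD.nil)
        (g := fun _ p y t => (p.2.2.1 && (p.2.1 == y), t))
        (EffD.pair (EffD.and (EffD.fst (EffD.snd (EffD.snd (EffD.fst EffD.id))))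
          (EffD.beqBool (EffD.fst (EffD.snd (EffD.fst EffD.id))) (EffD.fst (EffD.snd EffD.id))))
          (EffD.snd (EffD.snd EffD.id))))
  refine (EffD.and (EffD.fst h1) (EffD.isNil (EffD.snd h1))).congr fun n a => ?_
  have key : ∀ (l t : Str) (o : Bool), (let c := (l.foldl (fun c x => _root_.strCase (false, ([] : Str))
      (fun y t => (c.1 && (x == y), t)) c.2) (o, t)); c.1 && decide (c.2 = [])) =
        (o && decide (l = t)) := by
    intro l
    induction l with
    | nil =>
      intro t o
      cases t <;> simp
    | cons x l ih =>
      intro t o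
      simp only [List.foldl_cons]
      cases t with
      | nil => exact (ih [] false).trans (by simp)
      | cons y t =>
        refine (ih t (o && (x == y))).trans ?_
        cases o <;> cases x <;> cases y <;> simp
  simpa using key (l n a) (l' n a) true

theorem EffD.evens (hl : EffD adv (β := fun _ => Str) l) (h : ShortStr l) :
    EffD adv (β := fun _ => Str) fun n a => _root_.evens (l n a) := by
  have h1 : EffD adv (β := fun _ => Bool × Str) fun n a =>
      (l n a).foldl (fun c x => (!c.1, if c.1 then x :: c.2 else c.2)) (true, ([] : Str)) :=
    EffD.foldl hl h (EffD.pair (EffD.bool true) EffD.nil)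
      (f := fun _ _ x c => (!c.1, if c.1 then x :: c.2 else c.2))
      (EffD.pair (EffD.not (EffD.fst (EffD.snd (EffD.snd EffD.id))))
        (EffD.ite (EffD.fst (EffD.snd (EffD.snd EffD.id)))
          (EffD.cons (EffD.fst (EffD.snd EffD.id)) (EffD.snd (EffD.snd (EffD.snd EffD.id))))
          (EffD.snd (EffD.snd (EffD.snd EffD.id)))))
  refine ((EffD.snd h1).reverse (h.mono ?_)).congr fun n a => ?_
  · intro n a
    rw [evens_eq_foldl]
    simpa using evens_length_le _
  · beta_reduce
    rw [evens_eq_foldl]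
    simp

theorem EffD.val {p : ∀ n, β n → Prop} {f : ∀ n, α n → {b : β n // p n b}} (hf : EffD adv f) :
    EffD adv fun n a => (f n a).1 :=
  hf.retype (fun _ a => a) (fun _ _ => rfl) (fun _ => rfl) fun _ _ => rfl

theorem EffD.subtype {p : ∀ n, β n → Prop} {f : ∀ n, α n → β n} (hf : EffD adv f)
    (h : ∀ n a, p n (f n a)) :
    EffD adv (β := fun n => {b : β n // p n b}) fun n a => ⟨f n a, h n a⟩ :=
  hf.retype (fun _ a => a) (fun _ _ => rfl) (fun _ => rfl) fun _ _ => rfl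

theorem EffD.selectBits (hl : EffD adv (β := fun _ => Str) l) (h : ShortStr l)
    (hl' : EffD adv (β := fun _ => Str) l') (h' : ShortStr l') :
    EffD adv (β := fun _ => Str) fun n a => _root_.selectBits (l n a) (l' n a) := by
  obtain ⟨L, hL, hL'⟩ := h'
  have step : ∀ (n : ℕ) (x : Bool) (c : {s : Str // s.length ≤ L n}),
      (_root_.evens (if x then c.1.tail else c.1)).length ≤ L n := by
    intro n x c
    refine (evens_length_le _).trans (le_trans ?_ c.2)
    cases x <;> simp
  -- The loop state carries its length bound in its type, because the inner loop of `EffD.evens`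
  -- needs such a bound for every state.
  have h1 : EffD adv (β := fun n => {s : Str // s.length ≤ L n}) fun n a =>
      (l n a).foldl (fun c x => ⟨_root_.evens (if x then c.1.tail else c.1), step n x c⟩)
        ⟨l' n a, hL' n a⟩ :=
    EffD.foldl hl h (hl'.subtype hL')
      (f := fun n _ x c => ⟨_root_.evens (if x then c.1.tail else c.1), step n x c⟩)
      (EffD.subtype (EffD.evens (EffD.ite (EffD.fst (EffD.snd EffD.id))
        (EffD.tail (EffD.val (EffD.snd (EffD.snd EffD.id)))) (EffD.val (EffD.snd (EffD.snd EffD.id))))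
        ⟨L, hL, fun n p => by
          refine le_trans ?_ p.2.2.2
          dsimp only
          split_ifs <;> simp⟩) fun n p => step n p.2.1 p.2.2)
  refine (EffD.val h1).congr fun n a => ?_
  generalize hc : (⟨l' n a, hL' n a⟩ : {s : Str // s.length ≤ L n}) = c
  have hc' : l' n a = c.1 := by rw [← hc]
  rw [hc']
  clear hc hc'
  induction l n a generalizing c with
  | nil => rfl
  | cons x t ih =>
    rw [List.foldl_cons, ih]
    rfl

/-- The loop of `foldl_clog`, with the length bound of the number to be halved kept in the type;
`gen` below forgets this bound again. -/
theorem EffLen.clog {k : ℕ → ℕ} (h : EffLen adv k) : EffLen adv fun n => Nat.clog 2 (k n) := by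
  refine ⟨h.1.mono fun n => Nat.clog_le_of_le_pow (Nat.lt_two_pow_self).le, ?_⟩
  have h1 : EffD adv (α := fun _ => Unit) (β := fun n => {s : Str // s.length ≤ k n} × Str)
      fun n a => (unary (k n)).foldl (fun c _ => _root_.strCase c
        (fun _ _ => (⟨_root_.evens c.1.1, (evens_length_le _).trans c.1.2⟩, true :: c.2)) c.1.1.tail)
        (⟨unary (k n), by simp [unary]⟩, []) :=
    EffD.foldl h.eff h.short (EffD.pair (EffD.subtype h.eff fun n a => by simp [unary]) EffD.nil)
      (f := fun n _ _ c => _root_.strCase c (fun _ _ =>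
        (⟨_root_.evens c.1.1, (evens_length_le _).trans c.1.2⟩, true :: c.2)) c.1.1.tail)
      (EffD.strCase (EffD.tail (EffD.val (EffD.fst (EffD.snd (EffD.snd EffD.id)))))
        (EffD.snd (EffD.snd EffD.id))
        (g := fun n (p : Unit × Bool × {s : Str // s.length ≤ k n} × Str) _ _ => (⟨_root_.evens p.2.2.1.1, (evens_length_le _).trans p.2.2.1.2⟩,
          true :: p.2.2.2))
        (EffD.pair (EffD.subtype (EffD.evens
          (EffD.val (EffD.fst (EffD.snd (EffD.snd (EffD.fst EffD.id)))))
          ⟨k, h.1, fun n p => p.1.2.2.1.2⟩) fun n p => (evens_length_le _).trans p.1.2.2.1.2)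
          (EffD.push true (EffD.snd (EffD.snd (EffD.snd (EffD.fst EffD.id)))))))
  refine (EffD.snd h1).congr fun n a => ?_
  dsimp only
  have h2 := foldl_clog (unary (k n)) (k n) 0 (by simp [unary])
  rw [zero_add] at h2
  refine Eq.trans ?_ h2
  have gen : ∀ (t : Str) (c : {s : Str // s.length ≤ k n} × Str) (d : Str × Str),
      (c.1.1, c.2) = d → (t.foldl (fun c _ => _root_.strCase c (fun _ _ =>
        ((⟨_root_.evens c.1.1, (evens_length_le _).trans c.1.2⟩ : {s : Str // s.length ≤ k n}),
          true :: c.2)) c.1.1.tail) c).2 =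
      (t.foldl (fun c _ => _root_.strCase c (fun _ _ => (_root_.evens c.1, true :: c.2)) c.1.tail) d).2 := by
    intro t
    induction t with
    | nil =>
      rintro c _ rfl
      rfl
    | cons x t ih =>
      rintro c _ rfl
      rw [List.foldl_cons, List.foldl_cons]
      apply ih
      cases h : c.1.1.tail <;> simp [_root_.strCase]
  exact gen _ _ _ rfl

theorem EffLen.add {K L : ℕ → ℕ} (hK : EffLen adv K) (hL : EffLen adv L) :
    EffLen adv fun n => K n + L n :=
  ⟨hK.1.add hL.1, (EffD.append hK.2 hK.short hL.2).congr fun n a => by simp [unary]⟩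

theorem EffLen.mul {K L : ℕ → ℕ} (hK : EffLen adv K) (hL : EffLen adv L) :
    EffLen adv fun n => K n * L n := by
  refine ⟨hK.1.mul hL.1, (EffD.foldl hK.2 hK.short EffD.nil (f := fun n _ _ c => unary (L n) ++ c)
    (EffD.append hL.eff hL.short (EffD.snd (EffD.snd EffD.id)))).congr fun n a => ?_⟩
  dsimp only
  have : ∀ (k j : ℕ), (unary k).foldl (fun c _ => unary (L n) ++ c) (unary j) =
      unary (k * L n + j) := by
    intro k
    induction k with
    | zero => simp [unary]
    | succ k ih =>
      intro j
      have e : unary (L n) ++ unary j = unary (L n + j) := by simp [unary]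
      rw [show unary (k + 1) = true :: unary k from rfl, List.foldl_cons, e]
      refine (ih _).trans ?_
      congr 1
      ring
  exact this (K n) 0

theorem EffLen.const (c : ℕ) : EffLen adv fun _ => c := by
  refine ⟨PolyLe.const c, ?_⟩
  induction c with
  | zero => exact EffD.nil
  | succ c ih => exact EffD.push true ih

theorem EffLen.id : EffLen adv fun n => n := ⟨PolyLe.id, EffD.sec⟩

theorem EffLen.poly (p : Polynomial ℕ) : EffLen adv fun n => p.eval n := by
  induction p using Polynomial.induction_on' with
  | add p q hp hq => simpa using hp.add hq
  | monomial i a =>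
    have : EffLen adv fun n => n ^ i := by
      induction i with
      | zero => simpa using EffLen.const 1
      | succ i ih => simpa [pow_succ] using ih.mul EffLen.id
    simpa using (EffLen.const a).mul this

theorem EffLen.succ {L : ℕ → ℕ} (hL : EffLen adv L) : EffLen adv fun n => L n + 1 :=
  hL.add (EffLen.const 1)

/-! ## Efficient functions with bit strings of fixed length -/

theorem EffD.ofFn {L : ℕ → ℕ} {f : ∀ n, α n → Bits (L n)} (hf : EffD adv f) :
    EffD adv (β := fun _ => Str) fun n a => List.ofFn (f n a) :=
  hf.retype (fun _ a => a) (fun _ _ => rfl) (fun _ => rfl) fun _ _ => rfl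

theorem EffD.toBits {L : ℕ → ℕ} {f : ∀ n, α n → Bits (L n)} (hl : EffD adv (β := fun _ => Str) l)
    (h : ∀ n a, List.ofFn (f n a) = l n a) : EffD adv f :=
  hl.retype (fun _ a => a) (fun _ _ => rfl) (fun _ => rfl) fun n a => congrArg (fun x => [x]) (h n a)

theorem PolyLe.shortBits {L : ℕ → ℕ} (h : PolyLe L) (f : ∀ n, α n → Bits (L n)) :
    ShortStr fun n a => List.ofFn (f n a) := ⟨L, h, fun n a => by simp⟩

theorem EffD.eqBits {L : ℕ → ℕ} (hL : PolyLe L) {f g : ∀ n, α n → Bits (L n)} (hf : EffD adv f)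
    (hg : EffD adv g) : EffD adv (β := fun _ => Bool) fun n a => decide (f n a = g n a) :=
  (EffD.eqStr hf.ofFn (hL.shortBits f) hg.ofFn).congr fun n a => by
    simp only [decide_eq_decide]
    exact List.ofFn_injective.eq_iff

theorem Eff.unif {L : ℕ → ℕ} (hL : EffLen adv L) :
    Eff adv (β := fun n => Bits (L n)) fun n (_ : α n) => _root_.unif (L n) := by
  -- The length of the string of coins is recorded in its type, so that its reversal is a loop of
  -- bounded length.
  have h1 : Eff adv (α := α) (β := fun n => {s : Str // s.length = L n}) fun n _ => (_root_.unif (L n)).map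
      fun x => ⟨(List.ofFn x).reverse, by simp⟩ := by
    refine (Eff.foldlM hL.eff hL.short (EffD.nil (α := α))
      (f := fun _ _ _ c => _root_.coin >>= fun b => (pure (b :: c) : PMF Str))
      (Eff.bind Eff.coin (g := fun n (p : α n × Bool × Str) b => (pure (b :: p.2.2) : PMF Str))
        (EffD.cons (EffD.snd EffD.id) (EffD.snd (EffD.snd (EffD.fst EffD.id)))))).retype
      (fun _ a => a) (fun _ _ => rfl) (fun _ => rfl) fun n a => ?_
    rw [PMF.map_comp]
    refine Eq.trans ?_ (congrArg (PMF.map rep) (foldlM_coin (L n) []).symm)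
    rw [PMF.map_comp]
    congr 1
    funext x
    simp [rep]
  refine (Eff.comp (g := fun n (s : {s : Str // s.length = L n}) => (pure s.1.reverse : PMF Str))
    (EffD.reverse (EffD.val EffD.id) ⟨L, hL.1, fun n s => s.2.le⟩) h1).retype
      (fun _ a => a) (fun _ _ => rfl) (fun _ => rfl) fun n a => ?_
  have : ((_root_.unif (L n)).map (fun x => (⟨(List.ofFn x).reverse, by simp⟩ : {s : Str // s.length = L n}))
      >>= fun s => (pure s.1.reverse : PMF Str)) = (_root_.unif (L n)).map fun x => List.ofFn x := by
    refine (PMF.bind_map _ _ _).trans ?_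
    simp only [Function.comp_def, List.reverse_reverse]
    rfl
  rw [this, PMF.map_comp]
  rfl

theorem EffD.readBits {L : ℕ → ℕ} (hL : EffLen adv L) (hl : EffD adv (β := fun _ => Str) l) :
    EffD adv fun n a => _root_.readBits (L n) (l n a) :=
  EffD.toBits (EffD.ite (EffD.lengthEq hL.eff hL.short hl) hl (EffD.replicate false hL.eff hL.short))
    fun n a => by
      rw [ofFn_readBits]
      simp [unary]

theorem EffD.zeros {L : ℕ → ℕ} (hL : EffLen adv L) :
    EffD adv (α := α) (β := fun n => Bits (L n)) fun _ _ _ => false :=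
  EffD.toBits (EffD.replicate false hL.eff hL.short) fun n a => by
    rw [List.ofFn_const]
    simp [unary]

theorem EffD.readBool (hl : EffD adv (β := fun _ => Str) l) :
    EffD adv (β := fun _ => Bool) fun n a => _root_.readBool (l n a) :=
  (EffD.strCase hl (EffD.bool false) (g := fun _ _ b t => _root_.strCase b (fun _ _ => false) t)
    (EffD.strCase (EffD.snd (EffD.snd EffD.id)) (EffD.fst (EffD.snd EffD.id))
      (g := fun _ _ _ _ => false) (EffD.bool false))).congr fun n a => (readBool_eq _).symm

/-- The comparison `bitsVal < k` is a lookup in the string `1^k`: the selection is nonempty iff the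
position exists. The prefix `h2` bounds the loop when the string is too long. -/
theorem EffD.isIndex {k : ℕ → ℕ} (hk : EffLen adv k) (hl : EffD adv (β := fun _ => Str) l) :
    EffD adv (β := fun _ => Bool) fun n a =>
      decide ((l n a).length = Nat.clog 2 (k n) ∧ bitsVal (l n a) < k n) := by
  have h1 := EffD.lengthEq hk.clog.eff hk.clog.short hl
  have h2 := EffD.take hk.clog.eff hk.clog.short hl
  have h3 := EffD.selectBits h2 (hk.clog.short.mono fun n a => by simp)
    hk.eff hk.short
  refine (h1.and h3.isNil.not).congr fun n a => ?_
  rw [Bool.eq_iff_iff]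
  simp only [unary, List.length_replicate, Bool.and_eq_true, decide_eq_true_eq, Bool.not_eq_true',
    decide_eq_false_iff_not]
  refine and_congr_right fun h => ?_
  rw [List.take_of_length_le h.le, ← List.head?_eq_none_iff, List.head?_eq_getElem?, selectBits_getElem?]
  simp

theorem EffD.readFin {k : ℕ → ℕ} (hk : EffLen adv k) (h0 : ∀ n, 0 < k n)
    (hl : EffD adv (β := fun _ => Str) l) : EffD adv fun n a => _root_.readFin (h0 n) (l n a) :=
  (EffD.ite (EffD.isIndex hk hl) hl
    (EffD.replicate false hk.clog.eff hk.clog.short)).retype (fun _ a => a) (fun _ _ => rfl)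
    (fun _ => rfl) fun n a => by
      refine congrArg (fun x => [x]) ((ofFn_readFin (h0 n) (l n a)).trans ?_)
      simp [unary]

theorem EffD.indexBits {k : ℕ → ℕ} {i : ∀ n, α n → Fin (k n)} (hi : EffD adv i) :
    EffD adv (β := fun _ => Str) fun n a => List.ofFn (_root_.indexBits (i n a)) :=
  hi.retype (fun _ a => a) (fun _ _ => rfl) (fun _ => rfl) fun _ _ => rfl

theorem EffLen.shortIndex {k : ℕ → ℕ} (hk : EffLen adv k) (i : ∀ n, α n → Fin (k n)) :
    ShortStr fun n a => List.ofFn (_root_.indexBits (i n a)) :=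
  hk.clog.short.mono fun n a => by simp [unary]

theorem EffD.lookup {k : ℕ → ℕ} (hk : EffLen adv k) {m : ∀ n, α n → Bits (k n)}
    {i : ∀ n, α n → Fin (k n)} (hm : EffD adv m) (hi : EffD adv i) :
    EffD adv (β := fun _ => Bool) fun n a => m n a (i n a) :=
  (EffD.headD (EffD.selectBits hi.indexBits (hk.shortIndex i) hm.ofFn (hk.1.shortBits m))).congr
    fun n a => by rw [selectBits_indexBits]; rfl

theorem EffD.indexed {k : ℕ → ℕ} (hk : EffLen adv k) {i : ∀ n, α n → Fin (k n)}
    {b : ∀ n, α n → Bool} (hi : EffD adv i) (hb : EffD adv (β := fun _ => Bool) b) :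
    EffD adv fun n a => _root_.indexed (i n a) (b n a) :=
  EffD.toBits (EffD.append hi.indexBits (hk.shortIndex i) (EffD.cons hb EffD.nil)) fun n a => by
    rw [_root_.indexed, List.ofFn_succ']
    simp [List.concat_eq_append]

theorem EffD.appendBits {K L : ℕ → ℕ} (hK : PolyLe K) {f : ∀ n, α n → Bits (K n)}
    {g : ∀ n, α n → Bits (L n)} (hf : EffD adv f) (hg : EffD adv g) :
    EffD adv (β := fun n => Bits (K n + L n)) fun n a => Fin.append (f n a) (g n a) :=
  EffD.toBits (EffD.append hf.ofFn (hK.shortBits f) hg.ofFn) fun n a => List.ofFn_fin_append _ _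

theorem EffD.leftBits {K L : ℕ → ℕ} (hK : EffLen adv K) {f : ∀ n, α n → Bits (K n + L n)}
    (hf : EffD adv f) : EffD adv (β := fun n => Bits (K n)) fun n a j => f n a (Fin.castAdd (L n) j) :=
  EffD.toBits (EffD.take hK.eff hK.short hf.ofFn) fun n a => by
    conv_rhs => rw [← Fin.append_castAdd_natAdd (f := f n a), List.ofFn_fin_append]
    simp [unary]

theorem EffD.rightBits {K L : ℕ → ℕ} (hK : EffLen adv K) {f : ∀ n, α n → Bits (K n + L n)}
    (hf : EffD adv f) : EffD adv (β := fun n => Bits (L n)) fun n a j => f n a (Fin.natAdd (K n) j) :=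
  EffD.toBits (EffD.drop hK.eff hK.short hf.ofFn) fun n a => by
    conv_rhs => rw [← Fin.append_castAdd_natAdd (f := f n a), List.ofFn_fin_append]
    simp [unary]

/-- The string that encodes an optional bit string. -/
def optStr {L : ℕ} : Option (Bits L) → Str
  | none => []
  | some x => true :: List.ofFn x

theorem EffD.optStr {L : ℕ → ℕ} {o : ∀ n, α n → Option (Bits (L n))} (ho : EffD adv o) :
    EffD adv (β := fun _ => Str) fun n a => _root_.optStr (o n a) :=
  ho.retype (fun _ a => a) (fun _ _ => rfl) (fun _ => rfl) fun n a => by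
    cases o n a <;> rfl

theorem Eff.optCase {L : ℕ → ℕ} (hL : EffLen adv L) {o : ∀ n, α n → Option (Bits (L n))}
    (ho : EffD adv o) {f : ∀ n, α n → PMF (β n)} {g : ∀ n, α n → Bits (L n) → PMF (β n)}
    (hf : Eff adv f) (hg : Eff adv (α := fun n => α n × Bits (L n)) fun n p => g n p.1 p.2) :
    Eff adv fun n a => (o n a).elim (f n a) (g n a) :=
  (Eff.strCase ho.optStr hf (g := fun n a _ t => g n a (_root_.readBits (L n) t))
    (Eff.compD hg (EffD.pair (EffD.fst EffD.id)
      (EffD.readBits hL (EffD.snd (EffD.snd EffD.id)))))).congr fun n a => by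
      cases o n a <;> simp [_root_.optStr, _root_.strCase, readBits_ofFn]

/-- The length of the outputs of an efficient function is efficiently computable. -/
theorem EffLen.of_eff (hadv : PolyLe fun n => (adv n).length)
    (hα : ∃ L, PolyLe L ∧ ∀ n (a : α n), ∀ s ∈ rep a, s.length ≤ L n) {L : ℕ → ℕ}
    {f : ∀ n, α n → PMF (Bits (L n))} (hf : Eff adv f) {a : ∀ n, Unit → PMF (α n)}
    (ha : Eff adv (α := fun _ => Unit) a) : EffLen adv L := by
  have hL : PolyLe L := by
    obtain ⟨M, hM, hM'⟩ := hf.length_le hadv hα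
    refine hM.mono fun n => ?_
    obtain ⟨x, -⟩ := (a n ()).exists_mem_support
    obtain ⟨y, hy⟩ := (f n x).exists_mem_support
    simpa using hM' n x y hy (List.ofFn y) (by simp [rep])
  -- All samples have the same length, so a sample with its bits overwritten by ones is `1^(L n)`,
  -- whatever its randomness.
  refine ⟨hL, (Eff.comp (EffD.replicate true (EffD.ofFn EffD.id)
    (hL.shortBits fun n (x : Bits (L n)) => x)) (Eff.comp hf ha)).congr fun n u => ?_⟩
  simp only [List.length_ofFn]
  exact bind_const_pmf _ _

end

/-! ## Simulating an adversary

The registers of the simulated program are the registers `100, 101, …` of the simulating one, and its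
oracle queries are answered by a subroutine that has access to the registers below 100. -/

/-- The program `P` with its registers shifted by 100, where queries are replaced by programs. -/
def Prog.trans (h : List ℕ → List ℕ → Prog) : Prog → Prog
  | skip => skip
  | push b r => push b (100 + r)
  | pop r => pop (100 + r)
  | copy src dst => copy (100 + src) (100 + dst)
  | coin r => coin (100 + r)
  | hadamard q => hadamard (100 + q)
  | tgate q => tgate (100 + q)
  | cnot c t => cnot (100 + c) (100 + t)
  | measure q r => measure (100 + q) (100 + r)
  | reset => reset
  | query args res => h args res
  -- Subroutines work on fresh registers, so the registers below 100 are passed in and returned; the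
  -- state of the simulated oracle survives the call.
  | call P args res => call (P.trans h) (List.range 100 ++ args.map (100 + ·))
      (List.range 100 ++ res.map (100 + ·))
  | seq P Q => seq (P.trans h) (Q.trans h)
  | branch r P Q R => branch (100 + r) (P.trans h) (Q.trans h) (R.trans h)
  | loop r P => loop (100 + r) (P.trans h)

/-- The simulating machine `s` contains the registers and the qubits of the simulated machine `a`. -/
structure Simulates (s a : Mem) : Prop where
  regs : ∀ r, s.regs (100 + r) = a.regs r
  qubits : s.qubits = a.qubits

theorem idxOf_map_add (c r : ℕ) (l : List ℕ) :
    List.idxOf (c + r) (l.map (c + ·)) = List.idxOf r l := by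
  induction l with
  | nil => rfl
  | cons y l ih =>
    have : (c + y == c + r) = (y == r) := by
      rw [Bool.eq_iff_iff]
      simp
    simp only [List.map_cons, List.idxOf_cons, ih, this]

namespace Simulates

variable {s a : Mem}

theorem map_regs (h : Simulates s a) (rs : List ℕ) :
    (rs.map (100 + ·)).map s.regs = rs.map a.regs := by
  rw [List.map_map]
  exact List.map_congr_left fun r _ => h.regs r

theorem set (h : Simulates s a) (r : ℕ) (x : Str) :
    Simulates (s.tick.set (100 + r) x) (a.tick.set r x) := by
  refine ⟨fun r' => ?_, h.qubits⟩
  have := h.regs r'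
  by_cases e : r' = r
  · subst e
    simp [Mem.set, Mem.tick]
  · simpa [Mem.set, Mem.tick, e] using this

theorem store (h : Simulates s a) (res : List ℕ) (xs : List Str) {t : Mem}
    (ht : ∀ r, t.regs (100 + r) = (s.store (res.map (100 + ·)) xs).regs (100 + r))
    (hq : t.qubits = s.qubits) {b : Mem} (hb : b.regs = (a.store res xs).regs)
    (hbq : b.qubits = a.qubits) : Simulates t b := by
  refine ⟨fun r => ?_, hq.trans (h.qubits.trans hbq.symm)⟩
  rw [ht, hb]
  simp only [Mem.store, idxOf_map_add, List.mem_map, Nat.add_left_cancel_iff, exists_eq_right, h.regs]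

end Simulates

theorem idxOf_range_append {r m : ℕ} (h : r < m) (l : List ℕ) :
    List.idxOf r (List.range m ++ l) = r := by
  rw [List.idxOf_append_of_mem (by simpa using h)]
  have := (List.nodup_range (n := m)).idxOf_getElem r (by simpa using h)
  simpa using this

/-- The simulation theorem. The oracle `O'` of the simulated machine has the states `(x, st)`, where
`st` is the state of the real oracle `O`, and `x` is stored in the registers below 100. -/
theorem Prog.trans_couples {X σ : Type} {O : Oracle σ} {O' : Oracle (X × σ)}
    {h : List ℕ → List ℕ → Prog} {Gl : X → (ℕ → Str) → Prop}
    (hG : ∀ x g g', (∀ r < 100, g r = g' r) → Gl x g → Gl x g') {K : ℕ} (hK : 0 < K)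
    (hh : ∀ args res (s a : Mem) (x : X) (st : σ), Gl x s.regs → Simulates s a →
      Couples ((h args res).exec O (s, st)) (O' (x, st) (args.map a.regs)) fun t b =>
        Gl b.2.1 t.1.regs ∧ Simulates t.1 (a.tick.store res b.1) ∧ t.2 = b.2.2 ∧
          t.1.clock ≤ s.clock + K)
    (P : Prog) (s a : Mem) (x : X) (st : σ) (hx : Gl x s.regs) (hs : Simulates s a) :
    Couples ((P.trans h).exec O (s, st)) (P.exec O' (a, x, st)) fun t b =>
      Gl b.2.1 t.1.regs ∧ Simulates t.1 b.1 ∧ t.2 = b.2.2 ∧ a.clock ≤ b.1.clock ∧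
        t.1.clock + K * a.clock ≤ s.clock + K * b.1.clock := by
  -- The clock inequality says that each simulated step costs at most `K` real ones. It is written
  -- with sums, so that it can be chained without subtraction.
  induction P generalizing s a x st with
  | skip =>
    simp only [trans, exec]
    refine Couples.pure ⟨hx, ⟨hs.regs, hs.qubits⟩, rfl, ?_, ?_⟩ <;>
      simp only [Mem.tick, Nat.mul_add] <;> omega
  | push b r | pop r | copy r' r =>
    simp only [trans, exec]
    rw [hs.regs]
    refine Couples.pure ⟨hG _ _ _ (fun r' hr => ?_) hx, hs.set _ _, rfl, ?_, ?_⟩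
    · exact (Function.update_of_ne (by omega) _ _).symm
    all_goals (simp only [Mem.tick, Mem.set, Nat.mul_add]; omega)
  | coin r =>
    simp only [trans, exec]
    rw [hs.regs]
    refine (Couples.refl _).bind ?_
    rintro b _ rfl
    refine Couples.pure ⟨hG _ _ _ (fun r' hr => ?_) hx, hs.set _ _, rfl, ?_, ?_⟩
    · exact (Function.update_of_ne (by omega) _ _).symm
    all_goals (simp only [Mem.tick, Mem.set, Nat.mul_add]; omega)
  | measure q r =>
    simp only [trans, exec]
    rw [hs.regs, hs.regs, hs.qubits]
    refine (Couples.refl _).bind ?_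
    rintro b _ rfl
    refine Couples.pure ⟨hG _ _ _ (fun r' hr => ?_) hx, ⟨(hs.set _ _).regs, rfl⟩, rfl, ?_, ?_⟩
    · exact (Function.update_of_ne (by omega) _ _).symm
    all_goals (simp only [Mem.tick, Mem.set, Nat.mul_add]; omega)
  | hadamard q | tgate q | cnot c t | reset =>
    simp only [trans, exec, hs.regs, hs.qubits]
    refine Couples.pure ⟨hx, ⟨hs.regs, rfl⟩, rfl, ?_, ?_⟩ <;>
      simp only [Mem.tick, Nat.mul_add] <;> omega
  | query args res =>
    simp only [trans]
    have := (hh args res s a x st hx hs).bind (T := fun t b =>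
      Gl b.2.1 t.1.regs ∧ Simulates t.1 b.1 ∧ t.2 = b.2.2 ∧ a.clock ≤ b.1.clock ∧
        t.1.clock + K * a.clock ≤ s.clock + K * b.1.clock) (k := fun t => pure t)
      (l := fun b : List Str × X × σ => pure (a.tick.store res b.1, b.2)) (by
      rintro t b ⟨h1, h2, h3, h4⟩
      refine Couples.pure ⟨h1, h2, h3, ?_, ?_⟩ <;>
      simp only [Mem.tick, Mem.store, Nat.mul_add] <;> omega)
    rwa [bind_pure] at this
  | call P args res ih =>
    simp only [trans, exec]
    have hl : ∀ r < 100, (Mem.empty.load ((List.range 100 ++ args.map (100 + ·)).map s.regs)).regs r =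
        s.regs r := by
      intro r hr
      simp only [Mem.load, List.map_append, List.getD_eq_getElem?_getD]
      rw [List.getElem?_append_left (by simpa using hr)]
      simp [hr]
    have hl' : ∀ r, (Mem.empty.load ((List.range 100 ++ args.map (100 + ·)).map s.regs)).regs (100 + r) =
        (Mem.empty.load (args.map a.regs)).regs r := by
      intro r
      rw [List.map_append, hs.map_regs]
      have := Mem.load_append_regs Mem.empty ((List.range 100).map s.regs) (args.map a.regs) r
      rw [List.length_map, List.length_range] at this
      rw [this]
      rfl
    refine (ih { s.tick with regs := _ } { a.tick with regs := _ } x st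
      (hG _ _ _ (fun r hr => (hl r hr).symm) hx) ⟨hl', hs.qubits⟩).bind ?_
    rintro t b ⟨h1, h2, h3, h4, h5⟩
    refine Couples.pure ⟨hG _ _ _ ?_ h1, ⟨fun r => ?_, h2.qubits⟩, h3, ?_, ?_⟩
    · intro r hr
      simp only [Mem.store, idxOf_range_append hr, List.mem_append, List.mem_range, hr, true_or, if_true,
        Mem.out, List.getD_eq_getElem?_getD, List.getElem?_map, List.length_append, List.length_range]
      rw [List.getElem?_range (by omega)]
      simp
    · have e : List.idxOf (100 + r) (List.range 100 ++ res.map (100 + ·)) = 100 + List.idxOf r res := by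
        rw [List.idxOf_append_of_notMem (by simp), List.length_range, idxOf_map_add]
      simp only [Mem.store, e, List.mem_append, List.mem_range, List.mem_map, Nat.add_left_cancel_iff,
        exists_eq_right, hs.regs, not_lt.2 (Nat.le_add_right 100 r), false_or]
      split_ifs with hr
      · have hr' := List.idxOf_lt_length_of_mem hr
        simp only [Mem.out, List.getD_eq_getElem?_getD, List.getElem?_map, List.length_append,
          List.length_range, List.length_map]
        rw [List.getElem?_range (by omega), List.getElem?_range hr']
        simp [h2.regs]
      · rfl
    all_goals (simp only [Mem.tick, Nat.mul_add] at h4 h5 ⊢; omega)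
  | seq P Q ihP ihQ =>
    simp only [trans, exec]
    refine (ihP s a x st hx hs).bind ?_
    rintro ⟨t, st'⟩ ⟨b, x', _⟩ ⟨h1, h2, rfl, h4, h5⟩
    refine (ihQ t b x' st' h1 h2).mono ?_
    rintro u c ⟨h6, h7, h8, h9, h10⟩
    simp only at h4 h5
    exact ⟨h6, h7, h8, by omega, by omega⟩
  | branch r P Q R ihP ihQ ihR =>
    simp only [trans, exec, hs.regs]
    have key : ∀ P : Prog, (∀ (s a : Mem) (x : X) (st : σ), Gl x s.regs → Simulates s a →
      Couples ((P.trans h).exec O (s, st)) (P.exec O' (a, x, st)) fun t b =>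
      Gl b.2.1 t.1.regs ∧ Simulates t.1 b.1 ∧ t.2 = b.2.2 ∧ a.clock ≤ b.1.clock ∧
        t.1.clock + K * a.clock ≤ s.clock + K * b.1.clock) →
      Couples ((P.trans h).exec O (s.tick, st)) (P.exec O' (a.tick, x, st)) fun t b =>
      Gl b.2.1 t.1.regs ∧ Simulates t.1 b.1 ∧ t.2 = b.2.2 ∧ a.clock ≤ b.1.clock ∧
        t.1.clock + K * a.clock ≤ s.clock + K * b.1.clock := by
      intro P ih
      refine (ih s.tick a.tick x st hx ⟨hs.regs, hs.qubits⟩).mono ?_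
      rintro u c ⟨h6, h7, h8, h9, h10⟩
      simp only [Mem.tick, Nat.mul_add] at h9 h10
      exact ⟨h6, h7, h8, by omega, by omega⟩
    split
    · exact key P ihP
    · exact key Q ihQ
    · exact key R ihR
  | loop r P ih =>
    simp only [trans, exec, hs.regs]
    refine iterPMF_rel ?_ _ ⟨hx, ⟨hs.regs, hs.qubits⟩, rfl, ?_, ?_⟩
    · rintro ⟨t, st'⟩ ⟨b, x', _⟩ ⟨h1, h2, rfl, h4, h5⟩
      refine (ih t.tick b.tick x' st' h1 ⟨h2.regs, h2.qubits⟩).mono ?_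
      rintro u c ⟨h6, h7, h8, h9, h10⟩
      simp only [Mem.tick, Nat.mul_add] at h4 h5 h9 h10
      exact ⟨h6, h7, h8, by omega, by omega⟩
    all_goals (simp only [Mem.tick, Nat.mul_add]; omega)

/-! ## Comparing runs with related oracles -/

/-- `Prog.exec_compare` with the relation `R st₁ st₂ → x ≤ y`, which is the comparison of test
functions behind `Couples`. -/
theorem Prog.exec_couples {σ₁ σ₂ : Type} {O₁ : Oracle σ₁} {O₂ : Oracle σ₂} {R : σ₁ → σ₂ → Prop}
    (hO : ∀ st₁ st₂ q, R st₁ st₂ → Couples (O₁ st₁ q) (O₂ st₂ q) fun a b => a.1 = b.1 ∧ R a.2 b.2)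
    (P : Prog) (s : Mem) {st₁ : σ₁} {st₂ : σ₂} (h : R st₁ st₂) :
    Couples (P.exec O₁ (s, st₁)) (P.exec O₂ (s, st₂)) fun t u => t.1 = u.1 ∧ R t.2 u.2 := by
  intro f g hfg
  refine Prog.exec_compare O₁ O₂ (fun _ st₁ st₂ x y => R st₁ st₂ → x ≤ y) ?_ ?_ ?_ P f g ?_ s st₁ st₂ h
  · exact fun h => h
  · exact fun p x y h hR => expect_mono fun b => h b hR
  · intro t st₁ st₂ q x y h hR
    refine hO st₁ st₂ q hR _ _ ?_
    rintro ⟨a, st⟩ ⟨_, st'⟩ ⟨rfl, hst⟩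
    exact h a st st' hst
  · exact fun s st₁ st₂ hR => hfg _ _ ⟨rfl, hR⟩

/-- Everything that happens with the first oracle is possible with the second one. -/
theorem Prog.exec_support {σ₁ σ₂ : Type} {O₁ : Oracle σ₁} {O₂ : Oracle σ₂} {st₂ : σ₂}
    (hO : ∀ st₁ q, ∀ a ∈ (O₁ st₁ q).support, (a.1, st₂) ∈ (O₂ st₂ q).support)
    (P : Prog) (s : Mem) (st₁ : σ₁) {t : Mem × σ₁} (ht : t ∈ (P.exec O₁ (s, st₁)).support) :
    (t.1, st₂) ∈ (P.exec O₂ (s, st₂)).support := by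
  classical
  -- The expectation of an indicator is nonzero iff the state is reachable, so the statement about
  -- supports is again a comparison of two numbers.
  have key := Prog.exec_compare O₁ O₂ (fun _ _ st x y => st = st₂ → x ≠ 0 → y ≠ 0) ?_ ?_ ?_ P
    (fun u => if u = t then 1 else 0) (fun u => if u = (t.1, st₂) then 1 else 0) ?_ s st₁ st₂ rfl
  · rw [expect_single, expect_single] at key
    exact key ht
  · exact fun h => h
  · intro _ _ st p x y h e hx hy
    rw [expect_eq_zero_iff] at hy
    rw [Ne, expect_eq_zero_iff] at hx
    push Not at hx
    obtain ⟨b, hb, hb'⟩ := hx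
    exact h b e hb' (hy b hb)
  · intro _ st st' q x y h e hx hy
    subst e
    rw [expect_eq_zero_iff] at hy
    rw [Ne, expect_eq_zero_iff] at hx
    push Not at hx
    obtain ⟨a, ha, ha'⟩ := hx
    exact h a.1 a.2 st' rfl ha' (hy _ (hO st q a ha))
  · intro u st st' e hu
    subst e
    have : (u, st) = t := by
      by_contra h
      simp [h] at hu
    simp [← this]

/-- Once the clock is beyond that of `t`, the probability to end in `t` is 0, and this is preserved
backwards through all instructions. -/
theorem Prog.exec_clock {σ : Type} {O : Oracle σ} (P : Prog) (s : Mem × σ) {t : Mem × σ}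
    (ht : t ∈ (P.exec O s).support) : s.1.clock ≤ t.1.clock := by
  classical
  by_contra hlt
  have key := Prog.exec_compare O O (fun c _ _ x _ => t.1.clock < c → x = 0) ?_ ?_ ?_ P
    (fun u => if u = t then 1 else 0) (fun u => if u = t then 1 else 0) ?_ s.1 s.2 s.2 (by omega)
  · rw [expect_single] at key
    exact ht key
  · exact fun h hc => h (by omega)
  · intro _ _ _ p x y h hc
    rw [expect_eq_zero_iff]
    exact fun b _ => h b hc
  · intro _ _ st' q x y h hc
    rw [expect_eq_zero_iff]
    exact fun a _ => h a.1 a.2 st' (by omega)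
  · intro u st st' hu
    have : (u, st) ≠ t := by
      rintro rfl
      exact lt_irrefl _ hu
    simp [this]

/-! ## Efficient functions that use an oracle -/

/-- A randomized function that uses an oracle for functions from `X` to `Y`; the state of the oracle
is passed along. -/
abbrev Kernel (X Y α β : ℕ → Type) :=
  ∀ n (σ : Type), (σ → X n → PMF (Y n × σ)) → α n × σ → PMF (β n × σ)

section Kernels

variable {adv : ℕ → Str} {X Y α β γ δ : ℕ → Type} [∀ n, BitRep (X n)] [∀ n, BitRep (Y n)]
  [∀ n, BitRep (α n)] [∀ n, BitRep (β n)] [∀ n, BitRep (γ n)] [∀ n, BitRep (δ n)]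
  [Arity X] [Arity Y] [Arity α] [Arity β] [Arity γ] [Arity δ]

/-- Kernels that are computable in polynomial time. -/
def EffO (adv : ℕ → Str) (k : Kernel X Y α β) : Prop :=
  ∃ (P : Prog) (p : Polynomial ℕ), ∀ n (σ : Type) (F : σ → X n → PMF (Y n × σ)) (a : α n) (s : Mem)
    (st : σ), s.regs = (Mem.empty.load ([unary n, adv n] ++ rep a)).regs →
    Couples (P.exec (oracle F) (s, st)) (k n σ F (a, st)) fun t b =>
      t.1.regs = (Mem.empty.load (rep b.1)).regs ∧ t.1.qubits = s.qubits ∧ t.2 = b.2 ∧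
        t.1.clock ≤ s.clock + p.eval n

theorem Prog.clear_exec {σ : Type} (O : Oracle σ) (s : Mem × σ) (rs : List ℕ) :
    (call skip [] rs).exec O s = pure ({ s.1.store rs [] with clock := s.1.clock + 2 }, s.2) := by
  simp only [exec, LawfulMonad.pure_bind]
  congr 2
  simp only [Mem.tick, Mem.mk.injEq, and_true]
  refine ⟨?_, rfl⟩
  funext r
  simp only [Mem.store]
  split_ifs with h
  · have := List.idxOf_lt_length_of_mem h
    simp [Mem.out, this, Mem.load, Mem.empty]
  · rfl

theorem store_out_load (s : Mem) (res : List ℕ) (xs : List Str) :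
    s.store res ((Mem.empty.load xs).out 0 res.length) = s.store res xs := by
  simp only [Mem.store, Mem.mk.injEq, and_true]
  funext r
  split_ifs with h
  · have := List.idxOf_lt_length_of_mem h
    simp [Mem.out, this, Mem.load, Mem.empty]
  · rfl

/-- The effect of calling an efficient kernel. -/
theorem call_couples_of_effO {k : Kernel X Y α β} {P : Prog} {p : Polynomial ℕ}
    (hp : ∀ n (σ : Type) (F : σ → X n → PMF (Y n × σ)) (a : α n) (s : Mem) (st : σ),
      s.regs = (Mem.empty.load ([unary n, adv n] ++ rep a)).regs →
      Couples (P.exec (oracle F) (s, st)) (k n σ F (a, st)) fun t b =>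
        t.1.regs = (Mem.empty.load (rep b.1)).regs ∧ t.1.qubits = s.qubits ∧ t.2 = b.2 ∧
          t.1.clock ≤ s.clock + p.eval n)
    {n : ℕ} {σ : Type} {F : σ → X n → PMF (Y n × σ)} {a : α n} {s : Mem} {st : σ}
    {args res : List ℕ} (hargs : args.map s.regs = [unary n, adv n] ++ rep a) :
    Couples ((Prog.call P args res).exec (oracle F) (s, st)) (k n σ F (a, st)) fun t b =>
      t.1.regs = (s.store res (rep b.1)).regs ∧ t.1.qubits = s.qubits ∧ t.2 = b.2 ∧
        t.1.clock ≤ s.clock + 1 + p.eval n := by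
  simp only [Prog.exec]
  have := (hp n σ F a { s.tick with regs := (Mem.empty.load (args.map s.regs)).regs } st
    (by simp only [hargs])).bind (T := fun t b => t.1.regs = (s.store res (rep b.1)).regs ∧
      t.1.qubits = s.qubits ∧ t.2 = b.2 ∧ t.1.clock ≤ s.clock + 1 + p.eval n)
    (k := fun t => pure ({ t.1 with regs := (s.store res (t.1.out 0 res.length)).regs }, t.2))
    (l := fun b => pure b) (by
      rintro t b ⟨h1, h2, h3, h4⟩
      refine Couples.pure ⟨?_, h2, h3, h4⟩
      have : t.1.out 0 res.length = (Mem.empty.load (rep b.1)).out 0 res.length := by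
        simp only [Mem.out, h1]
      simp only [this, store_out_load])
  rwa [bind_pure] at this

/-- It suffices that the output registers are right. -/
theorem EffO.of_out {k : Kernel X Y α β} (P : Prog) (p : Polynomial ℕ)
    (hp : ∀ n (σ : Type) (F : σ → X n → PMF (Y n × σ)) (a : α n) (s : Mem) (st : σ),
      s.regs = (Mem.empty.load ([unary n, adv n] ++ rep a)).regs →
      Couples (P.exec (oracle F) (s, st)) (k n σ F (a, st)) fun t b =>
        t.1.out 0 (Arity.ar β) = rep b.1 ∧ t.1.qubits = s.qubits ∧ t.2 = b.2 ∧
          t.1.clock ≤ s.clock + p.eval n) : EffO adv k := by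
  -- `EffO` requires that nothing but the output is left. Only the first `2 + ar α` registers are
  -- occupied at the start, so after the output is written it suffices to clear that many registers
  -- behind it.
  refine ⟨.seq (.call P (List.range' 0 (2 + Arity.ar α)) (List.range' 0 (Arity.ar β)))
    (.call .skip [] (List.range' (Arity.ar β) (2 + Arity.ar α))), p + 3, fun n σ F a s st hs => ?_⟩
  rw [Prog.exec_seq, ← bind_pure (k n σ F (a, st))]
  have hargs : (List.range' 0 (2 + Arity.ar α)).map s.regs = [unary n, adv n] ++ rep a := by
    rw [map_regs_congr hs, load_input]
  have h1 : Couples ((Prog.call P (List.range' 0 (2 + Arity.ar α)) (List.range' 0 (Arity.ar β))).exec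
      (oracle F) (s, st)) (k n σ F (a, st)) fun t b =>
      t.1.regs = (s.store (List.range' 0 (Arity.ar β)) (rep b.1)).regs ∧ t.1.qubits = s.qubits ∧
        t.2 = b.2 ∧ t.1.clock ≤ s.clock + 1 + p.eval n := by
    simp only [Prog.exec]
    rw [← bind_pure (k n σ F (a, st))]
    refine (hp n σ F a { s.tick with regs := (Mem.empty.load _).regs } st
      (by simp only [hargs])).bind ?_
    rintro t b ⟨h1, h2, h3, h4⟩
    refine Couples.pure ⟨?_, h2, h3, h4⟩
    rw [List.length_range', h1]
  refine h1.bind ?_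
  rintro t b ⟨h1, h2, h3, h4⟩
  rw [Prog.clear_exec]
  refine Couples.pure ⟨?_, h2, h3, ?_⟩
  · funext r
    simp only [Mem.store, h1, hs, Mem.load, List.mem_range'_1, zero_le, true_and, zero_add]
    have hb := length_rep_eq b.1
    have ha := length_rep_eq a
    have hc : Mem.empty.regs r = [] := rfl
    by_cases h5 : r < Arity.ar β
    · rw [if_neg (by omega), if_pos h5]
      have : List.idxOf r (List.range' 0 (Arity.ar β)) = r := by
        rw [← List.range_eq_range']
        simpa using idxOf_range_append h5 []
      rw [this, hc]
    · rw [if_neg h5, List.getD_eq_default (rep b.1) _ (by omega), hc]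
      split_ifs with h6
      · rfl
      · rw [List.getD_eq_default]
        simp only [List.length_append, ha, List.length_cons, List.length_nil]
        omega
  · simp only [Polynomial.eval_add, Polynomial.eval_ofNat]
    omega

theorem EffO.of_eff {f : ∀ n, α n → PMF (β n)} (hf : Eff adv f) :
    EffO adv (X := X) (Y := Y) fun n _ _ z => f n z.1 >>= fun b => pure (b, z.2) := by
  obtain ⟨P, hP, p, hp⟩ := hf
  refine EffO.of_out (.call P (List.range' 0 (2 + Arity.ar α)) (List.range' 0 (Arity.ar β))) (p + 1)
    fun n σ F a s st hs => ?_
  refine (call_couples_of_eff (s := (s, st)) hP hp (a := a) ?_ (by simp)).map_right ?_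
  · rw [map_regs_congr hs, load_input]
  · rintro t b ⟨h1, h2, h3, -, h4⟩
    refine ⟨?_, h2, h3, ?_⟩
    · rw [Mem.out_eq_map, map_regs_congr h1, Mem.map_store _ List.nodup_range'
        (by simp [length_rep_eq])]
    · simp only [Polynomial.eval_add, Polynomial.eval_one]
      simp only at h4
      omega

/-- At most one query. -/
theorem EffO.ask {pre : ∀ n, α n → PMF (γ n × X n)} {c : ∀ n, γ n → Bool}
    {post : ∀ n, γ n → Y n → PMF (β n)} {other : ∀ n, γ n → PMF (β n)}
    (hpre : Eff adv (β := fun n => γ n × X n) pre) (hc : EffD adv c)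
    (hpost : Eff adv (α := fun n => γ n × Y n) fun n p => post n p.1 p.2) (hother : Eff adv other) :
    EffO adv (X := X) (Y := Y) fun n _ F z => pre n z.1 >>= fun r =>
      if c n r.1 then F z.2 r.2 >>= fun y => post n r.1 y.1 >>= fun b => pure (b, y.2)
      else other n r.1 >>= fun b => pure (b, z.2) := by
  obtain ⟨P, hP, p, hp⟩ := hpre
  obtain ⟨C, hC, q, hq⟩ := hc
  obtain ⟨Q, hQ, q', hq'⟩ := hpost
  obtain ⟨R, hR, r, hr⟩ := hother
  -- From register `b` on, the query and later its answer are stored behind the kept value; register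
  -- `e` holds the bit that decides whether to ask.
  let b := 2 + Arity.ar γ
  let e := b + Arity.ar X
  refine EffO.of_out (.seq (.call P (List.range' 0 (2 + Arity.ar α)) (List.range' 2 (Arity.ar γ + Arity.ar X)))
    (.seq (.call C (List.range' 0 b) [e]) (.branch e .skip
      (.call R (List.range' 0 b) (List.range' 0 (Arity.ar β)))
      (.seq (.query (List.range' b (Arity.ar X)) (List.range' b (Arity.ar Y)))
        (.call Q (List.range' 0 (b + Arity.ar Y)) (List.range' 0 (Arity.ar β)))))))
    (p + q + q' + r + 5) fun n σ F a s st hs => ?_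
  have h0 : (List.range' 0 (2 + Arity.ar α)).map s.regs = [unary n, adv n] ++ rep a := by
    rw [map_regs_congr hs, load_input]
  have h01 : [0, 1].map s.regs = [unary n, adv n] := by
    rw [map_regs_congr hs, map_load_base]
  have split2 : ∀ m, List.range' 0 (2 + m) = [0, 1] ++ List.range' 2 m := fun m =>
    (List.range'_append_1 (s := 0) (m := 2) (n := m)).symm
  have splitb : List.range' 2 (Arity.ar γ + Arity.ar X) =
      List.range' 2 (Arity.ar γ) ++ List.range' b (Arity.ar X) :=
    (List.range'_append_1 (s := 2)).symm
  have splitc : List.range' 0 (b + Arity.ar Y) = List.range' 0 b ++ List.range' b (Arity.ar Y) := by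
    have := List.range'_append_1 (s := 0) (m := b) (n := Arity.ar Y)
    rw [zero_add] at this
    exact this.symm
  have splitd : List.range' 0 b = [0, 1] ++ List.range' 2 (Arity.ar γ) := split2 _
  rw [Prog.exec_seq]
  refine (call_couples_of_eff (s := (s, st)) (β := fun n => γ n × X n) hP hp h0
    (by simp; rfl)).bind ?_
  rintro ⟨t, st'⟩ ⟨g, x⟩ ⟨h1, h2, h3, -, h4⟩
  simp only at h1 h2 h3 h4
  subst h3
  have ht : (List.range' 2 (Arity.ar γ + Arity.ar X)).map t.regs = rep g ++ rep x := by
    rw [map_regs_congr h1]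
    exact Mem.map_store _ List.nodup_range' (by simp [rep_prod, length_rep_eq])
  rw [splitb, List.map_append] at ht
  obtain ⟨htg, htx⟩ := List.append_inj ht (by simp [length_rep_eq])
  have ht0 : [0, 1].map t.regs = [unary n, adv n] := by
    rw [map_regs_congr h1, Mem.map_store_of_disjoint _ _ (by simp), h01]
  have htb : (List.range' 0 b).map t.regs = [unary n, adv n] ++ rep g := by
    rw [splitd, List.map_append, ht0, htg]
  rw [Prog.exec_seq, ← LawfulMonad.pure_bind (c n g) fun v =>
    if v then F st' x >>= fun y => post n g y.1 >>= fun b => (pure (b, y.2) : PMF (β n × σ))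
      else other n g >>= fun b => pure (b, st')]
  refine (call_couples_of_eff (s := (t, st')) hC hq htb rfl).bind ?_
  rintro ⟨u, st''⟩ v ⟨h5, h6, h7, -, h8⟩
  simp only at h5 h6 h7 h8
  subst h7
  have hu : u.regs e = [v] := by
    have : List.map u.regs [e] = [[v]] := by
      rw [map_regs_congr h5, Mem.map_store _ (List.nodup_singleton _) rfl]
      rfl
    simpa using this
  have hub : (List.range' 0 b).map u.regs = [unary n, adv n] ++ rep g := by
    rw [map_regs_congr h5, Mem.map_store_of_disjoint _ _ (by simp [e]; omega), htb]
  have hux : (List.range' b (Arity.ar X)).map u.regs = rep x := by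
    rw [map_regs_congr h5, Mem.map_store_of_disjoint _ _ (by simp [e]; omega), htx]
  cases v
  · rw [Prog.exec_branch_false _ (s := (u, st'')) hu, if_neg (by simp)]
    refine (call_couples_of_eff (s := (u.tick, st'')) hR hr (a := g) hub (by simp)).map_right ?_
    rintro t' b' ⟨h9, h10, h11, -, h12⟩
    refine ⟨?_, ?_, h11, ?_⟩
    · rw [Mem.out_eq_map, map_regs_congr h9, Mem.map_store _ List.nodup_range'
        (by simp [length_rep_eq])]
    · rw [h10, ← h2, ← h6]
      rfl
    · simp only [Polynomial.eval_add, Polynomial.eval_ofNat]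
      simp only [Mem.tick] at h12
      omega
  · rw [Prog.exec_branch_true _ (s := (u, st'')) hu, if_pos rfl, Prog.exec_seq]
    have hO : (oracle F) st'' (rep x) = (F st'' x).map fun r => (rep r.1, r.2) := by
      simp only [oracle, parse_rep]
    simp only [Prog.exec]
    rw [show List.map u.tick.regs (List.range' b (Arity.ar X)) = rep x from hux, hO]
    rw [bind_assoc]
    have e1 : ∀ K : List Str × σ → PMF (Mem × σ), (((F st'' x).map fun r => (rep r.1, r.2)) >>= K) =
        F st'' x >>= fun r => K (rep r.1, r.2) := fun K => PMF.bind_map _ _ _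
    rw [e1]
    refine (Couples.refl _).bind ?_
    rintro ⟨y, st₂⟩ _ rfl
    rw [LawfulMonad.pure_bind]
    have hv : (List.range' 0 (b + Arity.ar Y)).map
        (u.tick.tick.store (List.range' b (Arity.ar Y)) (rep y)).regs =
        [unary n, adv n] ++ rep (g, y) := by
      rw [splitc, List.map_append, Mem.map_store_of_disjoint _ _ (by simp; omega),
        Mem.map_store _ List.nodup_range' (by simp [length_rep_eq]), rep_prod, ← List.append_assoc]
      congr 1
    refine (call_couples_of_eff (α := fun n => γ n × Y n) (s := (u.tick.tick.store
      (List.range' b (Arity.ar Y)) (rep y), st₂)) hQ hq' (a := (g, y)) hv (by simp)).map_right ?_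
    rintro t' b' ⟨h9, h10, h11, -, h12⟩
    refine ⟨?_, ?_, h11, ?_⟩
    · rw [Mem.out_eq_map, map_regs_congr h9, Mem.map_store _ List.nodup_range'
        (by simp [length_rep_eq])]
    · rw [h10, ← h2, ← h6]
      rfl
    · simp only [Polynomial.eval_add, Polynomial.eval_ofNat]
      simp only [Mem.tick, Mem.store] at h12
      omega

end Kernels

/-! ## Typed steps of an adversary that simulates another one

The registers 0 and 1 contain `1^n` and the advice, the registers from 16 on a typed state, and the
registers from 100 on belong to the simulated machine. -/

theorem Mem.store_append (s : Mem) {rs rs' : List ℕ} {xs ys : List Str} (h : rs.length = xs.length)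
    (r : ℕ) : (s.store (rs ++ rs') (xs ++ ys)).regs r =
      if r ∈ rs then xs.getD (rs.idxOf r) [] else (s.store rs' ys).regs r := by
  simp only [store, List.mem_append]
  by_cases hr : r ∈ rs
  · have := List.idxOf_lt_length_of_mem hr
    rw [if_pos (Or.inl hr), if_pos hr, List.idxOf_append_of_mem hr]
    simp only [List.getD_eq_getElem?_getD]
    rw [List.getElem?_append_left (by omega)]
  · simp only [hr, false_or, if_false]
    split_ifs
    · rw [List.idxOf_append_of_notMem hr]
      simp only [List.getD_eq_getElem?_getD]
      rw [List.getElem?_append_right (by omega), h, Nat.add_sub_cancel_left]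
    · rfl

section Typed

variable {adv : ℕ → Str} {X Y S S' S'' V U Q Z : ℕ → Type} [∀ n, BitRep (X n)] [∀ n, BitRep (Y n)]
  [∀ n, BitRep (S n)] [∀ n, BitRep (S' n)] [∀ n, BitRep (S'' n)] [∀ n, BitRep (V n)]
  [∀ n, BitRep (U n)] [∀ n, BitRep (Q n)] [∀ n, BitRep (Z n)]
  [Arity X] [Arity Y] [Arity S] [Arity S'] [Arity S''] [Arity V] [Arity U] [Arity Q] [Arity Z]

/-- The global registers contain the typed state `x`. -/
structure Globals (adv : ℕ → Str) {n : ℕ} (x : S n) (g : ℕ → Str) : Prop where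
  sec : g 0 = unary n
  advice : g 1 = adv n
  state : (List.range' 16 (Arity.ar S)).map g = rep x

theorem Globals.congr {n : ℕ} {x : S n} {g g' : ℕ → Str} (har : 16 + Arity.ar S ≤ 100)
    (h : ∀ r < 100, g r = g' r) (hg : Globals adv x g) : Globals adv x g' := by
  refine ⟨(h 0 (by norm_num)).symm.trans hg.sec, (h 1 (by norm_num)).symm.trans hg.advice, ?_⟩
  rw [← hg.state]
  refine List.map_congr_left fun r hr => (h r ?_).symm
  simp only [List.mem_range'_1] at hr
  omega

/-- Steps with state spaces `S` and `S'`, that may also involve the simulated machine. -/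
abbrev SKernel (X Y S S' : ℕ → Type) :=
  ∀ n (σ : Type), (σ → X n → PMF (Y n × σ)) → S n × Mem × σ → PMF (S' n × Mem × σ)

/-- A program that performs a step in polynomial time, if the simulated machine is in `Pre`; and it is
in `Post` afterwards. -/
def Realized (adv : ℕ → Str) (Pre Post : ℕ → Set Mem) (K : SKernel X Y S S') : Prop :=
  ∃ (P : Prog) (p : Polynomial ℕ), ∀ n (σ : Type) (F : σ → X n → PMF (Y n × σ)) (x : S n) (a s : Mem)
    (st : σ), Globals adv x s.regs → Simulates s a → a ∈ Pre n →
    Couples (P.exec (oracle F) (s, st)) (K n σ F (x, a, st)) fun t b =>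
      Globals adv b.1 t.1.regs ∧ Simulates t.1 b.2.1 ∧ t.2 = b.2.2 ∧ b.2.1 ∈ Post n ∧
        t.1.clock ≤ s.clock + p.eval n

namespace Realized

variable {Pre Mid Post : ℕ → Set Mem}

theorem congr {K L : SKernel X Y S S'} (h : Realized adv Pre Post K)
    (hKL : ∀ n σ F z, K n σ F z = L n σ F z) : Realized adv Pre Post L := by
  have : K = L := by
    funext n σ F z
    exact hKL n σ F z
  rwa [← this]

theorem seq {K : SKernel X Y S S'} {L : SKernel X Y S' S''} (hK : Realized adv Pre Mid K)
    (hL : Realized adv Mid Post L) :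
    Realized adv Pre Post fun n σ F z => K n σ F z >>= L n σ F := by
  obtain ⟨P, p, hp⟩ := hK
  obtain ⟨Q, q, hq⟩ := hL
  refine ⟨.seq P Q, p + q, fun n σ F x a s st hx hs ha => ?_⟩
  rw [Prog.exec_seq]
  refine (hp n σ F x a s st hx hs ha).bind ?_
  rintro ⟨t, st'⟩ ⟨y, b, _⟩ ⟨h1, h2, rfl, h3, h4⟩
  refine (hq n σ F y b t st' h1 h2 h3).mono ?_
  rintro u c ⟨h5, h6, h7, h8, h9⟩
  refine ⟨h5, h6, h7, h8, ?_⟩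
  simp only [Polynomial.eval_add] at h4 ⊢
  omega

theorem kernel {k : Kernel X Y S S'} (hk : EffO adv k) (har : 16 + Arity.ar S' ≤ 100) :
    Realized adv Pre Pre fun n σ F z => k n σ F (z.1, z.2.2) >>= fun b => pure (b.1, z.2.1, b.2) := by
  obtain ⟨P, p, hp⟩ := hk
  refine ⟨.call P ([0, 1] ++ List.range' 16 (Arity.ar S)) (List.range' 16 (Arity.ar S')), p + 1,
    fun n σ F x a s st hx hs ha => ?_⟩
  refine (call_couples_of_effO hp (a := x) ?_).map_right ?_
  · rw [List.map_append, hx.state]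
    simp [hx.sec, hx.advice]
  · rintro t ⟨y, st'⟩ ⟨h1, h2, h3, h4⟩
    have h5 : ∀ r, r < 16 ∨ 100 ≤ r → t.1.regs r = s.regs r := by
      intro r hr
      rw [h1]
      simp only [Mem.store, List.mem_range'_1]
      rw [if_neg (by omega)]
    refine ⟨⟨(h5 0 (by norm_num)).trans hx.sec, (h5 1 (by norm_num)).trans hx.advice, ?_⟩,
      ⟨fun r => (h5 _ (by omega)).trans (hs.regs r), h2.trans hs.qubits⟩, h3, ha, ?_⟩
    · rw [map_regs_congr h1, Mem.map_store _ List.nodup_range' (by simp [length_rep_eq])]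
    · simp only [Polynomial.eval_add, Polynomial.eval_one]
      omega

/-- A calculation without queries. -/
theorem eff {f : ∀ n, S n → PMF (S' n)} (hf : Eff adv f) (har : 16 + Arity.ar S' ≤ 100) :
    Realized adv (X := X) (Y := Y) Pre Pre fun n _ _ z => f n z.1 >>= fun y => pure (y, z.2) :=
  (kernel (EffO.of_eff hf) har).congr fun n σ F z => by
    simp only [bind_assoc, LawfulMonad.pure_bind]

/-- Reading a register of the simulated machine. -/
theorem read (r : ℕ) (har : 16 + Arity.ar S + 1 ≤ 100) :
    Realized adv (X := X) (Y := Y) (S := S) (S' := fun n => S n × Str) Pre Pre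
      fun n _ _ z => pure ((z.1, z.2.1.regs r), z.2) := by
  refine ⟨.copy (100 + r) (16 + Arity.ar S), 1, fun n σ F x a s st hx hs ha => ?_⟩
  simp only [Prog.exec]
  rw [hs.regs]
  refine Couples.pure ⟨⟨?_, ?_, ?_⟩, ⟨fun r' => ?_, hs.qubits⟩, rfl, ha, ?_⟩
  · exact (Function.update_of_ne (by omega) _ _).trans hx.sec
  · exact (Function.update_of_ne (by omega) _ _).trans hx.advice
  · have e : List.range' 16 (Arity.ar fun n => S n × Str) =
        List.range' 16 (Arity.ar S) ++ [16 + Arity.ar S] :=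
      (List.range'_append_1 (s := 16) (m := Arity.ar S) (n := 1)).symm
    rw [e, List.map_append, Mem.map_set_of_notMem _ (by simp), rep_prod]
    congr 1
    · exact hx.state
    · simp [Mem.set, rep]
  · exact (Function.update_of_ne (by omega) _ _).trans (hs.regs r')
  · simp [Mem.tick, Mem.set]

/-- Playing a round of the simulated adversary. -/
theorem run (A : Adversary) (j : ℕ) {h : List ℕ → List ℕ → Prog}
    {O' : ∀ n (σ : Type), (σ → X n → PMF (Y n × σ)) → Oracle (S n × σ)} (p : Polynomial ℕ)
    (hh : ∀ n (σ : Type) (F : σ → X n → PMF (Y n × σ)) (args res : List ℕ) (s a : Mem) (x : S n)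
      (st : σ), Globals adv x s.regs → Simulates s a →
      Couples ((h args res).exec (oracle F) (s, st)) (O' n σ F (x, st) (args.map a.regs)) fun t b =>
        Globals adv b.2.1 t.1.regs ∧ Simulates t.1 (a.tick.store res b.1) ∧ t.2 = b.2.2 ∧
          t.1.clock ≤ s.clock + p.eval n)
    (hadv : EffD adv (α := fun _ => Unit) (β := fun _ => Str) fun n _ => A.advice n)
    (har : 16 + Arity.ar S + Arity.ar V ≤ 100)
    (hpost : ∀ n (σ : Type) (F : σ → X n → PMF (Y n × σ)), ∀ a ∈ Pre n, ∀ (v : V n) (x : S n) (st : σ),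
      ∀ t ∈ (A.run n j (O' n σ F) (rep v) (a, x, st)).support, t.1 ∈ Post n)
    {T : ℕ → ℕ} (hT : PolyLe T) (hT' : ∀ n, ∀ a ∈ Post n, a.clock ≤ T n) :
    Realized adv (S := fun n => S n × V n) Pre Post fun n σ F z =>
      A.run n j (O' n σ F) (rep z.1.2) (z.2.1, z.1.1, z.2.2) >>= fun t => pure (t.2.1, t.1, t.2.2) := by
  obtain ⟨R, hR, r, hr⟩ := hadv
  obtain ⟨q, hq⟩ := hT
  -- Register 15 is scratch space for the advice of the simulated adversary, which may differ from
  -- the advice at hand. Its input is then assembled in the registers from 100 on.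
  refine ⟨.seq (.call R [0, 1] [15]) (.seq (.move ([0, 15] ++ List.range' (16 + Arity.ar S) (Arity.ar V))
    (List.range' 100 (2 + Arity.ar V))) ((A.prog j).trans h)), r + 3 + (p + 1) * q,
    fun n σ F x a s st hx hs ha => ?_⟩
  obtain ⟨x, v⟩ := x
  simp only
  have e : List.range' 16 (Arity.ar fun n => S n × V n) =
      List.range' 16 (Arity.ar S) ++ List.range' (16 + Arity.ar S) (Arity.ar V) :=
    (List.range'_append_1 (s := 16) (m := Arity.ar S) (n := Arity.ar V)).symm
  have hx' := hx.state
  rw [e, List.map_append, rep_prod] at hx'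
  obtain ⟨hx1, hx2⟩ := List.append_inj hx' (by simp [length_rep_eq])
  rw [Prog.exec_seq, ← LawfulMonad.pure_bind (A.advice n) fun _ =>
    A.run n j (O' n σ F) (rep v) (a, x, st) >>= fun t => (pure (t.2.1, t.1, t.2.2) : PMF (S n × Mem × σ))]
  refine (call_couples_of_eff (s := (s, st)) (a := ()) hR hr (by simp [hx.sec, hx.advice, rep]) rfl).support.bind ?_
  rintro ⟨t, st'⟩ y ⟨⟨h1, h2, h3, -, h4⟩, -, hy⟩
  simp only at h1 h2 h3 h4
  subst h3
  rw [mem_support_pure] at hy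
  subst hy
  have h5 : ∀ r', r' ≠ 15 → t.regs r' = s.regs r' := by
    intro r' hr'
    rw [h1]
    simp [Mem.store, hr']
  have h6 : t.regs 15 = A.advice n := by
    rw [h1]
    simp [Mem.store, rep]
  have h7 : ([0, 15] ++ List.range' (16 + Arity.ar S) (Arity.ar V)).map t.regs =
      unary n :: A.advice n :: rep v := by
    rw [List.map_append, ← hx2]
    simp only [List.map_cons, List.map_nil, h6, h5 0 (by norm_num), hx.sec, List.cons_append,
      List.nil_append]
    congr 2
    refine List.map_congr_left fun r' hr' => h5 r' ?_
    simp only [List.mem_range'_1] at hr'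
    omega
  rw [Prog.exec_seq, Prog.move_exec _ _ (by simp; omega), LawfulMonad.pure_bind, h7]
  simp only
  rw [Adversary.run]
  refine (Prog.trans_couples (O' := O' n σ F) (Gl := fun x g => Globals adv x g)
    (fun x g g' hg hx => hx.congr (by omega) hg) (K := p.eval n + 1) (Nat.succ_pos _)
    (fun args res s a x st hx hs => (hh n σ F args res s a x st hx hs).mono ?_) (A.prog j) _
    (a.load (unary n :: A.advice n :: rep v)) x st' ?_ ?_).support.map_right ?_
  · rintro t b ⟨h1, h2, h3, h4⟩
    exact ⟨h1, h2, h3, by omega⟩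
  · have h8 : ∀ r < 100, (t.store (List.range' 100 (2 + Arity.ar V))
        (unary n :: A.advice n :: rep v)).regs r = t.regs r := by
      intro r hr
      simp only [Mem.store, List.mem_range'_1]
      rw [if_neg (by omega)]
    refine ⟨?_, ?_, ?_⟩
    · exact (h8 0 (by norm_num)).trans ((h5 0 (by norm_num)).trans hx.sec)
    · exact (h8 1 (by norm_num)).trans ((h5 1 (by norm_num)).trans hx.advice)
    · rw [← hx1]
      refine List.map_congr_left fun r' hr' => ?_
      simp only [List.mem_range'_1] at hr'
      exact (h8 r' (by omega)).trans (h5 r' (by omega))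
  · refine ⟨fun r' => ?_, h2.trans hs.qubits⟩
    simp only [Mem.store, Mem.load, List.mem_range'_1]
    have hl : (unary n :: A.advice n :: rep v).length = 2 + Arity.ar V := by
      simp [length_rep_eq]
      omega
    by_cases hr' : r' < 2 + Arity.ar V
    · have e2 : List.range' 100 (2 + Arity.ar V) = (List.range (2 + Arity.ar V)).map (100 + ·) :=
        List.range'_eq_map_range
      rw [if_pos (by omega), e2, idxOf_map_add]
      have := idxOf_range_append hr' []
      rw [List.append_nil] at this
      rw [this]
      simp only [List.getD_eq_getElem?_getD]
      rw [List.getElem?_eq_getElem (by omega)]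
      rfl
    · rw [if_neg (by omega), List.getD_eq_default _ _ (by omega), h5 _ (by omega), hs.regs]
  · rintro u ⟨b, x', st₂⟩ ⟨⟨h8, h9, h10, h11, h12⟩, -, h13⟩
    -- Only reachable states of the simulated machine count: `Post` bounds its clock, hence the
    -- number of simulated steps.
    have hb : b ∈ Post n := hpost n σ F a ha v x st' _ h13
    refine ⟨h8, h9, h10, hb, ?_⟩
    have h14 := (hT' n b hb).trans (hq n)
    have h15 := Nat.mul_le_mul_left (p.eval n + 1) h14
    simp only [Polynomial.eval_add, Polynomial.eval_mul, Polynomial.eval_one,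
      Polynomial.eval_ofNat] at h12 ⊢
    omega

/-- A round without oracle. -/
theorem runSilent (A : Adversary) (j : ℕ)
    (hadv : EffD adv (α := fun _ => Unit) (β := fun _ => Str) fun n _ => A.advice n)
    (har : 16 + Arity.ar S + Arity.ar V ≤ 100)
    (hpost : ∀ n, ∀ a ∈ Pre n, ∀ (v : V n),
      ∀ t ∈ (A.run n j noOracle (rep v) (a, ())).support, t.1 ∈ Post n)
    {T : ℕ → ℕ} (hT : PolyLe T) (hT' : ∀ n, ∀ a ∈ Post n, a.clock ≤ T n) :
    Realized adv (X := X) (Y := Y) (S := fun n => S n × V n) Pre Post fun n _ _ z =>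
      A.run n j noOracle (rep z.1.2) (z.2.1, ()) >>= fun t => pure (z.1.1, t.1, z.2.2) := by
  have key : ∀ n (σ : Type) (x : S n) (st : σ) (v : V n) (a : Mem),
      Couples (A.run n j (fun w _ => (pure ([], w) : PMF (List Str × S n × σ))) (rep v) (a, x, st))
        (A.run n j noOracle (rep v) (a, ())) fun t u => t.1 = u.1 ∧ t.2 = (x, st) :=
    fun n σ x st v a => Prog.exec_couples (R := fun w _ => w = (x, st)) (by
      rintro w _ q rfl
      exact Couples.pure ⟨rfl, rfl⟩) _ _ rfl
  -- Queries of a round without oracle are answered by nothing: the handler just clears the result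
  -- registers.
  refine (run (X := X) (Y := Y) A j (h := fun _ res => .call .skip [] (res.map (100 + ·)))
    (O' := fun n σ F w _ => pure ([], w)) (p := 2) ?_ hadv har ?_ hT hT').congr ?_
  · intro n σ F args res s a x st hx hs
    rw [Prog.clear_exec]
    refine Couples.pure ⟨hx.congr (by omega) fun r hr => ?_, ?_, rfl, ?_⟩
    · simp only [Mem.store, List.mem_map]
      rw [if_neg]
      rintro ⟨r', -, h⟩
      omega
    · apply hs.store res []
      exacts [fun _ => rfl, rfl, rfl, rfl]
    · simp
  · rintro n σ - a ha v x st t ht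
    obtain ⟨u, hu, h, -⟩ := (key n σ x st v a).exists_right ht
    rw [h]
    exact hpost n a ha v u hu
  · rintro n σ - ⟨⟨x, v⟩, a, st⟩
    refine (key n σ x st v a).bind_eq ?_
    rintro ⟨t, w⟩ ⟨u, -⟩ ⟨rfl, rfl⟩
    rfl

end Realized

/-- The oracle with states in `S n × σ` that is given by a kernel. -/
noncomputable def handle (k : Kernel X Y (fun n => S n × Q n) fun n => S n × Z n) (n : ℕ) (σ : Type)
    (F : σ → X n → PMF (Y n × σ)) : S n × σ → Q n → PMF (Z n × S n × σ) :=
  fun w q => (k n σ F ((w.1, q), w.2)).map fun r => (r.1.2, (r.1.1, r.2))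

/-- The queries of the simulated adversary are answered by an efficient kernel that acts on the
typed state. The handler first tests whether the query, a pair of strings, is well-formed; otherwise
it clears the result registers, as a typed oracle would. -/
theorem Realized.runOracle {Pre Post : ℕ → Set Mem} (A : Adversary) (j : ℕ)
    {k : Kernel X Y (fun n => S n × Q n) fun n => S n × Z n} (hk : EffO adv k)
    (hQ : Arity.ar Q = 2)
    (hQ' : EffD adv (α := fun _ => Str × Str) (β := fun _ => Bool) fun n q =>
      open Classical in decide ([q.1, q.2] ∈ msgs (Q n)))
    (hadv : EffD adv (α := fun _ => Unit) (β := fun _ => Str) fun n _ => A.advice n)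
    (har : 16 + Arity.ar S + Arity.ar V ≤ 100)
    (hpost : ∀ n (σ : Type) (G : σ → Q n → PMF (Z n × σ)), ∀ a ∈ Pre n, ∀ (v : V n) (st : σ),
      ∀ t ∈ (A.run n j (oracle G) (rep v) (a, st)).support, t.1 ∈ Post n)
    {T : ℕ → ℕ} (hT : PolyLe T) (hT' : ∀ n, ∀ a ∈ Post n, a.clock ≤ T n) :
    Realized adv (X := X) (Y := Y) (S := fun n => S n × V n) Pre Post fun n σ F z =>
      A.run n j (oracle (handle k n σ F)) (rep z.1.2) (z.2.1, z.1.1, z.2.2) >>= fun t =>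
        pure (t.2.1, t.1, t.2.2) := by
  obtain ⟨P, p, hp⟩ := hk
  obtain ⟨R, hR, r, hr⟩ := hQ'
  refine Realized.run (X := X) (Y := Y) A j (h := fun args res => if args.length = 2 then
      .seq (.call R ([0, 1] ++ args.map (100 + ·)) [15]) (.branch 15 .skip
        (.call .skip [] (res.map (100 + ·)))
        (.call P ([0, 1] ++ (List.range' 16 (Arity.ar S) ++ args.map (100 + ·)))
          (List.range' 16 (Arity.ar S) ++ res.map (100 + ·))))
    else .call .skip [] (res.map (100 + ·)))
    (O' := fun n σ F => oracle (handle k n σ F)) (p := p + r + 6) ?_ hadv har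
    (fun n σ F a ha v x st t ht => hpost n _ _ a ha v _ t ht) hT hT'
  intro n σ F args res s a x st hx hs
  have clear : ∀ (s' : Mem) (st' : σ), (∀ i, i ≠ 15 → s'.regs i = s.regs i) → s'.qubits = s.qubits →
      s'.clock ≤ s.clock + 2 + r.eval n →
      Couples ((Prog.call .skip [] (res.map (100 + ·))).exec (oracle F) (s', st')) (pure ([], x, st'))
        fun t b => Globals adv b.2.1 t.1.regs ∧ Simulates t.1 (a.tick.store res b.1) ∧ t.2 = b.2.2 ∧
          t.1.clock ≤ s.clock + (p + r + 6).eval n := by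
    intro s' st' h1 h2 h3
    rw [Prog.clear_exec]
    refine Couples.pure ⟨?_, ?_, rfl, ?_⟩
    · refine ⟨?_, ?_, ?_⟩
      · simp only [Mem.store, List.mem_map]
        rw [if_neg (by rintro ⟨r', -, h⟩; omega), h1 _ (by norm_num), hx.sec]
      · simp only [Mem.store, List.mem_map]
        rw [if_neg (by rintro ⟨r', -, h⟩; omega), h1 _ (by norm_num), hx.advice]
      · rw [← hx.state]
        refine List.map_congr_left fun i hi => ?_
        simp only [List.mem_range'_1] at hi
        simp only [Mem.store, List.mem_map]
        rw [if_neg (by rintro ⟨r', -, h⟩; omega), h1 _ (by omega)]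
    · apply hs.store res []
      · intro i
        simp only [Mem.store, h1 _ (show 100 + i ≠ 15 by omega)]
      · exact h2
      · rfl
      · rfl
    · simp only [Polynomial.eval_add, Polynomial.eval_ofNat]
      omega
  have hO : args.map a.regs ∉ msgs (Q n) →
      oracle (handle k n σ F) (x, st) (args.map a.regs) = pure ([], x, st) := by
    intro h
    simp only [oracle, parse_eq_none h]
  split_ifs with hlen
  · obtain ⟨i, j, rfl⟩ := List.length_eq_two.1 hlen
    have h0 : ([0, 1] ++ [i, j].map (100 + ·)).map s.regs = [unary n, adv n] ++ rep (a.regs i, a.regs j) := by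
      simp [hx.sec, hx.advice, hs.regs, rep]
    rw [Prog.exec_seq, ← LawfulMonad.pure_bind (open Classical in
      decide ([a.regs i, a.regs j] ∈ msgs (Q n))) fun _ : Bool =>
      oracle (handle k n σ F) (x, st) ([i, j].map a.regs)]
    refine (call_couples_of_eff (s := (s, st)) hR hr h0 rfl).support.bind ?_
    rintro ⟨t, st'⟩ v ⟨⟨h1, h2, h3, -, h4⟩, -, hv⟩
    simp only at h1 h2 h3 h4
    subst h3
    rw [mem_support_pure] at hv
    have h5 : ∀ i, i ≠ 15 → t.regs i = s.regs i := by
      intro r' hr'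
      rw [h1]
      simp [Mem.store, hr']
    have h6 : t.regs 15 = [v] := by
      rw [h1]
      simp [Mem.store, rep]
    have h7 : (List.range' 16 (Arity.ar S)).map t.regs = rep x := by
      rw [← hx.state]
      refine List.map_congr_left fun i hi => h5 i ?_
      simp only [List.mem_range'_1] at hi
      omega
    cases v
    · rw [Prog.exec_branch_false _ (s := (t, st')) h6, hO (by simpa using hv.symm)]
      exact clear t.tick st' h5 h2 (by simp only [Mem.tick]; omega)
    · rw [Prog.exec_branch_true _ (s := (t, st')) h6]
      have hm : [a.regs i, a.regs j] ∈ msgs (Q n) := by simpa using hv.symm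
      obtain ⟨q, hq⟩ := hm
      have hO' : oracle (handle k n σ F) (x, st') ([i, j].map a.regs) =
          (k n σ F ((x, q), st')).map fun r => (rep r.1.2, (r.1.1, r.2)) := by
        have : [i, j].map a.regs = rep q := hq.symm
        simp only [oracle, this, parse_rep, handle, PMF.map_comp]
        rfl
      rw [hO']
      refine (call_couples_of_effO (s := t.tick) hp (a := (x, q)) ?_).map_right ?_
      · show List.map t.regs _ = _
        rw [List.map_append, List.map_append, h7, rep_prod, hq]
        have h13 : ∀ i, t.regs (100 + i) = a.regs i := fun i => (h5 _ (by omega)).trans (hs.regs i)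
        simp [h5, hx.sec, hx.advice, h13]
      · rintro u ⟨⟨x', z⟩, st₂⟩ ⟨h8, h9, h10, h11⟩
        have hl : (List.range' 16 (Arity.ar S)).length = (rep x').length := by simp [length_rep_eq]
        simp only [rep_prod] at h8
        have h12 : ∀ r', r' < 16 → r' ≠ 15 → u.1.regs r' = s.regs r' := by
          intro r' hr' hr''
          rw [h8, Mem.store_append _ hl, if_neg (by simp; omega)]
          simp only [Mem.store, List.mem_map]
          rw [if_neg (by rintro ⟨i, -, h⟩; omega)]
          exact h5 r' hr''
        refine ⟨⟨(h12 0 (by norm_num) (by norm_num)).trans hx.sec,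
          (h12 1 (by norm_num) (by norm_num)).trans hx.advice, ?_⟩,
          ?_, h10, ?_⟩
        · rw [← Mem.map_store t.tick (List.nodup_range' (s := 16) (n := Arity.ar S)) hl]
          refine List.map_congr_left fun i hi => ?_
          rw [h8, Mem.store_append _ hl, if_pos hi]
          simp only [Mem.store, hi, if_true]
        · refine hs.store res (rep z) (fun i => ?_) (h9.trans h2) rfl rfl
          rw [h8, Mem.store_append _ hl, if_neg (by simp; omega)]
          simp only [Mem.store]
          split_ifs
          · rfl
          · exact h5 _ (by omega)
        · simp only [Mem.tick, Polynomial.eval_add, Polynomial.eval_ofNat] at h11 ⊢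
          omega
  · rw [hO]
    · exact clear s st (fun _ _ => rfl) rfl (by omega)
    · rintro ⟨q, hq⟩
      have := congrArg List.length hq
      rw [length_rep_eq, hQ, List.length_map] at this
      exact hlen this.symm

end Typed

/-! ## Rounds of an adversary that simulates another one -/

section Rounds

variable {adv : ℕ → Str} {X Y S S' S'' V U Q Z : ℕ → Type} [∀ n, BitRep (X n)] [∀ n, BitRep (Y n)]
  [∀ n, BitRep (S n)] [∀ n, BitRep (S' n)] [∀ n, BitRep (S'' n)] [∀ n, BitRep (V n)]
  [∀ n, BitRep (U n)] [∀ n, BitRep (Q n)] [∀ n, BitRep (Z n)]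
  [Arity X] [Arity Y] [Arity S] [Arity S'] [Arity S''] [Arity V] [Arity U] [Arity Q] [Arity Z]
  {Pre Post : ℕ → Set Mem}

/-- A run of a complete adversary as a subroutine, before the simulated machine has started. -/
theorem Realized.sub {K : SKernel X Y S S'} (hK : Realized adv (fun _ => {Mem.empty}) Post K)
    (har : 16 + Arity.ar S ≤ 100) (har' : 16 + Arity.ar S' ≤ 100) :
    Realized adv (fun _ => {Mem.empty}) (fun _ => {Mem.empty}) fun n σ F z =>
      K n σ F (z.1, Mem.empty, z.2.2) >>= fun b => pure (b.1, z.2.1, b.2.2) := by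
  obtain ⟨P, p, hp⟩ := hK
  -- The call is given no register from 100 on, so the inner machine starts empty. The quantum
  -- memory is shared with the caller: it has to be in its initial state before the call, and the
  -- final `reset` restores that state.
  refine ⟨.seq (.call P (List.range' 0 (16 + Arity.ar S)) (List.range' 0 (16 + Arity.ar S'))) .reset,
    p + 2, fun n σ F x a s st hx hs ha => ?_⟩
  rw [Set.mem_singleton_iff] at ha
  subst ha
  have hr : ∀ r, ((List.range' 0 (16 + Arity.ar S)).map s.regs).getD r [] =
      if r < 16 + Arity.ar S then s.regs r else [] := by
    intro r
    rw [List.getD_eq_getElem?_getD, List.getElem?_map]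
    split_ifs with h
    · rw [List.getElem?_range' (by omega)]
      simp
    · rw [List.getElem?_eq_none (by simpa using h)]
      rfl
  rw [Prog.exec_seq]
  simp only [Prog.exec, bind_assoc]
  refine (hp n σ F x Mem.empty _ st ⟨?_, ?_, ?_⟩ ⟨?_, ?_⟩ rfl).bind ?_
  · exact (hr 0).trans ((if_pos (by omega)).trans hx.sec)
  · exact (hr 1).trans ((if_pos (by omega)).trans hx.advice)
  · rw [← hx.state]
    refine List.map_congr_left fun i hi => ?_
    simp only [List.mem_range'_1] at hi
    exact (hr i).trans (if_pos (by omega))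
  · exact fun r => (hr _).trans (if_neg (by omega))
  · exact hs.qubits
  · rintro ⟨t, st'⟩ ⟨y, b, _⟩ ⟨h1, h2, rfl, -, h4⟩
    rw [LawfulMonad.pure_bind]
    have ht : ∀ r, (s.store (List.range' 0 (16 + Arity.ar S'))
        (t.out 0 (List.range' 0 (16 + Arity.ar S')).length)).regs r =
        if r < 16 + Arity.ar S' then t.regs r else s.regs r := by
      intro r
      simp only [Mem.store, List.mem_range'_1, zero_le, true_and, zero_add]
      split_ifs with h
      · have := idxOf_range_append h []
        rw [List.append_nil, List.range_eq_range'] at this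
        rw [this]
        simp only [Mem.out, List.getD_eq_getElem?_getD, List.getElem?_map, List.length_range']
        rw [List.getElem?_range h]
        simp
      · rfl
    refine Couples.pure ⟨⟨?_, ?_, ?_⟩, ⟨?_, rfl⟩, rfl, rfl, ?_⟩
    · exact (ht 0).trans ((if_pos (by omega)).trans h1.sec)
    · exact (ht 1).trans ((if_pos (by omega)).trans h1.advice)
    · rw [← h1.state]
      refine List.map_congr_left fun i hi => ?_
      simp only [List.mem_range'_1] at hi
      exact (ht i).trans (if_pos (by omega))
    · exact fun r => (ht _).trans ((if_neg (by omega)).trans (hs.regs r))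
    · simp only [Mem.tick, Polynomial.eval_add, Polynomial.eval_ofNat] at h4 ⊢
      omega

/-- The memory contains the typed state `x` and the simulated machine `a`. -/
structure Holds {n : ℕ} (x : S n) (a s : Mem) : Prop extends Simulates s a where
  state : (List.range' 16 (Arity.ar S)).map s.regs = rep x

theorem Holds.empty (n : ℕ) : Holds (S := fun _ => Unit) (n := n) () Mem.empty Mem.empty :=
  ⟨⟨fun _ => rfl, rfl⟩, rfl⟩

/-- A program for a round with incoming message in `V` and outgoing message in `U`. -/
def RealizesRound (adv : ℕ → Str) (Pre Post : ℕ → Set Mem) (P : Prog)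
    (K : SKernel X Y (fun n => S n × V n) fun n => S' n × U n) : Prop :=
  ∃ p : Polynomial ℕ, ∀ n (σ : Type) (F : σ → X n → PMF (Y n × σ)) (x : S n) (v : V n) (a s : Mem)
    (st : σ), Holds x a s → a ∈ Pre n →
    Couples (P.exec (oracle F) (s.load (unary n :: adv n :: rep v), st)) (K n σ F ((x, v), a, st))
      fun t b => Holds b.1.1 b.2.1 t.1 ∧ t.1.out 0 (Arity.ar U) = rep b.1.2 ∧ t.2 = b.2.2 ∧
        b.2.1 ∈ Post n ∧ t.1.clock ≤ s.clock + p.eval n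

/-- The incoming message in the registers from 2 on is moved behind the typed state, and the
outgoing one from there to the registers from 0 on. Both fit below register 16, where the state
begins, so they do not disturb it. -/
theorem Realized.round {K : SKernel X Y (fun n => S n × V n) fun n => S' n × U n}
    (hK : Realized adv Pre Post K) (hV : 2 + Arity.ar V ≤ 16) (hU : Arity.ar U ≤ 16)
    (hS : 16 + Arity.ar S + Arity.ar V ≤ 100) : ∃ P, RealizesRound adv Pre Post P K := by
  obtain ⟨P, p, hp⟩ := hK
  refine ⟨.seq (.move (List.range' 2 (Arity.ar V)) (List.range' (16 + Arity.ar S) (Arity.ar V)))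
    (.seq P (.move (List.range' (16 + Arity.ar S') (Arity.ar U)) (List.range' 0 (Arity.ar U)))),
    p + 4, fun n σ F x v a s st hx ha => ?_⟩
  rw [Prog.exec_seq, Prog.move_exec _ _ (by simp), LawfulMonad.pure_bind, Prog.exec_seq]
  have hl : (unary n :: adv n :: rep v).length = 2 + Arity.ar V := by
    simp [length_rep_eq]
    omega
  have h1 : (List.range' 2 (Arity.ar V)).map (s.load (unary n :: adv n :: rep v)).regs = rep v := by
    have := Mem.map_load_range' s (unary n :: adv n :: rep v)
    rw [hl, ← List.range'_append_1 (s := 0) (m := 2)] at this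
    rw [List.map_append] at this
    exact (List.append_inj this rfl).2
  have h2 : ∀ r, 16 ≤ r → (s.load (unary n :: adv n :: rep v)).regs r = s.regs r := by
    intro r hr
    exact List.getD_eq_default _ _ (by omega)
  have e : ∀ (S V : ℕ → Type) [∀ n, BitRep (S n)] [∀ n, BitRep (V n)] [Arity S] [Arity V],
      List.range' 16 (Arity.ar fun n => S n × V n) =
      List.range' 16 (Arity.ar S) ++ List.range' (16 + Arity.ar S) (Arity.ar V) := fun S V _ _ _ _ =>
    (List.range'_append_1 (s := 16) (m := Arity.ar S) (n := Arity.ar V)).symm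
  rw [h1, ← bind_pure (K n σ F ((x, v), a, st))]
  have h3 : ∀ r, r < 16 + Arity.ar S ∨ 100 ≤ r → ((s.load (unary n :: adv n :: rep v)).store
      (List.range' (16 + Arity.ar S) (Arity.ar V)) (rep v)).regs r =
      (s.load (unary n :: adv n :: rep v)).regs r := by
    intro r hr
    simp only [Mem.store, List.mem_range'_1]
    rw [if_neg (by omega)]
  refine (hp n σ F (x, v) a _ st ⟨?_, ?_, ?_⟩ ⟨?_, ?_⟩ ha).bind ?_
  · exact h3 0 (by omega)
  · exact h3 1 (by omega)
  · rw [e, List.map_append, rep_prod]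
    congr 1
    · rw [← hx.state]
      refine List.map_congr_left fun i hi => ?_
      simp only [List.mem_range'_1] at hi
      exact (h3 i (by omega)).trans (h2 i (by omega))
    · exact Mem.map_store _ List.nodup_range' (by simp [length_rep_eq])
  · exact fun r => (h3 _ (by omega)).trans ((h2 _ (by omega)).trans (hx.regs r))
  · exact hx.qubits
  · rintro ⟨t, st'⟩ ⟨⟨y, u⟩, b, _⟩ ⟨h4, h5, rfl, h6, h7⟩
    have h8 := h4.state
    rw [e, List.map_append, rep_prod] at h8
    obtain ⟨h8, h9⟩ := List.append_inj h8 (by simp [length_rep_eq])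
    rw [Prog.move_exec _ _ (by simp), h9]
    have h10 : ∀ r, 16 ≤ r → (t.store (List.range' 0 (Arity.ar U)) (rep u)).regs r = t.regs r := by
      intro r hr
      simp only [Mem.store, List.mem_range'_1]
      rw [if_neg (by omega)]
    refine Couples.pure ⟨⟨⟨?_, h5.qubits⟩, ?_⟩, ?_, rfl, h6, ?_⟩
    · exact fun r => (h10 _ (by omega)).trans (h5.regs r)
    · rw [← h8]
      refine List.map_congr_left fun i hi => ?_
      simp only [List.mem_range'_1] at hi
      exact h10 i (by omega)
    · rw [Mem.out_eq_map]
      exact Mem.map_store t List.nodup_range' (by simp [length_rep_eq])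
    · simp only [Mem.load, Polynomial.eval_add, Polynomial.eval_ofNat] at h7 ⊢
      omega

end Rounds

/-! ## Reachable states -/

/-- The states that can be reached in one round. -/
def Adversary.next (A : Adversary) (n j : ℕ) (R : Round) (S : Set Mem) : Set Mem :=
  {t | ∃ s ∈ S, ∃ xs ∈ R.input s, ∃ O : Oracle Unit,
    (∀ q, ∀ a ∈ (O () q).support, a.1 ∈ R.answer q) ∧ (t, ()) ∈ (A.run n j O xs (s, ())).support}

theorem Adversary.reach_cons (A : Adversary) (n j : ℕ) (R : Round) (Rs : List Round) (S : Set Mem) :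
    A.reach n j (R :: Rs) S = A.reach n (j + 1) Rs (A.next n j R S) := rfl

/-- An oracle with well-formed answers is an oracle for a typed function. -/
theorem exists_eq_oracle {α β : Type} [BitRep α] [BitRep β] (O : Oracle Unit)
    (hO : ∀ q, ∀ a ∈ (O () q).support, a.1 ∈ answers α β q) :
    ∃ F : Unit → α → PMF (β × Unit), O = oracle F := by
  classical
  have h1 : ∀ x : α, ∀ a ∈ (O () (rep x)).support, ∃ y : β, rep y = a.1 := by
    intro x a ha
    have := hO _ a ha
    rw [answers, if_pos ⟨x, rfl⟩] at this
    exact this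
  have h2 : ∀ x : α, Nonempty β := by
    intro x
    obtain ⟨a, ha⟩ := (O () (rep x)).exists_mem_support
    obtain ⟨y, -⟩ := h1 x a ha
    exact ⟨y⟩
  refine ⟨fun _ x => (O () (rep x)).map fun a =>
    (haveI := h2 x; Function.invFun (rep : β → List Str) a.1, ()), ?_⟩
  funext st q
  rw [oracle]
  by_cases hq : q ∈ msgs α
  · obtain ⟨x, rfl⟩ := hq
    have := h2 x
    simp only [parse_rep, PMF.map_comp]
    refine Eq.trans (bind_pure (O st (rep x))).symm (bind_congr_support fun a ha => ?_)
    simp only [Function.comp_apply, Function.invFun_eq (h1 x a ha)]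
    rfl
  · rw [parse_eq_none hq]
    have : ∀ a ∈ (O st q).support, a = ([], st) := by
      intro a ha
      have := hO q a ha
      rw [answers, if_neg hq] at this
      exact Prod.ext this rfl
    refine Eq.trans (bind_pure (O st q)).symm
      (Eq.trans (bind_congr_support (l := fun _ => pure ([], st)) ?_) ?_)
    · intro a ha
      rw [this a ha]
    · exact bind_const_pmf _ _

theorem oracle_answers {σ α β : Type} [BitRep α] [BitRep β] (F : σ → α → PMF (β × σ)) (st : σ)
    (q : List Str) : ∀ a ∈ (oracle F st q).support, a.1 ∈ answers α β q := by
  classical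
  intro a ha
  rw [oracle] at ha
  by_cases hq : q ∈ msgs α
  · rw [answers, if_pos hq]
    obtain ⟨x, rfl⟩ := hq
    simp only [parse_rep, PMF.mem_support_map_iff] at ha
    obtain ⟨y, -, rfl⟩ := ha
    exact ⟨y.1, rfl⟩
  · rw [parse_eq_none hq, mem_support_pure] at ha
    rw [answers, if_neg hq, ha]
    rfl

/-- Reachability asks only what is possible, and an oracle with uniformly random answers makes every
well-formed answer possible. It can therefore replace any stateful oracle of a game. If there are no
answers at all, there are no well-formed queries either. -/
theorem Adversary.mem_next_of_oracle (A : Adversary) {n j : ℕ} {S : Set Mem} {α β σ : Type} [BitRep α]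
    [BitRep β] [Fintype β] {R : Round} (hR : R.answer = answers α β) (F : σ → α → PMF (β × σ)) {s : Mem}
    (hs : s ∈ S) {xs : List Str} (hxs : xs ∈ R.input s) {st : σ} {t : Mem × σ}
    (ht : t ∈ (A.run n j (oracle F) xs (s, st)).support) : t.1 ∈ A.next n j R S := by
  classical
  by_cases hβ : Nonempty β
  · refine ⟨s, hs, xs, hxs, oracle fun _ (_ : α) => (PMF.uniformOfFintype β).map fun y => (y, ()), ?_, ?_⟩
    · rw [hR]
      exact oracle_answers _ _
    · refine Prog.exec_support ?_ _ _ st ht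
      intro st q a ha
      by_cases hq : q ∈ msgs α
      · obtain ⟨x, rfl⟩ := hq
        simp only [oracle, parse_rep, PMF.mem_support_map_iff] at ha ⊢
        obtain ⟨y, -, rfl⟩ := ha
        exact ⟨(y.1, ()), ⟨y.1, PMF.mem_support_uniformOfFintype _, rfl⟩, rfl⟩
      · simp only [oracle, parse_eq_none hq, mem_support_pure] at ha ⊢
        rw [ha]
  · have hα : IsEmpty α ∨ IsEmpty σ := by
      by_contra hcon
      rw [not_or, not_isEmpty_iff, not_isEmpty_iff] at hcon
      obtain ⟨⟨x⟩, ⟨st⟩⟩ := hcon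
      obtain ⟨y, -⟩ := (F st x).exists_mem_support
      exact hβ ⟨y.1⟩
    rcases hα with hα | hσ
    swap
    · exact hσ.elim st
    refine ⟨s, hs, xs, hxs, oracle (α := α) (β := β) fun _ => hα.elim, ?_, ?_⟩
    · rw [hR]
      exact oracle_answers _ _
    · refine Prog.exec_support ?_ _ _ st ht
      intro st q a ha
      have hq : q ∉ msgs α := by
        rintro ⟨x, -⟩
        exact hα.elim x
      simp only [oracle, parse_eq_none hq, mem_support_pure] at ha ⊢
      rw [ha]

theorem Adversary.mem_next_of_silent (A : Adversary) {n j : ℕ} {S : Set Mem} {input : Mem → Set (List Str)}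
    {s : Mem} (hs : s ∈ S) {xs : List Str} (hxs : xs ∈ input s) {t : Mem × Unit}
    (ht : t ∈ (A.run n j noOracle xs (s, ())).support) : t.1 ∈ A.next n j (silent input) S :=
  ⟨s, hs, xs, hxs, noOracle, fun q a ha => by
    simp only [noOracle, mem_support_pure] at ha
    rw [ha]
    rfl, ht⟩

theorem Adversary.next_mono (A : Adversary) {n j : ℕ} {R : Round} {S S' : Set Mem} (h : S ⊆ S') :
    A.next n j R S ⊆ A.next n j R S' := by
  rintro t ⟨s, hs, r⟩
  exact ⟨s, h hs, r⟩

/-- A bound for the time after a round is a bound for the time before. -/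
theorem Adversary.clock_le_of_next (A : Adversary) {n j : ℕ} {R : Round} {S : Set Mem} {T : ℕ}
    (h : ∀ t ∈ A.next n j R S, t.clock ≤ T) (hR : ∀ s, (R.input s).Nonempty)
    (hR' : ∀ q, (R.answer q).Nonempty) : ∀ s ∈ S, s.clock ≤ T := by
  intro s hs
  obtain ⟨xs, hxs⟩ := hR s
  let O : Oracle Unit := fun _ q => pure ((hR' q).choose, ())
  obtain ⟨t, ht⟩ := (A.run n j O xs (s, ())).exists_mem_support
  have h1 := Prog.exec_clock _ _ ht
  refine le_trans h1 (h t.1 ⟨s, hs, xs, hxs, O, ?_, ht⟩)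
  intro q a ha
  simp only [O, mem_support_pure] at ha
  rw [ha]
  exact (hR' q).choose_spec

/-- The states before, between and after the rounds of an adversary against the game of extraction-less
watermarking. -/
theorem Adversary.QPT.stages {A : Adversary} {u : Uniformity} {V₀ V₁ V₂ Q Z : ℕ → Type}
    [∀ n, BitRep (V₀ n)] [∀ n, BitRep (V₁ n)] [∀ n, BitRep (V₂ n)] [∀ n, BitRep (Q n)]
    [∀ n, BitRep (Z n)] [∀ n, Fintype (Z n)] [∀ n, Nonempty (Z n)] [∀ n, Nonempty (V₁ n)]
    [∀ n, Nonempty (V₂ n)]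
    (hA : A.QPT u fun n => [silent fun _ => msgs (V₀ n), ⟨fun _ => msgs (V₁ n), answers (Q n) (Z n)⟩,
      silent fun _ => msgs (V₂ n)]) :
    ∃ (S₁ S₂ S₃ : ℕ → Set Mem) (T : ℕ → ℕ), PolyLe T ∧
      (∀ n, ∀ a ∈ S₁ n, a.clock ≤ T n) ∧ (∀ n, ∀ a ∈ S₂ n, a.clock ≤ T n) ∧
      (∀ n, ∀ a ∈ S₃ n, a.clock ≤ T n) ∧
      (∀ n, ∀ a ∈ ({Mem.empty} : Set Mem), ∀ v : V₀ n,
        ∀ t ∈ (A.run n 0 noOracle (rep v) (a, ())).support, t.1 ∈ S₁ n) ∧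
      (∀ n (σ : Type) (G : σ → Q n → PMF (Z n × σ)), ∀ a ∈ S₁ n, ∀ (v : V₁ n) (st : σ),
        ∀ t ∈ (A.run n 1 (oracle G) (rep v) (a, st)).support, t.1 ∈ S₂ n) ∧
      (∀ n, ∀ a ∈ S₂ n, ∀ v : V₂ n,
        ∀ t ∈ (A.run n 2 noOracle (rep v) (a, ())).support, t.1 ∈ S₃ n) := by
  classical
  obtain ⟨-, p, hp⟩ := hA
  have h3 := fun n => hp n
  simp only [Adversary.reach_cons] at h3
  -- The polynomial bounds the clock at the end of the game only; clocks never decrease and every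
  -- reachable state can be continued, so the same bound holds after the earlier rounds.
  have h2 := fun n => A.clock_le_of_next (h3 n) (fun _ => Set.range_nonempty _)
    (fun _ => Set.singleton_nonempty _)
  have h1 := fun n => A.clock_le_of_next (h2 n) (fun _ => Set.range_nonempty _) (fun q => by
    simp only [answers]
    split_ifs
    · exact Set.range_nonempty _
    · exact Set.singleton_nonempty _)
  refine ⟨fun n => A.next n 0 (silent fun _ => msgs (V₀ n)) {Mem.empty},
    fun n => A.next n 1 ⟨fun _ => msgs (V₁ n), answers (Q n) (Z n)⟩ (A.next n 0 _ {Mem.empty}),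
    fun n => A.next n 2 (silent fun _ => msgs (V₂ n)) (A.next n 1 _ (A.next n 0 _ {Mem.empty})),
    fun n => p.eval n, PolyLe.eval p, h1, h2, h3, ?_, ?_, ?_⟩
  · exact fun n a ha v t ht =>
      A.mem_next_of_silent (input := fun _ => msgs (V₀ n)) ha (Set.mem_range_self v) ht
  · exact fun n σ G a ha v st t ht =>
      A.mem_next_of_oracle (R := ⟨fun _ => msgs (V₁ n), answers (Q n) (Z n)⟩) rfl G ha
        (Set.mem_range_self v) ht
  · exact fun n a ha v t ht =>
      A.mem_next_of_silent (input := fun _ => msgs (V₂ n)) ha (Set.mem_range_self v) ht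

/-! ## Reductions -/

section Reductions

variable {X Y S S' V U : ℕ → Type} [∀ n, BitRep (X n)] [∀ n, BitRep (Y n)]
  [∀ n, BitRep (S n)] [∀ n, BitRep (S' n)] [∀ n, BitRep (V n)]
  [∀ n, BitRep (U n)] [Arity X] [Arity Y] [Arity S] [Arity S'] [Arity V] [Arity U]
  {Pre Post : ℕ → Set Mem}

/-- A round of an adversary that simulates another one. -/
theorem RealizesRound.run {B : Adversary} {j : ℕ}
    {K : SKernel X Y (fun n => S n × V n) fun n => S' n × U n}
    (hK : RealizesRound B.advice Pre Post (B.prog j) K) {n : ℕ} {σ : Type}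
    (F : σ → X n → PMF (Y n × σ)) (v : V n) (st : σ) {x : S n} {a s : Mem} (h : Holds x a s)
    (ha : a ∈ Pre n) :
    Couples (B.run n j (oracle F) (rep v) (s, st)) (K n σ F ((x, v), a, st)) fun t b =>
      Holds b.1.1 b.2.1 t.1 ∧ t.1.out 0 (Arity.ar U) = rep b.1.2 ∧ t.2 = b.2.2 ∧ b.2.1 ∈ Post n := by
  obtain ⟨p, hp⟩ := hK
  refine (hp n σ F x v a s st h ha).mono ?_
  rintro t b ⟨h1, h2, h3, h4, -⟩
  exact ⟨h1, h2, h3, h4⟩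

/-- The states after a round of an adversary that simulates another one. -/
def Sent (S U : ℕ → Type) [∀ n, BitRep (S n)] [∀ n, BitRep (U n)] [Arity S] [Arity U]
    (Post : ℕ → Set Mem) (p : Polynomial ℕ) (n : ℕ) : Set Mem :=
  {s | ∃ (x : S n) (u : U n), ∃ a ∈ Post n, Holds x a s ∧ s.out 0 (Arity.ar U) = rep u ∧
    s.clock ≤ p.eval n}

theorem Sent.init (n : ℕ) :
    {Mem.empty} ⊆ Sent (fun _ => Unit) (fun _ => Unit) (fun _ => {Mem.empty}) 0 n := by
  rintro _ rfl
  exact ⟨(), (), Mem.empty, rfl, Holds.empty n, rfl, Nat.zero_le _⟩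

/-- The simulating adversary stays within polynomial time against arbitrary well-formed answers,
since these come from a typed oracle. The message format may depend on what was sent before; this is
needed for the length of the constrained key. -/
theorem RealizesRound.next {B : Adversary} {j : ℕ} {U₀ : ℕ → Type} [∀ n, BitRep (U₀ n)] [Arity U₀]
    {K : SKernel X Y (fun n => S n × V n) fun n => S' n × U n}
    (hK : RealizesRound B.advice Pre Post (B.prog j) K) (p : Polynomial ℕ) {R : ℕ → Round}
    (hR : ∀ n s (u : U₀ n), s.out 0 (Arity.ar U₀) = rep u → (R n).input s ⊆ msgs (V n))
    (hR' : ∀ n, (R n).answer = answers (X n) (Y n)) :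
    ∃ q : Polynomial ℕ, ∀ n, B.next n j (R n) (Sent S U₀ Pre p n) ⊆ Sent S' U Post q n := by
  obtain ⟨q, hq⟩ := hK
  refine ⟨p + q, fun n => ?_⟩
  rintro t ⟨s, ⟨x, u, a, ha, hx, hu, hp⟩, xs, hxs, O, hO, ht⟩
  obtain ⟨v, rfl⟩ := hR n s u hu hxs
  rw [hR'] at hO
  obtain ⟨F, rfl⟩ := exists_eq_oracle O hO
  obtain ⟨⟨⟨y, w⟩, b, st⟩, -, h1, h2, -, h3, h4⟩ := (hq n Unit F x v a s () hx ha).exists_right ht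
  refine ⟨y, w, b, h3, h1, h2, ?_⟩
  simp only [Polynomial.eval_add] at h4 ⊢
  omega

theorem Sent.clock {p : Polynomial ℕ} {n : ℕ} {s : Mem} (h : s ∈ Sent S U Post p n) :
    s.clock ≤ p.eval n := by
  obtain ⟨x, u, a, -, -, -, h⟩ := h
  exact h

end Reductions

/-! ## Negligible functions -/

theorem Negl.of_le {f g : ℕ → ℝ} (hf : Negl f) (h : ∀ n, |g n| ≤ f n) : Negl g :=
  Asymptotics.SuperpolynomialDecay.trans_abs_le hf fun n => (h n).trans (le_abs_self _)

theorem Negl.add {f g : ℕ → ℝ} (hf : Negl f) (hg : Negl g) : Negl fun n => f n + g n :=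
  Asymptotics.SuperpolynomialDecay.add hf hg

theorem Negl.const_mul {f : ℕ → ℝ} (hf : Negl f) (c : ℝ) : Negl fun n => c * f n :=
  Asymptotics.SuperpolynomialDecay.const_mul hf c

theorem Negl.abs {f : ℕ → ℝ} (hf : Negl f) : Negl fun n => |f n| :=
  Asymptotics.SuperpolynomialDecay.trans_abs_le hf fun n => by simp

theorem Negl.poly_mul {f : ℕ → ℝ} (hf : Negl f) {L : ℕ → ℕ} (hL : PolyLe L) :
    Negl fun n => L n * f n := by
  obtain ⟨p, hp⟩ := hL
  have h := Asymptotics.SuperpolynomialDecay.polynomial_mul hf.abs (p.map (Nat.castRingHom ℝ))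
  refine Negl.of_le h fun n => ?_
  have h1 : (p.map (Nat.castRingHom ℝ)).eval (n : ℝ) = ((p.eval n : ℕ) : ℝ) := by
    rw [Polynomial.eval_map, Polynomial.eval₂_at_natCast]
    simp
  rw [h1, abs_mul, Nat.abs_cast]
  gcongr
  exact hp n

/-- `n^m · √f` is the root of `n^(2m) · f`. -/
theorem Negl.sqrt {f : ℕ → ℝ} (hf : Negl f) : Negl fun n => Real.sqrt (f n) := by
  intro m
  have h := (Real.continuous_sqrt.tendsto 0).comp (hf (2 * m))
  rw [Real.sqrt_zero] at h
  refine h.congr fun n => ?_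
  simp only [Function.comp_apply]
  rw [Real.sqrt_mul (by positivity), mul_comm 2 m, pow_mul, Real.sqrt_sq (by positivity)]

/-! ## Approximate couplings -/

section Approx

variable {α β γ δ : Type}

/-- Two random values can be coupled such that the relation `R` holds with probability at least
`1 - ε`. -/
def Approx (p : PMF α) (q : PMF β) (R : α → β → Prop) (ε : ENNReal) : Prop :=
  ∀ (f : α → ENNReal) (g : β → ENNReal), (∀ a, f a ≤ 1) → (∀ a b, R a b → f a ≤ g b) →
    expect p f ≤ expect q g + ε

theorem Couples.approx {p : PMF α} {q : PMF β} {R : α → β → Prop} (h : Couples p q R) :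
    Approx p q R 0 := fun f g _ hfg => (h f g hfg).trans (by simp)

theorem expect_add_const (p : PMF α) (f : α → ENNReal) (c : ENNReal) :
    expect p (fun a => f a + c) = expect p f + c := by
  rw [expect_add, expect_const]

namespace Approx

variable {p : PMF α} {q : PMF β} {R S : α → β → Prop} {ε ε' : ENNReal}

theorem mono (h : Approx p q R ε) (hR : ∀ a b, R a b → S a b) (hε : ε ≤ ε') : Approx p q S ε' :=
  fun f g hf hfg => (h f g hf fun a b hab => hfg a b (hR a b hab)).trans (by gcongr)

theorem one : Approx p q R 1 := fun _ _ hf _ => (expect_le_one hf).trans le_add_self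

theorem bind {k : α → PMF γ} {l : β → PMF δ} {T : γ → δ → Prop} (h : Approx p q R ε)
    (h' : ∀ a b, R a b → Approx (k a) (l b) T ε') : Approx (p >>= k) (q >>= l) T (ε' + ε) := by
  intro f g hf hfg
  rw [expect_bind, expect_bind, ← add_assoc, ← expect_add_const]
  exact h _ _ (fun a => expect_le_one hf) fun a b hab => h' a b hab f g hf hfg

/-- With a common first sample the errors are averaged instead of maximized. This allows error terms
that depend on the keys and are small only on average. -/
theorem bind_self {k : α → PMF γ} {l : α → PMF δ} {T : γ → δ → Prop} {e : α → ENNReal}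
    (h : ∀ a ∈ p.support, Approx (k a) (l a) T (e a)) : Approx (p >>= k) (p >>= l) T (expect p e) := by
  intro f g hf hfg
  rw [expect_bind, expect_bind, ← expect_add]
  exact expect_mono_of_support fun a ha => h a ha f g hf hfg

theorem pure {a : α} {b : β} (h : R a b) : Approx (Pure.pure a) (Pure.pure b) R 0 :=
  (Couples.pure h).approx

theorem refl (p : PMF α) : Approx p p Eq 0 := (Couples.refl p).approx

theorem bool_le {p q : PMF Bool} (h : Approx p q Eq ε) (b : Bool) : p b ≤ q b + ε := by
  have := h (fun c => if c = b then 1 else 0) (fun c => if c = b then 1 else 0)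
    (fun a => by split_ifs <;> simp) (by
      rintro _ _ rfl
      exact le_rfl)
  rwa [expect_single, expect_single] at this

end Approx

theorem pmf_bool_false (p : PMF Bool) : (p false).toReal = 1 - (p true).toReal := by
  have h := p.tsum_coe
  rw [tsum_fintype, Fintype.sum_bool] at h
  have h' := congrArg ENNReal.toReal h
  rw [ENNReal.toReal_add (p.apply_ne_top _) (p.apply_ne_top _), ENNReal.toReal_one] at h'
  linarith

/-- The one-sided inequality for both outcomes of a bit is two-sided, since the two probabilities
add up to 1. -/
theorem Approx.prob {p q : PMF Bool} {ε : ENNReal} (h : Approx p q Eq ε) {r : ℝ} (hr : 0 ≤ r)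
    (hε : ε ≤ ENNReal.ofReal r) : |prob p - prob q| ≤ r := by
  have key : ∀ b, (p b).toReal ≤ (q b).toReal + r := by
    intro b
    have h1 := (h.bool_le b).trans (add_le_add_right hε (q b))
    have h2 := ENNReal.toReal_mono (by simp [q.apply_ne_top]) h1
    rwa [ENNReal.toReal_add (q.apply_ne_top _) ENNReal.ofReal_ne_top, ENNReal.toReal_ofReal hr] at h2
  have h1 := key true
  have h2 := key false
  rw [pmf_bool_false, pmf_bool_false] at h2
  rw [abs_le, _root_.prob, _root_.prob]
  constructor <;> linarith

/-- Runs with oracles whose answers differ only with a small probability. -/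
theorem Prog.exec_approx {σ₁ σ₂ : Type} {O₁ : Oracle σ₁} {O₂ : Oracle σ₂} {R : ℕ → σ₁ → σ₂ → Prop}
    (hR : ∀ t st₁ st₂, R t st₁ st₂ → R (t + 1) st₁ st₂) {T : ℕ} {ε : ENNReal}
    (hO : ∀ t st₁ st₂ q, t < T → R t st₁ st₂ →
      Approx (O₁ st₁ q) (O₂ st₂ q) (fun a b => a.1 = b.1 ∧ R (t + 1) a.2 b.2) ε)
    (P : Prog) (s : Mem) {st₁ : σ₁} {st₂ : σ₂} (h : R s.clock st₁ st₂)
    (hT : ∀ t ∈ (P.exec O₁ (s, st₁)).support, t.1.clock ≤ T) :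
    Approx (P.exec O₁ (s, st₁)) (P.exec O₂ (s, st₂)) (fun t u => t.1 = u.1 ∧ R t.1.clock t.2 u.2)
      (T * ε) := by
  intro f g hf hfg
  have hs : s.clock ≤ T := by
    obtain ⟨t, ht⟩ := (P.exec O₁ (s, st₁)).exists_mem_support
    exact (Prog.exec_clock P _ ht).trans (hT t ht)
  -- Final states with a clock beyond `T` have probability 0, so `f` may be set to 0 there. In the
  -- induction, queries after time `T` then cost nothing.
  have h1 : expect (P.exec O₁ (s, st₁)) f =
      expect (P.exec O₁ (s, st₁)) fun t => if t.1.clock ≤ T then f t else 0 :=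
    expect_congr fun t ht => by rw [if_pos (hT t ht)]
  rw [h1]
  -- The remaining error budget at time `t` is `(T - t) · ε`: every query takes a step and uses up
  -- one `ε`.
  have key := (Prog.exec_compare O₁ O₂ (fun t st₁ st₂ x y => x ≤ 1 ∧ (T < t → x = 0) ∧
    (t ≤ T → R t st₁ st₂ → x ≤ y + ((T - t : ℕ) : ENNReal) * ε)) ?_ ?_ ?_ P
    (fun t => if t.1.clock ≤ T then f t else 0) g ?_ s st₁ st₂).2.2 hs h
  · refine key.trans ?_
    gcongr
    exact Nat.sub_le _ _
  · rintro t st₁ st₂ x y ⟨h1, h2, h3⟩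
    refine ⟨h1, fun h => h2 (by omega), fun h hr => ?_⟩
    by_cases ht : t + 1 ≤ T
    · refine (h3 ht (hR _ _ _ hr)).trans ?_
      gcongr
      omega
    · rw [h2 (by omega)]
      exact bot_le
  · rintro t st₁ st₂ p x y h
    refine ⟨expect_le_one fun b => (h b).1, fun ht => ?_, fun ht hr => ?_⟩
    · exact expect_eq_zero_iff.2 fun b _ => (h b).2.1 ht
    · rw [← expect_add_const]
      exact expect_mono fun b => (h b).2.2 ht hr
  · rintro t st₁ st₂ q x y h
    refine ⟨expect_le_one fun b => (h b.1 b.2 st₂).1, fun ht => ?_, fun ht hr => ?_⟩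
    · exact expect_eq_zero_iff.2 fun b _ => (h b.1 b.2 st₂).2.1 (by omega)
    · by_cases ht' : t < T
      · have h4 := hO t st₁ st₂ q ht' hr x (fun b => y b + ((T - (t + 1) : ℕ) : ENNReal) * ε)
          (fun a => (h a.1 a.2 st₂).1) (by
            rintro ⟨a, st⟩ ⟨_, st'⟩ ⟨rfl, hst⟩
            exact (h a st st').2.2 ht' hst)
        refine h4.trans ?_
        rw [expect_add_const, add_assoc]
        have : T - t = (T - (t + 1)) + 1 := by omega
        rw [this]
        push_cast
        rw [add_mul, one_mul]
      · have : expect (O₁ st₁ q) x = 0 :=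
          expect_eq_zero_iff.2 fun b _ => (h b.1 b.2 st₂).2.1 (by omega)
        rw [this]
        exact bot_le
  · intro u st st'
    refine ⟨?_, fun h => if_neg (by simp only; omega), fun h hr => ?_⟩
    · split_ifs
      · exact hf _
      · exact zero_le
    · rw [if_pos h]
      exact (hfg _ _ ⟨rfl, hr⟩).trans le_self_add

/-- A potential that grows in expectation by at most `c` with every query. -/
theorem Prog.exec_potential {σ : Type} {O : Oracle σ} {Φ : σ → ENNReal} {c : ENNReal}
    (hO : ∀ st q, expect (O st q) (fun a => Φ a.2) ≤ Φ st + c) {T : ℕ} (P : Prog) (s : Mem) (st : σ)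
    (hT : ∀ t ∈ (P.exec O (s, st)).support, t.1.clock ≤ T) :
    expect (P.exec O (s, st)) (fun t => Φ t.2) ≤ Φ st + T * c := by
  have hs : s.clock ≤ T := by
    obtain ⟨t, ht⟩ := (P.exec O (s, st)).exists_mem_support
    exact (Prog.exec_clock P _ ht).trans (hT t ht)
  have h1 : expect (P.exec O (s, st)) (fun t => Φ t.2) =
      expect (P.exec O (s, st)) fun t => if t.1.clock ≤ T then Φ t.2 else 0 :=
    expect_congr fun t ht => by rw [if_pos (hT t ht)]
  rw [h1]
  have key := (Prog.exec_compare O O (fun t st _ x _ => (T < t → x = 0) ∧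
    (t ≤ T → x ≤ Φ st + ((T - t : ℕ) : ENNReal) * c)) ?_ ?_ ?_ P
    (fun t => if t.1.clock ≤ T then Φ t.2 else 0) (fun _ => 0) ?_ s st st).2 hs
  · refine key.trans ?_
    gcongr
    exact Nat.sub_le _ _
  · rintro t st - x - ⟨h2, h3⟩
    refine ⟨fun h => h2 (by omega), fun h => ?_⟩
    by_cases ht : t + 1 ≤ T
    · refine (h3 ht).trans ?_
      gcongr
      omega
    · rw [h2 (by omega)]
      exact bot_le
  · rintro t st - p x - h
    refine ⟨fun ht => expect_eq_zero_iff.2 fun b _ => (h b).1 ht, fun ht => ?_⟩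
    exact (expect_mono fun b => (h b).2 ht).trans (expect_const p _).le
  · rintro t st st' q x - h
    refine ⟨fun ht => expect_eq_zero_iff.2 fun b _ => (h b.1 b.2 st').1 (by omega), fun ht => ?_⟩
    by_cases ht' : t < T
    · refine (expect_mono fun a : List Str × σ => (h a.1 a.2 st').2 ht').trans ?_
      rw [expect_add_const]
      refine (add_le_add_left (hO st q) _).trans ?_
      rw [add_assoc]
      have : T - t = (T - (t + 1)) + 1 := by omega
      rw [this]
      push_cast
      rw [add_mul, one_mul, add_comm c]
    · have : expect (O st q) x = 0 :=
        expect_eq_zero_iff.2 fun b _ => (h b.1 b.2 st').1 (by omega)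
      rw [this]
      exact bot_le
  · intro u st st'
    refine ⟨fun h => if_neg (by simp only; omega), fun h => ?_⟩
    rw [if_pos h]
    exact le_self_add

end Approx

/-! ## Probabilities of games -/

theorem prob_nonneg (g : PMF Bool) : 0 ≤ prob g := ENNReal.toReal_nonneg

theorem prob_le_one (g : PMF Bool) : prob g ≤ 1 :=
  ENNReal.toReal_mono ENNReal.one_ne_top (g.coe_le_one true)

theorem bind_apply_true {α : Type} (p : PMF α) (k : α → PMF Bool) :
    (p >>= k) true = expect p fun a => k a true := rfl

theorem prob_coin_bind (X : Bool → PMF Bool) :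
    prob (coin >>= X) = (prob (X true) + prob (X false)) / 2 := by
  have h : (coin >>= X) true = 2⁻¹ * X true true + 2⁻¹ * X false true := by
    rw [bind_apply_true, expect, tsum_fintype, Fintype.sum_bool]
    simp [coin]
  rw [prob, h, ENNReal.toReal_add (ENNReal.mul_ne_top (by simp) (PMF.apply_ne_top _ _))
    (ENNReal.mul_ne_top (by simp) (PMF.apply_ne_top _ _)), ENNReal.toReal_mul, ENNReal.toReal_mul]
  simp only [ENNReal.toReal_inv, ENNReal.toReal_ofNat, prob]
  ring

theorem prob_bind_beq (p : PMF Bool) (b : Bool) :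
    prob (p >>= fun v => pure (v == b)) = if b then prob p else 1 - prob p := by
  cases b
  · have : (p >>= fun v => (pure (v == false) : PMF Bool)) true = p false := by
      rw [bind_apply_true, expect, tsum_fintype, Fintype.sum_bool]
      show p true * (PMF.pure _ true) + p false * (PMF.pure _ true) = _
      simp [PMF.pure_apply]
    rw [prob, this, pmf_bool_false]
    simp [prob]
  · simp only [beq_true, bind_pure, if_true]

theorem prob_not (p : PMF Bool) : prob (p >>= fun v => pure !v) = 1 - prob p := by
  have := prob_bind_beq p false
  simpa using this

/-- The advantage in a game in which a coin is guessed. -/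
theorem advantage_guess (X : Bool → PMF Bool) :
    advantage (coin >>= fun b => X b >>= fun v => pure (v == b)) = |prob (X true) - prob (X false)| := by
  rw [advantage, prob_coin_bind, prob_bind_beq, prob_bind_beq]
  simp only [if_true, Bool.false_eq_true, if_false]
  rw [show (prob (X true) + (1 - prob (X false))) / 2 - 1 / 2 = (prob (X true) - prob (X false)) / 2 by ring,
    abs_div, abs_two]
  ring

/-- A comparison of distributions that holds up to a negligible error. -/
theorem negl_of_approx {g g' : ℕ → PMF Bool} {e : ℕ → ENNReal} {r : ℕ → ℝ}
    (h : ∀ n, Approx (g n) (g' n) Eq (e n)) (hr : Negl r) (hr0 : ∀ n, 0 ≤ r n)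
    (he : ∀ n, e n ≤ ENNReal.ofReal (r n)) : Negl fun n => |prob (g n) - prob (g' n)| :=
  hr.of_le fun n => by
    rw [abs_abs]
    exact (h n).prob (hr0 n) (he n)

/-! ## The efficient primitives -/

section

variable {adv : ℕ → Str} {α β : ℕ → Type} [∀ n, BitRep (α n)] [∀ n, BitRep (β n)] [Arity α] [Arity β]

/-- The strings equal to a given one. -/
abbrev Single (l : Str) : Type := {s : Str // s = l}

theorem EffD.single {l : ℕ → Str} (h : EffD adv (α := fun _ => Unit) (β := fun _ => Str) fun n _ => l n) :
    EffD adv (β := fun n => Single (l n)) fun n (_ : α n) => ⟨l n, rfl⟩ :=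
  EffD.subtype (p := fun n s => s = l n)
    (EffD.comp (g := fun n (_ : Unit) => l n) h (EffD.unit (α := α))) fun _ _ => rfl

/-- The second parameter `1^κ` becomes an input whose type has a single element, and this element is
then computed from `1^n`. -/
theorem Eff.of_computes₂ {κ : ℕ → ℕ} (hκ : EffLen adv κ) {f : ∀ n, α n → PMF (β n)} {P : Prog}
    (hP : P.Classical) {T : ℕ → ℕ} (hT : PolyLe T)
    (h : ∀ n a, P.Computes (unary n :: unary (κ n) :: rep a) (f n a) (T n)) : Eff adv f := by
  have h1 : Eff adv (α := fun n => Single (unary (κ n)) × α n) fun n a => f n a.2 := by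
    refine Eff.of_computes hP hT fun n a => ?_
    have h2 := h n a.2
    have h3 : rep a = unary (κ n) :: rep a.2 := by
      rw [rep_prod]
      show [a.1.1] ++ rep a.2 = _
      rw [a.1.2]
      rfl
    rwa [h3]
  have h2 : EffD adv fun n (a : α n) => ((⟨unary (κ n), rfl⟩, a) : Single (unary (κ n)) × α n) :=
    EffD.pair (EffD.single hκ.2) EffD.id
  have h3 := Eff.compD h1 h2
  exact h3

theorem EffLen.of_unaryComputable {κ : ℕ → ℕ} (hκ : UnaryComputable κ) : EffLen adv κ := by
  refine ⟨?_, Eff.of_ppt hκ⟩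
  have h : Eff (fun _ => []) (α := fun _ => Unit) (β := fun _ => Str) fun n _ => pure (unary (κ n)) :=
    Eff.of_ppt hκ
  obtain ⟨L, hL, hL'⟩ := h.length_le (PolyLe.const 0) ⟨fun _ => 0, PolyLe.const 0, fun n a s hs => by
    cases hs⟩
  refine hL.mono fun n => ?_
  simpa [unary] using hL' n () (unary (κ n)) ((mem_support_pure).2 rfl) (unary (κ n)) (by simp [rep])

end

section Primitives

variable {k dom ran κ : ℕ → ℕ} (E : SKE (fun n => Nat.clog 2 (k n) + 1) dom) (C : CPRF dom ran)
  (P : PKE (fun n => C.skLen n (κ n) + E.keyLen n)) (D : ConstraintCircuits E κ)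

/-- The algorithms of the construction are efficient functions. -/
structure EfficientPrimitives (adv : ℕ → Str) : Prop where
  kLen : EffLen adv k
  domLen : EffLen adv dom
  ranLen : EffLen adv ran
  κLen : EffLen adv κ
  keyLen : EffLen adv E.keyLen
  cskLen : EffLen adv fun n => C.skLen n (κ n)
  ctLen : EffLen adv P.ctLen
  gen : Eff adv (α := fun _ => Unit) fun n _ => E.gen n
  enc : Eff adv (α := fun n => Bits (E.keyLen n) × Bits (Nat.clog 2 (k n) + 1)) fun n a => E.enc n a.1 a.2
  setup : Eff adv (α := fun _ => Unit) fun n _ => C.setup n (κ n)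
  constrain : Eff adv (α := fun n => Bits (C.mskLen n (κ n)) × Circ (dom n) (κ n))
    fun n a => C.constrain n (κ n) a.1 a.2
  eval : EffD adv (α := fun n => Bits (C.mskLen n (κ n)) × Bits (dom n))
    (β := fun n => Bits (ran n)) fun n a => C.eval n (κ n) a.1 a.2
  ceval : EffD adv (α := fun n => Bits (C.skLen n (κ n)) × Bits (dom n))
    (β := fun n => Bits (ran n)) fun n a => C.ceval n (κ n) a.1 a.2
  pgen : Eff adv (α := fun _ => Unit) fun n _ => P.gen n
  penc : Eff adv (α := fun n => Bits (P.pkLen n) × Bits (C.skLen n (κ n) + E.keyLen n))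
    fun n a => P.enc n a.1 a.2
  pdec : EffD adv (α := fun n => Bits (P.skLen n) × Bits (P.ctLen n)) fun n a => P.dec n a.1 a.2
  mark : EffD adv (α := fun n => Bits (E.keyLen n) × Bits (k n))
    (β := fun n => Circ (dom n) (κ n)) fun n a => D.mark n a.1 a.2
  auth : EffD adv (α := fun n => Bits (E.keyLen n))
    (β := fun n => Circ (dom n) (κ n)) fun n a => D.auth n a

theorem Eff.of_secParams {κ : ℕ → ℕ} {adv : ℕ → Str} (hκ : EffLen adv κ) {α β : ℕ × ℕ → Type}
    [∀ i, BitRep (α i)] [∀ i, BitRep (β i)] [Arity fun n => α (n, κ n)] [Arity fun n => β (n, κ n)]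
    {f : ∀ i, α i → PMF (β i)} (hf : PPT secParams f) :
    Eff adv (α := fun n => α (n, κ n)) (β := fun n => β (n, κ n)) fun n a => f (n, κ n) a := by
  obtain ⟨Q, hQ, p, hp⟩ := hf
  refine Eff.of_computes₂ hκ hQ (PolyLe.eval_comp p (PolyLe.id.add hκ.1)) fun n a => ?_
  simpa using hp (n, κ n) a

/-- The outputs of an efficient sampler are short. -/
theorem EffLen.of_sample {adv : ℕ → Str} (hadv : PolyLe fun n => (adv n).length) {L : ℕ → ℕ}
    {f : ∀ n, Unit → PMF (Bits (L n))} (hf : Eff adv f) : EffLen adv L :=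
  EffLen.of_eff (α := fun _ => Unit) hadv ⟨fun _ => 0, PolyLe.const 0, fun n a s hs => by cases hs⟩ hf
    (a := fun _ _ => pure ()) EffD.unit

variable {E C P D}

/-- Only `1^k` and `1^κ` are assumed to be computable. The other lengths are read off from samples:
a ciphertext of a uniform plaintext, a PRF value at a uniform point, a constrained key for `D_auth`,
an encryption of a uniform string as tag. -/
theorem EfficientPrimitives.of_efficient {adv : ℕ → Str} (hadv : PolyLe fun n => (adv n).length)
    (hk' : UnaryComputable k) (hκ : UnaryComputable κ) (hE : E.Efficient) (hC : C.Efficient)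
    (hP : P.Efficient) : EfficientPrimitives E C P D adv := by
  obtain ⟨hE1, hE2, -⟩ := hE
  obtain ⟨hC1, hC2, hC3, hC4⟩ := hC
  obtain ⟨hP1, hP2, hP3⟩ := hP
  have k1 : EffLen adv k := EffLen.of_unaryComputable hk'
  have κ1 : EffLen adv κ := EffLen.of_unaryComputable hκ
  have gen : Eff adv (α := fun _ => Unit) fun n _ => E.gen n := Eff.of_ppt hE1
  have enc : Eff adv (α := fun n => Bits (E.keyLen n) × Bits (Nat.clog 2 (k n) + 1))
    fun n a => E.enc n a.1 a.2 := Eff.of_ppt hE2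
  have setup : Eff adv (α := fun _ => Unit) fun n _ => C.setup n (κ n) := Eff.of_secParams κ1 hC1
  have constrain : Eff adv (α := fun n => Bits (C.mskLen n (κ n)) × Circ (dom n) (κ n))
    fun n a => C.constrain n (κ n) a.1 a.2 := Eff.of_secParams κ1 hC2
  have eval : EffD adv (α := fun n => Bits (C.mskLen n (κ n)) × Bits (dom n))
    (β := fun n => Bits (ran n)) fun n a => C.eval n (κ n) a.1 a.2 := Eff.of_secParams κ1 hC3
  have ceval : EffD adv (α := fun n => Bits (C.skLen n (κ n)) × Bits (dom n))
    (β := fun n => Bits (ran n)) fun n a => C.ceval n (κ n) a.1 a.2 := Eff.of_secParams κ1 hC4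
  have pgen : Eff adv (α := fun _ => Unit) fun n _ => P.gen n := Eff.of_ppt hP1
  have penc : Eff adv (α := fun n => Bits (P.pkLen n) × Bits (C.skLen n (κ n) + E.keyLen n))
    fun n a => P.enc n a.1 a.2 := Eff.of_ppt hP2
  have mark : EffD adv (α := fun n => Bits (E.keyLen n) × Bits (k n))
    (β := fun n => Circ (dom n) (κ n)) fun n a => D.mark n a.1 a.2 := Eff.of_ppt D.mark_ppt
  have auth : EffD adv (α := fun n => Bits (E.keyLen n))
    (β := fun n => Circ (dom n) (κ n)) fun n a => D.auth n a := Eff.of_ppt D.auth_ppt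
  have keyLen : EffLen adv E.keyLen := EffLen.of_sample hadv gen
  have domE : Eff adv (α := fun _ => Unit) (β := fun n => Bits (dom n)) fun n _ =>
      E.gen n >>= fun key => unif (Nat.clog 2 (k n) + 1) >>= fun p => E.enc n key p :=
    Eff.bind gen (Eff.bind (g := fun n (a : Unit × Bits (E.keyLen n)) p => E.enc n a.2 p) (Eff.unif k1.clog.succ)
      (Eff.compD enc (EffD.pair (EffD.snd (EffD.fst EffD.id)) (EffD.snd EffD.id))))
  have dom1 : EffLen adv dom := EffLen.of_sample hadv domE
  have ranE : Eff adv (α := fun _ => Unit) (β := fun n => Bits (ran n)) fun n _ =>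
      C.setup n (κ n) >>= fun msk => unif (dom n) >>= fun x => pure (C.eval n (κ n) msk x) :=
    Eff.bind setup (Eff.bind (g := fun n (a : Unit × Bits (C.mskLen n (κ n))) x => pure (C.eval n (κ n) a.2 x)) (Eff.unif dom1)
      (EffD.comp eval (EffD.pair (EffD.snd (EffD.fst EffD.id)) (EffD.snd EffD.id))))
  have cskE : Eff adv (α := fun _ => Unit) (β := fun n => Bits (C.skLen n (κ n))) fun n _ =>
      C.setup n (κ n) >>= fun msk => E.gen n >>= fun key => C.constrain n (κ n) msk (D.auth n key) :=
    Eff.bind setup (Eff.bind (g := fun n (a : Unit × Bits (C.mskLen n (κ n))) key => C.constrain n (κ n) a.2 (D.auth n key))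
      (Eff.compD gen EffD.unit)
      (Eff.compD constrain (EffD.pair (EffD.snd (EffD.fst EffD.id)) (EffD.comp auth (EffD.snd EffD.id)))))
  have csk1 : EffLen adv fun n => C.skLen n (κ n) := EffLen.of_sample hadv cskE
  have ctE : Eff adv (α := fun _ => Unit) (β := fun n => Bits (P.ctLen n)) fun n _ =>
      P.gen n >>= fun keys => unif (C.skLen n (κ n) + E.keyLen n) >>= fun d => P.enc n keys.1 d :=
    Eff.bind pgen (Eff.bind (g := fun n (a : Unit × (Bits (P.pkLen n) × Bits (P.skLen n))) d => P.enc n a.2.1 d) (Eff.unif (csk1.add keyLen))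
      (Eff.compD penc (EffD.pair (EffD.fst (EffD.snd (EffD.fst EffD.id))) (EffD.snd EffD.id))))
  exact {
    kLen := k1
    domLen := dom1
    ranLen := EffLen.of_sample hadv ranE
    κLen := κ1
    keyLen := keyLen
    cskLen := csk1
    ctLen := EffLen.of_sample hadv ctE
    gen := gen
    enc := enc
    setup := setup
    constrain := constrain
    eval := eval
    ceval := ceval
    pgen := pgen
    penc := penc
    pdec := Eff.of_ppt hP3
    mark := mark
    auth := auth }

theorem Uniformity.Advice.polyLe {u : Uniformity} {a : ℕ → Str} (h : u.Advice a) :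
    PolyLe fun n => (a n).length := by
  cases u with
  | uniform => exact (PolyLe.const 0).mono fun n => by rw [h n]; rfl
  | nonuniform => exact h

theorem Uniformity.Advice.nil (u : Uniformity) : u.Advice fun _ => [] := by
  cases u with
  | uniform => exact fun _ => rfl
  | nonuniform => exact ⟨0, fun n => Nat.zero_le _⟩

end Primitives

/-! ## Tools for reductions -/

section Rounds

variable {adv : ℕ → Str} {X Y S S₁ S' V U Q Z : ℕ → Type} [∀ n, BitRep (X n)] [∀ n, BitRep (Y n)]
  [∀ n, BitRep (S n)] [∀ n, BitRep (S₁ n)] [∀ n, BitRep (S' n)] [∀ n, BitRep (V n)]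
  [∀ n, BitRep (U n)] [∀ n, BitRep (Q n)] [∀ n, BitRep (Z n)]
  [Arity X] [Arity Y] [Arity S] [Arity S₁] [Arity S'] [Arity V] [Arity U] [Arity Q] [Arity Z]
  {Pre Post : ℕ → Set Mem}

/-- A calculation, a round of the simulated adversary without oracle, and another calculation that may
use the first two registers of the adversary. -/
theorem Realized.silentRound (A : Adversary) (j : ℕ) {pre : ∀ n, S n → PMF (S₁ n × V n)}
    (hpre : Eff adv pre) {post : ∀ n, (S₁ n × Str) × Str → PMF (S' n)} (hpost : Eff adv post)
    (hadv : EffD adv (α := fun _ => Unit) (β := fun _ => Str) fun n _ => A.advice n)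
    (h₁ : Arity.ar S₁ + Arity.ar V ≤ 80) (h₂ : Arity.ar S' ≤ 80)
    (hP : ∀ n, ∀ a ∈ Pre n, ∀ (v : V n),
      ∀ t ∈ (A.run n j noOracle (rep v) (a, ())).support, t.1 ∈ Post n)
    (hT : ∃ T, PolyLe T ∧ ∀ n, ∀ a ∈ Post n, a.clock ≤ T n) :
    Realized adv (X := X) (Y := Y) Pre Post fun n _ _ z =>
      pre n z.1 >>= fun r => A.run n j noOracle (rep r.2) (z.2.1, ()) >>= fun t =>
        post n ((r.1, t.1.regs 0), t.1.regs 1) >>= fun y => pure (y, t.1, z.2.2) := by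
  obtain ⟨T, hT, hT'⟩ := hT
  have e : Arity.ar (fun n => S₁ n × V n) = Arity.ar S₁ + Arity.ar V := rfl
  have e' : Arity.ar (fun n => S₁ n × Str) = Arity.ar S₁ + 1 := rfl
  refine (((((Realized.eff hpre (by omega)).seq
    (Realized.runSilent A j hadv (by omega) hP hT hT')).seq (Realized.read 0 (by omega))).seq
    (Realized.read 1 (by omega))).seq (Realized.eff hpost (by omega))).congr fun n σ F z => ?_
  simp only [bind_assoc, LawfulMonad.pure_bind]

/-- A calculation, a round of the simulated adversary with a simulated oracle, and another step. -/
theorem Realized.oracleRound (A : Adversary) (j : ℕ) {pre : ∀ n, S n → PMF (S₁ n × V n)}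
    (hpre : Eff adv pre) {k : Kernel X Y (fun n => S₁ n × Q n) fun n => S₁ n × Z n} (hk : EffO adv k)
    {post : Kernel X Y S₁ S'} (hpost : EffO adv post) (hQ : Arity.ar Q = 2)
    (hQ' : EffD adv (α := fun _ => Str × Str) (β := fun _ => Bool) fun n q =>
      open Classical in decide ([q.1, q.2] ∈ msgs (Q n)))
    (hadv : EffD adv (α := fun _ => Unit) (β := fun _ => Str) fun n _ => A.advice n)
    (h₁ : Arity.ar S₁ + Arity.ar V ≤ 80) (h₂ : Arity.ar S' ≤ 80)
    (hP : ∀ n (σ : Type) (G : σ → Q n → PMF (Z n × σ)), ∀ a ∈ Pre n, ∀ (v : V n) (st : σ),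
      ∀ t ∈ (A.run n j (oracle G) (rep v) (a, st)).support, t.1 ∈ Post n)
    (hT : ∃ T, PolyLe T ∧ ∀ n, ∀ a ∈ Post n, a.clock ≤ T n) :
    Realized adv Pre Post fun n σ F z =>
      pre n z.1 >>= fun r => A.run n j (oracle (handle k n σ F)) (rep r.2) (z.2.1, r.1, z.2.2) >>= fun t =>
        post n σ F t.2 >>= fun y => pure (y.1, t.1, y.2) := by
  obtain ⟨T, hT, hT'⟩ := hT
  have e : Arity.ar (fun n => S₁ n × V n) = Arity.ar S₁ + Arity.ar V := rfl
  refine (((Realized.eff hpre (by omega)).seq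
    (Realized.runOracle A j hk hQ hQ' hadv (by omega) hP hT hT')).seq
    (Realized.kernel hpost (by omega))).congr fun n σ F z => ?_
  simp only [bind_assoc, LawfulMonad.pure_bind]

end Rounds

section QPT

variable {X₀ Y₀ X₁ Y₁ X₂ Y₂ S₁ S₂ S₃ V₀ V₁ V₂ U₀ U₁ U₂ : ℕ → Type}
  [∀ n, BitRep (X₀ n)] [∀ n, BitRep (Y₀ n)] [∀ n, BitRep (X₁ n)] [∀ n, BitRep (Y₁ n)]
  [∀ n, BitRep (X₂ n)] [∀ n, BitRep (Y₂ n)] [∀ n, BitRep (S₁ n)] [∀ n, BitRep (S₂ n)]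
  [∀ n, BitRep (S₃ n)] [∀ n, BitRep (V₀ n)] [∀ n, BitRep (V₁ n)] [∀ n, BitRep (V₂ n)]
  [∀ n, BitRep (U₀ n)] [∀ n, BitRep (U₁ n)] [∀ n, BitRep (U₂ n)]
  [Arity X₀] [Arity Y₀] [Arity X₁] [Arity Y₁] [Arity X₂] [Arity Y₂] [Arity S₁] [Arity S₂] [Arity S₃]
  [Arity V₀] [Arity V₁] [Arity V₂] [Arity U₀] [Arity U₁] [Arity U₂] {Post₀ Post₁ Post₂ : ℕ → Set Mem}

theorem Adversary.QPT.of_rounds₂ {B : Adversary} {u : Uniformity} (hadv : u.Advice B.advice)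
    {K₀ : SKernel X₀ Y₀ (fun n => Unit × V₀ n) fun n => S₁ n × U₀ n}
    (h₀ : RealizesRound B.advice (fun _ => {Mem.empty}) Post₀ (B.prog 0) K₀)
    {K₁ : SKernel X₁ Y₁ (fun n => S₁ n × V₁ n) fun n => S₂ n × U₁ n}
    (h₁ : RealizesRound B.advice Post₀ Post₁ (B.prog 1) K₁) {R₀ R₁ : ℕ → Round}
    (hR₀ : ∀ n s, (R₀ n).input s ⊆ msgs (V₀ n)) (hR₀' : ∀ n, (R₀ n).answer = answers (X₀ n) (Y₀ n))
    (hR₁ : ∀ n s (u : U₀ n), s.out 0 (Arity.ar U₀) = rep u → (R₁ n).input s ⊆ msgs (V₁ n))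
    (hR₁' : ∀ n, (R₁ n).answer = answers (X₁ n) (Y₁ n)) : B.QPT u fun n => [R₀ n, R₁ n] := by
  obtain ⟨p, hp⟩ := h₀.next (U₀ := fun _ => Unit) 0 (fun n s _ _ => hR₀ n s) hR₀'
  obtain ⟨q, hq⟩ := h₁.next p hR₁ hR₁'
  refine ⟨hadv, q, fun n s hs => ?_⟩
  simp only [Adversary.reach_cons] at hs
  exact Sent.clock (S := S₂) (U := U₁) (hq n (B.next_mono ((B.next_mono (Sent.init n)).trans (hp n)) hs))

theorem Adversary.QPT.of_rounds₃ {B : Adversary} {u : Uniformity} (hadv : u.Advice B.advice)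
    {K₀ : SKernel X₀ Y₀ (fun n => Unit × V₀ n) fun n => S₁ n × U₀ n}
    (h₀ : RealizesRound B.advice (fun _ => {Mem.empty}) Post₀ (B.prog 0) K₀)
    {K₁ : SKernel X₁ Y₁ (fun n => S₁ n × V₁ n) fun n => S₂ n × U₁ n}
    (h₁ : RealizesRound B.advice Post₀ Post₁ (B.prog 1) K₁)
    {K₂ : SKernel X₂ Y₂ (fun n => S₂ n × V₂ n) fun n => S₃ n × U₂ n}
    (h₂ : RealizesRound B.advice Post₁ Post₂ (B.prog 2) K₂) {R₀ R₁ R₂ : ℕ → Round}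
    (hR₀ : ∀ n s, (R₀ n).input s ⊆ msgs (V₀ n)) (hR₀' : ∀ n, (R₀ n).answer = answers (X₀ n) (Y₀ n))
    (hR₁ : ∀ n s (u : U₀ n), s.out 0 (Arity.ar U₀) = rep u → (R₁ n).input s ⊆ msgs (V₁ n))
    (hR₁' : ∀ n, (R₁ n).answer = answers (X₁ n) (Y₁ n))
    (hR₂ : ∀ n s, (R₂ n).input s ⊆ msgs (V₂ n)) (hR₂' : ∀ n, (R₂ n).answer = answers (X₂ n) (Y₂ n)) :
    B.QPT u fun n => [R₀ n, R₁ n, R₂ n] := by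
  obtain ⟨p, hp⟩ := h₀.next (U₀ := fun _ => Unit) 0 (fun n s _ _ => hR₀ n s) hR₀'
  obtain ⟨q, hq⟩ := h₁.next p hR₁ hR₁'
  obtain ⟨r, hr⟩ := h₂.next (U₀ := U₁) q (fun n s _ _ => hR₂ n s) hR₂'
  refine ⟨hadv, r, fun n s hs => ?_⟩
  simp only [Adversary.reach_cons] at hs
  exact Sent.clock (S := S₃) (U := U₂)
    (hr n (B.next_mono ((B.next_mono ((B.next_mono (Sent.init n)).trans (hp n))).trans (hq n)) hs))

end QPT

theorem answers_empty (β : Type) [BitRep β] : answers Empty β = fun _ => {[]} := by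
  funext q
  rw [answers, if_neg]
  rintro ⟨x, -⟩
  exact x.elim

theorem msgs_unit : msgs Unit = {[]} := by
  ext q
  simp [msgs, rep]

theorem noOracle_eq (β : Type) [BitRep β] :
    noOracle = oracle fun (_ : Unit) (x : Empty) => (x.elim : PMF (β × Unit)) := by
  funext st q
  rw [oracle, parse_eq_none]
  · rfl
  · rintro ⟨x, -⟩
    exact x.elim

theorem Mem.read_eq {β : Type} [BitRep β] [Inhabited β] {s : Mem} {j : ℕ} {x : β}
    (h : s.out j (BitRep.arity β) = rep x) : s.read β j = x := by
  rw [Mem.read, h, parse_rep]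
  rfl

/-- Runs with oracles that give the same answers. -/
theorem Adversary.run_couples {σ₁ σ₂ α β : Type} [BitRep α] [BitRep β] {G₁ : σ₁ → α → PMF (β × σ₁)}
    {G₂ : σ₂ → α → PMF (β × σ₂)} {R : σ₁ → σ₂ → Prop}
    (h : ∀ st₁ st₂ q, R st₁ st₂ → Couples (G₁ st₁ q) (G₂ st₂ q) fun a b => a.1 = b.1 ∧ R a.2 b.2)
    (A : Adversary) (n j : ℕ) (xs : List Str) (a : Mem) {st₁ : σ₁} {st₂ : σ₂} (hst : R st₁ st₂) :
    Couples (A.run n j (oracle G₁) xs (a, st₁)) (A.run n j (oracle G₂) xs (a, st₂))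
      fun t u => t.1 = u.1 ∧ R t.2 u.2 := by
  refine Prog.exec_couples (fun st₁ st₂ q hR => ?_) _ _ hst
  rw [oracle, oracle]
  cases (parse q : Option α) with
  | none => exact Couples.pure ⟨rfl, hR⟩
  | some x =>
    refine (h st₁ st₂ x hR).bind fun a b hab => Couples.pure ⟨?_, hab.2⟩
    simp only [hab.1]

/-- The oracle queries of a run are approximately correct. -/
theorem Adversary.run_approx {σ₁ σ₂ α β : Type} [BitRep α] [BitRep β] {G₁ : σ₁ → α → PMF (β × σ₁)}
    {G₂ : σ₂ → α → PMF (β × σ₂)} {R : σ₁ → σ₂ → Prop} {ε : ENNReal} {T : ℕ}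
    (h : ∀ st₁ st₂ q, R st₁ st₂ → Approx (G₁ st₁ q) (G₂ st₂ q) (fun a b => a.1 = b.1 ∧ R a.2 b.2) ε)
    (A : Adversary) (n j : ℕ) (xs : List Str) (a : Mem) {st₁ : σ₁} {st₂ : σ₂} (hst : R st₁ st₂)
    (hT : ∀ t ∈ (A.run n j (oracle G₁) xs (a, st₁)).support, t.1.clock ≤ T) :
    Approx (A.run n j (oracle G₁) xs (a, st₁)) (A.run n j (oracle G₂) xs (a, st₂))
      (fun t u => t.1 = u.1 ∧ R t.2 u.2) (T * ε) := by
  refine (Prog.exec_approx (R := fun _ => R) (fun _ _ _ h => h) (fun t st₁ st₂ q _ hR => ?_) _ _ hst hT)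
  rw [oracle, oracle]
  cases (parse q : Option α) with
  | none => exact (Approx.pure ⟨rfl, hR⟩).mono (fun _ _ h => h) bot_le
  | some x =>
    have h1 := (h st₁ st₂ x hR).bind (k := fun r : β × σ₁ => Pure.pure ((rep r.1 : List Str), r.2))
      (l := fun r : β × σ₂ => Pure.pure ((rep r.1 : List Str), r.2))
      (T := fun a b : List Str × _ => a.1 = b.1 ∧ R a.2 b.2) (ε' := 0)
      fun a b hab => Approx.pure ⟨by simp only [hab.1], hab.2⟩
    rw [zero_add] at h1
    exact h1

/-- A potential of the state of an oracle. -/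
theorem Adversary.run_potential {σ α β : Type} [BitRep α] [BitRep β] {G : σ → α → PMF (β × σ)}
    {Φ : σ → ENNReal} {c : ENNReal} (h : ∀ st q, expect (G st q) (fun a => Φ a.2) ≤ Φ st + c)
    (A : Adversary) (n j : ℕ) (xs : List Str) (a : Mem) (st : σ) {T : ℕ}
    (hT : ∀ t ∈ (A.run n j (oracle G) xs (a, st)).support, t.1.clock ≤ T) :
    expect (A.run n j (oracle G) xs (a, st)) (fun t => Φ t.2) ≤ Φ st + T * c := by
  refine Prog.exec_potential (fun st q => ?_) _ _ st hT
  rw [oracle]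
  cases (parse q : Option α) with
  | none => exact (expect_pure _ _).trans_le le_self_add
  | some x =>
    rw [expect_map]
    exact h st x

theorem EffD.isTagQuery {adv : ℕ → Str} {L k : ℕ → ℕ} (hL : EffLen adv L) (hk : EffLen adv k) :
    EffD adv (α := fun _ => Str × Str) (β := fun _ => Bool) fun n q =>
      open Classical in decide ([q.1, q.2] ∈ msgs (Bits (L n) × Fin (k n))) := by
  classical
  have h1 := EffD.lengthEq (α := fun _ => Str × Str) hL.eff hL.short
    (l' := fun n q => q.1) (EffD.fst EffD.id)
  have h2 := EffD.isIndex (α := fun _ => Str × Str) hk (l := fun n q => q.2) (EffD.snd EffD.id)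
  refine (h1.and h2).congr fun n q => ?_
  rw [Bool.eq_iff_iff]
  simp only [unary, List.length_replicate, Bool.and_eq_true, decide_eq_true_eq]
  rw [mem_msgs_bits, mem_msgs_fin]
  constructor
  · rintro ⟨⟨x, hx⟩, y, hy⟩
    refine ⟨(x, y), ?_⟩
    rw [rep_prod]
    exact congrArg₂ (· ++ ·) hx hy
  · rintro ⟨⟨x, y⟩, h⟩
    obtain ⟨h3, h4⟩ := List.append_inj (s₁ := rep x) (s₂ := [q.1]) (t₁ := rep y) (t₂ := [q.2]) h rfl
    exact ⟨⟨x, h3⟩, y, h4⟩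

/-- What is used of the memory of an adversary against extraction-less watermarking. -/
structure Stages (A : Adversary) (V₀ V₁ V₂ Q Z : ℕ → Type) [∀ n, BitRep (V₀ n)] [∀ n, BitRep (V₁ n)]
    [∀ n, BitRep (V₂ n)] [∀ n, BitRep (Q n)] [∀ n, BitRep (Z n)] (S₁ S₂ S₃ : ℕ → Set Mem) (T : ℕ → ℕ) :
    Prop where
  poly : PolyLe T
  clock₁ : ∀ n, ∀ a ∈ S₁ n, a.clock ≤ T n
  clock₂ : ∀ n, ∀ a ∈ S₂ n, a.clock ≤ T n
  clock₃ : ∀ n, ∀ a ∈ S₃ n, a.clock ≤ T n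
  run₀ : ∀ n, ∀ a ∈ ({Mem.empty} : Set Mem), ∀ v : V₀ n,
    ∀ t ∈ (A.run n 0 noOracle (rep v) (a, ())).support, t.1 ∈ S₁ n
  run₁ : ∀ n (σ : Type) (G : σ → Q n → PMF (Z n × σ)), ∀ a ∈ S₁ n, ∀ (v : V₁ n) (st : σ),
    ∀ t ∈ (A.run n 1 (oracle G) (rep v) (a, st)).support, t.1 ∈ S₂ n
  run₂ : ∀ n, ∀ a ∈ S₂ n, ∀ v : V₂ n,
    ∀ t ∈ (A.run n 2 noOracle (rep v) (a, ())).support, t.1 ∈ S₃ n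

/-- The guess of a coin that is tossed in the middle of a game. -/
theorem advantage_guess_bind {α : Type} (p : PMF α) (X : α → Bool → PMF Bool) :
    advantage (p >>= fun a => coin >>= fun b => X a b >>= fun v => pure (v == b)) =
      |prob (p >>= fun a => X a true) - prob (p >>= fun a => X a false)| := by
  rw [bind_comm_pmf, ← advantage_guess fun b => p >>= fun a => X a b]
  simp only [bind_assoc]

/-! ## The hybrid games -/

section Hybrids

variable {k dom ran κ : ℕ → ℕ} (hk : ∀ n, 0 < k n) (E : SKE (fun n => Nat.clog 2 (k n) + 1) dom)
  (C : CPRF dom ran) (P : PKE (fun n => C.skLen n (κ n) + E.keyLen n)) (D : ConstraintCircuits E κ)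
  (A : Adversary)

/-- The simulation for a valid tag, where the values of the PRF are given by `G`. -/
noncomputable def simVia {n : ℕ} {σ : Type} (key : Bits (E.keyLen n))
    (G : σ → Fin (k n) → Bool → Bits (dom n) → PMF (Bits (ran n) × σ)) (st : σ) (i : Fin (k n)) :
    PMF ((Bool × Bits (dom n) × Bits (ran n)) × σ) :=
  coin >>= fun γ => E.enc n key (indexed i γ) >>= fun x => G st i γ x >>= fun y =>
    pure ((γ, x, y.1), y.2)

/-- The simulation for the plaintext of a tag. -/
noncomputable def simOpt {n : ℕ} (o : Option (Bits (C.skLen n (κ n) + E.keyLen n))) (i : Fin (k n)) :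
    PMF (Bool × Bits (dom n) × Bits (ran n)) :=
  o.elim (pure (false, fun _ => false, fun _ => false)) fun d =>
    coin >>= fun γ => E.enc n (fun j => d (Fin.natAdd (C.skLen n (κ n)) j)) (indexed i γ) >>= fun x =>
      pure (γ, x, C.ceval n (κ n) (fun j => d (Fin.castAdd (E.keyLen n) j)) x)

/-- The simulation oracle, where the tag `τ` is treated separately. -/
noncomputable def tagged {n : ℕ} (sk : Bits (P.skLen n)) (τ : Bits (P.ctLen n)) {σ : Type}
    (G : σ → Fin (k n) → PMF ((Bool × Bits (dom n) × Bits (ran n)) × σ)) (st : σ)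
    (q : Bits (P.ctLen n) × Fin (k n)) : PMF ((Bool × Bits (dom n) × Bits (ran n)) × σ) :=
  if q.1 = τ then G st q.2 else simOpt E C (P.dec n sk q.1) q.2 >>= fun z => pure (z, st)

/-- The end of the game, after the challenge is known. -/
noncomputable def guess (n : ℕ) (z : Bool × Bits (dom n) × Bits (ran n)) (a : Mem) : PMF Bool :=
  A.run n 2 noOracle (rep z) (a, ()) >>= fun s => pure (readBool (s.1.regs 0))

/-- The challenge, where the value at the challenge point is given by `R`. -/
noncomputable def challenge {n : ℕ} (key : Bits (E.keyLen n)) (i : Fin (k n))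
    (R : Bool → Bits (dom n) → PMF (Bits (ran n))) (b : Bool) :
    PMF (Bool × Bits (dom n) × Bits (ran n)) :=
  coin >>= fun γ => (if b then E.enc n key (indexed i γ) else unif (dom n)) >>= fun x =>
    R γ x >>= fun y => pure (γ, x, y)

/-- The game from the second round on, with simulated values given by `G` and `R`. -/
noncomputable def play {n : ℕ} (sk : Bits (P.skLen n)) (a : Mem) (key : Bits (E.keyLen n))
    (i : Fin (k n)) (τ : Bits (P.ctLen n)) (c : Bits (C.skLen n (κ n))) {σ : Type}
    (G : σ → Fin (k n) → Bool → Bits (dom n) → PMF (Bits (ran n) × σ))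
    (R : σ → Bool → Bool → Bits (dom n) → PMF (Bits (ran n))) (st : σ) : PMF Bool :=
  A.run n 1 (oracle (tagged E C P sk τ (simVia E key G))) (rep (τ, c)) (a, st) >>= fun t =>
    coin >>= fun b => challenge E key i (R t.2 b) b >>= fun z => guess A n z t.1 >>= fun v => pure (v == b)

/-- The first round of the game, in which the adversary chooses a message and an index. -/
noncomputable def opening (n : ℕ) :
    PMF ((Bits (P.pkLen n) × Bits (P.skLen n)) × Mem × Bits (k n) × Fin (k n)) :=
  P.gen n >>= fun keys => A.run n 0 noOracle (rep keys.1) (Mem.empty, ()) >>= fun t =>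
    pure (keys, t.1, readBits (k n) (t.1.regs 0), readFin (hk n) (t.1.regs 1))

/-- The value at the challenge point in the second case of the game. -/
noncomputable def maskedEval {n : ℕ} (msk : Bits (C.mskLen n (κ n))) (m : Bits (k n)) (i : Fin (k n))
    (γ : Bool) (x : Bits (dom n)) : PMF (Bits (ran n)) :=
  if γ = m i then unif (ran n) else pure (C.eval n (κ n) msk x)

/-- The game with an encrypted tag, or with a tag that is independent of the keys. -/
noncomputable def tagGame (n : ℕ) (b' : Bool) : PMF Bool :=
  opening hk E C P A n >>= fun o => E.gen n >>= fun key => C.setup n (κ n) >>= fun msk =>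
  C.constrain n (κ n) msk (D.auth n key) >>= fun skA =>
  C.constrain n (κ n) msk (D.mark n key o.2.2.1) >>= fun c =>
  P.enc n o.1.1 (if b' then fun _ => false else Fin.append skA key) >>= fun τ =>
  play E C P A o.1.2 o.2.1 key o.2.2.2 τ c
    (fun (_ : Unit) _ _ x => pure (C.ceval n (κ n) skA x, ()))
    (fun _ b γ x => if b then pure (C.ceval n (κ n) skA x) else maskedEval C msk o.2.2.1 o.2.2.2 γ x) ()

/-- The game with the values of the PRF; the value at the challenge point is given by `R`. -/
noncomputable def evalGame (n : ℕ) (R : Bits (C.mskLen n (κ n)) → Bits (k n) → Fin (k n) → Bool → Bool →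
    Bits (dom n) → PMF (Bits (ran n))) : PMF Bool :=
  opening hk E C P A n >>= fun o => E.gen n >>= fun key => C.setup n (κ n) >>= fun msk =>
  C.constrain n (κ n) msk (D.mark n key o.2.2.1) >>= fun c => P.enc n o.1.1 (fun _ => false) >>= fun τ =>
  play E C P A o.1.2 o.2.1 key o.2.2.2 τ c
    (fun (_ : Unit) _ _ x => pure (C.eval n (κ n) msk x, ())) (fun _ => R msk o.2.2.1 o.2.2.2) ()

/-- The game with the simulator of the constrained PRF, which is given the bits `f`. -/
noncomputable def simGame (S : C.Simulator) (n : ℕ) (f : Bits (E.keyLen n) → Bits (k n) → Fin (k n) →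
    Bool → Bits (dom n) → Bool) (f' : Bits (E.keyLen n) → Bits (k n) → Bits (dom n) → Bool) : PMF Bool :=
  opening hk E C P A n >>= fun o => E.gen n >>= fun key => S.init n (κ n) >>= fun r =>
  P.enc n o.1.1 (fun _ => false) >>= fun τ =>
  play E C P A o.1.2 o.2.1 key o.2.2.2 τ r.2
    (fun st i γ x => (S.step n (κ n) st x (f key o.2.2.1 i γ x)).map Prod.swap)
    (fun st _ γ x => if γ = o.2.2.1 o.2.2.2 then unif (ran n) else
      (S.step n (κ n) st x (f' key o.2.2.1 x)).map Prod.snd) r.1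

end Hybrids

/-! ## Efficiency of the parts of the hybrid games -/

section Parts

variable {k dom ran κ : ℕ → ℕ} {E : SKE (fun n => Nat.clog 2 (k n) + 1) dom}
  {C : CPRF dom ran} {P : PKE (fun n => C.skLen n (κ n) + E.keyLen n)} {D : ConstraintCircuits E κ}
  {adv : ℕ → Str} {α : ℕ → Type} [∀ n, BitRep (α n)] [Arity α]

namespace EfficientPrimitives

theorem gen_of (t : EfficientPrimitives E C P D adv) : Eff adv fun n (_ : α n) => E.gen n :=
  Eff.compD (g := fun n (_ : Unit) => E.gen n) t.gen (EffD.unit (α := α))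

theorem setup_of (t : EfficientPrimitives E C P D adv) : Eff adv fun n (_ : α n) => C.setup n (κ n) :=
  Eff.compD (g := fun n (_ : Unit) => C.setup n (κ n)) t.setup (EffD.unit (α := α))

theorem pgen_of (t : EfficientPrimitives E C P D adv) : Eff adv fun n (_ : α n) => P.gen n :=
  Eff.compD (g := fun n (_ : Unit) => P.gen n) t.pgen (EffD.unit (α := α))

theorem enc_of (t : EfficientPrimitives E C P D adv) {a : ∀ n, α n → Bits (E.keyLen n)} {b : ∀ n, α n → Bits (Nat.clog 2 (k n) + 1)}
    (ha : EffD adv a) (hb : EffD adv b) : Eff adv fun n x => E.enc n (a n x) (b n x) :=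
  Eff.compD (f := fun n x => (a n x, b n x)) t.enc (EffD.pair ha hb)

theorem constrain_of (t : EfficientPrimitives E C P D adv) {a : ∀ n, α n → Bits (C.mskLen n (κ n))} {b : ∀ n, α n → Circ (dom n) (κ n)}
    (ha : EffD adv a) (hb : EffD adv b) : Eff adv fun n x => C.constrain n (κ n) (a n x) (b n x) :=
  Eff.compD (f := fun n x => (a n x, b n x)) t.constrain (EffD.pair ha hb)

theorem eval_of (t : EfficientPrimitives E C P D adv) {a : ∀ n, α n → Bits (C.mskLen n (κ n))} {b : ∀ n, α n → Bits (dom n)}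
    (ha : EffD adv a) (hb : EffD adv b) : EffD adv fun n x => C.eval n (κ n) (a n x) (b n x) :=
  EffD.comp (f := fun n x => (a n x, b n x)) t.eval (EffD.pair ha hb)

theorem ceval_of (t : EfficientPrimitives E C P D adv) {a : ∀ n, α n → Bits (C.skLen n (κ n))} {b : ∀ n, α n → Bits (dom n)}
    (ha : EffD adv a) (hb : EffD adv b) : EffD adv fun n x => C.ceval n (κ n) (a n x) (b n x) :=
  EffD.comp (f := fun n x => (a n x, b n x)) t.ceval (EffD.pair ha hb)

theorem penc_of (t : EfficientPrimitives E C P D adv) {a : ∀ n, α n → Bits (P.pkLen n)} {b : ∀ n, α n → Bits (C.skLen n (κ n) + E.keyLen n)}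
    (ha : EffD adv a) (hb : EffD adv b) : Eff adv fun n x => P.enc n (a n x) (b n x) :=
  Eff.compD (f := fun n x => (a n x, b n x)) t.penc (EffD.pair ha hb)

theorem pdec_of (t : EfficientPrimitives E C P D adv) {a : ∀ n, α n → Bits (P.skLen n)} {b : ∀ n, α n → Bits (P.ctLen n)}
    (ha : EffD adv a) (hb : EffD adv b) : EffD adv fun n x => P.dec n (a n x) (b n x) :=
  EffD.comp (f := fun n x => (a n x, b n x)) t.pdec (EffD.pair ha hb)

theorem mark_of (t : EfficientPrimitives E C P D adv) {a : ∀ n, α n → Bits (E.keyLen n)} {b : ∀ n, α n → Bits (k n)}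
    (ha : EffD adv a) (hb : EffD adv b) : EffD adv fun n x => D.mark n (a n x) (b n x) :=
  EffD.comp (f := fun n x => (a n x, b n x)) t.mark (EffD.pair ha hb)

theorem auth_of (t : EfficientPrimitives E C P D adv) {a : ∀ n, α n → Bits (E.keyLen n)} (ha : EffD adv a) :
    EffD adv fun n x => D.auth n (a n x) :=
  EffD.comp (f := a) t.auth ha

theorem simOpt_of (t : EfficientPrimitives E C P D adv) {o : ∀ n, α n → Option (Bits (C.skLen n (κ n) + E.keyLen n))}
    {i : ∀ n, α n → Fin (k n)} (ho : EffD adv o) (hi : EffD adv i) :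
    Eff adv fun n x => simOpt E C (o n x) (i n x) := by
  refine Eff.optCase (t.cskLen.add t.keyLen) ho
    (EffD.pair (EffD.bool false) (EffD.pair (EffD.zeros t.domLen) (EffD.zeros t.ranLen))) ?_
  refine Eff.bind Eff.coin (Eff.bind (t.enc_of (EffD.rightBits t.cskLen ?_) (EffD.indexed t.kLen ?_ ?_))
    (EffD.pair ?_ (EffD.pair ?_ (t.ceval_of (EffD.leftBits t.cskLen ?_) ?_))))
  · exact EffD.snd (EffD.fst EffD.id)
  · exact EffD.comp hi (EffD.fst (EffD.fst EffD.id))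
  · exact EffD.snd EffD.id
  · exact EffD.snd (EffD.fst EffD.id)
  · exact EffD.snd EffD.id
  · exact EffD.snd (EffD.fst (EffD.fst EffD.id))
  · exact EffD.snd EffD.id

theorem challenge_of (t : EfficientPrimitives E C P D adv) {key : ∀ n, α n → Bits (E.keyLen n)} {i : ∀ n, α n → Fin (k n)}
    {R : ∀ n, α n → Bool → Bits (dom n) → PMF (Bits (ran n))} {b : ∀ n, α n → Bool}
    (hkey : EffD adv key) (hi : EffD adv i) (hb : EffD adv b)
    (hR : Eff adv (α := fun n => (α n × Bool) × Bits (dom n)) fun n p => R n p.1.1 p.1.2 p.2) :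
    Eff adv fun n x => challenge E (key n x) (i n x) (R n x) (b n x) := by
  refine Eff.bind Eff.coin (Eff.bind (Eff.ite ?_ (t.enc_of ?_ (EffD.indexed t.kLen ?_ ?_))
    (Eff.unif t.domLen)) (Eff.bind (Eff.congr hR ?_) ?_))
  · exact EffD.comp hb (EffD.fst EffD.id)
  · exact EffD.comp hkey (EffD.fst EffD.id)
  · exact EffD.comp hi (EffD.fst EffD.id)
  · exact EffD.snd EffD.id
  · intros; rfl
  · exact EffD.pair (EffD.snd (EffD.fst (EffD.fst EffD.id))) (EffD.pair (EffD.snd (EffD.fst EffD.id))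
      (EffD.snd EffD.id))

theorem maskedEval_of (t : EfficientPrimitives E C P D adv) {msk : ∀ n, α n → Bits (C.mskLen n (κ n))} {m : ∀ n, α n → Bits (k n)}
    {i : ∀ n, α n → Fin (k n)} {γ : ∀ n, α n → Bool} {x : ∀ n, α n → Bits (dom n)}
    (hmsk : EffD adv msk) (hm : EffD adv m) (hi : EffD adv i) (hγ : EffD adv γ) (hx : EffD adv x) :
    Eff adv fun n a => maskedEval C (msk n a) (m n a) (i n a) (γ n a) (x n a) := by
  refine (Eff.ite (EffD.beqBool hγ (EffD.lookup t.kLen hm hi)) (Eff.unif t.ranLen)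
    (t.eval_of hmsk hx)).congr fun n a => ?_
  simp only [beq_iff_eq]
  rfl

end EfficientPrimitives

end Parts

/-! ## Games with adversaries that are given by typed steps -/

/-- A function as an oracle that keeps a list of the queries. -/
noncomputable def logging {α β : Type} (f : α → PMF β) (log : List α) (a : α) : PMF (β × List α) :=
  (f a).map fun b => (b, a :: log)

theorem logged_eq {α β : Type} [BitRep α] [BitRep β] (f : α → PMF β) :
    logged f = oracle (logging f) := rfl

theorem ite_bind_pmf {α β : Type} (c : Prop) [Decidable c] (p q : PMF α) (f : α → PMF β) :
    (if c then p >>= f else q >>= f) = (if c then p else q) >>= f := by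
  split_ifs <;> rfl

section Games

variable {S₁ S₂ S₃ : ℕ → Type} [∀ n, BitRep (S₁ n)] [∀ n, BitRep (S₂ n)] [∀ n, BitRep (S₃ n)]
  [Arity S₁] [Arity S₂] [Arity S₃] {Post₀ Post₁ Post₂ : ℕ → Set Mem} {B : Adversary} {u : Uniformity}

/-- Here, as for the other games below, the machine disappears: an adversary realized by typed steps
can be replaced by these steps, because its outgoing registers and its typed state determine all
that the game reads. -/
theorem PKE.game_eq {pt : ℕ → ℕ} {E : PKE pt}
    {K₀ : SKernel (fun n => Bits (E.ctLen n)) (fun n => Option (Bits (pt n)))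
      (fun n => Unit × Bits (E.pkLen n)) fun n => S₁ n × Bits (pt n) × Bits (pt n)}
    (h₀ : RealizesRound B.advice (fun _ => {Mem.empty}) Post₀ (B.prog 0) K₀)
    {K₁ : SKernel (fun n => Bits (E.ctLen n)) (fun n => Option (Bits (pt n)))
      (fun n => S₁ n × Bits (E.ctLen n)) fun n => S₂ n × Bool}
    (h₁ : RealizesRound B.advice Post₀ Post₁ (B.prog 1) K₁) (n : ℕ) :
    E.game B n = E.gen n >>= fun keys =>
      K₀ n _ (logging fun c => pure (E.dec n keys.2 c)) (((), keys.1), Mem.empty, []) >>= fun r =>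
      coin >>= fun b => E.enc n keys.1 (if b then r.1.2.2 else r.1.2.1) >>= fun c =>
      K₁ n _ (logging fun c => pure (E.dec n keys.2 c)) ((r.1.1, c), r.2.1, []) >>= fun s =>
      if c ∈ s.2.2 then coin else pure (s.1.2 == b) := by
  refine bind_congr_support fun keys _ => ?_
  simp only [logged_eq]
  refine (h₀.run _ keys.1 [] (Holds.empty n) rfl).bind_eq ?_
  rintro ⟨s, log⟩ r ⟨h2, h3, -, h4⟩
  have e : ([s.regs 0] ++ [s.regs 1] : List Str) = rep r.1.2.1 ++ rep r.1.2.2 := h3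
  obtain ⟨e0, e1⟩ := List.append_inj e rfl
  have e0' : s.read (Bits (pt n)) 0 = r.1.2.1 := Mem.read_eq e0
  have e1' : s.read (Bits (pt n)) 1 = r.1.2.2 := Mem.read_eq e1
  simp only [e0', e1']
  refine bind_congr_support fun b _ => bind_congr_support fun c _ => ?_
  refine (h₁.run _ c [] h2 h4).bind_eq ?_
  rintro ⟨s', log'⟩ r' ⟨-, h6, h7, -⟩
  have e2 : s'.read Bool = r'.1.2 := Mem.read_eq h6
  simp only at h7
  simp only [e2, h7]

theorem PKE.qpt {pt : ℕ → ℕ} {E : PKE pt} (hu : u.Advice B.advice)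
    {K₀ : SKernel (fun n => Bits (E.ctLen n)) (fun n => Option (Bits (pt n)))
      (fun n => Unit × Bits (E.pkLen n)) fun n => S₁ n × Bits (pt n) × Bits (pt n)}
    (h₀ : RealizesRound B.advice (fun _ => {Mem.empty}) Post₀ (B.prog 0) K₀)
    {K₁ : SKernel (fun n => Bits (E.ctLen n)) (fun n => Option (Bits (pt n)))
      (fun n => S₁ n × Bits (E.ctLen n)) fun n => S₂ n × Bool}
    (h₁ : RealizesRound B.advice Post₀ Post₁ (B.prog 1) K₁) : B.QPT u E.rounds :=
  Adversary.QPT.of_rounds₂ hu h₀ h₁ (fun _ _ => subset_rfl) (fun _ => rfl)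
    (fun _ _ _ _ => subset_rfl) fun _ => rfl

theorem SKE.game_eq {pt ct : ℕ → ℕ} {E : SKE pt ct}
    {K₀ : SKernel (fun n => Bits (pt n)) (fun n => Bits (ct n))
      (fun _ => Unit × Unit) fun n => S₁ n × Bits (pt n)}
    (h₀ : RealizesRound B.advice (fun _ => {Mem.empty}) Post₀ (B.prog 0) K₀)
    {K₁ : SKernel (fun n => Bits (pt n)) (fun n => Bits (ct n))
      (fun n => S₁ n × Bits (ct n)) fun n => S₂ n × Bool}
    (h₁ : RealizesRound B.advice Post₀ Post₁ (B.prog 1) K₁) (n : ℕ) :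
    E.game B n = E.gen n >>= fun key =>
      K₀ n _ (logging (E.enc n key)) (((), ()), Mem.empty, []) >>= fun r =>
      coin >>= fun b => (if b then unif (ct n) else E.enc n key r.1.2) >>= fun c =>
      K₁ n _ (logging (E.enc n key)) ((r.1.1, c), r.2.1, r.2.2) >>= fun s => pure (s.1.2 == b) := by
  refine bind_congr_support fun key _ => ?_
  simp only [logged_eq]
  refine (h₀.run _ () [] (Holds.empty n) rfl).bind_eq ?_
  rintro ⟨s, log⟩ r ⟨h2, h3, h3', h4⟩
  have e0' : s.read (Bits (pt n)) 0 = r.1.2 := Mem.read_eq h3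
  simp only at h3'
  simp only [e0', h3']
  refine bind_congr_support fun b _ => ?_
  rw [ite_bind_pmf]
  refine bind_congr_support fun c _ => ?_
  refine (h₁.run _ c r.2.2 h2 h4).bind_eq ?_
  rintro ⟨s', log'⟩ r' ⟨-, h6, h7, -⟩
  have e2 : s'.read Bool = r'.1.2 := Mem.read_eq h6
  simp only [e2]

theorem SKE.qpt {pt ct : ℕ → ℕ} {E : SKE pt ct} (hu : u.Advice B.advice)
    {K₀ : SKernel (fun n => Bits (pt n)) (fun n => Bits (ct n))
      (fun _ => Unit × Unit) fun n => S₁ n × Bits (pt n)}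
    (h₀ : RealizesRound B.advice (fun _ => {Mem.empty}) Post₀ (B.prog 0) K₀)
    {K₁ : SKernel (fun n => Bits (pt n)) (fun n => Bits (ct n))
      (fun n => S₁ n × Bits (ct n)) fun n => S₂ n × Bool}
    (h₁ : RealizesRound B.advice Post₀ Post₁ (B.prog 1) K₁) : B.QPT u E.rounds :=
  Adversary.QPT.of_rounds₂ (V₀ := fun _ => Unit) hu h₀ h₁ (fun _ _ => msgs_unit.ge) (fun _ => rfl)
    (fun _ _ _ _ => subset_rfl) fun _ => rfl

namespace CPRF

variable {dom ran κ : ℕ → ℕ} {C : CPRF dom ran}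

/-- The first message in the games: the parameter and the constraint. -/
abbrev FirstMessage (dom κ : ℕ → ℕ) (n : ℕ) : Type := Single (unary (κ n)) × Circ (dom n) (κ n)

/-- The types in the game depend on the parameter that was sent, which equals `κ n` only by a proof.
Abstracting the rest of the game into `Φ` moves this equality past all dependent types at once. -/
theorem sent_eq (C : CPRF dom ran) {n : ℕ} {s : Mem} {r : FirstMessage dom κ n}
    (h : s.out 0 2 = rep r) {β : Sort*} (Φ : ∀ κ, Circ (dom n) κ → β) :
    Φ (sentParam s) (C.sentConstraint n s) = Φ (κ n) r.2 := by
  have e : ([s.regs 0] ++ [s.regs 1] : List Str) = rep r.1 ++ rep r.2 := h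
  obtain ⟨e0, e1⟩ := List.append_inj e rfl
  have e2 : s.regs 0 = unary (κ n) := by
    have : [s.regs 0] = [r.1.1] := e0
    exact (List.cons.inj this).1.trans r.1.2
  have e3 : sentParam s = κ n := by
    rw [sentParam, e2]
    simp [unary]
  have e4 : ∀ κ', κ' = κ n → Φ κ' (s.read (Circ (dom n) κ') 1) = Φ (κ n) r.2 := by
    rintro _ rfl
    rw [Mem.read_eq (x := r.2) e1]
  exact e4 _ e3

theorem secondRound_input (C : CPRF dom ran) {n : ℕ} {s : Mem} {r : FirstMessage dom κ n}
    (h : s.out 0 2 = rep r) : (C.secondRound n).input s = msgs (Bits (C.skLen n (κ n))) :=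
  C.sent_eq h fun κ' _ => msgs (Bits (C.skLen n κ'))

theorem correctnessGame_eq {K₀ : SKernel (fun _ => Empty) (fun _ => Unit)
      (fun _ => Unit × Unit) fun n => S₁ n × FirstMessage dom κ n}
    (h₀ : RealizesRound B.advice (fun _ => {Mem.empty}) Post₀ (B.prog 0) K₀)
    {K₁ : SKernel (fun n => Bits (dom n)) (fun n => Bits (ran n))
      (fun n => S₁ n × Bits (C.skLen n (κ n))) fun n => S₂ n × Bits (dom n)}
    (h₁ : RealizesRound B.advice Post₀ Post₁ (B.prog 1) K₁) (n : ℕ) :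
    C.correctnessGame B n =
      K₀ n Unit (fun _ x => x.elim) (((), ()), Mem.empty, ()) >>= fun r =>
      C.setup n (κ n) >>= fun msk => C.constrain n (κ n) msk r.1.2.2 >>= fun sk =>
      K₁ n _ (logging fun x => pure (C.eval n (κ n) msk x)) ((r.1.1, sk), r.2.1, []) >>= fun s =>
      pure (decide (C.eval n (κ n) msk s.1.2 ≠ C.ceval n (κ n) sk s.1.2 ∧ r.1.2.2.eval s.1.2 = false)) := by
  simp only [correctnessGame, noOracle_eq Unit, logged_eq]
  refine (h₀.run _ () () (Holds.empty n) rfl).bind_eq ?_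
  rintro ⟨s, log⟩ r ⟨h2, h3, -, h4⟩
  refine (C.sent_eq h3 fun κ' f => C.setup n κ' >>= fun msk => C.constrain n κ' msk f >>= fun sk =>
    B.run n 1 (oracle (logging fun x => pure (C.eval n κ' msk x))) (rep sk) (s, []) >>= fun s =>
    pure (decide (C.eval n κ' msk (s.1.read (Bits (dom n))) ≠ C.ceval n κ' sk (s.1.read (Bits (dom n))) ∧
      f.eval (s.1.read (Bits (dom n))) = false))).trans ?_
  refine bind_congr_support fun msk _ => bind_congr_support fun sk _ => ?_
  refine (h₁.run _ sk [] h2 h4).bind_eq ?_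
  rintro ⟨s', log'⟩ r' ⟨-, h6, h7, -⟩
  have e2 : s'.read (Bits (dom n)) = r'.1.2 := Mem.read_eq h6
  simp only [e2]

theorem firstRound_answer : firstRound.answer = answers Empty Unit := (answers_empty Unit).symm

theorem qpt₂ (hu : u.Advice B.advice) {U : ℕ → Type} [∀ n, BitRep (U n)] [Arity U]
    {K₀ : SKernel (fun _ => Empty) (fun _ => Unit)
      (fun _ => Unit × Unit) fun n => S₁ n × FirstMessage dom κ n}
    (h₀ : RealizesRound B.advice (fun _ => {Mem.empty}) Post₀ (B.prog 0) K₀)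
    {K₁ : SKernel (fun n => Bits (dom n)) (fun n => Bits (ran n))
      (fun n => S₁ n × Bits (C.skLen n (κ n))) fun n => S₂ n × U n}
    (h₁ : RealizesRound B.advice Post₀ Post₁ (B.prog 1) K₁) :
    B.QPT u fun n => [firstRound, C.secondRound n] :=
  Adversary.QPT.of_rounds₂ (V₀ := fun _ => Unit) hu h₀ h₁ (fun _ _ => msgs_unit.ge)
    (fun _ => firstRound_answer) (fun _ _ _ h => (C.secondRound_input h).le) fun _ => rfl

theorem privacyGame_eq {K₀ : SKernel (fun _ => Empty) (fun _ => Unit)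
      (fun _ => Unit × Unit) fun n => S₁ n × FirstMessage dom κ n}
    (h₀ : RealizesRound B.advice (fun _ => {Mem.empty}) Post₀ (B.prog 0) K₀)
    {K₁ : SKernel (fun n => Bits (dom n)) (fun n => Bits (ran n))
      (fun n => S₁ n × Bits (C.skLen n (κ n))) fun n => S₂ n × Bool}
    (h₁ : RealizesRound B.advice Post₀ Post₁ (B.prog 1) K₁) (S : C.Simulator) (n : ℕ) :
    C.privacyGame S B n =
      K₀ n Unit (fun _ x => x.elim) (((), ()), Mem.empty, ()) >>= fun r => coin >>= fun b =>
      (if b then S.init n (κ n) >>= fun q => K₁ n _ (fun st x =>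
          (S.step n (κ n) st x (r.1.2.2.eval x)).map Prod.swap) ((r.1.1, q.2), r.2.1, q.1) >>= fun s =>
          pure s.1.2
        else C.setup n (κ n) >>= fun msk => C.constrain n (κ n) msk r.1.2.2 >>= fun sk =>
          K₁ n _ (logging fun x => pure (C.eval n (κ n) msk x)) ((r.1.1, sk), r.2.1, []) >>= fun s =>
          pure s.1.2) >>= fun v => pure (v == b) := by
  simp only [privacyGame, noOracle_eq Unit, logged_eq]
  refine (h₀.run _ () () (Holds.empty n) rfl).bind_eq ?_
  rintro ⟨s, log⟩ r ⟨h2, h3, -, h4⟩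
  refine bind_congr_support fun b _ => ?_
  cases b
  · simp only [Bool.false_eq_true, if_false, bind_assoc, LawfulMonad.pure_bind]
    refine (C.sent_eq h3 fun κ' f => C.setup n κ' >>= fun msk => C.constrain n κ' msk f >>= fun sk =>
      B.run n 1 (oracle (logging fun x => pure (C.eval n κ' msk x))) (rep sk) (s, []) >>= fun s =>
      pure (s.1.read Bool == false)).trans ?_
    refine bind_congr_support fun msk _ => bind_congr_support fun sk _ => ?_
    refine (h₁.run _ sk [] h2 h4).bind_eq ?_
    rintro ⟨s', log'⟩ r' ⟨-, h6, h7, -⟩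
    have e2 : s'.read Bool = r'.1.2 := Mem.read_eq h6
    simp only [e2]
  · simp only [if_true, bind_assoc, LawfulMonad.pure_bind]
    refine (C.sent_eq h3 fun κ' f => S.init n κ' >>= fun r =>
      B.run n 1 (oracle fun st x => (S.step n κ' st x (f.eval x)).map Prod.swap) (rep r.2) (s, r.1) >>=
      fun s => pure (s.1.read Bool == true)).trans ?_
    refine bind_congr_support fun q _ => ?_
    refine (h₁.run _ q.2 q.1 h2 h4).bind_eq ?_
    rintro ⟨s', log'⟩ r' ⟨-, h6, h7, -⟩
    have e2 : s'.read Bool = r'.1.2 := Mem.read_eq h6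
    simp only [e2]

theorem pseudorandomnessGame_eq {K₀ : SKernel (fun _ => Empty) (fun _ => Unit)
      (fun _ => Unit × Unit) fun n => S₁ n × FirstMessage dom κ n}
    (h₀ : RealizesRound B.advice (fun _ => {Mem.empty}) Post₀ (B.prog 0) K₀)
    {K₁ : SKernel (fun n => Bits (dom n)) (fun n => Bits (ran n))
      (fun n => S₁ n × Bits (C.skLen n (κ n))) fun n => S₂ n × Bits (dom n)}
    (h₁ : RealizesRound B.advice Post₀ Post₁ (B.prog 1) K₁)
    {K₂ : SKernel (fun n => Bits (dom n)) (fun n => Bits (ran n))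
      (fun n => S₂ n × Bits (ran n)) fun n => S₃ n × Bool}
    (h₂ : RealizesRound B.advice Post₁ Post₂ (B.prog 2) K₂) (n : ℕ) :
    C.pseudorandomnessGame B n =
      K₀ n Unit (fun _ x => x.elim) (((), ()), Mem.empty, ()) >>= fun r =>
      C.setup n (κ n) >>= fun msk => C.constrain n (κ n) msk r.1.2.2 >>= fun sk =>
      K₁ n _ (logging fun x => pure (C.eval n (κ n) msk x)) ((r.1.1, sk), r.2.1, []) >>= fun s =>
      coin >>= fun b => (if b then unif (ran n) else pure (C.eval n (κ n) msk s.1.2)) >>= fun y =>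
      K₂ n _ (logging fun x => pure (C.eval n (κ n) msk x)) ((s.1.1, y), s.2.1, s.2.2) >>= fun s' =>
      if s.1.2 ∉ s'.2.2 ∧ r.1.2.2.eval s.1.2 ≠ false then pure (s'.1.2 == b) else coin := by
  simp only [pseudorandomnessGame, noOracle_eq Unit, logged_eq, ite_bind_pmf]
  refine (h₀.run _ () () (Holds.empty n) rfl).bind_eq ?_
  rintro ⟨s, log⟩ r ⟨h2, h3, -, h4⟩
  refine (C.sent_eq h3 fun κ' f => C.setup n κ' >>= fun msk => C.constrain n κ' msk f >>= fun sk =>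
    B.run n 1 (oracle (logging fun x => pure (C.eval n κ' msk x))) (rep sk) (s, []) >>= fun s =>
    coin >>= fun b => (if b then unif (ran n) else pure (C.eval n κ' msk (s.1.read (Bits (dom n))))) >>=
    fun y => B.run n 2 (oracle (logging fun x => pure (C.eval n κ' msk x))) (rep y) s >>= fun s' =>
    if s.1.read (Bits (dom n)) ∉ s'.2 ∧ f.eval (s.1.read (Bits (dom n))) ≠ false then
      pure (s'.1.read Bool == b) else coin).trans ?_
  refine bind_congr_support fun msk _ => bind_congr_support fun sk _ => ?_
  refine (h₁.run _ sk [] h2 h4).bind_eq ?_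
  rintro ⟨s', log'⟩ r' ⟨h5, h6, h7, h8⟩
  have e2 : s'.read (Bits (dom n)) = r'.1.2 := Mem.read_eq h6
  simp only at h7
  simp only [e2, h7]
  refine bind_congr_support fun b _ => bind_congr_support fun y _ => ?_
  refine (h₂.run _ y r'.2.2 h5 h8).bind_eq ?_
  rintro ⟨s₂, log₂⟩ r₂ ⟨-, h9, h10, -⟩
  have e3 : s₂.read Bool = r₂.1.2 := Mem.read_eq h9
  simp only at h10
  simp only [e3, h10]

theorem qpt₃ (hu : u.Advice B.advice)
    {K₀ : SKernel (fun _ => Empty) (fun _ => Unit)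
      (fun _ => Unit × Unit) fun n => S₁ n × FirstMessage dom κ n}
    (h₀ : RealizesRound B.advice (fun _ => {Mem.empty}) Post₀ (B.prog 0) K₀)
    {K₁ : SKernel (fun n => Bits (dom n)) (fun n => Bits (ran n))
      (fun n => S₁ n × Bits (C.skLen n (κ n))) fun n => S₂ n × Bits (dom n)}
    (h₁ : RealizesRound B.advice Post₀ Post₁ (B.prog 1) K₁)
    {K₂ : SKernel (fun n => Bits (dom n)) (fun n => Bits (ran n))
      (fun n => S₂ n × Bits (ran n)) fun n => S₃ n × Bool}
    (h₂ : RealizesRound B.advice Post₁ Post₂ (B.prog 2) K₂) :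
    B.QPT u fun n => [firstRound, C.secondRound n,
      ⟨fun _ => msgs (Bits (ran n)), answers (Bits (dom n)) (Bits (ran n))⟩] :=
  Adversary.QPT.of_rounds₃ (V₀ := fun _ => Unit) hu h₀ h₁ h₂ (fun _ _ => msgs_unit.ge)
    (fun _ => firstRound_answer) (fun _ _ _ h => (C.secondRound_input h).le) (fun _ => rfl)
    (fun _ _ => subset_rfl) fun _ => rfl

end CPRF

end Games

/-! ## The reduction to the security of public key encryption -/

section Reductions

variable {k dom ran κ : ℕ → ℕ} (hk : ∀ n, 0 < k n) {E : SKE (fun n => Nat.clog 2 (k n) + 1) dom}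
  {C : CPRF dom ran} {P : PKE (fun n => C.skLen n (κ n) + E.keyLen n)} {D : ConstraintCircuits E κ}
  {u : Uniformity} {A : Adversary}

/-- The adversaries of the hybrid games, with efficient algorithms. -/
structure HybridAdversary (E : SKE (fun n => Nat.clog 2 (k n) + 1) dom)
  (C : CPRF dom ran) (P : PKE (fun n => C.skLen n (κ n) + E.keyLen n)) (D : ConstraintCircuits E κ)
  (A : Adversary) (u : Uniformity) (S₁ S₂ S₃ : ℕ → Set Mem) (T : ℕ → ℕ) : Prop where
  advice : u.Advice A.advice
  prims : ∀ adv, u.Advice adv → EfficientPrimitives E C P D adv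
  stages : Stages A (fun n => Bits (P.pkLen n)) (fun n => Bits (P.ctLen n) × Bits (C.skLen n (κ n)))
    (fun n => Bool × Bits (dom n) × Bits (ran n)) (fun n => Bits (P.ctLen n) × Fin (k n))
    (fun n => Bool × Bits (dom n) × Bits (ran n)) S₁ S₂ S₃ T

variable {S₁ S₂ S₃ : ℕ → Set Mem} {T : ℕ → ℕ}

theorem map_bind_pmf {α β γ : Type} (p : PMF α) (f : α → PMF β) (g : β → γ) :
    (p >>= f).map g = p >>= fun a => (f a).map g := PMF.map_bind p f g

theorem map_pure_pmf {α β : Type} (a : α) (f : α → β) : (pure a : PMF α).map f = pure (f a) :=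
  PMF.pure_map f a

/-- The reduction draws all keys itself and offers `G_auth‖K` and zeros as its two plaintexts. It
answers queries for the challenge tag with the keys it knows and asks the decryption oracle for
every other tag, so it never violates the CCA rules. -/
theorem pke_step (hA : HybridAdversary E C P D A u S₁ S₂ S₃ T) (hP : P.CCASecure u) :
    Negl fun n => |prob (tagGame hk E C P D A n true) - prob (tagGame hk E C P D A n false)| := by
  have t := hA.prims _ hA.advice
  have hT := hA.stages.poly
  have post₀ : Eff A.advice (α := fun _ => (Unit × Str) × Str)
      (β := fun n => (Bits (E.keyLen n) × Bits (C.mskLen n (κ n)) × Bits (C.skLen n (κ n)) ×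
        Bits (C.skLen n (κ n)) × Bits (k n) × Fin (k n)) ×
        Bits (C.skLen n (κ n) + E.keyLen n) × Bits (C.skLen n (κ n) + E.keyLen n))
      fun n z => E.gen n >>= fun key => C.setup n (κ n) >>= fun msk =>
        C.constrain n (κ n) msk (D.auth n key) >>= fun skA =>
        C.constrain n (κ n) msk (D.mark n key (readBits (k n) z.1.2)) >>= fun c =>
        pure ((key, msk, skA, c, readBits (k n) z.1.2, readFin (hk n) z.2),
          Fin.append skA key, fun _ => false) := by
    refine Eff.bind t.gen_of (Eff.bind t.setup_of (Eff.bind (t.constrain_of ?_ (t.auth_of ?_))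
      (Eff.bind (t.constrain_of ?_ (t.mark_of ?_ (EffD.readBits t.kLen ?_)))
      (EffD.pair (EffD.pair ?_ (EffD.pair ?_ (EffD.pair ?_ (EffD.pair ?_ (EffD.pair
        (EffD.readBits t.kLen ?_) (EffD.readFin t.kLen hk ?_))))))
        (EffD.pair (EffD.appendBits t.cskLen.1 ?_ ?_) (EffD.zeros (t.cskLen.add t.keyLen)))))))
    -- What remains are projections of the input tuple.
    all_goals repeat first | with_reducible apply EffD.fst | with_reducible apply EffD.snd | with_reducible exact EffD.id
  obtain ⟨P₀, h₀⟩ := (Realized.silentRound (adv := A.advice) (X := fun n => Bits (P.ctLen n))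
    (Y := fun n => Option (Bits (C.skLen n (κ n) + E.keyLen n)))
    (S := fun n => Unit × Bits (P.pkLen n)) (S₁ := fun _ => Unit) (V := fun n => Bits (P.pkLen n))
    A 0 (pre := fun n z => pure z) EffD.id post₀ EffD.advice (Nat.le_of_ble_eq_true rfl) (Nat.le_of_ble_eq_true rfl)
    hA.stages.run₀ ⟨T, hT, hA.stages.clock₁⟩).round (Nat.le_of_ble_eq_true rfl) (Nat.le_of_ble_eq_true rfl) (Nat.le_of_ble_eq_true rfl)
  have pre₁ : Eff A.advice (α := fun n => (Bits (E.keyLen n) × Bits (C.mskLen n (κ n)) ×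
        Bits (C.skLen n (κ n)) × Bits (C.skLen n (κ n)) × Bits (k n) × Fin (k n)) × Bits (P.ctLen n))
      fun n z => pure (z, z.2, z.1.2.2.2.1) := by
    refine EffD.pair EffD.id (EffD.pair ?_ ?_)
    all_goals repeat first | with_reducible apply EffD.fst | with_reducible apply EffD.snd | with_reducible exact EffD.id
  have hask : EffO A.advice (X := fun n => Bits (P.ctLen n))
      (Y := fun n => Option (Bits (C.skLen n (κ n) + E.keyLen n)))
      (α := fun n => ((Bits (E.keyLen n) × Bits (C.mskLen n (κ n)) ×
        Bits (C.skLen n (κ n)) × Bits (C.skLen n (κ n)) × Bits (k n) × Fin (k n)) × Bits (P.ctLen n)) ×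
        Bits (P.ctLen n) × Fin (k n))
      (β := fun n => ((Bits (E.keyLen n) × Bits (C.mskLen n (κ n)) ×
        Bits (C.skLen n (κ n)) × Bits (C.skLen n (κ n)) × Bits (k n) × Fin (k n)) × Bits (P.ctLen n)) ×
        Bool × Bits (dom n) × Bits (ran n)) _ :=
    -- The decryption oracle is asked only if the tag differs from the challenge ciphertext `z.1.2`.
    EffO.ask (pre := fun n z => pure (z, z.2.1)) (c := fun n z => !decide (z.2.1 = z.1.2))
      (post := fun n z y => simOpt E C y z.2.2 >>= fun r => pure (z.1, r))
      (other := fun n z => coin >>= fun γ => E.enc n z.1.1.1 (indexed z.2.2 γ) >>= fun x =>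
        pure (z.1, γ, x, C.ceval n (κ n) z.1.1.2.2.1 x))
      (by
        refine EffD.pair EffD.id ?_
        all_goals repeat first | with_reducible apply EffD.fst | with_reducible apply EffD.snd | with_reducible exact EffD.id)
      (EffD.not (EffD.eqBits t.ctLen.1 (EffD.fst (EffD.snd EffD.id)) (EffD.snd (EffD.fst EffD.id))))
      (by
        refine Eff.bind (t.simOpt_of ?_ ?_) (EffD.pair ?_ ?_)
        all_goals repeat first | with_reducible apply EffD.fst | with_reducible apply EffD.snd | with_reducible exact EffD.id)
      (by
        refine Eff.bind Eff.coin (Eff.bind (t.enc_of ?_ (EffD.indexed t.kLen ?_ ?_))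
          (EffD.pair ?_ (EffD.pair ?_ (EffD.pair ?_ (t.ceval_of ?_ ?_)))))
        all_goals repeat first | with_reducible apply EffD.fst | with_reducible apply EffD.snd | with_reducible exact EffD.id)
  have post₁ : Eff A.advice (α := fun n => (Bits (E.keyLen n) × Bits (C.mskLen n (κ n)) ×
        Bits (C.skLen n (κ n)) × Bits (C.skLen n (κ n)) × Bits (k n) × Fin (k n)) × Bits (P.ctLen n))
      (β := fun n => Bool × Bool × Bits (dom n) × Bits (ran n))
      fun n z => coin >>= fun b => challenge E z.1.1 z.1.2.2.2.2.2 (fun γ x =>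
        if b then pure (C.ceval n (κ n) z.1.2.2.1 x) else
          maskedEval C z.1.2.1 z.1.2.2.2.2.1 z.1.2.2.2.2.2 γ x) b >>= fun r => pure (b, r) := by
    refine Eff.bind Eff.coin (Eff.bind (t.challenge_of ?_ ?_ ?_ (Eff.ite ?_ (t.ceval_of ?_ ?_)
      (t.maskedEval_of ?_ ?_ ?_ ?_ ?_))) (EffD.pair ?_ ?_))
    all_goals repeat first | with_reducible apply EffD.fst | with_reducible apply EffD.snd | with_reducible exact EffD.id
  have hlast : Eff A.advice (α := fun _ => (Bool × Str) × Str) (β := fun _ => Unit × Bool)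
      fun n z => pure ((), readBool z.1.2 == z.1.1) := by
    refine EffD.pair EffD.unit (EffD.beqBool (EffD.readBool ?_) ?_)
    all_goals repeat first | with_reducible apply EffD.fst | with_reducible apply EffD.snd | with_reducible exact EffD.id
  obtain ⟨P₁, h₁⟩ := ((Realized.oracleRound A 1 pre₁ hask (EffO.of_eff post₁) rfl
    (EffD.isTagQuery t.ctLen t.kLen) EffD.advice (Nat.le_of_ble_eq_true rfl) (Nat.le_of_ble_eq_true rfl) hA.stages.run₁
    ⟨T, hT, hA.stages.clock₂⟩).seq (Realized.silentRound A 2 (pre := fun n z => pure z) EffD.id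
      hlast EffD.advice (Nat.le_of_ble_eq_true rfl) (Nat.le_of_ble_eq_true rfl) hA.stages.run₂ ⟨T, hT, hA.stages.clock₃⟩)).round
      (Nat.le_of_ble_eq_true rfl) (Nat.le_of_ble_eq_true rfl) (Nat.le_of_ble_eq_true rfl)
  let B : Adversary := ⟨fun j => if j = 0 then P₀ else P₁, A.advice⟩
  have hB := PKE.qpt (B := B) hA.advice h₀ h₁
  refine (hP.2.2 B hB).of_le fun n => ?_
  rw [abs_abs, PKE.game_eq (B := B) h₀ h₁]
  simp only [bind_assoc, LawfulMonad.pure_bind]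
  rw [← advantage_guess fun b => tagGame hk E C P D A n b]
  refine le_of_eq (congrArg advantage ?_)
  simp only [tagGame, opening, play, guess, bind_assoc, LawfulMonad.pure_bind]
  -- The coin, which stands in front for `advantage_guess`, is commuted past each sample up to the
  -- place where the CCA game tosses it.
  refine (bind_comm_pmf _ _ _).trans (bind_congr_support fun keys _ => ?_)
  refine (bind_comm_pmf _ _ _).trans (bind_congr_support fun s _ => ?_)
  refine (bind_comm_pmf _ _ _).trans (bind_congr_support fun key _ => ?_)
  refine (bind_comm_pmf _ _ _).trans (bind_congr_support fun msk _ => ?_)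
  refine (bind_comm_pmf _ _ _).trans (bind_congr_support fun skA _ => ?_)
  refine (bind_comm_pmf _ _ _).trans (bind_congr_support fun c _ => ?_)
  refine bind_congr_support fun b _ => bind_congr_support fun τ _ => ?_
  -- The invariant contains that `τ` is not among the logged queries, so the penalty of the game
  -- never applies.
  refine ((A.run_couples (R := fun st _ => st.1 = ((key, msk, skA, c, readBits (k n) (s.1.regs 0),
    readFin (hk n) (s.1.regs 1)), τ) ∧ τ ∉ st.2) ?_ n 1 _ _ ⟨rfl, List.not_mem_nil⟩).bind_eq ?_).symm
  · rintro ⟨_, log⟩ ⟨⟩ q ⟨rfl, hlog⟩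
    simp only [handle, tagged, simVia]
    by_cases hq : q.1 = τ
    · simp only [hq, decide_true, Bool.not_true, Bool.false_eq_true, if_false, if_true, map_bind_pmf,
        map_pure_pmf, LawfulMonad.pure_bind]
      refine (Couples.refl _).bind ?_
      rintro γ _ rfl
      refine (Couples.refl _).bind ?_
      rintro x _ rfl
      exact Couples.pure ⟨rfl, rfl, hlog⟩
    · simp only [hq, decide_false, Bool.not_false, if_false, if_true, map_bind_pmf,
        map_pure_pmf, logging, LawfulMonad.pure_bind]
      refine (Couples.refl _).bind ?_
      rintro z _ rfl
      refine Couples.pure ⟨rfl, rfl, ?_⟩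
      simp only [List.mem_cons, not_or]
      exact ⟨fun h => hq h.symm, hlog⟩
  · rintro ⟨s', _, log⟩ ⟨_, ⟨⟩⟩ ⟨rfl, rfl, hlog⟩
    simp only [hlog, if_false]

end Reductions

/-! ## Correctness -/

theorem eq_true_of_prob_eq_one {g : PMF Bool} (h : prob g = 1) {b : Bool} (hb : b ∈ g.support) : b = true := by
  cases b with
  | true => rfl
  | false =>
    have h1 := pmf_bool_false g
    rw [show (g true).toReal = 1 from h, sub_self, ENNReal.toReal_eq_zero_iff] at h1
    exact absurd (h1.resolve_right (g.apply_ne_top _)) ((PMF.mem_support_iff _ _).1 hb)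

theorem SKE.Correct.dec_enc {pt ct : ℕ → ℕ} {E : SKE pt ct} (h : E.Correct) {n : ℕ} {key : Bits (E.keyLen n)}
    (hk : key ∈ (E.gen n).support) {p : Bits (pt n)} {x : Bits (ct n)} (hx : x ∈ (E.enc n key p).support) :
    E.dec n key x = some p :=
  of_decide_eq_true (eq_true_of_prob_eq_one (h n p)
    (mem_support_bind.2 ⟨key, hk, mem_support_bind.2 ⟨x, hx, mem_support_pure.2 rfl⟩⟩))

theorem PKE.Correct.dec_enc {pt : ℕ → ℕ} {E : PKE pt} (h : E.Correct) {n : ℕ} {keys}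
    (hk : keys ∈ (E.gen n).support) {p : Bits (pt n)} {x : Bits (E.ctLen n)}
    (hx : x ∈ (E.enc n keys.1 p).support) : E.dec n keys.2 x = some p :=
  of_decide_eq_true (eq_true_of_prob_eq_one (h n p)
    (mem_support_bind.2 ⟨keys, hk, mem_support_bind.2 ⟨x, hx, mem_support_pure.2 rfl⟩⟩))

/-! ### The true game as first hybrid, and constrained keys at sampled points. -/

section Reductions

variable {k dom ran κ : ℕ → ℕ} (hk : ∀ n, 0 < k n) (E : SKE (fun n => Nat.clog 2 (k n) + 1) dom)
  (C : CPRF dom ran) (P : PKE (fun n => C.skLen n (κ n) + E.keyLen n)) (D : ConstraintCircuits E κ)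
  (A : Adversary)

/-- The game from the second round on. -/
noncomputable def lateGame (n : ℕ) (o : (Bits (P.pkLen n) × Bits (P.skLen n)) × Mem × Bits (k n) × Fin (k n)) :
    PMF Bool :=
  C.setup n (κ n) >>= fun msk => E.gen n >>= fun key =>
  C.constrain n (κ n) msk (D.auth n key) >>= fun skA => P.enc n o.1.1 (Fin.append skA key) >>= fun τ =>
  C.constrain n (κ n) msk (D.mark n key o.2.2.1) >>= fun c =>
  A.run n 1 (oracle fun (_ : Unit) (q : Bits (P.ctLen n) × Fin (k n)) =>
    simOpt E C (P.dec n o.1.2 q.1) q.2 >>= fun z => pure (z, ())) (rep (τ, c)) (o.2.1, ()) >>= fun t =>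
  coin >>= fun b => (if b then simOpt E C (P.dec n o.1.2 τ) o.2.2.2 else
    challenge E key o.2.2.2 (maskedEval C msk o.2.2.1 o.2.2.2) false) >>= fun z =>
  guess A n z t.1 >>= fun v => pure (v == b)

variable {E C P D A}

theorem simOpt_append {n : ℕ} (skA : Bits (C.skLen n (κ n))) (key : Bits (E.keyLen n)) (i : Fin (k n)) :
    simOpt E C (some (Fin.append skA key)) i = coin >>= fun γ => E.enc n key (indexed i γ) >>= fun x =>
      pure (γ, x, C.ceval n (κ n) skA x) := by
  simp [simOpt]

/-- By perfect correctness the challenge tag decrypts to `G_auth‖K`. The separate treatment of this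
tag, in the oracle and in the challenge, thus gives what decrypting it would give. -/
theorem tagGame_false (hP : P.Correct) (n : ℕ) :
    tagGame hk E C P D A n false = opening hk E C P A n >>= lateGame E C P D A n := by
  refine bind_congr_support fun o ho => ?_
  have ho' : o.1 ∈ (P.gen n).support := by
    obtain ⟨keys, hkeys, h⟩ := mem_support_bind.1 ho
    obtain ⟨t, -, h⟩ := mem_support_bind.1 h
    rw [mem_support_pure.1 h]
    exact hkeys
  refine (bind_comm_pmf _ _ _).trans (bind_congr_support fun msk _ => bind_congr_support fun key _ =>
    bind_congr_support fun skA _ => (bind_comm_pmf _ _ _).trans (bind_congr_support fun τ hτ =>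
      bind_congr_support fun c _ => ?_))
  have hd := hP.dec_enc ho' hτ
  refine ((A.run_couples (R := fun _ _ => True) ?_ n 1 _ _ trivial).bind_eq ?_)
  · rintro ⟨⟩ ⟨⟩ q -
    rw [tagged]
    split_ifs with hq
    · rw [hq, hd]
      simp only [Bool.false_eq_true, if_false, simOpt_append, simVia, bind_assoc, LawfulMonad.pure_bind]
      exact (Couples.refl _).mono (by rintro _ _ rfl; exact ⟨rfl, trivial⟩)
    · exact (Couples.refl _).mono (by rintro _ _ rfl; exact ⟨rfl, trivial⟩)
  · rintro ⟨a, ⟨⟩⟩ ⟨_, ⟨⟩⟩ ⟨rfl, -⟩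
    refine bind_congr_support fun b _ => ?_
    congr 1
    cases b
    · rfl
    · rw [hd]
      simp only [Bool.false_eq_true, if_false, if_true, simOpt_append, challenge, LawfulMonad.pure_bind]

/-- The constrained keys are correct at the outputs of efficient samplers. -/
theorem CPRF.Correct.sample {u : Uniformity} (hC : C.Correct u) {adv : ℕ → Str} (hadv : u.Advice adv)
    (hκ : EffLen adv κ) {S : ℕ → Type} [∀ n, BitRep (S n)] [Arity S] (hS : 16 + (Arity.ar S + 2) ≤ 90)
    {F : ∀ n, PMF (S n × Circ (dom n) (κ n))} (hF : Eff adv fun n (_ : Unit) => F n)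
    {G : ∀ n, S n → PMF (Bits (dom n))} (hG : Eff adv G) :
    Negl fun n => prob (F n >>= fun r => C.setup n (κ n) >>= fun msk => C.constrain n (κ n) msk r.2 >>= fun sk =>
      G n r.1 >>= fun x =>
      pure (decide (C.eval n (κ n) msk x ≠ C.ceval n (κ n) sk x ∧ r.2.eval x = false))) := by
  have first : Eff adv (α := fun _ => Unit × Unit) (β := fun n => S n × CPRF.FirstMessage dom κ n)
      fun n _ => F n >>= fun r => pure (r.1, ⟨unary (κ n), rfl⟩, r.2) := by
    refine Eff.bind (Eff.compD hF EffD.unit) (EffD.pair ?_ (EffD.pair (EffD.single hκ.eff) ?_))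
    all_goals repeat first | with_reducible apply EffD.fst | with_reducible apply EffD.snd | with_reducible exact EffD.id
  have last : Eff adv (α := fun n => S n × Bits (C.skLen n (κ n))) (β := fun n => Unit × Bits (dom n))
      fun n z => G n z.1 >>= fun x => pure ((), x) := by
    refine Eff.bind (Eff.compD hG (EffD.fst EffD.id)) (EffD.pair EffD.unit (EffD.snd EffD.id))
  have e : Arity.ar (fun n => S n × CPRF.FirstMessage dom κ n) = Arity.ar S + 2 := rfl
  have e' : Arity.ar (fun n => S n × Bits (C.skLen n (κ n))) = Arity.ar S + 1 := rfl
  have e₁ : Arity.ar (fun n => Bits (C.skLen n (κ n))) = 1 := rfl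
  obtain ⟨P₀, h₀⟩ := (Realized.eff (X := fun _ => Empty) (Y := fun _ => Unit)
    (Pre := fun _ => {Mem.empty}) first (by omega)).round (Nat.le_of_ble_eq_true rfl)
      (Nat.le_of_ble_eq_true rfl) (Nat.le_of_ble_eq_true rfl)
  obtain ⟨P₁, h₁⟩ := (Realized.eff (X := fun n => Bits (dom n)) (Y := fun n => Bits (ran n))
    (Pre := fun _ => {Mem.empty}) last (Nat.le_of_ble_eq_true rfl)).round (Nat.le_of_ble_eq_true rfl)
      (Nat.le_of_ble_eq_true rfl) (by omega)
  let B : Adversary := ⟨fun j => if j = 0 then P₀ else P₁, adv⟩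
  have hB := CPRF.qpt₂ (B := B) (C := C) hadv h₀ h₁
  refine (hC B hB).of_le fun n => le_of_eq ?_
  rw [abs_of_nonneg (prob_nonneg _), CPRF.correctnessGame_eq (B := B) h₀ h₁]
  simp only [bind_assoc, LawfulMonad.pure_bind]

end Reductions

/-! ## The constrained key of the tag -/

theorem Approx.bind_eq_self {α γ : Type} {p q : PMF α} {k l : α → PMF γ} {ε ε' : ENNReal}
    (h : Approx p q Eq ε) (h' : ∀ a, Approx (k a) (l a) Eq ε') : Approx (p >>= k) (q >>= l) Eq (ε' + ε) :=
  h.bind (by rintro a _ rfl; exact h' a)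

theorem Approx.bind_const {α γ : Type} {p : PMF α} {k l : α → PMF γ} {ε : ENNReal}
    (h : ∀ a ∈ p.support, Approx (k a) (l a) Eq ε) : Approx (p >>= k) (p >>= l) Eq ε := by
  have := Approx.bind_self (e := fun _ => ε) h
  rwa [expect_const] at this

/-- Values that differ only in an event of small probability. -/
theorem Approx.of_event {α β : Type} (p : PMF α) (f g : α → β) (bad : α → Prop) [DecidablePred bad]
    (h : ∀ a ∈ p.support, ¬ bad a → f a = g a) :
    Approx (p >>= fun a => Pure.pure (f a)) (p >>= fun a => Pure.pure (g a)) Eq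
      (expect p fun a => if bad a then 1 else 0) := by
  refine Approx.bind_self fun a ha => ?_
  split_ifs with hb
  · exact Approx.one
  · rw [h a ha hb]
    exact Approx.refl _

/-- Used to pass from a uniform plaintext, which a reduction can sample, to all plaintexts at once.
The factor `2^L` is polynomial for `L = ⌈log₂ k⌉ + 1`, by `two_pow_clog_le`. -/
theorem expect_unif (L : ℕ) (f : Bits L → ENNReal) : ∑ p, f p = 2 ^ L * expect (unif L) f := by
  rw [expect, tsum_fintype, Finset.mul_sum]
  refine Finset.sum_congr rfl fun p _ => ?_
  rw [unif, PMF.uniformOfFintype_apply, ← mul_assoc]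
  simp only [Fintype.card_pi, Fintype.card_bool, Finset.prod_const, Finset.card_univ, Fintype.card_fin,
    Nat.cast_pow, Nat.cast_ofNat]
  rw [ENNReal.mul_inv_cancel (by simp) (by simp), one_mul]

theorem pure_decide_true (q : Prop) [Decidable q] : (pure (decide q) : PMF Bool) true = if q then 1 else 0 := by
  show (PMF.pure _) true = _
  rw [PMF.pure_apply]
  by_cases h : q <;> simp [h]

theorem ofReal_prob (g : PMF Bool) : ENNReal.ofReal (prob g) = g true :=
  ENNReal.ofReal_toReal (g.apply_ne_top _)

theorem two_pow_clog_le {k : ℕ} (hk : 0 < k) : 2 ^ Nat.clog 2 k ≤ 2 * k := by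
  rcases Nat.lt_or_ge 1 k with h | h
  · have h1 := Nat.pow_pred_clog_lt_self (b := 2) (by norm_num) h
    have h2 : 0 < Nat.clog 2 k := Nat.clog_pos (by norm_num) h
    calc 2 ^ Nat.clog 2 k = 2 ^ (Nat.clog 2 k).pred * 2 := by
          rw [← pow_succ, Nat.pred_eq_sub_one, Nat.sub_add_cancel h2]
      _ ≤ 2 * k := by omega
  · obtain rfl : k = 1 := by omega
    simp

section Reductions

variable {k dom ran κ : ℕ → ℕ} {hk : ∀ n, 0 < k n} {E : SKE (fun n => Nat.clog 2 (k n) + 1) dom}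
  {C : CPRF dom ran} {P : PKE (fun n => C.skLen n (κ n) + E.keyLen n)} {D : ConstraintCircuits E κ}
  {u : Uniformity} {A : Adversary} {S₁ S₂ S₃ : ℕ → Set Mem} {T : ℕ → ℕ}

theorem HybridAdversary.opening (hA : HybridAdversary E C P D A u S₁ S₂ S₃ T) {n : ℕ} {o}
    (ho : o ∈ (opening hk E C P A n).support) : o.1 ∈ (P.gen n).support ∧ o.2.1 ∈ S₁ n := by
  obtain ⟨keys, hkeys, h⟩ := mem_support_bind.1 ho
  obtain ⟨t, ht, h⟩ := mem_support_bind.1 h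
  rw [mem_support_pure.1 h]
  exact ⟨hkeys, hA.stages.run₀ n _ rfl _ _ ht⟩

/-- A union bound: every query takes a step, so there are at most `T n` queries with error `ε`, and
one challenge with error `ε'`. -/
theorem play_approx (hA : HybridAdversary E C P D A u S₁ S₂ S₃ T) {n : ℕ} {a : Mem} (ha : a ∈ S₁ n)
    (sk : Bits (P.skLen n)) (key : Bits (E.keyLen n)) (i : Fin (k n)) (τ : Bits (P.ctLen n))
    (c : Bits (C.skLen n (κ n))) {σ : Type}
    {G₁ G₂ : σ → Fin (k n) → Bool → Bits (dom n) → PMF (Bits (ran n) × σ)}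
    {R₁ R₂ : σ → Bool → Bool → Bits (dom n) → PMF (Bits (ran n))} {ε ε' : ENNReal}
    (hG : ∀ st i, Approx (simVia E key G₁ st i) (simVia E key G₂ st i) Eq ε)
    (hR : ∀ st b, Approx (challenge E key i (R₁ st b) b) (challenge E key i (R₂ st b) b) Eq ε') (st : σ) :
    Approx (play E C P A sk a key i τ c G₁ R₁ st) (play E C P A sk a key i τ c G₂ R₂ st) Eq
      (ε' + T n * ε) := by
  refine (Adversary.run_approx (R := Eq) ?_ A n 1 _ a rfl fun t ht =>
    hA.stages.clock₂ n _ (hA.stages.run₁ n σ _ a ha (τ, c) st t ht)).bind ?_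
  · rintro st _ q rfl
    rw [tagged, tagged]
    split_ifs
    · exact (hG st q.2).mono (by rintro _ _ rfl; exact ⟨rfl, rfl⟩) le_rfl
    · exact (Approx.refl _).mono (by rintro _ _ rfl; exact ⟨rfl, rfl⟩) bot_le
  · rintro ⟨a, st⟩ ⟨_, _⟩ ⟨rfl, rfl⟩
    refine Approx.bind_const fun b _ => ?_
    have := (hR st b).bind_eq_self (ε' := 0) (k := fun z => guess A n z a >>= fun v => pure (v == b)) fun z =>
      Approx.refl _
    rwa [zero_add] at this

theorem simVia_approx {n : ℕ} (key : Bits (E.keyLen n)) {σ : Type}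
    {G₁ G₂ : σ → Fin (k n) → Bool → Bits (dom n) → PMF (Bits (ran n) × σ)} {ε : ENNReal} (st : σ) (i : Fin (k n))
    (h : ∀ γ, Approx (E.enc n key (indexed i γ) >>= fun x => G₁ st i γ x >>= fun y => pure (x, y))
      (E.enc n key (indexed i γ) >>= fun x => G₂ st i γ x >>= fun y => pure (x, y)) Eq ε) :
    Approx (simVia E key G₁ st i) (simVia E key G₂ st i) Eq ε := by
  refine Approx.bind_const fun γ _ => ?_
  have := (h γ).bind_eq_self (ε' := 0) (k := fun z : Bits (dom n) × Bits (ran n) × σ =>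
    pure ((γ, z.1, z.2.1), z.2.2)) fun z => Approx.refl _
  rw [zero_add] at this
  simpa only [bind_assoc, LawfulMonad.pure_bind] using this

theorem challenge_approx {n : ℕ} (key : Bits (E.keyLen n)) (i : Fin (k n))
    {R₁ R₂ : Bool → Bits (dom n) → PMF (Bits (ran n))} {ε : ENNReal} (b : Bool)
    (h : ∀ γ, Approx ((if b then E.enc n key (indexed i γ) else unif (dom n)) >>= fun x =>
        R₁ γ x >>= fun y => pure (x, y))
      ((if b then E.enc n key (indexed i γ) else unif (dom n)) >>= fun x =>
        R₂ γ x >>= fun y => pure (x, y)) Eq ε) :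
    Approx (challenge E key i R₁ b) (challenge E key i R₂ b) Eq ε := by
  refine Approx.bind_const fun γ _ => ?_
  have := (h γ).bind_eq_self (ε' := 0) (k := fun z : Bits (dom n) × Bits (ran n) =>
    pure (γ, z.1, z.2)) fun z => Approx.refl _
  rw [zero_add] at this
  simpa only [bind_assoc, LawfulMonad.pure_bind] using this

/-- For fixed keys, let `W` be the sum over all plaintexts `p` of the probability that `G_auth` errs
at an encryption of `p`. It bounds the error of each answer, whatever indices the adversary asks
for. On average `W` is at most `4k` times the success probability of a correctness adversary that
makes no queries and encrypts a uniform plaintext. Hence `A` itself does not occur in the reduction.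
-/
theorem ceval_step (hA : HybridAdversary E C P D A u S₁ S₂ S₃ T) (hE : E.Correct) (hC : C.Correct u) :
    Negl fun n => |prob (tagGame hk E C P D A n true) - prob (evalGame hk E C P D A n
      fun msk m i b γ x => if b then pure (C.eval n (κ n) msk x) else maskedEval C msk m i γ x)| := by
  have t := hA.prims _ hA.advice
  have hN := hC.sample (S := fun n => Bits (E.keyLen n)) hA.advice t.κLen (Nat.le_of_ble_eq_true rfl)
    (F := fun n => E.gen n >>= fun key => pure (key, D.auth n key))
    (Eff.bind t.gen_of (EffD.pair (EffD.snd EffD.id) (t.auth_of (EffD.snd EffD.id))))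
    (G := fun n key => unif _ >>= fun p => E.enc n key p)
    (Eff.bind (Eff.unif t.kLen.clog.succ) (t.enc_of (EffD.fst EffD.id) (EffD.snd EffD.id)))
  have hL : PolyLe fun n => (T n + 1) * (2 * (2 * k n)) :=
    (hA.stages.poly.add (PolyLe.const 1)).mul ((PolyLe.const 2).mul ((PolyLe.const 2).mul t.kLen.1))
  refine negl_of_approx (fun n => ?_) (hN.poly_mul hL)
    (fun n => mul_nonneg (Nat.cast_nonneg _) (prob_nonneg _)) (e := fun n => (T n + 1) *
      expect (E.gen n) fun key => expect (C.setup n (κ n)) fun msk =>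
      expect (C.constrain n (κ n) msk (D.auth n key)) fun sk => ∑ p, expect (E.enc n key p) fun x =>
        if C.eval n (κ n) msk x ≠ C.ceval n (κ n) sk x ∧ (D.auth n key).eval x = false then 1 else 0) fun n => ?_
  · refine Approx.bind_const fun o ho => ?_
    obtain ⟨-, ha⟩ := hA.opening ho
    simp only [← expect_mul_left]
    refine Approx.bind_self fun key hkey => Approx.bind_self fun msk _ => ?_
    -- The second game has no constrained key for `D_auth`; an idle sample of one aligns it with the
    -- first game.
    conv => arg 2; rw [← bind_const_pmf (C.constrain n (κ n) msk (D.auth n key)) (C.constrain n (κ n) msk _ >>= _)]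
    refine Approx.bind_self fun sk _ => Approx.bind_const fun c _ => Approx.bind_const fun τ _ => ?_
    set W := ∑ p, expect (E.enc n key p) fun x =>
        if C.eval n (κ n) msk x ≠ C.ceval n (κ n) sk x ∧ (D.auth n key).eval x = false then 1 else 0 with hW
    have key' : ∀ p, Approx (E.enc n key p >>= fun x => pure (x, C.ceval n (κ n) sk x))
        (E.enc n key p >>= fun x => pure (x, C.eval n (κ n) msk x)) Eq W := by
      intro p
      refine (Approx.of_event _ _ _ (fun x => C.eval n (κ n) msk x ≠ C.ceval n (κ n) sk x ∧
        (D.auth n key).eval x = false) fun x hx hb => ?_).mono (fun _ _ h => h)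
        (Finset.single_le_sum (f := fun p => expect (E.enc n key p) _) (fun _ _ => bot_le) (Finset.mem_univ p))
      -- Ciphertexts decrypt, so `D_auth` is 0 and every disagreement counts as a violation of
      -- correctness.
      have h1 : (D.auth n key).eval x = false := by
        rw [← Bool.not_eq_true, D.auth_eval, hE.dec_enc hkey hx]
        simp
      simp only [h1, and_true, ne_eq, not_not] at hb
      rw [hb]
    have h := play_approx hA ha o.1.2 key o.2.2.2 τ c (σ := Unit) (ε := W) (ε' := W)
      (G₁ := fun _ _ _ x => pure (C.ceval n (κ n) sk x, ()))
      (G₂ := fun _ _ _ x => pure (C.eval n (κ n) msk x, ()))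
      (R₁ := fun _ b γ x => if b then pure (C.ceval n (κ n) sk x) else maskedEval C msk o.2.2.1 o.2.2.2 γ x)
      (R₂ := fun _ b γ x => if b then pure (C.eval n (κ n) msk x) else maskedEval C msk o.2.2.1 o.2.2.2 γ x)
      (fun st i => simVia_approx _ _ _ fun γ => ?_) (fun st b => challenge_approx _ _ _ fun γ => ?_) ()
    · rwa [add_comm, ← add_one_mul (T n : ENNReal) W] at h
    · have := (key' (indexed i γ)).bind_eq_self (ε' := 0) (k := fun z : Bits (dom n) × Bits (ran n) =>
        pure (z.1, z.2, ())) fun z => Approx.refl _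
      rw [zero_add] at this
      simpa only [bind_assoc, LawfulMonad.pure_bind] using this
    · cases b
      · exact (Approx.refl _).mono (fun _ _ h => h) bot_le
      · simpa only [if_true, LawfulMonad.pure_bind] using key' (indexed o.2.2.2 γ)
  · simp only [expect_unif]
    have hb : ((T n : ENNReal) + 1) * 2 ^ (Nat.clog 2 (k n) + 1) ≤ ((T n + 1) * (2 * (2 * k n)) : ℕ) := by
      have := two_pow_clog_le (hk n)
      push_cast
      rw [pow_succ, mul_comm _ (2 : ENNReal)]
      gcongr
      exact_mod_cast this
    rw [ENNReal.ofReal_mul (Nat.cast_nonneg _), ENNReal.ofReal_natCast, ofReal_prob]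
    simp only [bind_assoc, LawfulMonad.pure_bind]
    simp only [expect_mul_left]
    rw [← mul_assoc]
    refine mul_le_mul' hb (le_of_eq ?_)
    simp only [bind_apply_true, pure_decide_true]

end Reductions

/-! ## Reductions in which the constrained PRF is queried -/

theorem prob_bind_coin {α : Type} (p : PMF α) (X : α → Bool → PMF Bool) :
    prob (p >>= fun a => coin >>= fun b => X a b) =
      (prob (p >>= fun a => X a true) + prob (p >>= fun a => X a false)) / 2 := by
  rw [bind_comm_pmf, prob_coin_bind]

/-- A coin is as good as whether it agrees with a given bit. -/
theorem coin_bind_ite {α : Type} (c : Bool) (X : Bool → PMF α) :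
    coin >>= X = coin >>= fun g => X (if g then c else !c) := by
  have h : ∀ Y : Bool → PMF α, ∀ a, (coin >>= Y) a = 2⁻¹ * Y true a + 2⁻¹ * Y false a := by
    intro Y a
    show (PMF.bind _ _) a = _
    rw [PMF.bind_apply, tsum_fintype, Fintype.sum_bool]
    simp [coin]
  refine PMF.ext fun a => ?_
  rw [h, h]
  cases c <;> simp [add_comm]

section Reductions

variable {k dom ran κ : ℕ → ℕ} (hk : ∀ n, 0 < k n) (E : SKE (fun n => Nat.clog 2 (k n) + 1) dom)
  (C : CPRF dom ran) (P : PKE (fun n => C.skLen n (κ n) + E.keyLen n)) (D : ConstraintCircuits E κ)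
  (A : Adversary)

/-- The keys, the message and the index in the game. -/
abbrev Secrets (n : ℕ) : Type :=
  (Bits (P.pkLen n) × Bits (P.skLen n)) × Bits (E.keyLen n) × Bits (k n) × Fin (k n)

/-- The simulation oracle with the value of an oracle. -/
noncomputable def queryTagged : Kernel (fun n => Bits (dom n)) (fun n => Bits (ran n))
    (fun n => (Secrets E C P n × Bits (P.ctLen n)) × Bits (P.ctLen n) × Fin (k n))
    (fun n => (Secrets E C P n × Bits (P.ctLen n)) × Bool × Bits (dom n) × Bits (ran n)) := fun n _ F z =>
  (coin >>= fun γ => E.enc n z.1.1.1.2.1 (indexed z.1.2.2 γ) >>= fun x => pure ((z.1, γ, x), x)) >>= fun r =>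
  if decide (r.1.1.2.1 = r.1.1.1.2) then F z.2 r.2 >>= fun y =>
    (pure (r.1.1.1, r.1.2.1, r.1.2.2, y.1) : PMF _) >>= fun b => pure (b, y.2)
  else (simOpt E C (P.dec n r.1.1.1.1.1.2 r.1.1.2.1) r.1.1.2.2 >>= fun s => pure (r.1.1.1, s)) >>= fun b =>
    pure (b, z.2)

/-- The game up to the challenge, with a list of the points at which the PRF is evaluated. -/
noncomputable def evalPrefix (n : ℕ) : PMF (Secrets E C P n × Bits (C.mskLen n (κ n)) × Mem × List (Bits (dom n))) :=
  opening hk E C P A n >>= fun o => E.gen n >>= fun key => C.setup n (κ n) >>= fun msk =>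
  C.constrain n (κ n) msk (D.mark n key o.2.2.1) >>= fun c => P.enc n o.1.1 (fun _ => false) >>= fun τ =>
  A.run n 1 (oracle (tagged E C P o.1.2 τ (simVia E key fun log _ _ => logging (fun x => pure (C.eval n (κ n) msk x)) log)))
    (rep (τ, c)) (o.2.1, []) >>= fun t => pure ((o.1, key, o.2.2), msk, t)

variable {hk E C P D A}

/-- The list of evaluated points has no influence on the answers; it is added to make repetitions of
the challenge point visible. -/
theorem evalGame_eq (n : ℕ) (R) : evalGame hk E C P D A n R =
    evalPrefix hk E C P D A n >>= fun r => coin >>= fun b =>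
      challenge E r.1.2.1 r.1.2.2.2 (R r.2.1 r.1.2.2.1 r.1.2.2.2 b) b >>= fun z =>
      guess A n z r.2.2.1 >>= fun v => pure (v == b) := by
  simp only [evalPrefix, bind_assoc, LawfulMonad.pure_bind]
  refine bind_congr_support fun o _ => bind_congr_support fun key _ => bind_congr_support fun msk _ =>
    bind_congr_support fun c _ => bind_congr_support fun τ _ => ?_
  refine (A.run_couples (R := fun _ _ => True) ?_ n 1 _ _ trivial).bind_eq ?_
  · rintro ⟨⟩ log q -
    rw [tagged, tagged]
    split_ifs
    · simp only [simVia, logging, map_pure_pmf, LawfulMonad.pure_bind]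
      refine (Couples.refl _).bind ?_
      rintro γ _ rfl
      refine (Couples.refl _).bind ?_
      rintro x _ rfl
      exact Couples.pure ⟨rfl, trivial⟩
    · refine (Couples.refl _).bind ?_
      rintro x _ rfl
      exact Couples.pure ⟨rfl, trivial⟩
  · rintro ⟨a, ⟨⟩⟩ ⟨_, log⟩ ⟨rfl, -⟩
    rfl

theorem EfficientPrimitives.queryTagged_of {adv : ℕ → Str} (t : EfficientPrimitives E C P D adv) :
    EffO adv (queryTagged E C P) := by
  have pre : Eff adv (α := fun n => (Secrets E C P n × Bits (P.ctLen n)) × Bits (P.ctLen n) × Fin (k n))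
      (β := fun n => (((Secrets E C P n × Bits (P.ctLen n)) × Bits (P.ctLen n) × Fin (k n)) × Bool ×
      Bits (dom n)) × Bits (dom n)) fun n z => coin >>= fun γ =>
      E.enc n z.1.1.2.1 (indexed z.2.2 γ) >>= fun x => pure ((z, γ, x), x) := by
    refine Eff.bind Eff.coin (Eff.bind (t.enc_of ?_ (EffD.indexed t.kLen ?_ ?_))
      (EffD.pair (EffD.pair ?_ (EffD.pair ?_ ?_)) ?_))
    all_goals repeat first | with_reducible apply EffD.fst | with_reducible apply EffD.snd | with_reducible exact EffD.id
  have test : EffD adv (α := fun n => ((Secrets E C P n × Bits (P.ctLen n)) × Bits (P.ctLen n) × Fin (k n)) × Bool ×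
      Bits (dom n)) fun n r => decide (r.1.2.1 = r.1.1.2) := by
    refine EffD.eqBits t.ctLen.1 ?_ ?_
    all_goals repeat first | with_reducible apply EffD.fst | with_reducible apply EffD.snd | with_reducible exact EffD.id
  have post : Eff adv (α := fun n => (((Secrets E C P n × Bits (P.ctLen n)) × Bits (P.ctLen n) × Fin (k n)) × Bool ×
      Bits (dom n)) × Bits (ran n)) (β := fun n => (Secrets E C P n × Bits (P.ctLen n)) × Bool × Bits (dom n) × Bits (ran n))
      fun n z => pure (z.1.1.1, z.1.2.1, z.1.2.2, z.2) := by
    refine EffD.pair ?_ (EffD.pair ?_ (EffD.pair ?_ ?_))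
    all_goals repeat first | with_reducible apply EffD.fst | with_reducible apply EffD.snd | with_reducible exact EffD.id
  have other : Eff adv (α := fun n => ((Secrets E C P n × Bits (P.ctLen n)) × Bits (P.ctLen n) × Fin (k n)) × Bool ×
      Bits (dom n)) (β := fun n => (Secrets E C P n × Bits (P.ctLen n)) × Bool × Bits (dom n) × Bits (ran n))
      fun n r => simOpt E C (P.dec n r.1.1.1.1.2 r.1.2.1) r.1.2.2 >>= fun s => pure (r.1.1, s) := by
    refine Eff.bind (t.simOpt_of (t.pdec_of ?_ ?_) ?_) (EffD.pair ?_ ?_)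
    all_goals repeat first | with_reducible apply EffD.fst | with_reducible apply EffD.snd | with_reducible exact EffD.id
  have h := EffO.ask (X := fun n => Bits (dom n)) (Y := fun n => Bits (ran n))
    (post := fun n z y => pure (z.1.1, z.2.1, z.2.2, y)) pre test post other
  exact h

/-- The kernel never changes the secrets and the tag that it carries, so its oracle is `tagged` with
one query to `F` for each query with this tag. -/
theorem queryTagged_run (n : ℕ) (s : Secrets E C P n) (τ : Bits (P.ctLen n)) {σ : Type}
    (F : σ → Bits (dom n) → PMF (Bits (ran n) × σ)) (xs : List Str) (a : Mem) (st : σ) :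
    Couples (A.run n 1 (oracle (handle (S := fun n => Secrets E C P n × Bits (P.ctLen n)) (queryTagged E C P) n σ F))
        xs (a, (s, τ), st))
      (A.run n 1 (oracle (tagged E C P s.1.2 τ (simVia E s.2.1 fun st _ _ x => F st x))) xs (a, st))
      fun t u => t.1 = u.1 ∧ t.2.1 = (s, τ) ∧ t.2.2 = u.2 := by
  refine A.run_couples (R := fun (w : (Secrets E C P n × Bits (P.ctLen n)) × σ) v => w.1 = (s, τ) ∧ w.2 = v) ?_ n 1 _ _ ⟨rfl, rfl⟩
  rintro ⟨_, st⟩ _ q ⟨rfl, rfl⟩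
  simp only [handle, tagged, queryTagged, simVia, bind_assoc, LawfulMonad.pure_bind, map_bind_pmf, decide_eq_true_eq]
  by_cases hq : q.1 = τ
  · simp only [hq, if_true, map_bind_pmf, map_pure_pmf]
    refine (Couples.refl _).bind ?_
    rintro γ _ rfl
    refine (Couples.refl _).bind ?_
    rintro x _ rfl
    refine (Couples.refl _).bind ?_
    rintro y _ rfl
    exact Couples.pure ⟨rfl, rfl, rfl⟩
  · simp only [hq, if_false, map_bind_pmf, map_pure_pmf, bind_const_pmf]
    refine (Couples.refl _).bind ?_
    rintro z _ rfl
    exact Couples.pure ⟨rfl, rfl, rfl⟩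

variable {u : Uniformity} {S₁ S₂ S₃ : ℕ → Set Mem} {T : ℕ → ℕ}

/-- The first round of the adversaries against the constrained PRF. -/
theorem HybridAdversary.firstRound (hA : HybridAdversary E C P D A u S₁ S₂ S₃ T) :
    ∃ Q, RealizesRound A.advice (X := fun _ => Empty) (Y := fun _ => Unit) (S := fun _ => Unit)
      (V := fun _ => Unit) (S' := Secrets E C P) (U := CPRF.FirstMessage dom κ) (fun _ => {Mem.empty}) S₁ Q
      fun n _ _ z => P.gen n >>= fun keys => A.run n 0 noOracle (rep keys.1) (z.2.1, ()) >>= fun t =>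
        E.gen n >>= fun key => pure (((keys, key, readBits (k n) (t.1.regs 0), readFin (hk n) (t.1.regs 1)),
          ⟨unary (κ n), rfl⟩, D.mark n key (readBits (k n) (t.1.regs 0))), t.1, z.2.2) := by
  have t := hA.prims _ hA.advice
  have pre : Eff A.advice (α := fun _ => Unit × Unit)
      (β := fun n => (Bits (P.pkLen n) × Bits (P.skLen n)) × Bits (P.pkLen n))
      fun n _ => P.gen n >>= fun keys => pure (keys, keys.1) := by
    refine Eff.bind t.pgen_of (EffD.pair ?_ ?_)
    all_goals repeat first | with_reducible apply EffD.fst | with_reducible apply EffD.snd | with_reducible exact EffD.id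
  have post : Eff A.advice (α := fun n => ((Bits (P.pkLen n) × Bits (P.skLen n)) × Str) × Str)
      (β := fun n => Secrets E C P n × CPRF.FirstMessage dom κ n) fun n z => E.gen n >>= fun key =>
        pure ((z.1.1, key, readBits (k n) z.1.2, readFin (hk n) z.2), ⟨unary (κ n), rfl⟩,
          D.mark n key (readBits (k n) z.1.2)) := by
    refine Eff.bind t.gen_of (EffD.pair (EffD.pair ?_ (EffD.pair ?_ (EffD.pair (EffD.readBits t.kLen ?_)
      (EffD.readFin t.kLen hk ?_)))) (EffD.pair (EffD.single t.κLen.eff) (t.mark_of ?_ (EffD.readBits t.kLen ?_))))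
    all_goals repeat first | with_reducible apply EffD.fst | with_reducible apply EffD.snd | with_reducible exact EffD.id
  refine (((Realized.silentRound A 0 pre post EffD.advice (Nat.le_of_ble_eq_true rfl)
    (Nat.le_of_ble_eq_true rfl) hA.stages.run₀ ⟨T, hA.stages.poly, hA.stages.clock₁⟩).congr
    fun n σ F z => ?_).round (Nat.le_of_ble_eq_true rfl) (Nat.le_of_ble_eq_true rfl) (Nat.le_of_ble_eq_true rfl))
  simp only [bind_assoc, LawfulMonad.pure_bind]

/-- The second round of the adversaries against the constrained PRF. -/
theorem HybridAdversary.secondRound (hA : HybridAdversary E C P D A u S₁ S₂ S₃ T) {S' : ℕ → Type}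
    [∀ n, BitRep (S' n)] [Arity S'] (h : Arity.ar S' ≤ 80)
    {post : Kernel (fun n => Bits (dom n)) (fun n => Bits (ran n)) (fun n => Secrets E C P n × Bits (P.ctLen n)) S'}
    (hpost : EffO A.advice post) :
    Realized A.advice (X := fun n => Bits (dom n)) (Y := fun n => Bits (ran n))
      (S := fun n => Secrets E C P n × Bits (C.skLen n (κ n))) (S' := S') S₁ S₂ fun n σ F z =>
        P.enc n z.1.1.1.1 (fun _ => false) >>= fun τ =>
        A.run n 1 (oracle (tagged E C P z.1.1.1.2 τ (simVia E z.1.1.2.1 fun st _ _ x => F st x))) (rep (τ, z.1.2))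
          (z.2.1, z.2.2) >>= fun t =>
        post n σ F ((z.1.1, τ), t.2) >>= fun y => pure (y.1, t.1, y.2) := by
  have t := hA.prims _ hA.advice
  have pre : Eff A.advice (α := fun n => Secrets E C P n × Bits (C.skLen n (κ n)))
      (β := fun n => (Secrets E C P n × Bits (P.ctLen n)) × Bits (P.ctLen n) × Bits (C.skLen n (κ n)))
      fun n z => P.enc n z.1.1.1 (fun _ => false) >>= fun τ => pure ((z.1, τ), τ, z.2) := by
    refine Eff.bind (t.penc_of ?_ (EffD.zeros (t.cskLen.add t.keyLen))) (EffD.pair (EffD.pair ?_ ?_) (EffD.pair ?_ ?_))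
    all_goals repeat first | with_reducible apply EffD.fst | with_reducible apply EffD.snd | with_reducible exact EffD.id
  refine (Realized.oracleRound A 1 pre t.queryTagged_of hpost rfl (EffD.isTagQuery t.ctLen t.kLen)
    EffD.advice (Nat.le_of_ble_eq_true rfl) h hA.stages.run₁
    ⟨T, hA.stages.poly, hA.stages.clock₂⟩).congr fun n σ F z => ?_
  simp only [bind_assoc, LawfulMonad.pure_bind]
  refine bind_congr_support fun τ _ => ?_
  refine (queryTagged_run n z.1.1 τ F _ _ _).bind_eq ?_
  rintro ⟨a, _, st⟩ ⟨_, _⟩ ⟨rfl, rfl, rfl⟩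
  rfl

end Reductions

/-! ## Collisions of ciphertexts -/

theorem bind_map_pmf {α β γ : Type} (p : PMF α) (f : α → β) (k : β → PMF γ) :
    (p.map f >>= k) = p >>= fun a => k (f a) := PMF.bind_map p f k

theorem prob_mono {g g' : PMF Bool} (h : g true ≤ g' true) : prob g ≤ prob g' :=
  ENNReal.toReal_mono (g'.apply_ne_top _) h

section Collisions

variable {pt ct : ℕ → ℕ} {E : SKE pt ct} {u : Uniformity}

/-- Two encryptions of a random plaintext. -/
noncomputable def SKE.collision (E : SKE pt ct) (n : ℕ) : PMF Bool :=
  E.gen n >>= fun key => unif (pt n) >>= fun p => E.enc n key p >>= fun x => E.enc n key p >>= fun c =>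
    pure (decide (c = x))

/-- An adversary asks for an encryption of a random plaintext and then takes the same plaintext as
its challenge. If the challenge is an encryption, it repeats the known ciphertext with the collision
probability; if it is uniform, a repetition makes it decryptable, which sparsity excludes. The
collision probability is thus at most the advantage plus the sparsity error. -/
theorem SKE.Secure.collision_negl (hE : E.Secure u) {adv : ℕ → Str} (hadv : u.Advice adv) (hpt : EffLen adv pt)
    (hct : EffLen adv ct) :
    Negl fun n => prob (E.collision n) := by
  have first : EffO adv (X := fun n => Bits (pt n)) (Y := fun n => Bits (ct n)) (α := fun _ => Unit × Unit)
      (β := fun n => Bits (ct n) × Bits (pt n)) _ :=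
    EffO.ask (γ := fun n => Bits (pt n)) (pre := fun n _ => unif (pt n) >>= fun p => pure (p, p))
      (c := fun _ _ => true) (post := fun n p c => pure (c, p)) (other := fun n p => pure (fun _ => false, p))
      -- The test before the query is constantly true, so the dummy ciphertext of the other branch
      -- is never used.
      (Eff.bind (Eff.unif hpt) (EffD.pair (EffD.snd EffD.id) (EffD.snd EffD.id)))
      (EffD.bool true) (EffD.pair (EffD.snd EffD.id) (EffD.fst EffD.id))
      (EffD.pair (EffD.zeros hct) EffD.id)
  have last : Eff adv (α := fun n => Bits (ct n) × Bits (ct n)) (β := fun _ => Unit × Bool)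
      fun n z => pure ((), !decide (z.2 = z.1)) :=
    EffD.pair EffD.unit (EffD.not (EffD.eqBits hct.1 (EffD.snd EffD.id) (EffD.fst EffD.id)))
  obtain ⟨P₀, h₀⟩ := (Realized.kernel (Pre := fun _ => {Mem.empty}) first (Nat.le_of_ble_eq_true rfl)).round
    (Nat.le_of_ble_eq_true rfl) (Nat.le_of_ble_eq_true rfl) (Nat.le_of_ble_eq_true rfl)
  obtain ⟨P₁, h₁⟩ := (Realized.eff (X := fun n => Bits (pt n)) (Y := fun n => Bits (ct n))
    (Pre := fun _ => {Mem.empty}) last (Nat.le_of_ble_eq_true rfl)).round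
    (Nat.le_of_ble_eq_true rfl) (Nat.le_of_ble_eq_true rfl) (Nat.le_of_ble_eq_true rfl)
  let B : Adversary := ⟨fun j => if j = 0 then P₀ else P₁, adv⟩
  have hB := SKE.qpt (B := B) (E := E) hadv h₀ h₁
  refine ((hE.2.2.2 B hB).add hE.2.2.1).of_le fun n => ?_
  rw [abs_of_nonneg (prob_nonneg _), SKE.game_eq (B := B) h₀ h₁]
  simp only [bind_assoc, LawfulMonad.pure_bind, if_true, logging, bind_map_pmf]
  have e := advantage_guess_bind (E.gen n >>= fun key => unif (pt n) >>= fun p => E.enc n key p >>= fun x =>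
    pure (key, p, x)) fun a b => (if b then unif (ct n) else E.enc n a.1 a.2.1) >>= fun c =>
      pure !decide (c = a.2.2)
  simp only [bind_assoc, LawfulMonad.pure_bind, if_true, Bool.false_eq_true, if_false] at e
  have e' := fun X : Bits (E.keyLen n) → Bits (pt n) → PMF (Bits (ct n)) => prob_not (E.gen n >>= fun key =>
    unif (pt n) >>= fun p => E.enc n key p >>= fun x => X key p >>= fun c => pure (decide (c = x)))
  simp only [bind_assoc, LawfulMonad.pure_bind] at e'
  rw [e' fun _ _ => unif (ct n), e' fun key p => E.enc n key p] at e
  rw [e]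
  have h : prob (E.gen n >>= fun key => unif (pt n) >>= fun p => E.enc n key p >>= fun x => unif (ct n) >>= fun c =>
      pure (decide (c = x))) ≤ prob (E.gen n >>= fun key => unif (ct n) >>= fun c =>
      pure (decide (E.dec n key c ≠ none))) := by
    refine prob_mono ?_
    rw [bind_apply_true, bind_apply_true]
    refine expect_mono_of_support fun key hkey => ?_
    -- The sparsity experiment gets idle samples of a plaintext and a ciphertext, so that the two
    -- experiments can be compared sample by sample.
    rw [← bind_const_pmf (unif (pt n)) (unif (ct n) >>= fun c => _), bind_apply_true, bind_apply_true]
    refine expect_mono fun p => ?_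
    rw [← bind_const_pmf (E.enc n key p) (unif (ct n) >>= fun c => pure (decide (E.dec n key c ≠ none))),
      bind_apply_true, bind_apply_true]
    refine expect_mono_of_support fun x hx => ?_
    rw [bind_apply_true, bind_apply_true]
    refine expect_mono fun c => ?_
    rw [pure_decide_true, pure_decide_true]
    split_ifs with h1 h2 h2
    · exact le_rfl
    -- A uniform string equal to the honest ciphertext `x` decrypts, so it is counted by the
    -- sparsity experiment.
    · rw [h1, hE.2.1.dec_enc hkey hx] at h2
      simp at h2
    · exact bot_le
    · exact le_rfl
  have h' := le_abs_self ((1 - prob (E.gen n >>= fun key => unif (pt n) >>= fun p => E.enc n key p >>= fun x =>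
    unif (ct n) >>= fun c => pure (decide (c = x)))) - (1 - prob (E.gen n >>= fun key => unif (pt n) >>= fun p =>
    E.enc n key p >>= fun x => E.enc n key p >>= fun c => pure (decide (c = x)))))
  rw [SKE.collision]
  linarith

end Collisions

/-! ### The challenge ciphertext is new. -/

section Reductions

variable {k dom ran κ : ℕ → ℕ} {hk : ∀ n, 0 < k n} {E : SKE (fun n => Nat.clog 2 (k n) + 1) dom}
  {C : CPRF dom ran} {P : PKE (fun n => C.skLen n (κ n) + E.keyLen n)} {D : ConstraintCircuits E κ}
  {u : Uniformity} {A : Adversary} {S₁ S₂ S₃ : ℕ → Set Mem} {T : ℕ → ℕ}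

theorem mem_evalPrefix {n : ℕ} {r}
    (hr : r ∈ (evalPrefix hk E C P D A n).support) : r.1.2.1 ∈ (E.gen n).support := by
  obtain ⟨o, -, h⟩ := mem_support_bind.1 hr
  obtain ⟨key, hkey, h⟩ := mem_support_bind.1 h
  obtain ⟨msk, -, h⟩ := mem_support_bind.1 h
  obtain ⟨c, -, h⟩ := mem_support_bind.1 h
  obtain ⟨τ, -, h⟩ := mem_support_bind.1 h
  obtain ⟨t, -, h⟩ := mem_support_bind.1 h
  rw [mem_support_pure.1 h]
  exact hkey

/-- An encryption rarely has been used in the answers to the queries. -/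
theorem expect_repeated (hA : HybridAdversary E C P D A u S₁ S₂ S₃ T) (hE : E.Correct) (n : ℕ) :
    (expect (evalPrefix hk E C P D A n) fun r => expect (E.enc n r.1.2.1 (indexed r.1.2.2.2 (r.1.2.2.1 r.1.2.2.2)))
      fun x => if x ∈ r.2.2.2 then 1 else 0) ≤ ENNReal.ofReal ((T n * (2 * (2 * k n)) : ℕ) * prob (E.collision n)) := by
  have h0 : ENNReal.ofReal ((T n * (2 * (2 * k n)) : ℕ) * prob (E.collision n)) ≥
      expect (E.gen n) fun key => T n * ∑ p, expect (E.enc n key p) fun x => E.enc n key p x := by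
    have hb : (2 : ENNReal) ^ (Nat.clog 2 (k n) + 1) ≤ ((2 * (2 * k n)) : ℕ) := by
      have := two_pow_clog_le (hk n)
      push_cast
      rw [pow_succ, mul_comm _ (2 : ENNReal)]
      gcongr
      exact_mod_cast this
    simp only [expect_unif]
    rw [ENNReal.ofReal_mul (Nat.cast_nonneg _), ENNReal.ofReal_natCast, ofReal_prob, Nat.cast_mul]
    simp only [expect_mul_left]
    rw [mul_assoc]
    refine mul_le_mul' le_rfl (mul_le_mul' hb (le_of_eq ?_))
    simp only [SKE.collision, bind_apply_true, pure_decide_true]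
    simp only [expect_single]
  refine le_trans ?_ h0
  simp only [evalPrefix, expect_bind, expect_pure]
  refine (expect_mono_of_support fun o ho => ?_).trans (expect_const (opening hk E C P A n) _).le
  obtain ⟨-, ha⟩ := hA.opening ho
  refine expect_mono_of_support fun key hkey => ?_
  refine (expect_mono fun msk => ?_).trans (expect_const (C.setup n (κ n)) _).le
  refine (expect_mono fun c => ?_).trans (expect_const (C.constrain n (κ n) msk (D.mark n key o.2.2.1)) _).le
  refine (expect_mono fun τ => ?_).trans (expect_const (P.enc n o.1.1 _) _).le
  set p := indexed o.2.2.2 (o.2.2.1 o.2.2.2) with hp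
  -- The potential of a list of points is the sum of their probabilities under a fresh encryption of
  -- `p`, which bounds the probability to hit the list. Its expected growth per query is at most the
  -- sum, over all plaintexts, of the probability that two encryptions coincide.
  have key' := A.run_potential (G := tagged E C P o.1.2 τ (simVia E key fun log _ _ =>
      logging (fun x => (pure (C.eval n (κ n) msk x) : PMF (Bits (ran n)))) log))
    (Φ := fun log => (log.map fun x => E.enc n key p x).sum)
    (c := ∑ p, expect (E.enc n key p) fun x => E.enc n key p x) (fun log q => ?_) n 1 (rep (τ, c)) o.2.1 []
    (T := T n) fun t ht => hA.stages.clock₂ n _ (hA.stages.run₁ n _ _ _ ha (τ, c) [] t ht)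
  · rw [List.map_nil, List.sum_nil, zero_add] at key'
    refine le_trans (expect_mono fun t => ?_) key'
    have : ∀ log : List (Bits (dom n)), (expect (E.enc n key p) fun x => if x ∈ log then 1 else 0) ≤
        (log.map fun x => E.enc n key p x).sum := by
      intro log
      induction log with
      | nil => simp [expect_const]
      | cons y log ih =>
        rw [List.map_cons, List.sum_cons, ← expect_single (E.enc n key p) y]
        refine le_trans ?_ (add_le_add_right ih _)
        rw [← expect_add]
        refine expect_mono fun x => ?_
        by_cases h1 : x = y
        · simp [h1]
        · simp [h1]
    exact this t.2
  · rw [tagged]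
    split_ifs
    · simp only [simVia, logging, map_pure_pmf, LawfulMonad.pure_bind, expect_bind, expect_pure, List.map_cons,
        List.sum_cons, add_comm (E.enc n key p _), expect_add, expect_const]
      refine add_le_add_right ?_ _
      refine (expect_mono fun γ => ?_).trans (expect_const coin _).le
      by_cases h1 : indexed q.2 γ = p
      · rw [h1]
        exact Finset.single_le_sum (f := fun p => expect (E.enc n key p) fun x => E.enc n key p x)
          (fun _ _ => bot_le) (Finset.mem_univ p)
      -- A query for another plaintext adds nothing: a common ciphertext would decrypt to both
      -- plaintexts.
      · refine le_of_eq_of_le (expect_eq_zero_iff.2 fun x hx => ?_) bot_le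
        by_contra h2
        have h3 := hE.dec_enc hkey ((PMF.mem_support_iff _ _).2 h2)
        rw [hE.dec_enc hkey hx] at h3
        exact h1 (Option.some.inj h3)
    · rw [expect_bind]
      simp only [expect_pure, expect_const]
      exact le_self_add

end Reductions

/-! ## The reduction to pseudorandomness -/

section Reductions

variable {k dom ran κ : ℕ → ℕ} {hk : ∀ n, 0 < k n} {E : SKE (fun n => Nat.clog 2 (k n) + 1) dom}
  {C : CPRF dom ran} {P : PKE (fun n => C.skLen n (κ n) + E.keyLen n)} {D : ConstraintCircuits E κ}
  {u : Uniformity} {A : Adversary} {S₁ S₂ S₃ : ℕ → Set Mem} {T : ℕ → ℕ}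

/-- The end of the game after the choice of the challenge bit and of whether the bit of the challenge is the
one of the message. -/
noncomputable def evalBranch (A : Adversary) (n : ℕ)
    (R : Bits (C.mskLen n (κ n)) → Bits (k n) → Fin (k n) → Bool → Bool → Bits (dom n) → PMF (Bits (ran n)))
    (b g : Bool) (r : Secrets E C P n × Bits (C.mskLen n (κ n)) × Mem × List (Bits (dom n))) : PMF Bool :=
  (if b then E.enc n r.1.2.1 (indexed r.1.2.2.2 (if g then r.1.2.2.1 r.1.2.2.2 else !r.1.2.2.1 r.1.2.2.2))
    else unif (dom n)) >>= fun x =>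
  R r.2.1 r.1.2.2.1 r.1.2.2.2 b (if g then r.1.2.2.1 r.1.2.2.2 else !r.1.2.2.1 r.1.2.2.2) x >>= fun y =>
  guess A n ((if g then r.1.2.2.1 r.1.2.2.2 else !r.1.2.2.1 r.1.2.2.2), x, y) r.2.2.1 >>= fun v => pure (v == b)

/-- Four equally likely branches: the challenge bit `b`, and whether `γ` agrees with the bit of the
message, as encoded by `g`. -/
theorem prob_evalGame (n : ℕ) (R) : prob (evalGame hk E C P D A n R) =
    ((prob (evalPrefix hk E C P D A n >>= evalBranch A n R true true) +
      prob (evalPrefix hk E C P D A n >>= evalBranch A n R true false)) / 2 +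
    (prob (evalPrefix hk E C P D A n >>= evalBranch A n R false true) +
      prob (evalPrefix hk E C P D A n >>= evalBranch A n R false false)) / 2) / 2 := by
  rw [evalGame_eq, prob_bind_coin]
  congr 2 <;>
  · rw [← prob_bind_coin (evalPrefix hk E C P D A n) fun r g => evalBranch A n R _ g r]
    refine congrArg prob (bind_congr_support fun r _ => ?_)
    rw [challenge, bind_assoc, coin_bind_ite (r.1.2.2.1 r.1.2.2.2)]
    simp only [evalBranch, bind_assoc, LawfulMonad.pure_bind]

/-- The games differ only in the branch `b = g = true`, where the challenge is an encryption of
`i‖msg[i]` and the PRF value is replaced by a uniform string. The reduction takes `D[K,msg]` as its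
constraint, such an encryption as its challenge point, and outputs the guess of `A`. It is penalized
only if the point was queried before, which `expect_repeated` bounds. -/
theorem pr_step (hA : HybridAdversary E C P D A u S₁ S₂ S₃ T) (hE : E.Secure u) (hC : C.Pseudorandom u) :
    Negl fun n => |prob (evalGame hk E C P D A n
        fun msk m i b γ x => if b then pure (C.eval n (κ n) msk x) else maskedEval C msk m i γ x) -
      prob (evalGame hk E C P D A n fun msk m i _ => maskedEval C msk m i)| := by
  have t := hA.prims _ hA.advice
  have post : Eff A.advice (α := fun n => Secrets E C P n × Bits (P.ctLen n))
      (β := fun n => (Bool × Bits (dom n)) × Bits (dom n)) fun n z =>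
      E.enc n z.1.2.1 (indexed z.1.2.2.2 (z.1.2.2.1 z.1.2.2.2)) >>= fun x => pure ((z.1.2.2.1 z.1.2.2.2, x), x) := by
    refine Eff.bind (t.enc_of ?_ (EffD.indexed t.kLen ?_ (EffD.lookup t.kLen ?_ ?_)))
      (EffD.pair (EffD.pair (EffD.lookup t.kLen ?_ ?_) ?_) ?_)
    all_goals repeat first | with_reducible apply EffD.fst | with_reducible apply EffD.snd | with_reducible exact EffD.id
  have pre₂ : Eff A.advice (α := fun n => (Bool × Bits (dom n)) × Bits (ran n))
      (β := fun n => Unit × Bool × Bits (dom n) × Bits (ran n)) fun n z => pure ((), z.1.1, z.1.2, z.2) := by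
    refine EffD.pair EffD.unit (EffD.pair ?_ (EffD.pair ?_ ?_))
    all_goals repeat first | with_reducible apply EffD.fst | with_reducible apply EffD.snd | with_reducible exact EffD.id
  have post₂ : Eff A.advice (α := fun _ => (Unit × Str) × Str) (β := fun _ => Unit × Bool)
      fun n z => pure ((), readBool z.1.2) := by
    refine EffD.pair EffD.unit (EffD.readBool ?_)
    all_goals repeat first | with_reducible apply EffD.fst | with_reducible apply EffD.snd | with_reducible exact EffD.id
  obtain ⟨P₀, h₀⟩ := hA.firstRound (hk := hk)
  obtain ⟨P₁, h₁⟩ := (hA.secondRound (Nat.le_of_ble_eq_true rfl) (EffO.of_eff post)).round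
    (Nat.le_of_ble_eq_true rfl) (Nat.le_of_ble_eq_true rfl) (Nat.le_of_ble_eq_true rfl)
  obtain ⟨P₂, h₂⟩ := (Realized.silentRound (X := fun n => Bits (dom n)) (Y := fun n => Bits (ran n)) A 2 pre₂ post₂
    EffD.advice (Nat.le_of_ble_eq_true rfl) (Nat.le_of_ble_eq_true rfl) hA.stages.run₂
    ⟨T, hA.stages.poly, hA.stages.clock₃⟩).round
    (Nat.le_of_ble_eq_true rfl) (Nat.le_of_ble_eq_true rfl) (Nat.le_of_ble_eq_true rfl)
  let B : Adversary := ⟨fun j => if j = 0 then P₀ else if j = 1 then P₁ else P₂, A.advice⟩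
  have hB := CPRF.qpt₃ (B := B) (C := C) hA.advice h₀ h₁ h₂
  have hL : PolyLe fun n => 2 * (T n * (2 * (2 * k n))) :=
    (PolyLe.const 2).mul (hA.stages.poly.mul ((PolyLe.const 2).mul ((PolyLe.const 2).mul t.kLen.1)))
  refine ((hC B hB).add ((hE.collision_negl hA.advice t.kLen.clog.succ t.domLen).poly_mul hL)).of_le fun n => ?_
  have e := CPRF.pseudorandomnessGame_eq (B := B) (C := C) h₀ h₁ h₂ n
  set y : Bool → Bits (C.mskLen n (κ n)) → Bits (dom n) → PMF (Bits (ran n)) :=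
    fun b msk x => if b then unif (ran n) else pure (C.eval n (κ n) msk x) with hy
  have e₁ : C.pseudorandomnessGame B n = evalPrefix hk E C P D A n >>= fun r =>
      E.enc n r.1.2.1 (indexed r.1.2.2.2 (r.1.2.2.1 r.1.2.2.2)) >>= fun x => coin >>= fun b =>
      y b r.2.1 x >>= fun y => guess A n (r.1.2.2.1 r.1.2.2.2, x, y) r.2.2.1 >>= fun v =>
      if x ∉ r.2.2.2 ∧ (D.mark n r.1.2.1 r.1.2.2.1).eval x ≠ false then pure (v == b) else coin := by
    rw [e]
    simp only [evalPrefix, opening, guess, bind_assoc, LawfulMonad.pure_bind]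
    rfl
  have e₂ := advantage_guess_bind (evalPrefix hk E C P D A n >>= fun r =>
      E.enc n r.1.2.1 (indexed r.1.2.2.2 (r.1.2.2.1 r.1.2.2.2)) >>= fun x => pure (r, x))
    fun z b => y b z.1.2.1 z.2 >>= fun y => guess A n (z.1.1.2.2.1 z.1.1.2.2.2, z.2, y) z.1.2.2.1
  simp only [bind_assoc, LawfulMonad.pure_bind] at e₂
  have h₃ : Approx (C.pseudorandomnessGame B n) (evalPrefix hk E C P D A n >>= fun r =>
      E.enc n r.1.2.1 (indexed r.1.2.2.2 (r.1.2.2.1 r.1.2.2.2)) >>= fun x => coin >>= fun b =>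
      y b r.2.1 x >>= fun y => guess A n (r.1.2.2.1 r.1.2.2.2, x, y) r.2.2.1 >>= fun v =>
      pure (v == b)) Eq (expect (evalPrefix hk E C P D A n) fun r =>
        expect (E.enc n r.1.2.1 (indexed r.1.2.2.2 (r.1.2.2.1 r.1.2.2.2))) fun x => if x ∈ r.2.2.2 then 1 else 0) := by
    rw [e₁]
    refine Approx.bind_self fun r hr => Approx.bind_self fun x hx => ?_
    by_cases hxr : x ∈ r.2.2.2
    · rw [if_pos hxr]
      exact Approx.one
    · rw [if_neg hxr]
      -- The plaintext of the challenge point carries the bit of the message, so `D[K,msg]` is 1 and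
      -- the point is admissible.
      have h₄ : (D.mark n r.1.2.1 r.1.2.2.1).eval x ≠ false := by
        rw [Bool.ne_false_iff, D.mark_eval]
        exact ⟨_, hE.2.1.dec_enc (mem_evalPrefix hr) hx⟩
      simp only [hxr, h₄, not_false_eq_true, ne_eq]
      exact Approx.refl _
  have h₄ := (h₃.mono (fun _ _ h => h) (expect_repeated hA hE.2.1 n)).prob
    (mul_nonneg (Nat.cast_nonneg _) (prob_nonneg _)) le_rfl
  have h₅ : |prob (evalGame hk E C P D A n
        fun msk m i b γ x => if b then pure (C.eval n (κ n) msk x) else maskedEval C msk m i γ x) -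
      prob (evalGame hk E C P D A n fun msk m i _ => maskedEval C msk m i)| = |prob (evalPrefix hk E C P D A n >>= fun r =>
      E.enc n r.1.2.1 (indexed r.1.2.2.2 (r.1.2.2.1 r.1.2.2.2)) >>= fun x => 
      y true r.2.1 x >>= fun y => guess A n (r.1.2.2.1 r.1.2.2.2, x, y) r.2.2.1) - 
      prob (evalPrefix hk E C P D A n >>= fun r =>
      E.enc n r.1.2.1 (indexed r.1.2.2.2 (r.1.2.2.1 r.1.2.2.2)) >>= fun x => 
      y false r.2.1 x >>= fun y => guess A n (r.1.2.2.1 r.1.2.2.2, x, y) r.2.2.1)| / 4 := by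
    rw [prob_evalGame, prob_evalGame]
    -- The two games agree in three of the four branches (`a₁`, `a₂`); in the last one they are the
    -- two sides of the pseudorandomness game (`a₃`, `a₄`).
    have a₁ : ∀ g, evalBranch (E := E) (P := P) A n (fun msk m i b γ x => if b then pure (C.eval n (κ n) msk x) else
        maskedEval C msk m i γ x) false g = evalBranch A n (fun msk m i _ => maskedEval C msk m i) false g := fun g => rfl
    have a₂ : evalBranch (E := E) (P := P) A n (fun msk m i b γ x => if b then pure (C.eval n (κ n) msk x) else
        maskedEval C msk m i γ x) true false = evalBranch A n (fun msk m i _ => maskedEval C msk m i) true false := by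
      funext r
      simp [evalBranch, maskedEval]
    have a₃ : evalBranch (E := E) (P := P) A n (fun msk m i b γ x => if b then pure (C.eval n (κ n) msk x) else
        maskedEval C msk m i γ x) true true = fun r =>
        E.enc n r.1.2.1 (indexed r.1.2.2.2 (r.1.2.2.1 r.1.2.2.2)) >>= fun x => 
        y false r.2.1 x >>= fun y => guess A n (r.1.2.2.1 r.1.2.2.2, x, y) r.2.2.1 := by
      funext r
      simp [evalBranch, hy]
    have a₄ : evalBranch (E := E) (P := P) A n (fun msk m i _ => maskedEval C msk m i) true true = fun r =>
        E.enc n r.1.2.1 (indexed r.1.2.2.2 (r.1.2.2.1 r.1.2.2.2)) >>= fun x => 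
        y true r.2.1 x >>= fun y => guess A n (r.1.2.2.1 r.1.2.2.2, x, y) r.2.2.1 := by
      funext r
      simp [evalBranch, hy, maskedEval]
    rw [a₁, a₁, a₂, a₃, a₄, abs_sub_comm, ← abs_of_nonneg (show (0 : ℝ) ≤ 4 by norm_num), ← abs_div]
    congr 1
    ring
  rw [abs_abs, h₅, ← e₂, advantage, advantage]
  -- The true pseudorandomness game differs from the one without the penalty by at most the
  -- probability of a repeated point, hence so do their advantages up to a factor 2.
  have h₆ := abs_sub_abs_le_abs_sub (prob (evalPrefix hk E C P D A n >>= fun r =>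
      E.enc n r.1.2.1 (indexed r.1.2.2.2 (r.1.2.2.1 r.1.2.2.2)) >>= fun x => coin >>= fun b =>
      y b r.2.1 x >>= fun y => guess A n (r.1.2.2.1 r.1.2.2.2, x, y) r.2.2.1 >>= fun v =>
      pure (v == b)) - 1 / 2) (prob (C.pseudorandomnessGame B n) - 1 / 2)
  rw [sub_sub_sub_cancel_right] at h₆
  have h₇ := abs_nonneg (prob (C.pseudorandomnessGame B n) - 1 / 2)
  have h₈ : 0 ≤ ((T n * (2 * (2 * k n)) : ℕ) : ℝ) * prob (E.collision n) :=
    mul_nonneg (Nat.cast_nonneg _) (prob_nonneg _)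
  rw [abs_sub_comm] at h₄
  have h₉ := h₆.trans h₄
  rw [Nat.cast_mul 2 (T n * _), mul_assoc]
  push_cast at h₉ h₈ ⊢
  linarith

end Reductions

/-! ## The reduction to privacy -/

section Reductions

variable {k dom ran κ : ℕ → ℕ} {hk : ∀ n, 0 < k n} {E : SKE (fun n => Nat.clog 2 (k n) + 1) dom}
  {C : CPRF dom ran} {P : PKE (fun n => C.skLen n (κ n) + E.keyLen n)} {D : ConstraintCircuits E κ}
  {u : Uniformity} {A : Adversary} {S₁ S₂ S₃ : ℕ → Set Mem} {T : ℕ → ℕ}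

/-- The reduction plays the whole game with `A` and outputs whether `A` guesses the coin. It uses
the constrained key that it is given as marked circuit and its oracle as the PRF. For `γ = msg[i]`
the value of the challenge is uniform and the oracle is not asked. The simulator depends on this
reduction, hence on `A`, and is fixed for the remaining hybrids. -/
theorem privacy_step (hA : HybridAdversary E C P D A u S₁ S₂ S₃ T) (hC : C.Private u) :
    ∃ S : C.Simulator, S.Efficient u ∧ Negl fun n =>
      |prob (simGame hk E C P A S n (fun key m _ _ => (D.mark n key m).eval) fun key m => (D.mark n key m).eval) -
        prob (evalGame hk E C P D A n fun msk m i _ => maskedEval C msk m i)| := by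
  have t := hA.prims _ hA.advice
  have pre : Eff A.advice (α := fun n => Secrets E C P n × Bits (P.ctLen n))
      (β := fun n => (Bool × Bool × Bool × Bits (dom n)) × Bits (dom n)) fun n z =>
      coin >>= fun b => coin >>= fun γ =>
      (if b then E.enc n z.1.2.1 (indexed z.1.2.2.2 γ) else unif (dom n)) >>= fun x =>
      pure ((!(γ == z.1.2.2.1 z.1.2.2.2), b, γ, x), x) := by
    refine Eff.bind Eff.coin (Eff.bind Eff.coin (Eff.bind (Eff.ite ?_ (t.enc_of ?_ (EffD.indexed t.kLen ?_ ?_))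
      (Eff.unif t.domLen)) (EffD.pair (EffD.pair (EffD.not (EffD.beqBool ?_ (EffD.lookup t.kLen ?_ ?_)))
      (EffD.pair ?_ (EffD.pair ?_ ?_))) ?_)))
    all_goals repeat first | with_reducible apply EffD.fst | with_reducible apply EffD.snd | with_reducible exact EffD.id
  have test : EffD A.advice (α := fun n => Bool × Bool × Bool × Bits (dom n)) fun n z => z.1 := EffD.fst EffD.id
  have post : Eff A.advice (α := fun n => (Bool × Bool × Bool × Bits (dom n)) × Bits (ran n))
      (β := fun n => Bool × Bool × Bits (dom n) × Bits (ran n)) fun n z => pure (z.1.2.1, z.1.2.2.1, z.1.2.2.2, z.2) := by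
    refine EffD.pair ?_ (EffD.pair ?_ (EffD.pair ?_ ?_))
    all_goals repeat first | with_reducible apply EffD.fst | with_reducible apply EffD.snd | with_reducible exact EffD.id
  have other : Eff A.advice (α := fun n => Bool × Bool × Bool × Bits (dom n))
      (β := fun n => Bool × Bool × Bits (dom n) × Bits (ran n)) fun n z => unif (ran n) >>= fun y =>
      pure (z.2.1, z.2.2.1, z.2.2.2, y) := by
    refine Eff.bind (Eff.unif t.ranLen) (EffD.pair ?_ (EffD.pair ?_ (EffD.pair ?_ ?_)))
    all_goals repeat first | with_reducible apply EffD.fst | with_reducible apply EffD.snd | with_reducible exact EffD.id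
  have last : Eff A.advice (α := fun _ => (Bool × Str) × Str) (β := fun _ => Unit × Bool)
      fun n z => pure ((), readBool z.1.2 == z.1.1) := by
    refine EffD.pair EffD.unit (EffD.beqBool (EffD.readBool ?_) ?_)
    all_goals repeat first | with_reducible apply EffD.fst | with_reducible apply EffD.snd | with_reducible exact EffD.id
  have hask := EffO.ask (X := fun n => Bits (dom n)) (Y := fun n => Bits (ran n))
    (post := fun n z y => pure (z.2.1, z.2.2.1, z.2.2.2, y)) pre test post other
  obtain ⟨P₀, h₀⟩ := hA.firstRound (hk := hk)
  obtain ⟨P₁, h₁⟩ := ((hA.secondRound (Nat.le_of_ble_eq_true rfl) hask).seq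
    (Realized.silentRound A 2 (pre := fun n z => pure z) EffD.id last EffD.advice (Nat.le_of_ble_eq_true rfl)
      (Nat.le_of_ble_eq_true rfl) hA.stages.run₂ ⟨T, hA.stages.poly, hA.stages.clock₃⟩)).round
    (Nat.le_of_ble_eq_true rfl) (Nat.le_of_ble_eq_true rfl) (Nat.le_of_ble_eq_true rfl)
  let B : Adversary := ⟨fun j => if j = 0 then P₀ else P₁, A.advice⟩
  have hB := CPRF.qpt₂ (B := B) (C := C) hA.advice h₀ h₁
  obtain ⟨S, hS, hN⟩ := hC B hB
  refine ⟨S, hS, hN.of_le fun n => le_of_eq ?_⟩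
  rw [CPRF.privacyGame_eq (B := B) h₀ h₁ S n, abs_abs, advantage_guess_bind]
  simp only [if_true, Bool.false_eq_true, if_false]
  congr 3
  · simp only [simGame, opening, play, guess, challenge, bind_assoc, LawfulMonad.pure_bind]
    refine bind_congr_support fun keys _ => bind_congr_support fun t _ => bind_congr_support fun key _ =>
      bind_congr_support fun r _ => bind_congr_support fun τ _ => bind_congr_support fun s _ =>
      bind_congr_support fun b _ => bind_congr_support fun γ _ => bind_congr_support fun x _ => ?_
    -- If the bits agree, a uniform value is drawn; otherwise the value is that of the simulator,
    -- whose new state is no longer needed.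
    by_cases h : γ = readBits (k n) (t.1.regs 0) (readFin (hk n) (t.1.regs 1))
    · simp only [h, if_true, beq_self_eq_true, Bool.not_true, Bool.false_eq_true, if_false, bind_assoc,
        LawfulMonad.pure_bind]
    · simp only [h, beq_eq_false_iff_ne.2 h, if_false, Bool.not_false, if_true, bind_assoc,
        LawfulMonad.pure_bind, bind_map_pmf, Prod.swap]
  · rw [evalGame_eq]
    simp only [evalPrefix, opening, guess, challenge, maskedEval, bind_assoc, LawfulMonad.pure_bind]
    refine bind_congr_support fun keys _ => bind_congr_support fun t _ => bind_congr_support fun key _ =>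
      bind_congr_support fun msk _ => bind_congr_support fun c _ =>
      bind_congr_support fun τ _ => bind_congr_support fun s _ =>
      bind_congr_support fun b _ => bind_congr_support fun γ _ => bind_congr_support fun x _ => ?_
    by_cases h : γ = readBits (k n) (t.1.regs 0) (readFin (hk n) (t.1.regs 1))
    · simp only [h, if_true, beq_self_eq_true, Bool.not_true, Bool.false_eq_true, if_false, bind_assoc,
        LawfulMonad.pure_bind]
    · simp only [h, beq_eq_false_iff_ne.2 h, if_false, Bool.not_false, if_true, bind_assoc,
        LawfulMonad.pure_bind, logging, bind_map_pmf]

/-! ## The answers of the simulator -/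

/-- The bits that are given to the simulator are known without the key, up to sparsity. -/
theorem sparse_step (hA : HybridAdversary E C P D A u S₁ S₂ S₃ T) (hE : E.Secure u) (S : C.Simulator) :
    Negl fun n =>
      |prob (simGame hk E C P A S n (fun key m _ _ => (D.mark n key m).eval) fun key m => (D.mark n key m).eval) -
        prob (simGame hk E C P A S n (fun _ m i γ _ => decide (γ = m i)) fun _ _ _ => false)| := by
  refine negl_of_approx (e := fun n => (E.gen n >>= fun key => unif (dom n) >>= fun c =>
    pure (decide (E.dec n key c ≠ none))) true) (fun n => ?_) hE.2.2.1 (fun n => prob_nonneg _) fun n =>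
    (ofReal_prob _).ge
  refine Approx.bind_const fun o ho => ?_
  rw [bind_apply_true]
  refine Approx.bind_self fun key hkey => Approx.bind_const fun r _ => Approx.bind_const fun τ _ => ?_
  -- Decryption recovers `i‖γ`, and this string determines both `i` and `γ`.
  have hmark : ∀ i γ, ∀ x ∈ (E.enc n key (indexed i γ)).support,
      (D.mark n key o.2.2.1).eval x = decide (γ = o.2.2.1 i) := by
    intro i γ x hx
    rw [Bool.eq_iff_iff, D.mark_eval, hE.2.1.dec_enc hkey hx, decide_eq_true_eq]
    constructor
    · rintro ⟨j, hj⟩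
      have h := Option.some.inj hj
      rw [indexed, indexed, Fin.snoc_inj] at h
      rw [indexBits_injective h.1]
      exact h.2
    · rintro rfl
      exact ⟨i, rfl⟩
  have h := play_approx hA (hA.opening ho).2 o.1.2 key o.2.2.2 τ r.2 (ε := 0)
    (ε' := (unif (dom n) >>= fun c => (pure (decide (E.dec n key c ≠ none)) : PMF Bool)) true)
    (G₁ := fun st i γ x => (S.step n (κ n) st x ((D.mark n key o.2.2.1).eval x)).map Prod.swap)
    (G₂ := fun st i γ x => (S.step n (κ n) st x (decide (γ = o.2.2.1 i))).map Prod.swap)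
    (R₁ := fun st _ γ x => if γ = o.2.2.1 o.2.2.2 then unif (ran n) else
      (S.step n (κ n) st x ((D.mark n key o.2.2.1).eval x)).map Prod.snd)
    (R₂ := fun st _ γ x => if γ = o.2.2.1 o.2.2.2 then unif (ran n) else
      (S.step n (κ n) st x false).map Prod.snd)
    (fun st i => simVia_approx _ _ _ fun γ => ?_) (fun st b => challenge_approx _ _ _ fun γ => ?_) r.1
  · rwa [mul_zero, add_zero] at h
  -- The points of the queries are honest ciphertexts, so the bits agree without any error.
  · refine Approx.bind_const fun x hx => ?_
    rw [hmark i γ x hx]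
    exact Approx.refl _
  · by_cases hγ : γ = o.2.2.1 o.2.2.2
    · simp only [hγ, if_true]
      exact (Approx.refl _).mono (fun _ _ h => h) bot_le
    · simp only [hγ, if_false]
      cases b
      · rw [bind_apply_true]
        refine Approx.bind_self fun x _ => ?_
        rw [pure_decide_true]
        -- The challenge point is uniform here. If it is decryptable, all is lost; this has the
        -- probability of the sparsity experiment. Otherwise the bit is 0.
        split_ifs with hx
        · exact Approx.one
        · have : (D.mark n key o.2.2.1).eval x = false := by
            rw [← Bool.not_eq_true, D.mark_eval]
            rintro ⟨i, hi⟩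
            rw [hi] at hx
            simp at hx
          rw [this]
          exact Approx.refl _
      -- The challenge is an encryption with `γ ≠ msg[i]`, so its bit is 0 as well.
      · refine (Approx.bind_const (ε := 0) fun x hx => ?_).mono (fun _ _ h => h) bot_le
        rw [hmark _ γ x hx, decide_eq_false hγ]
        exact Approx.refl _

end Reductions

/-! ## Two advice strings -/

theorem evens_length (l : Str) : (evens l).length = (l.length + 1) / 2 := by
  induction l using evens.induct with
  | case1 | case2 => simp [evens]
  | case3 x y l ih => simp [evens, ih]; omega

/-- Two strings as one. -/
def joinStr (s t : Str) : Str := (unary s.length ++ List.replicate t.length false) ++ (s ++ t)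

theorem length_joinStr (s t : Str) : (joinStr s t).length = 2 * (s.length + t.length) := by
  simp [joinStr, unary]
  omega

theorem take_joinStr (s t : Str) : (joinStr s t).take (evens (joinStr s t)).length =
    unary s.length ++ List.replicate t.length false := by
  rw [evens_length, length_joinStr, show (2 * (s.length + t.length) + 1) / 2 = s.length + t.length by omega,
    joinStr, List.take_left' (by simp [unary])]

theorem drop_joinStr (s t : Str) : (joinStr s t).drop (evens (joinStr s t)).length = s ++ t := by
  rw [evens_length, length_joinStr, show (2 * (s.length + t.length) + 1) / 2 = s.length + t.length by omega,
    joinStr, List.drop_left' (by simp [unary])]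

theorem foldl_joinStr (m n : ℕ) : (unary m ++ List.replicate n false).foldl
    (fun c x => if x then x :: c else c) ([] : Str) = unary m := by
  have h1 : ∀ (n : ℕ) (c : Str), (List.replicate n false).foldl (fun c x => if x then x :: c else c) c = c := by
    intro n
    induction n with
    | zero => simp
    | succ n ih => simpa [List.replicate_succ] using ih
  have h2 : ∀ (m : ℕ) (c : Str), (unary m).foldl (fun c x => if x then x :: c else c) c = unary m ++ c := by
    intro m
    induction m with
    | zero => simp [unary]
    | succ m ih =>
      intro c
      rw [unary, List.replicate_succ, List.foldl_cons, ← unary, ih, if_pos rfl]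
      simp only [unary]
      rw [← List.replicate_succ, List.replicate_succ', List.append_assoc]
      rfl
  rw [List.foldl_append, h1, h2, List.append_nil]

/-- The reduction needs the advice of both `A` and the simulator. The header of `joinStr` is exactly
half of the string, so it is found by halving; the ones in it then tell where the first advice ends.
-/
theorem Uniformity.Advice.join {u : Uniformity} {s t : ℕ → Str} (hs : u.Advice s) (ht : u.Advice t) :
    ∃ adv, u.Advice adv ∧ EffD adv (α := fun _ => Unit) (β := fun _ => Str) (fun n _ => s n) ∧
      EffD adv (α := fun _ => Unit) (β := fun _ => Str) fun n _ => t n := by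
  cases u with
  | uniform =>
    refine ⟨fun _ => [], fun _ => rfl, ?_, ?_⟩
    · exact EffD.nil.congr fun n _ => (hs n).symm
    · exact EffD.nil.congr fun n _ => (ht n).symm
  | nonuniform =>
    have hL : PolyLe fun n => (joinStr (s n) (t n)).length := by
      simp only [length_joinStr]
      exact (PolyLe.const 2).mul ((show PolyLe fun n => (s n).length from hs).add
        (show PolyLe fun n => (t n).length from ht))
    refine ⟨fun n => joinStr (s n) (t n), hL, ?_⟩
    set adv := fun n => joinStr (s n) (t n)
    have a0 : EffD adv (α := fun _ => Unit) (β := fun _ => Str) fun n _ => adv n := EffD.advice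
    have s0 : ShortStr (α := fun _ => Unit) fun n _ => adv n := ⟨_, hL, fun n _ => le_rfl⟩
    have a1 := a0.evens s0
    have s1 : ShortStr (α := fun _ => Unit) fun n _ => evens (adv n) := s0.mono fun n _ => evens_length_le _
    have a2 := EffD.take a1 s1 a0
    have a3 := EffD.drop a1 s1 a0
    simp only [adv, take_joinStr, drop_joinStr] at a2 a3
    have s2 : ShortStr (α := fun _ => Unit) fun n _ => unary (s n).length ++ List.replicate (t n).length false :=
      s0.mono fun n _ => by
        rw [← take_joinStr]
        simp [adv]
    have a4 : EffD adv (α := fun _ => Unit) (β := fun _ => Str) fun n _ =>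
        (unary (s n).length ++ List.replicate (t n).length false).foldl
        (fun c x => if x then x :: c else c) ([] : Str) :=
      EffD.foldl a2 s2 EffD.nil (f := fun _ _ x c => if x then x :: c else c)
        (EffD.ite (EffD.fst (EffD.snd EffD.id)) (EffD.cons (EffD.fst (EffD.snd EffD.id)) (EffD.snd (EffD.snd EffD.id)))
          (EffD.snd (EffD.snd EffD.id)))
    simp only [foldl_joinStr] at a4
    have s4 : ShortStr (α := fun _ => Unit) fun n _ => unary (s n).length := s2.mono fun n _ => by simp
    have a5 := EffD.take a4 s4 a3
    have a6 := EffD.drop a4 s4 a3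
    simp only [unary, List.length_replicate, List.take_left, List.drop_left] at a5 a6
    exact ⟨a5, a6⟩

/-! ## Simulators with a bounded number of steps -/

/-- A random value, as an element of a subtype. -/
noncomputable def PMF.restrict {α : Type} (p : PMF α) (q : α → Prop) (h : ∀ a ∈ p.support, q a) : PMF {a // q a} :=
  p.bindOnSupport fun a ha => PMF.pure ⟨a, h a ha⟩

theorem PMF.restrict_bind {α β : Type} (p : PMF α) (q : α → Prop) (h : ∀ a ∈ p.support, q a) (f : α → PMF β) :
    ((p.restrict q h) >>= fun a => f a.1) = p >>= f := by
  show (p.restrict q h).bind (fun a => f a.1) = p.bind f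
  rw [← PMF.bindOnSupport_eq_bind, PMF.restrict, PMF.bindOnSupport_bindOnSupport]
  simp only [PMF.pure_bindOnSupport]
  rw [PMF.bindOnSupport_eq_bind]

namespace CPRF.Simulator

variable {dom ran : ℕ → ℕ} {C : CPRF dom ran} (S : C.Simulator) (κ B : ℕ → ℕ)

/-- The states of the simulator, with a bound of the number of further steps. -/
abbrev Bounded (n : ℕ) : Type := {z : Str × Str // ∃ j, z.1 ∈ S.states n (κ n) j ∧ j + z.2.length ≤ B n}

noncomputable def start (n : ℕ) : PMF (S.Bounded κ B n × Bits (C.skLen n (κ n))) :=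
  (S.init n (κ n)).restrict (fun z => z.1 ∈ S.states n (κ n) 0) (fun z hz => ⟨z.2, hz⟩) >>= fun z =>
    pure (⟨(z.1.1, unary (B n)), 0, z.2, by simp [unary]⟩, z.1.2)

-- Each step uses up one symbol of the counter. Once the counter is empty the state is kept and
-- zeros are returned; this makes the function total, and it does not occur in the reduction.
open Classical in
noncomputable def next (n : ℕ) (z : S.Bounded κ B n) (x : Bits (dom n)) (b : Bool) :
    PMF (S.Bounded κ B n × Bits (ran n)) :=
  if h : z.1.2 = [] then pure (z, fun _ => false) else
    (S.step n (κ n) z.1.1 x b).restrict (fun r => ∃ j, r.1 ∈ S.states n (κ n) j ∧ j + z.1.2.tail.length ≤ B n)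
      (fun r hr => by
        obtain ⟨j, hj, hl⟩ := z.2
        refine ⟨j + 1, ⟨z.1.1, hj, x, b, r.2, hr⟩, ?_⟩
        have := List.length_pos_iff.2 h
        rw [List.length_tail]
        omega) >>= fun r =>
      pure (⟨(r.1.1, z.1.2.tail), r.2⟩, r.1.2)

variable {S κ B} {u : Uniformity}

/-- The simulator's time may grow with the number of earlier queries. The counter bounds this number
by `B n`, which turns the time into a polynomial in `n` alone. -/
theorem Efficient.eff (hS : S.Efficient u) : ∃ sadv, u.Advice sadv ∧ ∀ adv,
    EffD adv (α := fun _ => Unit) (β := fun _ => Str) (fun n _ => sadv n) → ∀ κ B, EffLen adv κ → EffLen adv B →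
    EffLen adv ran → Eff adv (α := fun _ => Unit) (fun n _ => S.start κ B n) ∧
      Eff adv (α := fun n => S.Bounded κ B n × Bits (dom n) × Bool) fun n z => S.next κ B n z.1 z.2.1 z.2.2 := by
  obtain ⟨P₁, P₂, h₁, h₂, sadv, hs, p, hp⟩ := hS
  refine ⟨sadv, hs, fun adv hadv κ B hκ hB hran => ⟨?_, ?_⟩⟩
  · have init : Eff adv (α := fun n => Single (sadv n)) fun n _ => S.init n (κ n) :=
      Eff.of_computes₂ hκ h₁ (T := fun n => p.eval (n + κ n)) (PolyLe.eval_comp p (PolyLe.id.add hκ.1))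
        fun n a => by
          have h := (hp n (κ n)).1
          have e : rep a = [sadv n] := congrArg (fun s => [s]) a.2
          rwa [e]
    have h : Eff adv (α := fun _ => Unit) (β := fun n => (Str × Str) × Bits (C.skLen n (κ n))) fun n _ =>
        S.init n (κ n) >>= fun z => pure ((z.1, unary (B n)), z.2) :=
      Eff.bind (Eff.compD init (EffD.single hadv))
        (EffD.pair (EffD.pair (EffD.fst (EffD.snd EffD.id)) hB.eff) (EffD.snd (EffD.snd EffD.id)))
    refine h.retype (fun _ a => a) (fun _ _ => rfl) (fun _ => rfl) fun n _ => ?_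
    rw [start, map_bind_pmf, map_bind_pmf]
    simp only [map_pure_pmf]
    exact PMF.restrict_bind _ _ _ fun z : Str × Bits (C.skLen n (κ n)) => pure (rep ((z.1, unary (B n)), z.2))
  · have step : Eff adv (α := fun n => Single (sadv n) × {s : Str // ∃ j, s ∈ S.states n (κ n) j ∧ j ≤ B n} ×
        Bits (dom n) × Bool) (β := fun n => Str × Bits (ran n)) fun n z => S.step n (κ n) z.2.1.1 z.2.2.1 z.2.2.2 :=
      Eff.of_computes₂ hκ h₂ (T := fun n => p.eval (n + κ n + B n))
        (PolyLe.eval_comp p ((PolyLe.id.add hκ.1).add hB.1)) fun n a => by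
          obtain ⟨⟨_, rfl⟩, ⟨s, j, hs, hj⟩, x, b⟩ := a
          have h := (hp n (κ n)).2 j s hs x b
          exact ⟨h.1, fun t ht => (h.2 t ht).trans (Polynomial.eval_nat_mono p (by omega))⟩
    have h : Eff adv (α := fun n => S.Bounded κ B n × Bits (dom n) × Bool)
        (β := fun n => (Str × Str) × Bits (ran n)) fun n z =>
        if decide (z.1.1.2 = []) then pure (z.1.1, fun _ => false) else
          S.step n (κ n) z.1.1.1 z.2.1 z.2.2 >>= fun r => pure ((r.1, z.1.1.2.tail), r.2) := by
      have val : EffD adv (α := fun n => S.Bounded κ B n × Bits (dom n) × Bool) (β := fun _ => Str × Str)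
        fun n z => z.1.1 := EffD.val (EffD.fst EffD.id)
      have arg : EffD adv (α := fun n => S.Bounded κ B n × Bits (dom n) × Bool)
          (β := fun n => Single (sadv n) × {s : Str // ∃ j, s ∈ S.states n (κ n) j ∧ j ≤ B n} ×
            Bits (dom n) × Bool) fun n z => (⟨sadv n, rfl⟩, ⟨z.1.1.1, z.1.2.imp fun j h => ⟨h.1, by omega⟩⟩, z.2) :=
        EffD.pair (EffD.single hadv) (EffD.pair (EffD.subtype (EffD.fst val) _) (EffD.snd EffD.id))
      have val' : EffD adv (α := fun n => (S.Bounded κ B n × Bits (dom n) × Bool) × Str × Bits (ran n))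
          (β := fun _ => Str × Str) fun n z => z.1.1.1 := EffD.val (EffD.fst (EffD.fst EffD.id))
      exact Eff.ite (EffD.isNil (EffD.snd val)) (EffD.pair val (EffD.zeros hran)) (Eff.bind (Eff.compD step arg)
        (EffD.pair (EffD.pair (EffD.fst (EffD.snd EffD.id)) (EffD.tail (EffD.snd val'))) (EffD.snd (EffD.snd EffD.id))))
    refine h.retype (fun _ a => a) (fun _ _ => rfl) (fun _ => rfl) fun n z => ?_
    rw [next]
    by_cases hz : z.1.1.2 = []
    · simp only [hz, dif_pos, decide_true, if_true, map_pure_pmf]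
      rfl
    · simp only [hz, dif_neg, not_false_eq_true, decide_false, Bool.false_eq_true, if_false, map_bind_pmf, map_pure_pmf]
      exact PMF.restrict_bind _ _ _ fun r : Str × Bits (ran n) => pure (rep ((r.1, z.1.1.2.tail), r.2))

end CPRF.Simulator

/-! ## The reduction to pseudorandom ciphertexts -/

theorem Approx.bind_zero {α β γ δ : Type} {p : PMF α} {q : PMF β} {R : α → β → Prop} {k : α → PMF γ}
    {l : β → PMF δ} {Q : γ → δ → Prop} (h : Approx p q R 0) (h' : ∀ a b, R a b → Approx (k a) (l b) Q 0) :
    Approx (p >>= k) (q >>= l) Q 0 := by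
  have := h.bind h'
  rwa [zero_add] at this

/-- Runs with oracles that give the same answers as long as the clock does not exceed `T`. -/
theorem Adversary.run_approx_clock {σ₁ σ₂ α β : Type} [BitRep α] [BitRep β] {G₁ : σ₁ → α → PMF (β × σ₁)}
    {G₂ : σ₂ → α → PMF (β × σ₂)} {R : ℕ → σ₁ → σ₂ → Prop} {T : ℕ}
    (hR : ∀ t st₁ st₂, R t st₁ st₂ → R (t + 1) st₁ st₂)
    (h : ∀ t st₁ st₂ q, t < T → R t st₁ st₂ →
      Couples (G₁ st₁ q) (G₂ st₂ q) fun a b => a.1 = b.1 ∧ R (t + 1) a.2 b.2)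
    (A : Adversary) (n j : ℕ) (xs : List Str) (a : Mem) {st₁ : σ₁} {st₂ : σ₂} (hst : R a.clock st₁ st₂)
    (hT : ∀ t ∈ (A.run n j (oracle G₁) xs (a, st₁)).support, t.1.clock ≤ T) :
    Approx (A.run n j (oracle G₁) xs (a, st₁)) (A.run n j (oracle G₂) xs (a, st₂))
      (fun t u => t.1 = u.1 ∧ R t.1.clock t.2 u.2) 0 := by
  have h1 := Prog.exec_approx (O₁ := oracle G₁) (O₂ := oracle G₂) (R := R) (T := T) (ε := 0) hR
    (fun t st₁ st₂ q ht hst => Couples.approx ?_) (A.prog j) (a.load (unary n :: A.advice n :: xs)) hst hT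
  · exact h1.mono (fun _ _ h => h) (mul_zero _).le
  rw [oracle, oracle]
  cases (parse q : Option α) with
  | none => exact Couples.pure ⟨rfl, hR _ _ _ hst⟩
  | some x =>
    refine (h t st₁ st₂ x ht hst).bind fun a b hab => Couples.pure ⟨?_, hab.2⟩
    simp only [hab.1]

namespace CPRF.Simulator

variable {dom ran : ℕ → ℕ} {C : CPRF dom ran} (S : C.Simulator) (κ B : ℕ → ℕ)

theorem start_couples (n : ℕ) : Couples (S.start κ B n) (S.init n (κ n)) fun r z =>
    r.1.1 = (z.1, unary (B n)) ∧ r.2 = z.2 := by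
  refine (Couples.of_map_eq (f := fun r => (r.1.1, r.2)) (g := fun z => ((z.1, unary (B n)), z.2)) ?_).mono
    fun r z h => ⟨congrArg Prod.fst h, congrArg Prod.snd h⟩
  rw [start, map_bind_pmf]
  simp only [map_pure_pmf]
  exact PMF.restrict_bind _ _ _ fun z : Str × Bits (C.skLen n (κ n)) => pure ((z.1, unary (B n)), z.2)

/-- As long as the counter is not empty, the bounded simulator does the same as the true one. -/
theorem next_couples {n : ℕ} {z : S.Bounded κ B n} (hz : z.1.2 ≠ []) (x : Bits (dom n)) (b : Bool) :
    Couples (S.next κ B n z x b) (S.step n (κ n) z.1.1 x b) fun r s =>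
      r.1.1 = (s.1, z.1.2.tail) ∧ r.2 = s.2 := by
  refine (Couples.of_map_eq (f := fun r => (r.1.1, r.2)) (g := fun s => ((s.1, z.1.2.tail), s.2)) ?_).mono
    fun r s h => ⟨congrArg Prod.fst h, congrArg Prod.snd h⟩
  rw [next, dif_neg hz, map_bind_pmf]
  simp only [map_pure_pmf]
  exact PMF.restrict_bind _ _ _ fun r : Str × Bits (ran n) => pure ((r.1, z.1.2.tail), r.2)

end CPRF.Simulator

section Reductions

variable {k dom ran κ : ℕ → ℕ} {hk : ∀ n, 0 < k n} {E : SKE (fun n => Nat.clog 2 (k n) + 1) dom}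
  {C : CPRF dom ran} {P : PKE (fun n => C.skLen n (κ n) + E.keyLen n)} {D : ConstraintCircuits E κ}
  {u : Uniformity} {A : Adversary} {S₁ S₂ S₃ : ℕ → Set Mem} {T : ℕ → ℕ}

/-- What the reduction knows when it runs the simulator. -/
abbrev Known (P : PKE (fun n => C.skLen n (κ n) + E.keyLen n)) (S : C.Simulator) (B : ℕ → ℕ) (n : ℕ) : Type :=
  (Bits (P.skLen n) × Bits (k n) × Fin (k n) × Bits (P.ctLen n)) × S.Bounded κ B n

/-- The simulation oracle with the simulator of the PRF and an encryption oracle. -/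
noncomputable def simTagged (E : SKE (fun n => Nat.clog 2 (k n) + 1) dom)
    (P : PKE (fun n => C.skLen n (κ n) + E.keyLen n)) (S : C.Simulator) (B : ℕ → ℕ) :
    Kernel (fun n => Bits (Nat.clog 2 (k n) + 1)) (fun n => Bits (dom n))
      (fun n => Known P S B n × Bits (P.ctLen n) × Fin (k n))
      (fun n => Known P S B n × Bool × Bits (dom n) × Bits (ran n)) := fun n _ F z =>
  (coin >>= fun γ => pure ((z.1, γ), indexed z.1.2.2 γ)) >>= fun r =>
  if decide (r.1.1.2.1 = r.1.1.1.1.2.2.2) then F z.2 r.2 >>= fun x =>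
    (S.next κ B n r.1.1.1.2 x.1 (r.1.2 == r.1.1.1.1.2.1 r.1.1.2.2) >>= fun s =>
      pure ((r.1.1.1.1, s.1), r.1.2, x.1, s.2)) >>= fun b => pure (b, x.2)
  else (simOpt E C (P.dec n r.1.1.1.1.1 r.1.1.2.1) r.1.1.2.2 >>= fun s => pure (r.1.1.1, s)) >>= fun b =>
    pure (b, z.2)

theorem EfficientPrimitives.simTagged_of {adv : ℕ → Str} (t : EfficientPrimitives E C P D adv) {S : C.Simulator}
    {B : ℕ → ℕ} (hS : Eff adv (α := fun n => S.Bounded κ B n × Bits (dom n) × Bool)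
      fun n z => S.next κ B n z.1 z.2.1 z.2.2) : EffO adv (simTagged E P S B) := by
  have pre : Eff adv (α := fun n => Known P S B n × Bits (P.ctLen n) × Fin (k n))
      (β := fun n => ((Known P S B n × Bits (P.ctLen n) × Fin (k n)) × Bool) × Bits (Nat.clog 2 (k n) + 1))
      fun n z => coin >>= fun γ => pure ((z, γ), indexed z.2.2 γ) := by
    refine Eff.bind Eff.coin (EffD.pair (EffD.pair ?_ ?_) (EffD.indexed t.kLen ?_ ?_))
    all_goals repeat first | with_reducible apply EffD.fst | with_reducible apply EffD.snd | with_reducible exact EffD.id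
  have test : EffD adv (α := fun n => (Known P S B n × Bits (P.ctLen n) × Fin (k n)) × Bool)
      fun n r => decide (r.1.2.1 = r.1.1.1.2.2.2) := by
    refine EffD.eqBits t.ctLen.1 ?_ ?_
    all_goals repeat first | with_reducible apply EffD.fst | with_reducible apply EffD.snd | with_reducible exact EffD.id
  have post : Eff adv (α := fun n => ((Known P S B n × Bits (P.ctLen n) × Fin (k n)) × Bool) × Bits (dom n))
      (β := fun n => Known P S B n × Bool × Bits (dom n) × Bits (ran n))
      fun n z => S.next κ B n z.1.1.1.2 z.2 (z.1.2 == z.1.1.1.1.2.1 z.1.1.2.2) >>= fun s =>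
      pure ((z.1.1.1.1, s.1), z.1.2, z.2, s.2) := by
    have arg : EffD adv (α := fun n => ((Known P S B n × Bits (P.ctLen n) × Fin (k n)) × Bool) × Bits (dom n))
        (β := fun n => S.Bounded κ B n × Bits (dom n) × Bool)
        fun n z => (z.1.1.1.2, z.2, (z.1.2 == z.1.1.1.1.2.1 z.1.1.2.2)) := by
      refine EffD.pair ?_ (EffD.pair ?_ (EffD.beqBool ?_ (EffD.lookup t.kLen ?_ ?_)))
      all_goals repeat first | with_reducible apply EffD.fst | with_reducible apply EffD.snd | with_reducible exact EffD.id
    refine Eff.bind (Eff.compD hS arg) (EffD.pair (EffD.pair ?_ ?_) (EffD.pair ?_ (EffD.pair ?_ ?_)))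
    all_goals repeat first | with_reducible apply EffD.fst | with_reducible apply EffD.snd | with_reducible exact EffD.id
  have other : Eff adv (α := fun n => (Known P S B n × Bits (P.ctLen n) × Fin (k n)) × Bool)
      (β := fun n => Known P S B n × Bool × Bits (dom n) × Bits (ran n))
      fun n r => simOpt E C (P.dec n r.1.1.1.1 r.1.2.1) r.1.2.2 >>= fun s => pure (r.1.1, s) := by
    refine Eff.bind (t.simOpt_of (t.pdec_of ?_ ?_) ?_) (EffD.pair ?_ ?_)
    all_goals repeat first | with_reducible apply EffD.fst | with_reducible apply EffD.snd | with_reducible exact EffD.id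
  have h := EffO.ask (X := fun n => Bits (Nat.clog 2 (k n) + 1)) (Y := fun n => Bits (dom n))
    (post := fun n z y => S.next κ B n z.1.1.2 y (z.2 == z.1.1.1.2.1 z.1.2.2) >>= fun s =>
      pure ((z.1.1.1, s.1), z.2, y, s.2)) pre test post other
  exact h

/-- The invariant says that counter and clock together exceed `t`. Each query lowers the counter by
one and takes a step, and the run ends by time `t`, so a symbol is left for the challenge. -/
theorem simTagged_run {S : C.Simulator} {B : ℕ → ℕ} {n : ℕ} (key : Bits (E.keyLen n)) {w : Known P S B n} {st : Str}
    (hw : w.2.1 = (st, unary (B n))) (xs : List Str) (a : Mem) (log : List (Bits (Nat.clog 2 (k n) + 1))) {t : ℕ} (ht : t < B n)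
    (hT : ∀ s ∈ (A.run n 1 (oracle (handle (simTagged E P S B) n _ (logging (E.enc n key)))) xs (a, w, log)).support,
      s.1.clock ≤ t) :
    Approx (A.run n 1 (oracle (handle (simTagged E P S B) n _ (logging (E.enc n key)))) xs (a, w, log))
      (A.run n 1 (oracle (tagged E C P w.1.1 w.1.2.2.2 (simVia E key fun st i γ x =>
        (S.step n (κ n) st x (decide (γ = w.1.2.1 i))).map Prod.swap))) xs (a, st))
      (fun s s' => s.1 = s'.1 ∧ s.2.1.1 = w.1 ∧ s.2.1.2.1.1 = s'.2 ∧ s.2.1.2.1.2 ≠ []) 0 := by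
  refine (Adversary.run_approx_clock (T := t) (R := fun c (v : Known P S B n × List (Bits (Nat.clog 2 (k n) + 1))) st =>
    v.1.1 = w.1 ∧ v.1.2.1.1 = st ∧ 1 ≤ v.1.2.1.2.length ∧ t + 1 ≤ v.1.2.1.2.length + c) ?_ ?_ A n 1 xs a ?_ hT).mono ?_ le_rfl
  · rintro c v st ⟨h1, h2, h3, h4⟩
    exact ⟨h1, h2, h3, by omega⟩
  · rintro c ⟨v, log⟩ _ q hc ⟨h1, rfl, h3, h4⟩
    simp only at h1 h3 h4
    simp only [handle, tagged, simTagged, simVia, bind_assoc, LawfulMonad.pure_bind, map_bind_pmf, decide_eq_true_eq, h1]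
    by_cases hq : q.1 = w.1.2.2.2
    · simp only [hq, if_true, map_bind_pmf, map_pure_pmf, logging, bind_map_pmf]
      refine (Couples.refl _).bind ?_
      rintro γ _ rfl
      refine (Couples.refl _).bind ?_
      rintro x _ rfl
      rw [show (γ == w.1.2.1 q.2) = decide (γ = w.1.2.1 q.2) from rfl]
      refine (S.next_couples κ B (z := v.2) (by
        intro h
        rw [h] at h3
        simp at h3) x _).bind fun r s hrs => Couples.pure ⟨?_, rfl, ?_⟩
      · simp [hrs.2]
      · simp only [hrs.1, List.length_tail]
        exact ⟨rfl, by omega, by omega⟩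
    · simp only [hq, if_false, map_bind_pmf, map_pure_pmf, bind_const_pmf]
      refine (Couples.refl _).bind ?_
      rintro z _ rfl
      exact Couples.pure ⟨rfl, h1, rfl, h3, by simp only; omega⟩
  · refine ⟨rfl, by rw [hw], ?_⟩
    rw [hw]
    simp only [unary, List.length_replicate]
    omega
  · rintro s s' ⟨h1, h2, h3, h4, -⟩
    refine ⟨h1, h2, h3, fun h => ?_⟩
    rw [h] at h4
    simp at h4

end Reductions

/-! ### The key of the symmetric encryption serves only for encrypting. -/

section Reductions

variable {k dom ran κ : ℕ → ℕ} {hk : ∀ n, 0 < k n} {E : SKE (fun n => Nat.clog 2 (k n) + 1) dom}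
  {C : CPRF dom ran} {P : PKE (fun n => C.skLen n (κ n) + E.keyLen n)} {D : ConstraintCircuits E κ}
  {u : Uniformity} {A : Adversary} {S₁ S₂ S₃ : ℕ → Set Mem} {T : ℕ → ℕ}

/-- What the reduction knows when it has got the challenge. -/
abbrev Chosen (S : C.Simulator) (k κ B : ℕ → ℕ) (n : ℕ) : Type :=
  Bits (k n) × Fin (k n) × Bool × S.Bounded κ B n

/-- The game of the reduction with a fixed coin. -/
noncomputable def skeGame (hk : ∀ n, 0 < k n) (E : SKE (fun n => Nat.clog 2 (k n) + 1) dom)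
    (P : PKE (fun n => C.skLen n (κ n) + E.keyLen n)) (A : Adversary) (S : C.Simulator) (B : ℕ → ℕ) (n : ℕ)
    (b : Bool) : PMF Bool :=
  E.gen n >>= fun key => P.gen n >>= fun keys => A.run n 0 noOracle (rep keys.1) (Mem.empty, ()) >>= fun s =>
  S.start κ B n >>= fun r => P.enc n keys.1 (fun _ => false) >>= fun τ =>
  A.run n 1 (oracle (handle (simTagged E P S B) n _ (logging (E.enc n key)))) (rep (τ, r.2))
    (s.1, ((keys.2, readBits (k n) (s.1.regs 0), readFin (hk n) (s.1.regs 1), τ), r.1), []) >>= fun s =>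
  coin >>= fun γ => (if b then unif (dom n) else E.enc n key (indexed s.2.1.1.2.2.1 γ)) >>= fun c =>
  (if decide (γ = s.2.1.1.2.1 s.2.1.1.2.2.1) then unif (ran n) else
    S.next κ B n s.2.1.2 c false >>= fun r => pure r.2) >>= fun y => guess A n (γ, c, y) s.1

/-- In the game of ciphertext pseudorandomness the bit 1 stands for a uniform string, in the
watermarking game for a ciphertext; hence the negation. -/
theorem skeGame_not_approx (hA : HybridAdversary E C P D A u S₁ S₂ S₃ T) {S : C.Simulator} {B : ℕ → ℕ} {n : ℕ}
    (hB : T n < B n) (b : Bool) :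
    Approx (skeGame hk E P A S B n !b)
      (opening hk E C P A n >>= fun o => E.gen n >>= fun key => S.init n (κ n) >>= fun r =>
        P.enc n o.1.1 (fun _ => false) >>= fun τ => A.run n 1 (oracle (tagged E C P o.1.2 τ
          (simVia E key fun st i γ x => (S.step n (κ n) st x (decide (γ = o.2.2.1 i))).map Prod.swap)))
          (rep (τ, r.2)) (o.2.1, r.1) >>= fun s =>
        challenge E key o.2.2.2 (fun γ x => if γ = o.2.2.1 o.2.2.2 then unif (ran n) else
          (S.step n (κ n) s.2 x false).map Prod.snd) b >>= fun z => guess A n z s.1) Eq 0 := by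
  simp only [skeGame, opening, challenge, bind_assoc, LawfulMonad.pure_bind]
  rw [bind_comm_pmf]
  refine Approx.bind_const fun keys _ => ?_
  rw [bind_comm_pmf]
  refine Approx.bind_const fun s hs => Approx.bind_const fun key _ => ?_
  refine (S.start_couples κ B n).approx.bind_zero ?_
  rintro ⟨z, c⟩ ⟨st, c'⟩ ⟨hz, rfl⟩
  refine Approx.bind_const fun τ _ => ?_
  refine (simTagged_run (A := A) key hz _ _ _ hB fun t ht =>
    hA.stages.clock₂ n _ (hA.stages.run₁ n _ _ _ (hA.stages.run₀ n _ rfl _ _ hs) _ _ t ht)).bind_zero ?_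
  rintro ⟨s', ⟨w, z'⟩, log⟩ ⟨_, st'⟩ ⟨rfl, rfl, h1, h2⟩
  refine Approx.bind_const fun γ _ => ?_
  have h3 : (if !b then unif (dom n) else E.enc n key (indexed (readFin (hk n) (s.1.regs 1)) γ)) =
      if b then E.enc n key (indexed (readFin (hk n) (s.1.regs 1)) γ) else unif (dom n) := by
    cases b <;> rfl
  rw [h3]
  refine Approx.bind_const fun x _ => ?_
  by_cases h4 : γ = readBits (k n) (s.1.regs 0) (readFin (hk n) (s.1.regs 1))
  · simp only [h4, decide_true, if_true]
    exact Approx.refl _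
  · simp only [h4, decide_false, Bool.false_eq_true, if_false, bind_assoc, LawfulMonad.pure_bind, bind_map_pmf]
    simp only at h1 h2
    subst h1
    refine (S.next_couples κ B h2 x false).approx.bind_zero ?_
    rintro r s ⟨-, h5⟩
    rw [h5]
    exact Approx.refl _

/-- In this hybrid the key is used only to encrypt `i‖γ` for the queries and the challenge. The
reduction gets these ciphertexts from its oracle and its challenger, computes the bits for the
simulator from `γ` and `msg`, and outputs the guess of `A`. -/
theorem ske_step (hA : HybridAdversary E C P D A u S₁ S₂ S₃ T) (hE : E.Secure u) {S : C.Simulator}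
    (hS : S.Efficient u) :
    Negl fun n => advantage (simGame hk E C P A S n (fun _ m i γ _ => decide (γ = m i)) fun _ _ _ => false) := by
  obtain ⟨sadv, hs, hS⟩ := hS.eff
  obtain ⟨adv, hadv, hA', hs⟩ := Uniformity.Advice.join hA.advice hs
  have t := hA.prims _ hadv
  obtain ⟨p, hp⟩ := hA.stages.poly
  -- One step for each of the queries, and one more for the challenge.
  let B : ℕ → ℕ := fun n => p.eval n + 1
  obtain ⟨start, next⟩ := hS adv hs κ B t.κLen (EffLen.poly p).succ t.ranLen
  have post₀ : Eff adv (α := fun n => ((Bits (P.pkLen n) × Bits (P.skLen n)) × Str) × Str)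
      (β := fun n => Known P S B n × Bits (C.skLen n (κ n))) fun n z =>
      S.start κ B n >>= fun r => P.enc n z.1.1.1 (fun _ => false) >>= fun τ =>
      pure (((z.1.1.2, readBits (k n) z.1.2, readFin (hk n) z.2, τ), r.1), r.2) := by
    have start' : Eff adv (α := fun n => ((Bits (P.pkLen n) × Bits (P.skLen n)) × Str) × Str)
        (β := fun n => S.Bounded κ B n × Bits (C.skLen n (κ n))) fun n _ => S.start κ B n := by
      have h := Eff.compD (α := fun n => ((Bits (P.pkLen n) × Bits (P.skLen n)) × Str) × Str) start EffD.unit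
      exact h
    refine Eff.bind start' (Eff.bind (t.penc_of ?_ (EffD.zeros (t.cskLen.add t.keyLen)))
      (EffD.pair (EffD.pair (EffD.pair ?_ (EffD.pair (EffD.readBits t.kLen ?_)
      (EffD.pair (EffD.readFin t.kLen hk ?_) ?_))) ?_) ?_))
    all_goals repeat first | with_reducible apply EffD.fst | with_reducible apply EffD.snd | with_reducible exact EffD.id
  have pre₀ : Eff adv (α := fun _ => Unit × Unit)
      (β := fun n => (Bits (P.pkLen n) × Bits (P.skLen n)) × Bits (P.pkLen n)) fun n _ =>
      P.gen n >>= fun keys => pure (keys, keys.1) := by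
    refine Eff.bind (Eff.compD t.pgen EffD.unit) (EffD.pair ?_ ?_)
    all_goals repeat first | with_reducible apply EffD.fst | with_reducible apply EffD.snd | with_reducible exact EffD.id
  have pre₁ : Eff adv (α := fun n => Known P S B n × Bits (C.skLen n (κ n)))
      (β := fun n => Known P S B n × Bits (P.ctLen n) × Bits (C.skLen n (κ n))) fun n z =>
      pure (z.1, z.1.1.2.2.2, z.2) := by
    refine EffD.pair ?_ (EffD.pair ?_ ?_)
    all_goals repeat first | with_reducible apply EffD.fst | with_reducible apply EffD.snd | with_reducible exact EffD.id
  have post₁ : Eff adv (α := fun n => Known P S B n)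
      (β := fun n => Chosen S k κ B n × Bits (Nat.clog 2 (k n) + 1)) fun n z =>
      coin >>= fun γ => pure ((z.1.2.1, z.1.2.2.1, γ, z.2), indexed z.1.2.2.1 γ) := by
    refine Eff.bind Eff.coin (EffD.pair (EffD.pair ?_ (EffD.pair ?_ (EffD.pair ?_ ?_))) (EffD.indexed t.kLen ?_ ?_))
    all_goals repeat first | with_reducible apply EffD.fst | with_reducible apply EffD.snd | with_reducible exact EffD.id
  have pre₂ : Eff adv (α := fun n => Chosen S k κ B n × Bits (dom n))
      (β := fun n => Unit × Bool × Bits (dom n) × Bits (ran n)) fun n z =>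
      (if decide (z.1.2.2.1 = z.1.1 z.1.2.1) then unif (ran n) else
        S.next κ B n z.1.2.2.2 z.2 false >>= fun r => pure r.2) >>= fun y =>
      pure ((), z.1.2.2.1, z.2, y) := by
    have arg : EffD adv (α := fun n => Chosen S k κ B n × Bits (dom n))
        (β := fun n => S.Bounded κ B n × Bits (dom n) × Bool) fun n z => (z.1.2.2.2, z.2, false) := by
      refine EffD.pair ?_ (EffD.pair ?_ (EffD.bool false))
      all_goals repeat first | with_reducible apply EffD.fst | with_reducible apply EffD.snd | with_reducible exact EffD.id
    refine Eff.bind (Eff.ite (EffD.beqBool ?_ (EffD.lookup t.kLen ?_ ?_)) (Eff.unif t.ranLen)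
      (Eff.bind (Eff.compD next arg) (EffD.snd (EffD.snd EffD.id))))
      (EffD.pair EffD.unit (EffD.pair ?_ (EffD.pair ?_ ?_)))
    all_goals repeat first | with_reducible apply EffD.fst | with_reducible apply EffD.snd | with_reducible exact EffD.id
  have last : Eff adv (α := fun _ => (Unit × Str) × Str) (β := fun _ => Unit × Bool)
      fun n z => pure ((), readBool z.1.2) :=
    EffD.pair EffD.unit (EffD.readBool (EffD.snd (EffD.fst EffD.id)))
  obtain ⟨P₀, h₀⟩ := ((Realized.silentRound (X := fun n => Bits (Nat.clog 2 (k n) + 1)) (Y := fun n => Bits (dom n))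
    A 0 pre₀ post₀ hA' (Nat.le_of_ble_eq_true rfl) (Nat.le_of_ble_eq_true rfl) hA.stages.run₀
    ⟨T, hA.stages.poly, hA.stages.clock₁⟩).seq (Realized.oracleRound A 1 pre₁ (t.simTagged_of next)
    (EffO.of_eff post₁) rfl (EffD.isTagQuery t.ctLen t.kLen) hA' (Nat.le_of_ble_eq_true rfl)
    (Nat.le_of_ble_eq_true rfl) hA.stages.run₁ ⟨T, hA.stages.poly, hA.stages.clock₂⟩)).round
    (Nat.le_of_ble_eq_true rfl) (Nat.le_of_ble_eq_true rfl) (Nat.le_of_ble_eq_true rfl)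
  obtain ⟨P₁, h₁⟩ := (Realized.silentRound (X := fun n => Bits (Nat.clog 2 (k n) + 1)) (Y := fun n => Bits (dom n))
    A 2 pre₂ last hA' (Nat.le_of_ble_eq_true rfl) (Nat.le_of_ble_eq_true rfl) hA.stages.run₂
    ⟨T, hA.stages.poly, hA.stages.clock₃⟩).round
    (Nat.le_of_ble_eq_true rfl) (Nat.le_of_ble_eq_true rfl) (Nat.le_of_ble_eq_true rfl)
  let B' : Adversary := ⟨fun j => if j = 0 then P₀ else P₁, adv⟩
  have hB := SKE.qpt (B := B') (E := E) hadv h₀ h₁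
  refine (hE.2.2.2 B' hB).of_le fun n => le_of_eq ?_
  rw [SKE.game_eq (B := B') h₀ h₁]
  have e₁ := advantage_guess_bind (opening hk E C P A n >>= fun o => E.gen n >>= fun key => S.init n (κ n) >>= fun r =>
    P.enc n o.1.1 (fun _ => false) >>= fun τ => A.run n 1 (oracle (tagged E C P o.1.2 τ (simVia E key fun st i γ x =>
      (S.step n (κ n) st x (decide (γ = o.2.2.1 i))).map Prod.swap))) (rep (τ, r.2)) (o.2.1, r.1) >>= fun s =>
    pure (o, key, s)) fun a b => challenge E a.2.1 a.1.2.2.2 (fun γ x => if γ = a.1.2.2.1 a.1.2.2.2 then unif (ran n) else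
      (S.step n (κ n) a.2.2.2 x false).map Prod.snd) b >>= fun z => guess A n z a.2.2.1
  simp only [bind_assoc, LawfulMonad.pure_bind] at e₁
  have h (b : Bool) := (skeGame_not_approx (hk := hk) hA (S := S) (B := B) (Nat.lt_succ_of_le (hp n)) b).prob le_rfl bot_le
  -- The comparison with the true simulator has error 0, so the probabilities are equal.
  replace h := fun b => sub_eq_zero.1 (abs_nonpos_iff.1 (h b))
  simp only [simGame, play, bind_assoc]
  rw [e₁, ← h true, ← h false, abs_abs, abs_sub_comm, Bool.not_true, Bool.not_false, ← advantage_guess]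
  refine congrArg advantage ?_
  simp only [skeGame, guess, bind_assoc, LawfulMonad.pure_bind]
  refine (bind_comm_pmf _ _ _).trans (bind_congr_support fun key _ => ?_)
  refine (bind_comm_pmf _ _ _).trans (bind_congr_support fun keys _ => ?_)
  refine (bind_comm_pmf _ _ _).trans (bind_congr_support fun s _ => ?_)
  refine (bind_comm_pmf _ _ _).trans (bind_congr_support fun r _ => ?_)
  refine (bind_comm_pmf _ _ _).trans (bind_congr_support fun τ _ => ?_)
  refine (bind_comm_pmf _ _ _).trans (bind_congr_support fun t _ => ?_)
  exact bind_comm_pmf _ _ _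

end Reductions

/-! ## Security for an index that the adversary chooses -/

theorem Negl.advantage_trans {g g' : ℕ → PMF Bool} (h : Negl fun n => |prob (g n) - prob (g' n)|)
    (h' : Negl fun n => advantage (g' n)) : Negl fun n => advantage (g n) := by
  refine ((h.const_mul 2).add h').of_le fun n => ?_
  have := abs_sub_le (prob (g n)) (prob (g' n)) (1 / 2)
  rw [advantage, advantage, abs_of_nonneg (by positivity)]
  linarith

section Reductions

variable {k dom ran κ : ℕ → ℕ} {hk : ∀ n, 0 < k n} {E : SKE (fun n => Nat.clog 2 (k n) + 1) dom}
  {C : CPRF dom ran} {P : PKE (fun n => C.skLen n (κ n) + E.keyLen n)} {D : ConstraintCircuits E κ}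
  {u : Uniformity} {A : Adversary} {S₁ S₂ S₃ : ℕ → Set Mem} {T : ℕ → ℕ}

/-- The sum of all hybrid steps. The order matters: privacy comes after the challenge value has been
masked, so that the simulator is asked about the challenge point only where `D[K,msg]` is 0 up to
sparsity. -/
theorem HybridAdversary.advantage_negl (hA : HybridAdversary E C P D A u S₁ S₂ S₃ T) (hE : E.Secure u)
    (hC : C.SelectivelySingleKeyPrivate u) (hP : P.CCASecure u) :
    Negl fun n => advantage (_root_.opening hk E C P A n >>= lateGame E C P D A n) := by
  obtain ⟨S, hS, h⟩ := privacy_step (hk := hk) hA hC.2.2.2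
  simp only [← tagGame_false hk hP.2.1]
  refine Negl.advantage_trans (g' := fun n => tagGame hk E C P D A n true) ?_
    (.advantage_trans (ceval_step hA hE.2.1 hC.2.1) (.advantage_trans (pr_step hA hE hC.2.2.1)
    (.advantage_trans ?_ (.advantage_trans (sparse_step (hk := hk) hA hE S) (ske_step (hk := hk) hA hE hS)))))
  · simpa only [abs_sub_comm] using pke_step (hk := hk) hA hP
  · simpa only [abs_sub_comm] using h

end Reductions

section Reductions

variable {k dom ran κ : ℕ → ℕ} {hk : ∀ n, 0 < k n} {E : SKE (fun n => Nat.clog 2 (k n) + 1) dom}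
  {C : CPRF dom ran} {P : PKE (fun n => C.skLen n (κ n) + E.keyLen n)} {D : ConstraintCircuits E κ}
  {u : Uniformity} {A : Adversary} {S₁ S₂ S₃ : ℕ → Set Mem} {T : ℕ → ℕ}

/-! ## Security for a fixed index

An adversary that chooses a random index first plays the game alone, and in the true game it uses the result to correct
the sign of its advantage. -/

/-- The game of the construction with the index `i`. -/
noncomputable def indexGame (E : SKE (fun n => Nat.clog 2 (k n) + 1) dom) (C : CPRF dom ran)
    (P : PKE (fun n => C.skLen n (κ n) + E.keyLen n)) (D : ConstraintCircuits E κ) (A : Adversary) (n : ℕ)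
    (i : Fin (k n)) : PMF Bool :=
  P.gen n >>= fun keys => A.run n 0 noOracle (rep keys.1) (Mem.empty, ()) >>= fun t =>
    lateGame E C P D A n (keys, t.1, readBits (k n) (t.1.regs 0), i)

theorem sim_eq_simOpt (n : ℕ) (sk : Bits (P.skLen n)) (τ : Bits (P.ctLen n)) (i : Fin (k n)) :
    (cprfWatermarking E C P D).sim n sk τ i = simOpt E C (P.dec n sk τ) i := by
  simp only [cprfWatermarking]
  cases P.dec n sk τ <;> rfl

theorem simMDDGame_eq (n : ℕ) (i : Fin (k n)) :
    (cprfWatermarking E C P D).simMDDGame A n i = indexGame E C P D A n i := by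
  have hsim : ∀ sk τ j, (cprfWatermarking E C P D).sim n sk τ j = simOpt E C (P.dec n sk τ) j := sim_eq_simOpt n
  have hreal : ∀ msk key m, (cprfWatermarking E C P D).real n (msk, key) m i =
      challenge E key i (maskedEval C msk m i) false := by
    intro msk key m
    refine bind_congr_support fun γ _ => bind_congr_support fun x _ => ?_
    by_cases h : γ = m i
    · rw [if_pos h, maskedEval, if_pos h]
    · rw [if_neg h, maskedEval, if_neg h]
      rfl
  simp only [ELWMPRF.simMDDGame, hsim]
  refine bind_congr_support fun keys _ => bind_congr_support fun t _ => ?_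
  simp only [cprfWatermarking, lateGame, bind_assoc, LawfulMonad.pure_bind]
  refine bind_congr_support fun msk _ => bind_congr_support fun key _ => bind_congr_support fun skA _ =>
    bind_congr_support fun τ _ => bind_congr_support fun c _ => ?_
  refine (A.run_couples (R := fun _ _ => True) ?_ n 1 _ _ trivial).bind_eq ?_
  · rintro log ⟨⟩ q -
    refine Couples.bind (k := fun z => pure (z, q :: log)) (Couples.refl (simOpt E C (P.dec n keys.2 q.1) q.2)) ?_
    rintro z _ rfl
    exact Couples.pure ⟨rfl, trivial⟩
  · rintro ⟨s, log⟩ ⟨_, ⟨⟩⟩ ⟨rfl, -⟩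
    simp only [guess, bind_assoc, LawfulMonad.pure_bind]
    refine bind_congr_support fun b _ => ?_
    cases b
    · exact congrArg (· >>= _) (hreal msk key _)
    · rfl

/-- The adversary's run against its own challenger, and its advice about the answer. -/
theorem Realized.indexGame (hA : HybridAdversary E C P D A u S₁ S₂ S₃ T) {X Y : ℕ → Type} [∀ n, BitRep (X n)]
    [∀ n, BitRep (Y n)] [Arity X] [Arity Y] :
    Realized A.advice (X := X) (Y := Y) (S := fun n => Bits (P.pkLen n) × Fin (k n))
      (S' := fun n => (Bits (P.pkLen n) × Fin (k n)) × Bool) (fun _ => {Mem.empty}) (fun _ => {Mem.empty})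
      fun n _ _ z => indexGame E C P D A n z.1.2 >>= fun w => pure ((z.1, w), z.2) := by
  have t := hA.prims _ hA.advice
  have hT := hA.stages.poly
  have pre₀ : Eff A.advice (α := fun n => Bits (P.pkLen n) × Fin (k n))
      (β := fun n => ((Bits (P.pkLen n) × Fin (k n)) × Bits (P.pkLen n) × Bits (P.skLen n)) × Bits (P.pkLen n))
      fun n z => P.gen n >>= fun keys => pure ((z, keys), keys.1) := by
    refine Eff.bind t.pgen_of (EffD.pair (EffD.pair ?_ ?_) ?_)
    all_goals repeat first | with_reducible apply EffD.fst | with_reducible apply EffD.snd | with_reducible exact EffD.id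
  have post₀ : Eff A.advice
      (α := fun n => (((Bits (P.pkLen n) × Fin (k n)) × Bits (P.pkLen n) × Bits (P.skLen n)) × Str) × Str)
      (β := fun n => ((Bits (P.pkLen n) × Fin (k n)) × Bits (P.skLen n) × Bits (C.mskLen n (κ n)) ×
        Bits (k n) × Bits (P.ctLen n)) × Bits (P.ctLen n) × Bits (C.skLen n (κ n))) fun n z =>
      C.setup n (κ n) >>= fun msk => E.gen n >>= fun key => C.constrain n (κ n) msk (D.auth n key) >>= fun skA =>
      P.enc n z.1.1.2.1 (Fin.append skA key) >>= fun τ =>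
      C.constrain n (κ n) msk (D.mark n key (readBits (k n) z.1.2)) >>= fun c =>
      pure ((z.1.1.1, z.1.1.2.2, msk, readBits (k n) z.1.2, τ), τ, c) := by
    refine Eff.bind t.setup_of (Eff.bind t.gen_of (Eff.bind (t.constrain_of ?_ (t.auth_of ?_))
      (Eff.bind (t.penc_of ?_ (EffD.appendBits t.cskLen.1 ?_ ?_))
      (Eff.bind (t.constrain_of ?_ (t.mark_of ?_ (EffD.readBits t.kLen ?_)))
      (EffD.pair (EffD.pair ?_ (EffD.pair ?_ (EffD.pair ?_ (EffD.pair (EffD.readBits t.kLen ?_) ?_))))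
      (EffD.pair ?_ ?_))))))
    all_goals repeat first | with_reducible apply EffD.fst | with_reducible apply EffD.snd | with_reducible exact EffD.id
  have sim : Eff A.advice (α := fun n => ((Bits (P.pkLen n) × Fin (k n)) × Bits (P.skLen n) ×
      Bits (C.mskLen n (κ n)) × Bits (k n) × Bits (P.ctLen n)) × Bits (P.ctLen n) × Fin (k n))
      fun n z => simOpt E C (P.dec n z.1.2.1 z.2.1) z.2.2 >>= fun s => pure (z.1, s) := by
    refine Eff.bind (t.simOpt_of (t.pdec_of ?_ ?_) ?_) (EffD.pair ?_ ?_)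
    all_goals repeat first | with_reducible apply EffD.fst | with_reducible apply EffD.snd | with_reducible exact EffD.id
  have post₁ : Eff A.advice (α := fun n => (Bits (P.pkLen n) × Fin (k n)) × Bits (P.skLen n) ×
      Bits (C.mskLen n (κ n)) × Bits (k n) × Bits (P.ctLen n))
      (β := fun n => ((Bits (P.pkLen n) × Fin (k n)) × Bool) × Bool × Bits (dom n) × Bits (ran n)) fun n z =>
      coin >>= fun b => (if b then simOpt E C (P.dec n z.2.1 z.2.2.2.2) z.1.2 else
        coin >>= fun γ => unif (dom n) >>= fun x => maskedEval C z.2.2.1 z.2.2.2.1 z.1.2 γ x >>= fun y =>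
        pure (γ, x, y)) >>= fun r => pure ((z.1, b), r) := by
    refine Eff.bind Eff.coin (Eff.bind (Eff.ite ?_ (t.simOpt_of (t.pdec_of ?_ ?_) ?_) (Eff.bind Eff.coin
      (Eff.bind (Eff.unif t.domLen) (Eff.bind (t.maskedEval_of ?_ ?_ ?_ ?_ ?_) (EffD.pair ?_ (EffD.pair ?_ ?_))))))
      (EffD.pair (EffD.pair ?_ ?_) ?_))
    all_goals repeat first | with_reducible apply EffD.fst | with_reducible apply EffD.snd | with_reducible exact EffD.id
  have last : Eff A.advice (α := fun n => (((Bits (P.pkLen n) × Fin (k n)) × Bool) × Str) × Str)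
      (β := fun n => (Bits (P.pkLen n) × Fin (k n)) × Bool)
      fun n z => pure (z.1.1.1, readBool z.1.2 == z.1.1.2) := by
    refine EffD.pair ?_ (EffD.beqBool (EffD.readBool ?_) ?_)
    all_goals repeat first | with_reducible apply EffD.fst | with_reducible apply EffD.snd | with_reducible exact EffD.id
  refine (Realized.sub (((Realized.silentRound A 0 pre₀ post₀ EffD.advice (Nat.le_of_ble_eq_true rfl)
    (Nat.le_of_ble_eq_true rfl) hA.stages.run₀ ⟨T, hT, hA.stages.clock₁⟩).seq
    (Realized.oracleRound A 1 (pre := fun n z => pure z) EffD.id (EffO.of_eff sim) (EffO.of_eff post₁) rfl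
    (EffD.isTagQuery t.ctLen t.kLen) EffD.advice (Nat.le_of_ble_eq_true rfl) (Nat.le_of_ble_eq_true rfl) hA.stages.run₁
    ⟨T, hT, hA.stages.clock₂⟩)).seq (Realized.silentRound A 2 (pre := fun n z => pure z) EffD.id last EffD.advice
    (Nat.le_of_ble_eq_true rfl) (Nat.le_of_ble_eq_true rfl) hA.stages.run₂ ⟨T, hT, hA.stages.clock₃⟩))
    (Nat.le_of_ble_eq_true rfl) (Nat.le_of_ble_eq_true rfl)).congr fun n σ F z => ?_
  simp only [_root_.indexGame, lateGame, guess, challenge, bind_assoc, LawfulMonad.pure_bind]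
  refine bind_congr_support fun keys _ => bind_congr_support fun s _ => bind_congr_support fun msk _ =>
    bind_congr_support fun key _ => bind_congr_support fun skA _ => bind_congr_support fun τ _ =>
    bind_congr_support fun c _ => ?_
  refine (A.run_couples (R := fun st _ => st = ((z.1, keys.2, msk, readBits (k n) (s.1.regs 0), τ), z.2.2)) ?_
    n 1 _ _ rfl).bind_eq ?_
  · rintro _ ⟨⟩ q rfl
    simp only [handle, map_bind_pmf, map_pure_pmf]
    refine (Couples.refl _).bind ?_
    rintro x _ rfl
    exact Couples.pure ⟨rfl, rfl⟩
  · rintro ⟨s', _⟩ ⟨_, ⟨⟩⟩ ⟨rfl, rfl⟩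
    rfl

end Reductions

/-! ### Two independent plays of a game with the same parameter. -/

theorem prob_bind_bool (p : PMF Bool) (f : Bool → PMF Bool) :
    prob (p >>= f) = prob p * prob (f true) + (1 - prob p) * prob (f false) := by
  rw [← prob_not, prob, bind_apply_true, expect, tsum_fintype, Fintype.sum_bool, ENNReal.toReal_add
    (ENNReal.mul_ne_top (p.apply_ne_top _) ((f _).apply_ne_top _))
    (ENNReal.mul_ne_top (p.apply_ne_top _) ((f _).apply_ne_top _)), ENNReal.toReal_mul, ENNReal.toReal_mul]
  congr 2
  rw [prob, bind_apply_true, expect, tsum_fintype, Fintype.sum_bool]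
  congr 1
  have h (b : Bool) : (pure b : PMF Bool) true = if b then 1 else 0 := by
    show PMF.pure b true = _
    rw [PMF.pure_apply]
    cases b <;> simp
  simp [h]

theorem prob_unif_bind (L : ℕ) (G : Bits L → PMF Bool) : 2 ^ L * prob (unif L >>= G) = ∑ r, prob (G r) := by
  have h := congrArg ENNReal.toReal (expect_unif L fun r => G r true)
  rw [ENNReal.toReal_sum fun r _ => (G r).apply_ne_top _, ENNReal.toReal_mul] at h
  rw [← bind_apply_true] at h
  simpa [prob] using h.symm

/-- Two runs of a game with a random parameter agree with a noticeable bias if one of the games has a large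
advantage. -/
theorem advantage_sq_le (L : ℕ) (G : Bits L → PMF Bool) (r : Bits L) :
    advantage (G r) ^ 2 ≤
      2 ^ L * advantage (unif L >>= fun r => G r >>= fun w => G r >>= fun g => pure (g == w)) := by
  -- Two independent bits with bias `δ` agree with probability `1/2 + 2δ²`, so the sign of the bias
  -- disappears and the averages over `r` cannot cancel.
  have h (r : Bits L) : prob (G r >>= fun w => G r >>= fun g => pure (g == w)) - 1 / 2 = advantage (G r) ^ 2 / 2 := by
    rw [prob_bind_bool, prob_bind_beq, prob_bind_beq, advantage, mul_pow, sq_abs]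
    simp only [if_true, Bool.false_eq_true, if_false]
    ring
  have h1 := prob_unif_bind L fun r => G r >>= fun w => G r >>= fun g => pure (g == w)
  have h2 : ∑ r, (prob (G r >>= fun w => G r >>= fun g => pure (g == w)) - 1 / 2) =
      2 ^ L * (prob (unif L >>= fun r => G r >>= fun w => G r >>= fun g => pure (g == w)) - 1 / 2) := by
    rw [Finset.sum_sub_distrib, ← h1, mul_sub]
    simp
  simp only [h] at h2
  have h3 := Finset.single_le_sum (f := fun r => advantage (G r) ^ 2 / 2) (fun r _ => by positivity)
    (Finset.mem_univ r)
  have h4 := le_abs_self (prob (unif L >>= fun r => G r >>= fun w => G r >>= fun g => pure (g == w)) - 1 / 2)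
  conv_rhs => rw [advantage]
  have h5 : (0 : ℝ) < 2 ^ L := by positivity
  nlinarith [mul_le_mul_of_nonneg_left h4 h5.le]

section Reductions

variable {k dom ran κ : ℕ → ℕ} {hk : ∀ n, 0 < k n} {E : SKE (fun n => Nat.clog 2 (k n) + 1) dom}
  {C : CPRF dom ran} {P : PKE (fun n => C.skLen n (κ n) + E.keyLen n)} {D : ConstraintCircuits E κ}
  {u : Uniformity} {A B : Adversary} {S₁ S₂ S₃ : ℕ → Set Mem} {T : ℕ → ℕ}

theorem opening_lateGame_eq {R₁ R₂ R₃ : ℕ → Type} [∀ n, BitRep (R₁ n)] [∀ n, BitRep (R₂ n)] [∀ n, BitRep (R₃ n)]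
    [Arity R₁] [Arity R₂] [Arity R₃] {Post₀ Post₁ Post₂ : ℕ → Set Mem}
    {K₀ : SKernel (fun _ => Empty) (fun _ => Unit) (fun n => Unit × Bits (P.pkLen n))
      fun n => R₁ n × Bits (k n) × Fin (k n)}
    (h₀ : RealizesRound B.advice (fun _ => {Mem.empty}) Post₀ (B.prog 0) K₀)
    {K₁ : SKernel (fun n => Bits (P.ctLen n) × Fin (k n)) (fun n => Bool × Bits (dom n) × Bits (ran n))
      (fun n => R₁ n × Bits (P.ctLen n) × Bits (C.skLen n (κ n))) fun n => R₂ n × Unit}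
    (h₁ : RealizesRound B.advice Post₀ Post₁ (B.prog 1) K₁)
    {K₂ : SKernel (fun _ => Empty) (fun _ => Unit) (fun n => R₂ n × Bool × Bits (dom n) × Bits (ran n))
      fun n => R₃ n × Bool}
    (h₂ : RealizesRound B.advice Post₁ Post₂ (B.prog 2) K₂) (n : ℕ) :
    (opening hk E C P B n >>= lateGame E C P D B n) = P.gen n >>= fun keys =>
      K₀ n Unit (fun _ x => x.elim) (((), keys.1), Mem.empty, ()) >>= fun r =>
      C.setup n (κ n) >>= fun msk => E.gen n >>= fun key => C.constrain n (κ n) msk (D.auth n key) >>= fun skA =>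
      P.enc n keys.1 (Fin.append skA key) >>= fun τ => C.constrain n (κ n) msk (D.mark n key r.1.2.1) >>= fun c =>
      K₁ n Unit (fun (_ : Unit) q => simOpt E C (P.dec n keys.2 q.1) q.2 >>= fun z => pure (z, ()))
        ((r.1.1, τ, c), r.2.1, ()) >>= fun s =>
      coin >>= fun b => (if b then simOpt E C (P.dec n keys.2 τ) r.1.2.2 else
        challenge E key r.1.2.2 (maskedEval C msk r.1.2.1 r.1.2.2) false) >>= fun z =>
      K₂ n Unit (fun _ x => x.elim) ((s.1.1, z), s.2.1, ()) >>= fun v => pure (v.1.2 == b) := by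
  simp only [opening, lateGame, guess, bind_assoc, LawfulMonad.pure_bind, noOracle_eq Unit]
  refine bind_congr_support fun keys _ => (h₀.run _ keys.1 () (Holds.empty n) rfl).bind_eq ?_
  rintro ⟨s, _⟩ r ⟨e1, e2, -, e3⟩
  have e : ([s.regs 0] ++ [s.regs 1] : List Str) = rep r.1.2.1 ++ rep r.1.2.2 := e2
  obtain ⟨e4, e5⟩ := List.append_inj e rfl
  have e6 : readBits (k n) (s.regs 0) = r.1.2.1 := by rw [readBits, e4, parse_rep]; rfl
  have e7 : readFin (hk n) (s.regs 1) = r.1.2.2 := by rw [readFin, e5, parse_rep]; rfl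
  simp only [e6, e7]
  refine bind_congr_support fun msk _ => bind_congr_support fun key _ => bind_congr_support fun skA _ =>
    bind_congr_support fun τ _ => bind_congr_support fun c _ => (h₁.run _ (τ, c) () e1 e3).bind_eq ?_
  rintro ⟨t, _⟩ s ⟨f1, -, -, f3⟩
  refine bind_congr_support fun b _ => bind_congr_support fun z _ => (h₂.run _ z () f1 f3).bind_eq ?_
  rintro ⟨t', _⟩ v ⟨-, g2, -, -⟩
  have g3 : readBool (t'.regs 0) = v.1.2 := Mem.read_eq g2
  simp only [g3]

end Reductions

/-! ### Correcting the sign of the advantage. -/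

section Reductions

variable {k dom ran κ : ℕ → ℕ} {hk : ∀ n, 0 < k n} {E : SKE (fun n => Nat.clog 2 (k n) + 1) dom}
  {C : CPRF dom ran} {P : PKE (fun n => C.skLen n (κ n) + E.keyLen n)} {D : ConstraintCircuits E κ}
  {u : Uniformity} {A : Adversary} {S₁ S₂ S₃ : ℕ → Set Mem} {T : ℕ → ℕ}

theorem HybridAdversary.of_qpt (hA : A.QPT u (cprfWatermarking E C P D).rounds)
    (hp : ∀ adv, u.Advice adv → EfficientPrimitives E C P D adv) :
    ∃ S₁ S₂ S₃ T, HybridAdversary E C P D A u S₁ S₂ S₃ T := by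
  obtain ⟨S₁, S₂, S₃, T, h, h1, h2, h3, h4, h5, h6⟩ := Adversary.QPT.stages (A := A) (u := u)
    (V₀ := fun n => Bits (P.pkLen n)) (V₁ := fun n => Bits (P.ctLen n) × Bits (C.skLen n (κ n)))
    (V₂ := fun n => Bool × Bits (dom n) × Bits (ran n)) (Q := fun n => Bits (P.ctLen n) × Fin (k n))
    (Z := fun n => Bool × Bits (dom n) × Bits (ran n)) hA
  exact ⟨S₁, S₂, S₃, T, hA.1, hp, h, h1, h2, h3, h4, h5, h6⟩

/-- The adversary that corrects the sign of its advantage for a random index. -/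
theorem HybridAdversary.exists_signed (hk : ∀ n, 0 < k n) (hA : HybridAdversary E C P D A u S₁ S₂ S₃ T) :
    ∃ B : Adversary, B.QPT u (cprfWatermarking E C P D).rounds ∧ ∀ n,
      (_root_.opening hk E C P B n >>= lateGame E C P D B n) = unif (Nat.clog 2 (k n)) >>= fun r =>
        indexGame E C P D A n (readFin (hk n) (List.ofFn r)) >>= fun w =>
        indexGame E C P D A n (readFin (hk n) (List.ofFn r)) >>= fun g => pure (g == w) := by
  have t := hA.prims _ hA.advice
  have hT := hA.stages.poly
  have choose : Eff A.advice (α := fun n => Unit × Bits (P.pkLen n)) (β := fun n => Bits (P.pkLen n) × Fin (k n))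
      fun n z => unif (Nat.clog 2 (k n)) >>= fun r => pure (z.2, readFin (hk n) (List.ofFn r)) :=
    Eff.bind (Eff.unif t.kLen.clog) (EffD.pair (EffD.snd (EffD.fst EffD.id))
      (EffD.readFin t.kLen hk (EffD.ofFn (EffD.snd EffD.id))))
  have pre₀ : Eff A.advice (α := fun n => (Bits (P.pkLen n) × Fin (k n)) × Bool)
      (β := fun n => (Fin (k n) × Bool) × Bits (P.pkLen n)) fun n z => pure ((z.1.2, z.2), z.1.1) := by
    refine EffD.pair (EffD.pair ?_ ?_) ?_
    all_goals repeat first | with_reducible apply EffD.fst | with_reducible apply EffD.snd | with_reducible exact EffD.id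
  have post₀ : Eff A.advice (α := fun n => ((Fin (k n) × Bool) × Str) × Str)
      (β := fun n => Bool × Bits (k n) × Fin (k n)) fun n z =>
      pure (z.1.1.2, readBits (k n) z.1.2, z.1.1.1) := by
    refine EffD.pair ?_ (EffD.pair (EffD.readBits t.kLen ?_) ?_)
    all_goals repeat first | with_reducible apply EffD.fst | with_reducible apply EffD.snd | with_reducible exact EffD.id
  obtain ⟨P₀, h₀⟩ := ((((Realized.eff (X := fun _ => Empty) (Y := fun _ => Unit) choose (Nat.le_of_ble_eq_true rfl)).seq
    (Realized.indexGame hA)).seq (Realized.silentRound A 0 pre₀ post₀ EffD.advice (Nat.le_of_ble_eq_true rfl)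
    (Nat.le_of_ble_eq_true rfl) hA.stages.run₀ ⟨T, hT, hA.stages.clock₁⟩)).congr fun n σ F z => rfl).round
    (Nat.le_of_ble_eq_true rfl) (Nat.le_of_ble_eq_true rfl) (Nat.le_of_ble_eq_true rfl)
  -- In the true game the queries are passed on unchanged. The result of the private play is the
  -- only state, and the alternative branch is never taken.
  have forward := EffO.ask (adv := A.advice) (X := fun n => Bits (P.ctLen n) × Fin (k n))
    (Y := fun n => Bool × Bits (dom n) × Bits (ran n)) (α := fun n => Bool × Bits (P.ctLen n) × Fin (k n))
    (β := fun n => Bool × Bool × Bits (dom n) × Bits (ran n)) (γ := fun _ => Bool)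
    (pre := fun n z => pure z) (c := fun _ _ => true) (post := fun n z y => pure (z, y))
    (other := fun n z => pure (z, false, fun _ => false, fun _ => false)) EffD.id (EffD.bool true) EffD.id
    (EffD.pair EffD.id (EffD.pair (EffD.bool false) (EffD.pair (EffD.zeros t.domLen) (EffD.zeros t.ranLen))))
  have post₁ : Eff A.advice (α := fun _ => Bool) (β := fun _ => Bool × Unit) fun _ z => pure (z, ()) :=
    EffD.pair EffD.id EffD.unit
  obtain ⟨P₁, h₁⟩ := (Realized.oracleRound A 1 (V := fun n => Bits (P.ctLen n) × Bits (C.skLen n (κ n)))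
    (pre := fun n z => pure z) EffD.id forward (EffO.of_eff post₁) rfl
    (EffD.isTagQuery t.ctLen t.kLen) EffD.advice (Nat.le_of_ble_eq_true rfl) (Nat.le_of_ble_eq_true rfl) hA.stages.run₁
    ⟨T, hT, hA.stages.clock₂⟩).round (Nat.le_of_ble_eq_true rfl) (Nat.le_of_ble_eq_true rfl) (Nat.le_of_ble_eq_true rfl)
  have last : Eff A.advice (α := fun _ => (Bool × Str) × Str) (β := fun _ => Unit × Bool)
      fun n z => pure ((), readBool z.1.2 == z.1.1) :=
    EffD.pair EffD.unit (EffD.beqBool (EffD.readBool (EffD.snd (EffD.fst EffD.id))) (EffD.fst (EffD.fst EffD.id)))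
  obtain ⟨P₂, h₂⟩ := (Realized.silentRound (X := fun _ => Empty) (Y := fun _ => Unit) A 2 (pre := fun n z => pure z)
    EffD.id last EffD.advice (Nat.le_of_ble_eq_true rfl)
    (Nat.le_of_ble_eq_true rfl) hA.stages.run₂ ⟨T, hT, hA.stages.clock₃⟩).round
    (Nat.le_of_ble_eq_true rfl) (Nat.le_of_ble_eq_true rfl) (Nat.le_of_ble_eq_true rfl)
  let B : Adversary := ⟨fun j => if j = 0 then P₀ else if j = 1 then P₁ else P₂, A.advice⟩
  refine ⟨B, Adversary.QPT.of_rounds₃ (B := B) hA.advice h₀ h₁ h₂ (fun _ _ => subset_rfl)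
    (fun _ => (answers_empty Unit).symm) (fun _ _ _ _ => subset_rfl) (fun _ => rfl) (fun _ _ => subset_rfl)
    (fun _ => (answers_empty Unit).symm), fun n => ?_⟩
  rw [opening_lateGame_eq (B := B) h₀ h₁ h₂]
  simp only [bind_assoc, LawfulMonad.pure_bind]
  refine (bind_comm_pmf _ _ _).trans (bind_congr_support fun r _ => ?_)
  refine (bind_comm_pmf _ _ _).trans (bind_congr_support fun w _ => ?_)
  simp only [indexGame, lateGame, guess, bind_assoc, LawfulMonad.pure_bind]
  refine bind_congr_support fun keys _ => bind_congr_support fun s _ => bind_congr_support fun msk _ =>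
    bind_congr_support fun key _ => bind_congr_support fun skA _ => bind_congr_support fun τ _ =>
    bind_congr_support fun c _ => ?_
  refine (A.run_couples (R := fun st _ => st.1 = w) ?_ n 1 _ _ rfl).bind_eq ?_
  · rintro ⟨_, ⟨⟩⟩ ⟨⟩ q rfl
    simp only [handle, if_true, map_bind_pmf, map_pure_pmf, bind_assoc, LawfulMonad.pure_bind]
    refine (Couples.refl _).bind ?_
    rintro x _ rfl
    exact Couples.pure ⟨rfl, rfl⟩
  · rintro ⟨s', w', ⟨⟩⟩ ⟨_, ⟨⟩⟩ ⟨rfl, rfl⟩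
    refine bind_congr_support fun b _ => bind_congr_support fun z _ => bind_congr_support fun v _ => ?_
    congr 1
    -- The new adversary outputs whether the guess equals `w`. It wins iff `w` tells correctly
    -- whether the original adversary wins.
    generalize readBool _ = v
    cases v <;> cases b <;> cases w' <;> rfl

/-- The string that encodes `i n` is one of the `2^⌈log₂ k⌉ ≤ 2k` strings that the signed adversary
may draw, and the other strings contribute nonnegative squares. Its advantage is negligible, hence
so is the squared advantage for `i n`, and the root of a negligible function is negligible. -/
theorem HybridAdversary.indexGame_negl (hA : HybridAdversary E C P D A u S₁ S₂ S₃ T) (hk : ∀ n, 0 < k n)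
    (hE : E.Secure u) (hC : C.SelectivelySingleKeyPrivate u) (hP : P.CCASecure u) (i : ∀ n, Fin (k n)) :
    Negl fun n => advantage (indexGame E C P D A n (i n)) := by
  obtain ⟨B, hB, h⟩ := hA.exists_signed hk
  obtain ⟨S₁', S₂', S₃', T', hB⟩ := HybridAdversary.of_qpt hB hA.prims
  have h1 := ((hB.advantage_negl (hk := hk) hE hC hP).poly_mul
    ((PolyLe.const 2).mul (hA.prims _ hA.advice).kLen.1)).sqrt
  refine h1.of_le fun n => Real.abs_le_sqrt ?_
  rw [h]
  have h2 := advantage_sq_le (Nat.clog 2 (k n)) (fun r => indexGame E C P D A n (readFin (hk n) (List.ofFn r)))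
    (indexBits (i n))
  rw [readFin_rep] at h2
  refine h2.trans (mul_le_mul_of_nonneg_right ?_ (by rw [advantage]; positivity))
  exact_mod_cast two_pow_clog_le (hk n)

end Reductions

/-! ## Efficiency and evaluation correctness -/

section Construction

variable {k dom ran κ : ℕ → ℕ} {E : SKE (fun n => Nat.clog 2 (k n) + 1) dom}
  {C : CPRF dom ran} {P : PKE (fun n => C.skLen n (κ n) + E.keyLen n)} {D : ConstraintCircuits E κ}
  {u : Uniformity}

theorem EfficientPrimitives.watermarking (t : EfficientPrimitives E C P D fun _ => []) :
    (cprfWatermarking E C P D).Efficient := by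
  have gen : Eff (fun _ => []) (α := fun n => Bits (P.pkLen n))
      (β := fun n => (Bits (C.mskLen n (κ n)) × Bits (E.keyLen n)) × Bits (P.ctLen n))
      fun n pk => C.setup n (κ n) >>= fun msk => E.gen n >>= fun key =>
      C.constrain n (κ n) msk (D.auth n key) >>= fun sk => P.enc n pk (Fin.append sk key) >>= fun τ =>
      pure ((msk, key), τ) := by
    refine Eff.bind t.setup_of (Eff.bind t.gen_of (Eff.bind (t.constrain_of ?_ (t.auth_of ?_))
      (Eff.bind (t.penc_of ?_ (EffD.appendBits t.cskLen.1 ?_ ?_)) (EffD.pair (EffD.pair ?_ ?_) ?_))))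
    all_goals repeat first | with_reducible apply EffD.fst | with_reducible apply EffD.snd | with_reducible exact EffD.id
  have eval : EffD (fun _ => []) (α := fun n => (Bits (C.mskLen n (κ n)) × Bits (E.keyLen n)) × Bits (dom n))
      (β := fun n => Bits (ran n)) fun n a => C.eval n (κ n) a.1.1 a.2 :=
    t.eval_of (EffD.fst (EffD.fst EffD.id)) (EffD.snd EffD.id)
  have mark : Eff (fun _ => []) (α := fun n => Bits (P.pkLen n) × (Bits (C.mskLen n (κ n)) × Bits (E.keyLen n)) ×
      Bits (k n)) (β := fun n => Bits (C.skLen n (κ n)))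
      fun n a => C.constrain n (κ n) a.2.1.1 (D.mark n a.2.1.2 a.2.2) := by
    refine t.constrain_of ?_ (t.mark_of ?_ ?_)
    all_goals repeat first | with_reducible apply EffD.fst | with_reducible apply EffD.snd | with_reducible exact EffD.id
  have sim : Eff (fun _ => []) (α := fun n => Bits (P.skLen n) × Bits (P.ctLen n) × Fin (k n))
      fun n a => simOpt E C (P.dec n a.1 a.2.1) a.2.2 := by
    refine t.simOpt_of (t.pdec_of ?_ ?_) ?_
    all_goals repeat first | with_reducible apply EffD.fst | with_reducible apply EffD.snd | with_reducible exact EffD.id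
  refine ⟨t.pgen.ppt, gen.ppt, eval.ppt, mark.ppt, t.ceval.ppt,
    (sim.congr fun n a => (sim_eq_simOpt n a.1 a.2.1 a.2.2).symm).ppt⟩

/-- Efficiently samplable messages, or fixed messages that are given as advice. -/
theorem ELWMPRF.Messages.eff {M : ∀ n, PMF (Bits (k n))} (hM : Messages u M) (hk' : UnaryComputable k) :
    ∃ adv, u.Advice adv ∧ Eff adv (α := fun _ => Unit) fun n _ => M n := by
  cases u with
  | uniform => exact ⟨fun _ => [], Uniformity.Advice.nil _, Eff.of_ppt hM⟩
  | nonuniform =>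
    choose m hm using hM
    have hk : EffLen (fun n => List.ofFn (m n)) k := EffLen.of_unaryComputable hk'
    refine ⟨fun n => List.ofFn (m n), hk.1.mono fun n => by simp, ?_⟩
    refine Eff.congr (EffD.readBits (α := fun _ => Unit) hk EffD.advice) fun n _ => ?_
    simp only [hm, readBits_ofFn]

/-- A uniform `x` is undecryptable up to the sparsity error. Then `D[K,msg]` is 0 at `x`, so a wrong
value of the marked circuit is a violation of correctness by the adversary that submits a uniform
point. This adversary needs the message, which it samples or gets as advice. -/
theorem evaluationCorrect_watermarking (hk' : UnaryComputable k) (hE : E.Secure u) (hC : C.Correct u)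
    (t : ∀ adv, u.Advice adv → EfficientPrimitives E C P D adv) :
    (cprfWatermarking E C P D).EvaluationCorrect u := by
  intro M hM
  obtain ⟨adv, hadv, hM⟩ := hM.eff hk'
  have t := t adv hadv
  have hF : Eff adv (α := fun _ => Unit) (β := fun n => Unit × Circ (dom n) (κ n)) fun n _ =>
      M n >>= fun m => E.gen n >>= fun key => pure ((), D.mark n key m) := by
    refine Eff.bind hM (Eff.bind t.gen_of (EffD.pair EffD.unit (t.mark_of ?_ ?_)))
    all_goals repeat first | with_reducible apply EffD.fst | with_reducible apply EffD.snd | with_reducible exact EffD.id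
  have h1 := hC.sample hadv t.κLen (Nat.le_of_ble_eq_true rfl) hF (G := fun n _ => unif (dom n)) (Eff.unif t.domLen)
  simp only [bind_assoc, LawfulMonad.pure_bind] at h1
  have h2 : Negl fun n => |prob (M n >>= fun m => E.gen n >>= fun key => C.setup n (κ n) >>= fun msk =>
      C.constrain n (κ n) msk (D.mark n key m) >>= fun c => unif (dom n) >>= fun x =>
      pure !decide (C.ceval n (κ n) c x = C.eval n (κ n) msk x)) -
      prob (M n >>= fun m => E.gen n >>= fun key => C.setup n (κ n) >>= fun msk =>
      C.constrain n (κ n) msk (D.mark n key m) >>= fun c => unif (dom n) >>= fun x =>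
      pure (decide (C.eval n (κ n) msk x ≠ C.ceval n (κ n) c x ∧ (D.mark n key m).eval x = false)))| := by
    refine negl_of_approx (e := fun n => (E.gen n >>= fun key => unif (dom n) >>= fun c =>
      pure (decide (E.dec n key c ≠ none))) true) (fun n => ?_) hE.2.2.1 (fun n => prob_nonneg _) fun n =>
      (ofReal_prob _).ge
    refine Approx.bind_const fun m _ => ?_
    rw [bind_apply_true]
    refine Approx.bind_self fun key _ => Approx.bind_const fun msk _ => Approx.bind_const fun c _ => ?_
    simp only [bind_apply_true, pure_decide_true]
    refine Approx.of_event _ _ _ (fun x => E.dec n key x ≠ none) fun x _ hx => ?_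
    have h : (D.mark n key m).eval x = false := by
      rw [← Bool.not_eq_true, D.mark_eval, not_ne_iff.1 hx]
      simp
    simp only [h, and_true, ← decide_not, eq_comm, ne_eq]
  refine (h2.add h1).of_le fun n => ?_
  have h3 : (cprfWatermarking E C P D).evaluationGame M n = M n >>= fun m => E.gen n >>= fun key =>
      C.setup n (κ n) >>= fun msk => C.constrain n (κ n) msk (D.mark n key m) >>= fun c => unif (dom n) >>= fun x =>
      pure (decide (C.ceval n (κ n) c x = C.eval n (κ n) msk x)) := by
    refine bind_congr_support fun m _ => ?_
    simp only [cprfWatermarking, bind_assoc, LawfulMonad.pure_bind]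
    show (P.gen n >>= fun keys => C.setup n (κ n) >>= fun msk => E.gen n >>= fun key =>
      C.constrain n (κ n) msk (D.auth n key) >>= fun sk => P.enc n keys.1 (Fin.append sk key) >>= fun _ =>
      C.constrain n (κ n) msk (D.mark n key m) >>= fun c => unif (dom n) >>= fun x =>
      pure (decide (C.ceval n (κ n) c x = C.eval n (κ n) msk x))) = _
    -- The public keys, the key for `D_auth` and the tag have no influence on the comparison and are
    -- dropped.
    simp only [bind_const_pmf]
    exact bind_comm_pmf _ _ _
  have h4 := prob_not ((cprfWatermarking E C P D).evaluationGame M n)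
  rw [abs_of_nonneg (sub_nonneg.2 (prob_le_one _)), ← h4, h3]
  simp only [bind_assoc, LawfulMonad.pure_bind]
  exact sub_le_iff_le_add.1 (le_abs_self _)

end Construction

theorem mainTheorem7 (u : Uniformity) (k dom ran κ : ℕ → ℕ) (hk : ∀ n, 0 < k n)
    (hk' : UnaryComputable k) (hκ : UnaryComputable κ)
    (E : SKE (fun n => Nat.clog 2 (k n) + 1) dom) (C : CPRF dom ran)
    (P : PKE (fun n => C.skLen n (κ n) + E.keyLen n)) (D : ConstraintCircuits E κ)
    (hE : E.Secure u) (hC : C.SelectivelySingleKeyPrivate u) (hP : P.CCASecure u) :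
    (cprfWatermarking E C P D).Efficient ∧
      (cprfWatermarking E C P D).EvaluationCorrect u ∧
      (cprfWatermarking E C P D).SimMDDSecure u := by
  have t := fun adv (h : u.Advice adv) => EfficientPrimitives.of_efficient (D := D) h.polyLe hk' hκ hE.1 hC.1 hP.1
  refine ⟨(t _ (Uniformity.Advice.nil u)).watermarking, evaluationCorrect_watermarking hk' hE hC.2.1 t,
    fun i A hA => ?_⟩
  obtain ⟨S₁, S₂, S₃, T, hA⟩ := HybridAdversary.of_qpt hA t
  simp only [simMDDGame_eq]
  exact hA.indexGame_negl hk hE hC hP i
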